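/- **Setting.** Let $p$ be a prime, $\mathbf C$ the completion of an algebraic closure $\overline{\mathbf Q}_p$ of $\mathbf Q_p$, $K\subset\overline{\mathbf Q}_p$ a finite extension of $\mathbf Q_p$, $K_n=K(\mu_{p^n})$, $K_\infty=\bigcup_n K_n$ and $H_K=\mathrm{Gal}(\overline{\mathbf Q}_p/K_\infty)$. Let $\mathcal O_{\mathbf C}^\flat=\varprojlim_{x\mapsto x^p}\mathcal O_{\mathbf C}/p$, with fraction field $\mathbf C^\flat$, and put $\mathbf A_{\inf}=W(\mathcal O_{\mathbf C}^\flat)$, $\widetilde{\mathbf A}=W(\mathbf C^\flat)$. Fix primitive $p^n$-th roots of unity $\zeta_{p^n}$ with $\zeta_{p^{n+1}}^p=\zeta_{p^n}$, and put $\varepsilon=(1,\zeta_p,\zeta_{p^2},\dots)\in\mathcal O_{\mathbf C}^\flat$, $\varpi=\varepsilon-1$, $T=[\varepsilon]-1$. Let $A$ be a $p$-adically complete $\mathbf Z_p$-module which is finitely generated over a $p$-adically complete $\mathbf Z_p$-algebra $R$ topologically of finite type, the $\mathbf Z_p$-module structure of $A$ being induced from its $R$-module structure (for example, $A$ is a finitely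 generated $\mathbf Z_p$-module, with $R=\mathbf Z_p$, or $A=R$). Below, $r,s$ run over the positive rational numbers whose inverse lies in $\mathbf Z[1/p]$. Inverse limits, direct limits and localizations carry the inverse limit, resp. direct limit, topology; a quotient $M/[\varpi]^i$ is discrete. Put: - $\widetilde{\mathbf A}^{(0,r],\circ}=\mathbf A_{\inf}\langle p/[\varpi]^{1/r}\rangle\subset\widetilde{\mathbf A}$, the $p$-adic completion of $\mathbf A_{\inf}[p/[\varpi]^{1/r}]$, so that $\widetilde{\mathbf A}^{(0,s],\circ}\subset\widetilde{\mathbf A}^{(0,r],\circ}$ for $r\le s$; - $\widetilde{\mathbf A}_A^{(0,r]}=\big(\varprojlim_i(\widetilde{\mathbf A}^{(0,r],\circ}\otimes_{\mathbf Z_p}A)/[\varpi]^i\big)[1/[\varpi]]$ and $\widetilde{\mathbf A}_A^\dagger=\varinjlim_{r\to0}\widetilde{\mathbf A}_A^{(0,r]}$; - $\widetilde{\mathbf A}_A=\varprojlim_a\Big(\big(\varprojlim_i(W_a(\mathcal O_{\mathbf C}^\flat)\otimes_{\mathbf Z_p}A)/[\varpi]^i\big)[1/[\varpi]]\Big)$,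 where $W_a(\mathcal O_{\mathbf C}^\flat)=\mathbf A_{\inf}/p^a$; - $\widetilde{\mathbf A}_{K,A}^{(0,r]}$, $\widetilde{\mathbf A}_{K,A}^\dagger$, $\widetilde{\mathbf A}_{K,A}$, the invariants under $H_K$ of $\widetilde{\mathbf A}_A^{(0,r]}$, $\widetilde{\mathbf A}_A^\dagger$, $\widetilde{\mathbf A}_A$; - $\mathbf E_K\subset\mathbf C^\flat$, the field of norms of $K_\infty/K$; $\mathbf A_{\mathbf Q_p}\subset\widetilde{\mathbf A}$, the $p$-adic completion of $\mathbf Z_p[[T]][1/T]$; $\mathbf A_K\subset\widetilde{\mathbf A}$, the finite étale extension of $\mathbf A_{\mathbf Q_p}$ lifting the finite separable extension $\mathbf E_K/\mathbf E_{\mathbf Q_p}$; - $\mathbf A_K^{(0,r],\circ}=\mathbf A_K\cap\widetilde{\mathbf A}^{(0,r],\circ}$, $\ \mathbf A_{K,A}^{(0,r]}=\big(\varprojlim_i(\mathbf A_K^{(0,r],\circ}\otimes_{\mathbf Z_p}A)/T^i\big)[1/T]$, $\ \mathbf A_{K,A}^\dagger=\varinjlim_{r\to0}\mathbf A_{K,A}^{(0,r]}$.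 **Theorem 2.9 (with its consequences for the direct limits).** 1. For every $r$ there is a unique continuous map $f_r:\widetilde{\mathbf A}_A^{(0,r]}\to\widetilde{\mathbf A}_A$, linear over the subring of $\mathbf A_{\inf}$ generated over $\mathbf Z_p$ by the Teichmüller lift $[\varpi]$, sending the class of $x\otimes a$ to the class of $x\otimes a$ for $x\in\mathbf A_{\inf}$, $a\in A$. It is injective, and it commutes with the action of $H_K$. 2. For $r\le s$ the transition map $\widetilde{\mathbf A}_A^{(0,s]}\to\widetilde{\mathbf A}_A^{(0,r]}$ is injective. The maps $\widetilde{\mathbf A}_A^{(0,r]}\to\widetilde{\mathbf A}_A^\dagger$ are injective and every element of $\widetilde{\mathbf A}_A^\dagger$ is in the image of one of them, so $\widetilde{\mathbf A}_A^\dagger=\bigcup_r\widetilde{\mathbf A}_A^{(0,r]}$. The $f_r$ induce a continuous injective map $\widetilde{\mathbf A}_A^\dagger\to\widetilde{\mathbf A}_A$, which maps $\widetilde{\mathbf A}_{K,A}^\dagger$ into $\widetilde{\mathbf A}_{K,A}$. 3. For $r\le s$ the transition map restricts to an injective map $\widetilde{\mathbf A}_{K,A}^{(0,s]}\to\widetilde{\mathbf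 A}_{K,A}^{(0,r]}$, and $\widetilde{\mathbf A}_{K,A}^\dagger=\bigcup_r\widetilde{\mathbf A}_{K,A}^{(0,r]}$ inside $\widetilde{\mathbf A}_A^\dagger$. 4. For $r\le s$ the transition map $\mathbf A_{K,A}^{(0,s]}\to\mathbf A_{K,A}^{(0,r]}$ is injective. The maps $\mathbf A_{K,A}^{(0,r]}\to\mathbf A_{K,A}^\dagger$ are injective and every element of $\mathbf A_{K,A}^\dagger$ is in the image of one of them, so $\mathbf A_{K,A}^\dagger=\bigcup_r\mathbf A_{K,A}^{(0,r]}$. -/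

import Mathlib

open scoped TensorProduct NNReal

noncomputable section

namespace PhiGamma

/-! ### The field `ℂ_p`, its tilt and Witt vectors -/

section Base

variable (p : ℕ) [Fact p.Prime]

instance fact_not_isUnit : Fact (¬ IsUnit ((p : ℕ) : 𝓞_ℂ_[p])) := by
  refine ⟨fun h => ?_⟩
  have h1 := (PadicComplexInt.integers p).one_of_isUnit h
  rw [map_natCast, PadicComplex.valuation_p] at h1
  have hp : (1 : ℝ≥0) < (p : ℝ≥0) := by exact_mod_cast (Fact.out : p.Prime).one_lt
  have h2 : (1 : ℝ≥0) / p < 1 := by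
    rw [div_lt_one (by positivity)]; exact hp
  exact h2.ne h1

/-- The ring `𝓞_ℂ^♭`, the inverse limit of `𝓞_ℂ / p` along Frobenius. -/
abbrev OFlat : Type := PreTilt 𝓞_ℂ_[p] p

instance : IsDomain (OFlat p) :=
  PreTilt.isDomain ℂ_[p] (PadicComplex.valued p).v 𝓞_ℂ_[p] (PadicComplexInt.integers p) p

/-- The field `ℂ^♭`. -/
abbrev CFlat : Type := FractionRing (OFlat p)

instance : CharP (CFlat p) p :=
  charP_of_injective_algebraMap (IsFractionRing.injective (OFlat p) (CFlat p)) p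

/-- `A_inf = W(𝓞_ℂ^♭)`. -/
abbrev AInf : Type := WittVector p (OFlat p)

/-- `W(ℂ^♭)`. -/
abbrev ATilde : Type := WittVector p (CFlat p)

/-- Witt vectors of a ring of characteristic `p` form a `ℤ_p = W(𝔽_p)`-algebra. -/
def padicIntToWitt (R : Type*) [CommRing R] [CharP R p] : ℤ_[p] →+* WittVector p R :=
  (WittVector.map (ZMod.castHom (dvd_refl p) R)).comp (WittVector.equiv p).symm.toRingHom

instance : Algebra ℤ_[p] (AInf p) := (padicIntToWitt p (OFlat p)).toAlgebra

instance : Algebra ℤ_[p] (ATilde p) := (padicIntToWitt p (CFlat p)).toAlgebra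

instance : Algebra (AInf p) (ATilde p) :=
  (WittVector.map (algebraMap (OFlat p) (CFlat p))).toAlgebra

theorem map_padicIntToWitt {R S : Type*} [CommRing R] [CharP R p] [CommRing S] [CharP S p]
    (g : R →+* S) (z : ℤ_[p]) :
    WittVector.map g (padicIntToWitt p R z) = padicIntToWitt p S z := by
  have h : g.comp (ZMod.castHom (dvd_refl p) R) = ZMod.castHom (dvd_refl p) S :=
    RingHom.ext_zmod _ _
  ext n
  simp only [padicIntToWitt, RingHom.comp_apply, WittVector.map_coeff]
  rw [← h]; rfl

instance : IsScalarTower ℤ_[p] (AInf p) (ATilde p) :=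
  IsScalarTower.of_algebraMap_eq fun z => (map_padicIntToWitt p (algebraMap (OFlat p) (CFlat p)) z).symm

end Base

/-! ### The Galois action -/

section Galois

variable {p : ℕ} [Fact p.Prime]

/-- The absolute Galois group of `ℚ_p`. -/
abbrev GQp (p : ℕ) [Fact p.Prime] : Type := PadicAlgCl p ≃ₐ[ℚ_[p]] PadicAlgCl p

theorem GQp.norm_map (σ : GQp p) (x : PadicAlgCl p) : ‖σ x‖ = ‖x‖ :=
  (spectralNorm_eq_of_equiv σ x).symm

theorem GQp.continuous (σ : GQp p) : Continuous σ :=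
  (AddMonoidHomClass.isometry_of_norm σ (GQp.norm_map σ)).continuous

/-- The extension of a Galois automorphism to `ℂ_p` by continuity. -/
def galC (σ : GQp p) : ℂ_[p] →+* ℂ_[p] :=
  UniformSpace.Completion.mapRingHom (σ : PadicAlgCl p →+* PadicAlgCl p) (GQp.continuous σ)

theorem galC_coe (σ : GQp p) (x : PadicAlgCl p) : galC σ (x : ℂ_[p]) = ((σ x : PadicAlgCl p) : ℂ_[p]) :=
  UniformSpace.Completion.mapRingHom_coe (f := (σ : PadicAlgCl p →+* PadicAlgCl p)) (GQp.continuous σ) x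

theorem galC_continuous (σ : GQp p) : Continuous (galC σ) :=
  UniformSpace.Completion.continuous_map

theorem norm_galC (σ : GQp p) (x : ℂ_[p]) : ‖galC σ x‖ = ‖x‖ := by
  induction x using UniformSpace.Completion.induction_on with
  | hp => exact isClosed_eq (continuous_norm.comp (galC_continuous σ)) continuous_norm
  | ih a => rw [galC_coe, PadicComplex.norm_extends, PadicComplex.norm_extends, GQp.norm_map]

theorem mem_int_iff (x : ℂ_[p]) : x ∈ 𝓞_ℂ_[p] ↔ ‖x‖ ≤ 1 := by
  have h : ‖x‖ = ((Valued.v x : ℝ≥0) : ℝ) := by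
    rw [PadicComplex.norm_eq_norm]
    simp only [Valued.v.norm_def, PadicComplex.RankOne.hom_eq_embedding]
    rw [Valuation.embedding_restrict (PadicComplex.valued p).v x]
  rw [h]
  exact (NNReal.coe_le_one (r := Valued.v x)).symm

theorem galC_mul (σ τ : GQp p) (x : ℂ_[p]) : galC (σ * τ) x = galC σ (galC τ x) := by
  induction x using UniformSpace.Completion.induction_on with
  | hp => exact isClosed_eq (galC_continuous _) ((galC_continuous σ).comp (galC_continuous τ))
  | ih a => simp only [galC_coe]; rfl

theorem galC_one (x : ℂ_[p]) : galC (1 : GQp p) x = x := by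
  induction x using UniformSpace.Completion.induction_on with
  | hp => exact isClosed_eq (galC_continuous _) continuous_id
  | ih a => simp only [galC_coe]; rfl

/-- The Galois action on `𝓞_ℂ`. -/
def galO (σ : GQp p) : 𝓞_ℂ_[p] →+* 𝓞_ℂ_[p] :=
  ((galC σ).comp (SubringClass.subtype 𝓞_ℂ_[p])).codRestrict 𝓞_ℂ_[p] fun x => by
    rw [mem_int_iff]
    exact (norm_galC σ _).le.trans ((mem_int_iff _).1 x.2)

theorem coe_galO (σ : GQp p) (x : 𝓞_ℂ_[p]) : (galO σ x : ℂ_[p]) = galC σ x := rfl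

/-- The Galois action on `𝓞_ℂ / p`. -/
def galModP (σ : GQp p) : ModP 𝓞_ℂ_[p] p →+* ModP 𝓞_ℂ_[p] p :=
  Ideal.quotientMap _ (galO σ) (by
    rw [Ideal.span_le, Set.singleton_subset_iff]
    simp)

/-- The Galois action on `𝓞_ℂ^♭`. -/
def galOFlat (σ : GQp p) : OFlat p →+* OFlat p := Perfection.map p (galModP σ)

theorem coeff_galOFlat (σ : GQp p) (x : OFlat p) (n : ℕ) :
    PreTilt.coeff n (galOFlat σ x) = galModP σ (PreTilt.coeff n x) := rfl

theorem galOFlat_injective (σ : GQp p) : Function.Injective (galOFlat σ) := by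
  have key : ∀ x, galOFlat σ⁻¹ (galOFlat σ x) = x := by
    intro x
    refine Perfection.ext fun n => ?_
    change galModP σ⁻¹ (galModP σ (PreTilt.coeff n x)) = PreTilt.coeff n x
    obtain ⟨y, hy⟩ := Ideal.Quotient.mk_surjective (PreTilt.coeff n x)
    rw [← hy]
    simp only [galModP, Ideal.quotientMap_mk]
    congr 1
    apply Subtype.ext
    rw [coe_galO, coe_galO, ← galC_mul, inv_mul_cancel, galC_one]
  exact Function.LeftInverse.injective key

/-- The Galois action on `ℂ^♭`. -/
def galCFlat (σ : GQp p) : CFlat p →+* CFlat p := IsFractionRing.map (galOFlat_injective σ)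

/-- The Galois action on `A_inf`. -/
def galAInf (σ : GQp p) : AInf p →+* AInf p := WittVector.map (galOFlat σ)

/-- The Galois action on `W(ℂ^♭)`. -/
def galATilde (σ : GQp p) : ATilde p →+* ATilde p := WittVector.map (galCFlat σ)

theorem galATilde_algebraMap (σ : GQp p) (x : AInf p) :
    galATilde σ (algebraMap (AInf p) (ATilde p) x) = algebraMap (AInf p) (ATilde p) (galAInf σ x) := by
  refine WittVector.ext fun n => ?_
  change galCFlat σ (algebraMap _ _ (x.coeff n)) = algebraMap _ _ (galOFlat σ (x.coeff n))
  exact IsLocalization.map_eq (M := nonZeroDivisors (OFlat p)) (T := nonZeroDivisors (OFlat p))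
    (S := CFlat p) (Q := CFlat p) (g := galOFlat σ)
    (nonZeroDivisors_le_comap_nonZeroDivisors_of_injective _ (galOFlat_injective σ)) (x.coeff n)

theorem galAInf_algebraMap (σ : GQp p) (z : ℤ_[p]) :
    galAInf σ (algebraMap ℤ_[p] (AInf p) z) = algebraMap ℤ_[p] (AInf p) z :=
  map_padicIntToWitt p (galOFlat σ) z

/-- `K_n = K(μ_{p^n})`. -/
def cycloLayer (K : IntermediateField ℚ_[p] (PadicAlgCl p)) (n : ℕ) :
    IntermediateField ℚ_[p] (PadicAlgCl p) :=
  K ⊔ IntermediateField.adjoin ℚ_[p] {z | z ^ (p ^ n) = 1}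

/-- `K_∞ = K(μ_{p^∞})`. -/
def cycloField (K : IntermediateField ℚ_[p] (PadicAlgCl p)) :
    IntermediateField ℚ_[p] (PadicAlgCl p) :=
  K ⊔ IntermediateField.adjoin ℚ_[p] {z | ∃ n : ℕ, z ^ (p ^ n) = 1}

/-- `H_K`, the absolute Galois group of `K_∞`. -/
def HK (K : IntermediateField ℚ_[p] (PadicAlgCl p)) : Subgroup (GQp p) :=
  (cycloField K).fixingSubgroup

theorem HK_fix {K : IntermediateField ℚ_[p] (PadicAlgCl p)} (σ : HK K) {z : PadicAlgCl p} {n : ℕ}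
    (hz : z ^ (p ^ n) = 1) : (σ : GQp p) z = z := by
  refine (IntermediateField.mem_fixingSubgroup_iff _ _).1 σ.2 z ?_
  exact (le_sup_right : _ ≤ cycloField K) (IntermediateField.subset_adjoin _ _ ⟨n, hz⟩)

end Galois

/-! ### Completed and localised modules -/

section Completion

variable {S : Type*} [CommRing S] (π : S)

/-- The `π`-adic completion `lim_i M / π^i`. -/
abbrev Cpl (M : Type*) [AddCommGroup M] [Module S M] : Type _ :=
  AdicCompletion (Ideal.span {π}) M

/-- The inverse limit topology on `lim_i M / π^i`, each `M / π^i` being discrete. -/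
instance Cpl.topology (M : Type*) [AddCommGroup M] [Module S M] : TopologicalSpace (Cpl π M) :=
  ⨅ i : ℕ, TopologicalSpace.induced (AdicCompletion.eval (Ideal.span {π}) M i) ⊥

/-- The module `(lim_i M / π^i)[1/π]`. -/
def CplLoc (M : Type*) [AddCommGroup M] [Module S M] : Type _ :=
  LocalizedModule (Submonoid.powers π) (Cpl π M)

instance CplLoc.addCommGroup (M : Type*) [AddCommGroup M] [Module S M] :
    AddCommGroup (CplLoc π M) :=
  inferInstanceAs (AddCommGroup (LocalizedModule (Submonoid.powers π) (Cpl π M)))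

instance CplLoc.module (M : Type*) [AddCommGroup M] [Module S M] : Module S (CplLoc π M) :=
  inferInstanceAs (Module S (LocalizedModule (Submonoid.powers π) (Cpl π M)))

/-- The localisation map `M^∧ → M^∧[1/π]`. -/
def CplLoc.mk (M : Type*) [AddCommGroup M] [Module S M] : Cpl π M →ₗ[S] CplLoc π M :=
  LocalizedModule.mkLinearMap (Submonoid.powers π) (Cpl π M)

instance CplLoc.isLocalizedModule (M : Type*) [AddCommGroup M] [Module S M] :
    IsLocalizedModule (Submonoid.powers π) (CplLoc.mk π M) :=
  inferInstanceAs (IsLocalizedModule (Submonoid.powers π)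
    (LocalizedModule.mkLinearMap (Submonoid.powers π) (Cpl π M)))

/-- The map `m ↦ m / π^n`. -/
def CplLoc.div (M : Type*) [AddCommGroup M] [Module S M] (n : ℕ) (m : Cpl π M) : CplLoc π M :=
  LocalizedModule.mk m ⟨π ^ n, n, rfl⟩

/-- The direct limit topology on `M^∧[1/π] = colim (M^∧ → M^∧ → ⋯)`: the finest topology for
which all the maps `M^∧ → M^∧[1/π]`, `m ↦ m / π^n` are continuous. -/
instance CplLoc.topology (M : Type*) [AddCommGroup M] [Module S M] :
    TopologicalSpace (CplLoc π M) :=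
  ⨆ n : ℕ, TopologicalSpace.coinduced (CplLoc.div π M n) (Cpl.topology π M)

/-- The natural map `M → M^∧[1/π]`. -/
def CplLoc.of (M : Type*) [AddCommGroup M] [Module S M] : M →ₗ[S] CplLoc π M :=
  (CplLoc.mk π M).comp (AdicCompletion.of (Ideal.span {π}) M)

/-- Functoriality of `M ↦ M^∧[1/π]`. -/
def CplLoc.map {M N : Type*} [AddCommGroup M] [Module S M] [AddCommGroup N] [Module S N]
    (g : M →ₗ[S] N) : CplLoc π M →ₗ[S] CplLoc π N :=
  IsLocalizedModule.map (Submonoid.powers π) (CplLoc.mk π M) (CplLoc.mk π N)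
    ((AdicCompletion.map (Ideal.span {π}) g).restrictScalars S)

theorem CplLoc.map_mk {M N : Type*} [AddCommGroup M] [Module S M] [AddCommGroup N] [Module S N]
    (g : M →ₗ[S] N) (m : Cpl π M) :
    CplLoc.map π g (CplLoc.mk π M m) =
      CplLoc.mk π N (AdicCompletion.map (Ideal.span {π}) g m) :=
  IsLocalizedModule.map_apply (Submonoid.powers π) (CplLoc.mk π M) (CplLoc.mk π N)
    ((AdicCompletion.map (Ideal.span {π}) g).restrictScalars S) m

theorem CplLoc.map_of {M N : Type*} [AddCommGroup M] [Module S M] [AddCommGroup N] [Module S N]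
    (g : M →ₗ[S] N) (m : M) : CplLoc.map π g (CplLoc.of π M m) = CplLoc.of π N (g m) := by
  simp only [CplLoc.of, LinearMap.comp_apply]
  rw [CplLoc.map_mk, AdicCompletion.map_of]

theorem CplLoc.map_comp {M N P : Type*} [AddCommGroup M] [Module S M] [AddCommGroup N] [Module S N]
    [AddCommGroup P] [Module S P] (g : M →ₗ[S] N) (h : N →ₗ[S] P) :
    CplLoc.map π (h.comp g) = (CplLoc.map π h).comp (CplLoc.map π g) := by
  refine IsLocalizedModule.ext (Submonoid.powers π) (CplLoc.mk π M)
    (IsLocalizedModule.map_units (CplLoc.mk π P)) ?_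
  refine LinearMap.ext fun m => ?_
  simp only [LinearMap.comp_apply, CplLoc.map_mk, AdicCompletion.map_comp_apply]

end Completion

/-! ### Inclusions and reductions as linear maps over a smaller ring -/

section Generic

/-- The inclusion of subalgebras `U ⊆ V`, as a linear map over a ring `S` of scalars. -/
def inclLin (S : Type*) {R B : Type*} [CommRing S] [CommRing R] [CommRing B] [Algebra S R]
    [Algebra R B] [Algebra S B] [IsScalarTower S R B] {U V : Subalgebra R B} (h : U ≤ V) :
    U →ₗ[S] V where
  toFun x := ⟨x, h x.2⟩
  map_add' _ _ := rfl
  map_smul' _ _ := rfl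

theorem coe_inclLin (S : Type*) {R B : Type*} [CommRing S] [CommRing R] [CommRing B] [Algebra S R]
    [Algebra R B] [Algebra S B] [IsScalarTower S R B] {U V : Subalgebra R B} (h : U ≤ V) (x : U) :
    (inclLin S h x : B) = x := rfl

theorem factor_comp_quotientMap {S R : Type*} [CommRing S] [CommRing R] [Algebra S R]
    {I J : Ideal R} (hIJ : I ≤ J) (g : R →ₐ[S] R) (hI : I ≤ I.comap g) (hJ : J ≤ J.comap g) :
    (Ideal.Quotient.factorₐ S hIJ).toLinearMap.comp (Ideal.quotientMapₐ I g hI).toLinearMap =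
      (Ideal.quotientMapₐ J g hJ).toLinearMap.comp (Ideal.Quotient.factorₐ S hIJ).toLinearMap := by
  refine LinearMap.ext fun w => ?_
  obtain ⟨w, rfl⟩ := Ideal.Quotient.mk_surjective w
  rfl

end Generic

/-! ### The elements `ε`, `ϖ`, `T` -/

section Elements

/-- A compatible system of primitive `p`-power roots of unity. -/
structure CycloSystem (p : ℕ) [Fact p.Prime] where
  /-- the chosen primitive `p^n`-th root of unity -/
  ζ : ℕ → PadicAlgCl p
  isPrimitiveRoot : ∀ n, IsPrimitiveRoot (ζ n) (p ^ n)
  pow_succ : ∀ n, ζ (n + 1) ^ p = ζ n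

variable {p : ℕ} [Fact p.Prime] (Z : CycloSystem p)

theorem CycloSystem.pow_eq_one (n : ℕ) : Z.ζ n ^ p ^ n = 1 := (Z.isPrimitiveRoot n).pow_eq_one

/-- The roots of unity as elements of `𝓞_ℂ`. -/
def CycloSystem.zetaO (n : ℕ) : 𝓞_ℂ_[p] :=
  ⟨((Z.ζ n : PadicAlgCl p) : ℂ_[p]), by
    rw [mem_int_iff, PadicComplex.norm_extends]
    have h : ‖Z.ζ n‖ ^ p ^ n = 1 := by rw [← norm_pow, Z.pow_eq_one, norm_one]
    exact ((pow_eq_one_iff_of_nonneg (norm_nonneg _)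
      (pow_ne_zero _ (Fact.out : p.Prime).ne_zero)).1 h).le⟩

/-- `ε = (1, ζ_p, ζ_{p²}, …) ∈ 𝓞_ℂ^♭`. -/
def CycloSystem.eps : OFlat p :=
  ⟨fun n => Ideal.Quotient.mk _ (Z.zetaO n), fun n => by
    rw [← map_pow]
    congr 1
    apply Subtype.ext
    change ((Z.ζ (n + 1) : PadicAlgCl p) : ℂ_[p]) ^ p = ((Z.ζ n : PadicAlgCl p) : ℂ_[p])
    rw [← Z.pow_succ n]
    exact (map_pow (algebraMap (PadicAlgCl p) ℂ_[p]) _ _).symm⟩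

/-- `ϖ = ε - 1`. -/
def CycloSystem.varpi : OFlat p := Z.eps - 1

/-- `ϖ^{1/p^n}`. -/
def CycloSystem.varpiRoot (n : ℕ) : OFlat p := (frobeniusEquiv (OFlat p) p).symm^[n] Z.varpi

/-- The Teichmüller lift `[ϖ]`. -/
def CycloSystem.teichVarpi : AInf p := WittVector.teichmuller p Z.varpi

/-- `T = [ε] - 1`. -/
def CycloSystem.T : AInf p := WittVector.teichmuller p Z.eps - 1

/-- The subring `ℤ_p[P] ⊆ A_inf` generated by the Teichmüller lift `P = [ϖ]`. Everything below
that is completed or localised with respect to `[ϖ]` is regarded as a module over this ring. -/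
abbrev CycloSystem.PW : Type := ↥(Algebra.adjoin ℤ_[p] ({Z.teichVarpi} : Set (AInf p)))

/-- `[ϖ]` as an element of the ring it generates. -/
def CycloSystem.piW : Z.PW := ⟨Z.teichVarpi, Algebra.subset_adjoin rfl⟩

/-- The subring `ℤ_p[T] ⊆ A_inf`. Everything below that is completed or localised with
respect to `T` is regarded as a module over this ring. -/
abbrev CycloSystem.PT : Type := ↥(Algebra.adjoin ℤ_[p] ({Z.T} : Set (AInf p)))

/-- `T` as an element of `ℤ_p[T]`. -/
def CycloSystem.piT : Z.PT := ⟨Z.T, Algebra.subset_adjoin rfl⟩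

variable {K : IntermediateField ℚ_[p] (PadicAlgCl p)}

theorem gal_eps (σ : HK K) : galOFlat (σ : GQp p) Z.eps = Z.eps := by
  refine Perfection.ext fun n => ?_
  change galModP (σ : GQp p) (Ideal.Quotient.mk _ (Z.zetaO n)) = Ideal.Quotient.mk _ (Z.zetaO n)
  rw [galModP, Ideal.quotientMap_mk]
  congr 1
  apply Subtype.ext
  change galC (σ : GQp p) ((Z.ζ n : PadicAlgCl p) : ℂ_[p]) = ((Z.ζ n : PadicAlgCl p) : ℂ_[p])
  rw [galC_coe, HK_fix σ (Z.pow_eq_one n)]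

theorem gal_varpi (σ : HK K) : galOFlat (σ : GQp p) Z.varpi = Z.varpi := by
  rw [CycloSystem.varpi, map_sub, gal_eps, map_one]

theorem gal_varpiRoot (σ : HK K) (n : ℕ) :
    galOFlat (σ : GQp p) (Z.varpiRoot n) = Z.varpiRoot n := by
  induction n with
  | zero => exact gal_varpi Z σ
  | succ n ih =>
    apply (frobeniusEquiv (OFlat p) p).injective
    have h : frobeniusEquiv (OFlat p) p (Z.varpiRoot (n + 1)) = Z.varpiRoot n := by
      simp only [CycloSystem.varpiRoot, Function.iterate_succ_apply', RingEquiv.apply_symm_apply]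
    rw [h, ← ih, ← h]
    simp [frobeniusEquiv_apply, frobenius_def]

theorem galAInf_teichmuller (σ : GQp p) (x : OFlat p) :
    galAInf σ (WittVector.teichmuller p x) = WittVector.teichmuller p (galOFlat σ x) :=
  WittVector.map_teichmuller p (galOFlat σ) x

theorem galAInf_PW (σ : HK K) (s : Z.PW) : galAInf (σ : GQp p) (s : AInf p) = s := by
  obtain ⟨s, hs⟩ := s
  change galAInf (σ : GQp p) s = s
  induction hs using Algebra.adjoin_induction with
  | mem x hx =>
    rw [Set.mem_singleton_iff.1 hx, CycloSystem.teichVarpi, galAInf_teichmuller, gal_varpi]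
  | algebraMap z => exact galAInf_algebraMap _ z
  | add x y _ _ hx hy => rw [map_add, hx, hy]
  | mul x y _ _ hx hy => rw [map_mul, hx, hy]

/-- The action of `H_K` on `A_inf`, which is linear over `PW`. -/
def galAInfAlg (σ : HK K) : AInf p →ₐ[Z.PW] AInf p :=
  { galAInf (σ : GQp p) with commutes' := fun s => galAInf_PW Z σ s }

/-- The action of `H_K` on `W(ℂ^♭)`, which is linear over `PW`. -/
def galATildeAlg (σ : HK K) : ATilde p →ₐ[Z.PW] ATilde p :=
  { galATilde (σ : GQp p) with
    commutes' := fun s => by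
      change galATilde (σ : GQp p) (algebraMap (AInf p) (ATilde p) s) = _
      rw [galATilde_algebraMap, galAInf_PW]
      rfl }

end Elements

/-! ### The rings `Ã^{(0,r],∘}` -/

section Overconvergent

variable {p : ℕ} [Fact p.Prime]

/-- The radii: `r > 0` with `1/r ∈ ℤ[1/p]`. -/
abbrev Radius (p : ℕ) : Type := {r : ℚ // 0 < r ∧ ∃ m n : ℕ, (m : ℚ) = r⁻¹ * p ^ n}

variable (Z : CycloSystem p)

/-- The elements `z = p / [ϖ]^{1/r}` of `W(ℂ^♭)`; if `1/r = m/p^n`, then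
`[ϖ]^{1/r} = [ϖ^{1/p^n}]^m`. There is exactly one such `z`. -/
def pDivVarpi (r : Radius p) : Set (ATilde p) :=
  {z | ∃ m n : ℕ, (m : ℚ) = (r : ℚ)⁻¹ * p ^ n ∧
    z * algebraMap (AInf p) (ATilde p) (WittVector.teichmuller p (Z.varpiRoot n)) ^ m = p}

/-- `A_inf[p/[ϖ]^{1/r}]`. -/
def polyRing (r : Radius p) : Subalgebra (AInf p) (ATilde p) :=
  Algebra.adjoin (AInf p) (pDivVarpi Z r)

/-- `Ã^{(0,r],∘} = A_inf⟨p/[ϖ]^{1/r}⟩`, the `p`-adic completion of `B = A_inf[p/[ϖ]^{1/r}]`, as a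
subring of `W(ℂ^♭)`: the limits in `W(ℂ^♭)` of the sequences in `B` that are Cauchy for the
`p`-adic topology of `B`. In terms of Teichmüller expansions this is the set of all
`∑ p^k [x_k]` for which `val(x_k) + k · val(ϖ) / r` is nonnegative and tends to infinity. -/
def overconvInt (r : Radius p) : Subalgebra (AInf p) (ATilde p) where
  carrier := {x | ∃ s : ℕ → ATilde p, (∀ n, s n ∈ polyRing Z r) ∧
    (∀ n, ∃ b ∈ polyRing Z r, s (n + 1) - s n = (p : ATilde p) ^ n * b) ∧
    ∀ n, (p : ATilde p) ^ n ∣ x - s n}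
  mul_mem' := by
    rintro x y ⟨s, hs, hs', hx⟩ ⟨t, ht, ht', hy⟩
    refine ⟨fun n => s n * t n, fun n => mul_mem (hs n) (ht n), fun n => ?_, fun n => ?_⟩
    · obtain ⟨b, hb, hb'⟩ := hs' n
      obtain ⟨c, hc, hc'⟩ := ht' n
      refine ⟨s (n + 1) * c + b * t n,
        add_mem (mul_mem (hs _) hc) (mul_mem hb (ht n)), ?_⟩
      linear_combination s (n + 1) * hc' + t n * hb'
    · obtain ⟨u, hu⟩ := hx n
      obtain ⟨v, hv⟩ := hy n
      exact ⟨u * y + s n * v, by linear_combination y * hu + s n * hv⟩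
  add_mem' := by
    rintro x y ⟨s, hs, hs', hx⟩ ⟨t, ht, ht', hy⟩
    refine ⟨fun n => s n + t n, fun n => add_mem (hs n) (ht n), fun n => ?_, fun n => ?_⟩
    · obtain ⟨b, hb, hb'⟩ := hs' n
      obtain ⟨c, hc, hc'⟩ := ht' n
      exact ⟨b + c, add_mem hb hc, by linear_combination hb' + hc'⟩
    · obtain ⟨u, hu⟩ := hx n
      obtain ⟨v, hv⟩ := hy n
      exact ⟨u + v, by linear_combination hu + hv⟩
  algebraMap_mem' a :=
    ⟨fun _ => algebraMap _ _ a, fun _ => algebraMap_mem _ a,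
      fun _ => ⟨0, zero_mem _, by simp⟩, fun _ => by simp⟩

theorem polyRing_mono {r s : Radius p} (h : r ≤ s) : polyRing Z s ≤ polyRing Z r := by
  refine Algebra.adjoin_le ?_
  rintro z ⟨m, n, hmn, hz⟩
  obtain ⟨m', n', hmn'⟩ := r.2.2
  have hp0 : (0 : ℚ) < p := by exact_mod_cast (Fact.out : p.Prime).pos
  have hpne : (p : ATilde p) ≠ 0 := WittVector.p_nonzero p (CFlat p)
  have hroot : ∀ a b : ℕ, Z.varpiRoot (a + b) ^ p ^ b = Z.varpiRoot a := by
    intro a b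
    induction b with
    | zero => simp
    | succ b ih =>
      rw [← ih, pow_succ', pow_mul]
      congr 1
      have : frobenius (OFlat p) p (Z.varpiRoot (a + b + 1)) = Z.varpiRoot (a + b) := by
        rw [← frobeniusEquiv_apply]
        simp only [CycloSystem.varpiRoot, Function.iterate_succ_apply', RingEquiv.apply_symm_apply]
      exact this
  set τ : OFlat p → ATilde p :=
    fun x => algebraMap (AInf p) (ATilde p) (WittVector.teichmuller p x) with hτ
  have hτpow : ∀ x k, τ (x ^ k) = τ x ^ k := fun x k => by simp [hτ]
  have hm : m ≠ 0 := by
    rintro rfl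
    have : (0 : ℚ) < (s : ℚ)⁻¹ * p ^ n := mul_pos (inv_pos.2 s.2.1) (pow_pos hp0 n)
    rw [← hmn] at this
    simp at this
  -- pass to the common exponent `n + n'`
  set ρ := Z.varpiRoot (n + n') with hρ
  have h1 : Z.varpiRoot n = ρ ^ p ^ n' := (hroot n n').symm
  have h2 : Z.varpiRoot n' = ρ ^ p ^ n := by rw [hρ, add_comm, hroot]
  have hz1 : z * τ ρ ^ (p ^ n' * m) = p := by
    rw [pow_mul, ← hτpow, ← h1]; exact hz
  have hle : p ^ n' * m ≤ p ^ n * m' := by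
    have : (r : ℚ) ≤ s := h
    have hinv : (s : ℚ)⁻¹ ≤ (r : ℚ)⁻¹ := inv_anti₀ r.2.1 this
    have : ((p ^ n' * m : ℕ) : ℚ) ≤ ((p ^ n * m' : ℕ) : ℚ) := by
      push_cast
      rw [hmn, hmn']
      have hpp : (0 : ℚ) < p ^ n * p ^ n' := by positivity
      nlinarith
    exact_mod_cast this
  have hρ0 : ρ ≠ 0 := by
    intro h0
    apply hpne
    rw [← hz1, h0]
    have : τ (0 : OFlat p) = 0 := by simp [hτ]
    rw [this, zero_pow (mul_ne_zero (pow_ne_zero _ (Fact.out : p.Prime).ne_zero) hm), mul_zero]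
  have hunit : IsUnit (τ ρ) := by
    have : τ ρ = WittVector.teichmuller p (algebraMap (OFlat p) (CFlat p) ρ) :=
      WittVector.map_teichmuller p (algebraMap (OFlat p) (CFlat p)) ρ
    rw [this]
    refine IsUnit.map _ (IsUnit.mk0 _ ?_)
    exact (map_ne_zero_iff _ (IsFractionRing.injective (OFlat p) (CFlat p))).2 hρ0
  obtain ⟨u, hu⟩ := hunit
  have hmem : (p : ATilde p) * (↑(u⁻¹ ^ (p ^ n * m')) : ATilde p) ∈ polyRing Z r := by
    refine Algebra.subset_adjoin ⟨m', n', hmn', ?_⟩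
    rw [h2]
    change _ * τ _ ^ m' = _
    rw [hτpow, ← hu, ← pow_mul, mul_assoc, ← Units.val_pow_eq_pow_val, ← Units.val_mul,
      ← mul_pow]
    simp
  have hzeq : z = algebraMap (AInf p) (ATilde p)
      (WittVector.teichmuller p ρ ^ (p ^ n * m' - p ^ n' * m)) *
      ((p : ATilde p) * (↑(u⁻¹ ^ (p ^ n * m')) : ATilde p)) := by
    have e1 : algebraMap (AInf p) (ATilde p)
        (WittVector.teichmuller p ρ ^ (p ^ n * m' - p ^ n' * m)) =
        ((u ^ (p ^ n * m' - p ^ n' * m) : (ATilde p)ˣ) : ATilde p) := by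
      rw [map_pow, Units.val_pow_eq_pow_val, hu]
    have e2 : ((u ^ (p ^ n * m' - p ^ n' * m) : (ATilde p)ˣ) : ATilde p) *
        (↑(u⁻¹ ^ (p ^ n * m')) : ATilde p) = ((u⁻¹ ^ (p ^ n' * m) : (ATilde p)ˣ) : ATilde p) := by
      rw [← Units.val_mul]
      congr 1
      rw [inv_pow, inv_pow, mul_inv_eq_iff_eq_mul, eq_inv_mul_iff_mul_eq, ← pow_add,
        Nat.add_sub_cancel' hle]
    rw [e1, mul_left_comm, e2, ← hz1, ← hu, mul_assoc, ← Units.val_pow_eq_pow_val, ← Units.val_mul,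
      ← mul_pow]
    simp
  rw [hzeq]
  exact mul_mem (algebraMap_mem _ _) hmem

theorem overconvInt_mono {r s : Radius p} (h : r ≤ s) : overconvInt Z s ≤ overconvInt Z r := by
  rintro x ⟨t, ht, ht', hx⟩
  exact ⟨t, fun n => polyRing_mono Z h (ht n),
    fun n => (ht' n).imp fun b hb => ⟨polyRing_mono Z h hb.1, hb.2⟩, hx⟩

variable {K : IntermediateField ℚ_[p] (PadicAlgCl p)}

theorem gal_polyRing (σ : HK K) (r : Radius p) {x : ATilde p} (hx : x ∈ polyRing Z r) :
    galATilde (σ : GQp p) x ∈ polyRing Z r := by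
  induction hx using Algebra.adjoin_induction with
  | mem z hz =>
    obtain ⟨m, n, hmn, hz⟩ := hz
    refine Algebra.subset_adjoin ⟨m, n, hmn, ?_⟩
    have h := congrArg (galATilde (σ : GQp p)) hz
    rw [map_mul, map_pow, galATilde_algebraMap, galAInf_teichmuller, gal_varpiRoot,
      map_natCast] at h
    exact h
  | algebraMap a => rw [galATilde_algebraMap]; exact algebraMap_mem _ _
  | add x y _ _ hx hy => rw [map_add]; exact add_mem hx hy
  | mul x y _ _ hx hy => rw [map_mul]; exact mul_mem hx hy

theorem gal_overconvInt (σ : HK K) (r : Radius p) {x : ATilde p} (hx : x ∈ overconvInt Z r) :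
    galATilde (σ : GQp p) x ∈ overconvInt Z r := by
  obtain ⟨s, hs, hs', hx⟩ := hx
  refine ⟨fun n => galATilde (σ : GQp p) (s n), fun n => gal_polyRing Z σ r (hs n), fun n => ?_,
    fun n => ?_⟩
  · obtain ⟨b, hb, hb'⟩ := hs' n
    refine ⟨galATilde (σ : GQp p) b, gal_polyRing Z σ r hb, ?_⟩
    rw [← map_sub, hb', map_mul, map_pow, map_natCast]
  · have := map_dvd (galATilde (σ : GQp p)) (hx n)
    rwa [map_pow, map_natCast, map_sub] at this

/-- The action of `H_K` on `Ã^{(0,r],∘}`. -/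
def galOverconvInt (σ : HK K) (r : Radius p) : overconvInt Z r →ₗ[Z.PW] overconvInt Z r where
  toFun x := ⟨galATilde (σ : GQp p) x, gal_overconvInt Z σ r x.2⟩
  map_add' _ _ := Subtype.ext (map_add _ _ _)
  map_smul' s x := Subtype.ext ((galATildeAlg Z σ).toLinearMap.map_smul s (x : ATilde p))

/-- The inclusion `Ã^{(0,s],∘} ⊆ Ã^{(0,r],∘}` for `r ≤ s`. -/
def overconvIntIncl {r s : Radius p} (h : r ≤ s) : overconvInt Z s →ₗ[Z.PW] overconvInt Z r :=
  inclLin Z.PW (overconvInt_mono Z h)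

theorem coe_overconvIntIncl {r s : Radius p} (h : r ≤ s) (x : overconvInt Z s) :
    (overconvIntIncl Z h x : ATilde p) = x :=
  coe_inclLin Z.PW (overconvInt_mono Z h) x

theorem coe_galOverconvInt (σ : HK K) (r : Radius p) (x : overconvInt Z r) :
    (galOverconvInt Z σ r x : ATilde p) = galATilde (σ : GQp p) x := rfl

theorem overconvIntIncl_gal {r s : Radius p} (h : r ≤ s) (σ : HK K) :
    (overconvIntIncl Z h).comp (galOverconvInt Z σ s) =
      (galOverconvInt Z σ r).comp (overconvIntIncl Z h) := by
  refine LinearMap.ext fun x => Subtype.ext ?_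
  rw [LinearMap.comp_apply, LinearMap.comp_apply, coe_overconvIntIncl, coe_galOverconvInt,
    coe_galOverconvInt, coe_overconvIntIncl]

end Overconvergent

/-! ### Perfect coefficient modules -/

section Perfect

variable {p : ℕ} [Fact p.Prime] (Z : CycloSystem p)
variable (A : Type*) [AddCommGroup A] [Module ℤ_[p] A]

instance (r : Radius p) : Module Z.PW (overconvInt Z r ⊗[ℤ_[p]] A) :=
  TensorProduct.leftModule

/-- `Ã_A^{(0,r]} = (lim_i (Ã^{(0,r],∘} ⊗ A) / [ϖ]^i)[1/[ϖ]]`. -/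
abbrev OverconvA (r : Radius p) : Type _ := CplLoc Z.piW (overconvInt Z r ⊗[ℤ_[p]] A)

/-- The element `x ⊗ a` of `Ã_A^{(0,r]}` for `x ∈ A_inf`. -/
def OverconvA.tmul (r : Radius p) (x : AInf p) (a : A) : OverconvA Z A r :=
  CplLoc.of Z.piW _ (algebraMap (AInf p) (overconvInt Z r) x ⊗ₜ[ℤ_[p]] a)

/-- The transition map `Ã_A^{(0,s]} → Ã_A^{(0,r]}` for `r ≤ s`. -/
def OverconvA.trans {r s : Radius p} (h : r ≤ s) : OverconvA Z A s →ₗ[Z.PW] OverconvA Z A r :=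
  CplLoc.map Z.piW (TensorProduct.AlgebraTensorModule.rTensor ℤ_[p] A (overconvIntIncl Z h))

/-- `W_a(𝓞_ℂ^♭) = A_inf / p^a`. -/
abbrev WTrunc (p : ℕ) [Fact p.Prime] (a : ℕ) : Type :=
  AInf p ⧸ Ideal.span {(p : AInf p) ^ a}

instance (a : ℕ) : Module Z.PW (WTrunc p a ⊗[ℤ_[p]] A) := TensorProduct.leftModule

/-- `W_a(𝓞_ℂ^♭)_A[1/[ϖ]] = (lim_i (W_a(𝓞_ℂ^♭) ⊗ A) / [ϖ]^i)[1/[ϖ]]`. -/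
abbrev WTruncA (a : ℕ) : Type _ := CplLoc Z.piW (WTrunc p a ⊗[ℤ_[p]] A)

/-- The reduction `W_{a+1}(𝓞_ℂ^♭) → W_a(𝓞_ℂ^♭)`. -/
def WTrunc.red (a : ℕ) : WTrunc p (a + 1) →ₗ[Z.PW] WTrunc p a :=
  (Ideal.Quotient.factorₐ Z.PW (Ideal.span_singleton_le_span_singleton.2
    (pow_dvd_pow (p : AInf p) (Nat.le_succ a)))).toLinearMap

/-- The reduction `W_{a+1}(𝓞_ℂ^♭)_A[1/[ϖ]] → W_a(𝓞_ℂ^♭)_A[1/[ϖ]]`. -/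
def WTruncA.red (a : ℕ) : WTruncA Z A (a + 1) →ₗ[Z.PW] WTruncA Z A a :=
  CplLoc.map Z.piW (TensorProduct.AlgebraTensorModule.rTensor ℤ_[p] A (WTrunc.red Z a))

/-- `Ã_A = lim_a W_a(𝓞_ℂ^♭)_A[1/[ϖ]]`, with the inverse limit topology. -/
def ATildeA : Submodule Z.PW (∀ a : ℕ, WTruncA Z A a) where
  carrier := {x | ∀ a, WTruncA.red Z A a (x (a + 1)) = x a}
  zero_mem' a := by simp
  add_mem' hx hy a := by simp [hx a, hy a]
  smul_mem' c x hx a := by simp [hx a]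

/-- The element `x ⊗ b` of `Ã_A` for `x ∈ A_inf`. -/
def ATildeA.tmul (x : AInf p) (b : A) : ATildeA Z A :=
  ⟨fun a => CplLoc.of Z.piW _ ((Ideal.Quotient.mk _ x : WTrunc p a) ⊗ₜ[ℤ_[p]] b), fun a => by
    rw [WTruncA.red, CplLoc.map_of]
    rfl⟩

/-- `Ã_A^† = colim_r Ã_A^{(0,r]}`, the direct limit along `r → 0`. -/
abbrev Dagger : Type _ :=
  Module.DirectLimit (R := Z.PW) (ι := (Radius p)ᵒᵈ)
    (fun r => OverconvA Z A (OrderDual.ofDual r))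
    (fun _ _ h => OverconvA.trans Z A (OrderDual.ofDual_le_ofDual.2 h))

/-- The natural map `Ã_A^{(0,r]} → Ã_A^†`. -/
def Dagger.of (r : Radius p) : OverconvA Z A r →ₗ[Z.PW] Dagger Z A :=
  Module.DirectLimit.of (R := Z.PW) (ι := (Radius p)ᵒᵈ)
    (fun r => OverconvA Z A (OrderDual.ofDual r))
    (fun _ _ h => OverconvA.trans Z A (OrderDual.ofDual_le_ofDual.2 h)) (OrderDual.toDual r)

/-- The direct limit topology on `Ã_A^†`. -/
instance Dagger.topology : TopologicalSpace (Dagger Z A) :=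
  ⨆ r : Radius p, TopologicalSpace.coinduced (Dagger.of Z A r) inferInstance

/-! ### Invariants under `H_K` -/

variable {K : IntermediateField ℚ_[p] (PadicAlgCl p)}

/-- The action of `H_K` on `Ã_A^{(0,r]}`. -/
def OverconvA.gal (r : Radius p) (σ : HK K) : OverconvA Z A r →ₗ[Z.PW] OverconvA Z A r :=
  CplLoc.map Z.piW (TensorProduct.AlgebraTensorModule.rTensor ℤ_[p] A (galOverconvInt Z σ r))

/-- The action of `H_K` on `W_a(𝓞_ℂ^♭)`. -/
def WTrunc.gal (a : ℕ) (σ : HK K) : WTrunc p a →ₗ[Z.PW] WTrunc p a :=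
  (Ideal.quotientMapₐ (Ideal.span {(p : AInf p) ^ a}) (galAInfAlg Z σ) (by
    rw [Ideal.span_le, Set.singleton_subset_iff]
    simp)).toLinearMap

/-- The action of `H_K` on `W_a(𝓞_ℂ^♭)_A[1/[ϖ]]`. -/
def WTruncA.gal (a : ℕ) (σ : HK K) : WTruncA Z A a →ₗ[Z.PW] WTruncA Z A a :=
  CplLoc.map Z.piW (TensorProduct.AlgebraTensorModule.rTensor ℤ_[p] A (WTrunc.gal Z a σ))

theorem WTrunc.red_gal (a : ℕ) (σ : HK K) :
    (WTrunc.red Z a).comp (WTrunc.gal Z (a + 1) σ) = (WTrunc.gal Z a σ).comp (WTrunc.red Z a) :=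
  factor_comp_quotientMap _ (galAInfAlg Z σ) _ _

theorem WTruncA.red_gal (a : ℕ) (σ : HK K) (x : WTruncA Z A (a + 1)) :
    WTruncA.red Z A a (WTruncA.gal Z A (a + 1) σ x) = WTruncA.gal Z A a σ (WTruncA.red Z A a x) := by
  have h : (TensorProduct.AlgebraTensorModule.rTensor ℤ_[p] A (WTrunc.red Z a)).comp
      (TensorProduct.AlgebraTensorModule.rTensor ℤ_[p] A (WTrunc.gal Z (a + 1) σ)) =
      (TensorProduct.AlgebraTensorModule.rTensor ℤ_[p] A (WTrunc.gal Z a σ)).comp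
      (TensorProduct.AlgebraTensorModule.rTensor ℤ_[p] A (WTrunc.red Z a)) := by
    rw [← TensorProduct.AlgebraTensorModule.rTensor_comp,
      ← TensorProduct.AlgebraTensorModule.rTensor_comp, WTrunc.red_gal]
  have h2 := congrArg (CplLoc.map Z.piW) h
  rw [CplLoc.map_comp, CplLoc.map_comp] at h2
  exact LinearMap.congr_fun h2 x

/-- The action of `H_K` on `Ã_A`. -/
def ATildeA.gal (σ : HK K) : ATildeA Z A →ₗ[Z.PW] ATildeA Z A where
  toFun x := ⟨fun a => WTruncA.gal Z A a σ ((x : ∀ a, WTruncA Z A a) a), fun a => by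
    rw [WTruncA.red_gal, x.2 a]⟩
  map_add' _ _ := Subtype.ext (funext fun _ => map_add _ _ _)
  map_smul' c x := Subtype.ext (funext fun a => map_smul (WTruncA.gal Z A a σ) c (x.1 a))

theorem OverconvA.trans_gal {r s : Radius p} (h : r ≤ s) (σ : HK K) (x : OverconvA Z A s) :
    OverconvA.trans Z A h (OverconvA.gal Z A s σ x) =
      OverconvA.gal Z A r σ (OverconvA.trans Z A h x) := by
  have h1 : (TensorProduct.AlgebraTensorModule.rTensor ℤ_[p] A (overconvIntIncl Z h)).comp
      (TensorProduct.AlgebraTensorModule.rTensor ℤ_[p] A (galOverconvInt Z σ s)) =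
      (TensorProduct.AlgebraTensorModule.rTensor ℤ_[p] A (galOverconvInt Z σ r)).comp
      (TensorProduct.AlgebraTensorModule.rTensor ℤ_[p] A (overconvIntIncl Z h)) := by
    rw [← TensorProduct.AlgebraTensorModule.rTensor_comp,
      ← TensorProduct.AlgebraTensorModule.rTensor_comp, overconvIntIncl_gal]
  have h2 := congrArg (CplLoc.map Z.piW) h1
  rw [CplLoc.map_comp, CplLoc.map_comp] at h2
  exact LinearMap.congr_fun h2 x

/-- The action of `H_K` on `Ã_A^†`. -/
def Dagger.gal (σ : HK K) : Dagger Z A →ₗ[Z.PW] Dagger Z A :=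
  Module.DirectLimit.map (fun r => OverconvA.gal Z A (OrderDual.ofDual r) σ)
    (fun _ _ h => LinearMap.ext fun x => (OverconvA.trans_gal Z A (OrderDual.ofDual_le_ofDual.2 h) σ x).symm)

variable (K)

/-- `Ã_{K,A}^{(0,r]} = (Ã_A^{(0,r]})^{H_K}`. -/
def OverconvKA (r : Radius p) : Submodule Z.PW (OverconvA Z A r) :=
  ⨅ σ : HK K, LinearMap.eqLocus (OverconvA.gal Z A r σ) LinearMap.id

/-- `Ã_{K,A} = (Ã_A)^{H_K}`. -/
def ATildeKA : Submodule Z.PW (ATildeA Z A) :=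
  ⨅ σ : HK K, LinearMap.eqLocus (ATildeA.gal Z A σ) LinearMap.id

/-- `Ã_{K,A}^† = (Ã_A^†)^{H_K}`. -/
def DaggerKA : Submodule Z.PW (Dagger Z A) :=
  ⨅ σ : HK K, LinearMap.eqLocus (Dagger.gal Z A σ) LinearMap.id

end Perfect

/-! ### Imperfect coefficient rings -/

section Imperfect

variable {p : ℕ} [Fact p.Prime]

/-- The ring of integers `E_K^+` of the field of norms of `K_∞ / K`, inside `𝓞_ℂ^♭`: the
sequences `(x_n)` in the inverse limit of `𝓞_ℂ / p` along Frobenius such that, for all large `n`,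
`x_n` is congruent to an element of `𝓞_{K_n}` modulo the ideal of elements of valuation at least
`1/p`. -/
def EKplus (K : IntermediateField ℚ_[p] (PadicAlgCl p)) : Set (OFlat p) :=
  {x | ∃ n₀ : ℕ, ∀ n, n₀ ≤ n → ∃ y ∈ cycloLayer K n, ∃ z : 𝓞_ℂ_[p],
    Ideal.Quotient.mk _ z = PreTilt.coeff n x ∧
      ‖(z : ℂ_[p]) - ((y : PadicAlgCl p) : ℂ_[p])‖ ^ p ≤ 1 / (p : ℝ)}

/-- The field of norms `E_K` of `K_∞ / K`, inside `ℂ^♭`. -/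
def EK (K : IntermediateField ℚ_[p] (PadicAlgCl p)) : Set (CFlat p) :=
  {x | ∃ a ∈ EKplus K, ∃ b ∈ EKplus K, b ≠ 0 ∧
    x * algebraMap (OFlat p) (CFlat p) b = algebraMap (OFlat p) (CFlat p) a}

variable (Z : CycloSystem p)

/-- `A_{ℚ_p}^+ = ℤ_p[[T]]`, as the closure of `ℤ_p[T]` in `A_inf` for the `T`-adic topology. -/
def AQpPlus : Subalgebra ℤ_[p] (AInf p) where
  carrier := {x | ∀ n : ℕ, ∃ y ∈ Algebra.adjoin ℤ_[p] ({Z.T} : Set (AInf p)), Z.T ^ n ∣ x - y}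
  mul_mem' := by
    intro x x' hx hx' n
    obtain ⟨y, hy, u, hu⟩ := hx n
    obtain ⟨y', hy', v, hv⟩ := hx' n
    exact ⟨y * y', mul_mem hy hy', u * x' + y * v, by linear_combination x' * hu + y * hv⟩
  add_mem' := by
    intro x x' hx hx' n
    obtain ⟨y, hy, u, hu⟩ := hx n
    obtain ⟨y', hy', v, hv⟩ := hx' n
    exact ⟨y + y', add_mem hy hy', u + v, by linear_combination hu + hv⟩
  algebraMap_mem' z n := ⟨_, Subalgebra.algebraMap_mem _ z, by simp⟩

/-- `A_{ℚ_p}`, the `p`-adic completion of `ℤ_p[[T]][1/T]`, as the closure of `ℤ_p[[T]][1/T]` in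
`W(ℂ^♭)` for the `p`-adic topology (note that `T` is invertible in `W(ℂ^♭)`). -/
def AQp : Subalgebra ℤ_[p] (ATilde p) where
  carrier := {x | ∀ n : ℕ, ∃ m : ℕ, ∃ y ∈ AQpPlus Z,
    (p : ATilde p) ^ n ∣ algebraMap (AInf p) (ATilde p) Z.T ^ m * x - algebraMap _ _ y}
  mul_mem' := by
    intro x x' hx hx' n
    obtain ⟨m, y, hy, u, hu⟩ := hx n
    obtain ⟨m', y', hy', v, hv⟩ := hx' n
    refine ⟨m + m', y * y', mul_mem hy hy',
      u * (algebraMap (AInf p) (ATilde p) Z.T ^ m' * x') + algebraMap (AInf p) (ATilde p) y * v, ?_⟩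
    rw [map_mul]
    linear_combination (algebraMap (AInf p) (ATilde p) Z.T ^ m' * x') * hu +
      algebraMap (AInf p) (ATilde p) y * hv
  add_mem' := by
    intro x x' hx hx' n
    obtain ⟨m, y, hy, u, hu⟩ := hx n
    obtain ⟨m', y', hy', v, hv⟩ := hx' n
    have hT : Z.T ∈ AQpPlus Z := fun n => ⟨Z.T, Algebra.subset_adjoin rfl, by simp⟩
    refine ⟨m + m', Z.T ^ m' * y + Z.T ^ m * y',
      add_mem (mul_mem (pow_mem hT _) hy) (mul_mem (pow_mem hT _) hy'),
      algebraMap (AInf p) (ATilde p) Z.T ^ m' * u + algebraMap (AInf p) (ATilde p) Z.T ^ m * v, ?_⟩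
    rw [map_add, map_mul, map_mul, map_pow, map_pow]
    linear_combination algebraMap (AInf p) (ATilde p) Z.T ^ m' * hu +
      algebraMap (AInf p) (ATilde p) Z.T ^ m * hv
  algebraMap_mem' z n := ⟨0, _, Subalgebra.algebraMap_mem _ z, by
    rw [← IsScalarTower.algebraMap_apply ℤ_[p] (AInf p) (ATilde p)]; simp⟩

theorem algebraMap_PT_mem (s : Z.PT) : algebraMap (AInf p) (ATilde p) s ∈ AQp Z :=
  fun _ => ⟨0, s, fun _ => ⟨s, s.2, by simp⟩, by simp⟩

/-- `A_K`, the finite étale extension of `A_{ℚ_p}` in `W(ℂ^♭)` which lifts the finite separable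
extension `E_K / E_{ℚ_p}`. It is generated by the elements of `W(ℂ^♭)` which reduce into `E_K` and
are roots `x` of monic polynomials `f` over `A_{ℚ_p}` for which `f'(x)` is a unit. -/
def AK (K : IntermediateField ℚ_[p] (PadicAlgCl p)) : Subalgebra (AQp Z) (ATilde p) :=
  Algebra.adjoin (AQp Z) {x | x.coeff 0 ∈ EK K ∧ ∃ f : Polynomial (AQp Z),
    f.Monic ∧ Polynomial.aeval x f = 0 ∧ IsUnit (Polynomial.aeval x (Polynomial.derivative f))}

variable (K : IntermediateField ℚ_[p] (PadicAlgCl p))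

/-- `A_K^{(0,r],∘} = A_K ∩ Ã^{(0,r],∘}`. -/
def AKoverconvInt (r : Radius p) : Subalgebra Z.PT (ATilde p) where
  carrier := {x | x ∈ AK Z K ∧ x ∈ overconvInt Z r}
  mul_mem' hx hy := ⟨mul_mem hx.1 hy.1, mul_mem hx.2 hy.2⟩
  add_mem' hx hy := ⟨add_mem hx.1 hy.1, add_mem hx.2 hy.2⟩
  algebraMap_mem' s :=
    ⟨Subalgebra.algebraMap_mem (AK Z K) ⟨algebraMap (AInf p) (ATilde p) s, algebraMap_PT_mem Z s⟩,
      Subalgebra.algebraMap_mem (overconvInt Z r) (s : AInf p)⟩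

theorem AKoverconvInt_mono {r s : Radius p} (h : r ≤ s) :
    AKoverconvInt Z K s ≤ AKoverconvInt Z K r :=
  fun _ hx => ⟨hx.1, overconvInt_mono Z h hx.2⟩

/-- The inclusion `A_K^{(0,s],∘} ⊆ A_K^{(0,r],∘}` for `r ≤ s`. -/
def AKoverconvIntIncl {r s : Radius p} (h : r ≤ s) :
    AKoverconvInt Z K s →ₗ[Z.PT] AKoverconvInt Z K r :=
  inclLin Z.PT (AKoverconvInt_mono Z K h)

instance (r : Radius p) : SMulCommClass ℤ_[p] Z.PT (AKoverconvInt Z K r) :=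
  IsScalarTower.to_smulCommClass

variable (A : Type*) [AddCommGroup A] [Module ℤ_[p] A]

instance (r : Radius p) : Module Z.PT (AKoverconvInt Z K r ⊗[ℤ_[p]] A) :=
  TensorProduct.leftModule

/-- `A_{K,A}^{(0,r]} = (lim_i (A_K^{(0,r],∘} ⊗ A) / T^i)[1/T]`. -/
abbrev OverconvImpKA (r : Radius p) : Type _ := CplLoc Z.piT (AKoverconvInt Z K r ⊗[ℤ_[p]] A)

/-- The transition map `A_{K,A}^{(0,s]} → A_{K,A}^{(0,r]}` for `r ≤ s`. -/
def OverconvImpKA.trans {r s : Radius p} (h : r ≤ s) :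
    OverconvImpKA Z K A s →ₗ[Z.PT] OverconvImpKA Z K A r :=
  CplLoc.map Z.piT (TensorProduct.AlgebraTensorModule.rTensor ℤ_[p] A (AKoverconvIntIncl Z K h))

/-- `A_{K,A}^† = colim_r A_{K,A}^{(0,r]}`, the direct limit along `r → 0`. -/
abbrev DaggerImpKA : Type _ :=
  Module.DirectLimit (R := Z.PT) (ι := (Radius p)ᵒᵈ)
    (fun r => OverconvImpKA Z K A (OrderDual.ofDual r))
    (fun _ _ h => OverconvImpKA.trans Z K A (OrderDual.ofDual_le_ofDual.2 h))

/-- The natural map `A_{K,A}^{(0,r]} → A_{K,A}^†`. -/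
def DaggerImpKA.of (r : Radius p) : OverconvImpKA Z K A r →ₗ[Z.PT] DaggerImpKA Z K A :=
  Module.DirectLimit.of (R := Z.PT) (ι := (Radius p)ᵒᵈ)
    (fun r => OverconvImpKA Z K A (OrderDual.ofDual r))
    (fun _ _ h => OverconvImpKA.trans Z K A (OrderDual.ofDual_le_ofDual.2 h)) (OrderDual.toDual r)

/-- The direct limit topology on `A_{K,A}^†`. -/
instance DaggerImpKA.topology : TopologicalSpace (DaggerImpKA Z K A) :=
  ⨆ r : Radius p, TopologicalSpace.coinduced (DaggerImpKA.of Z K A r) inferInstance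

end Imperfect

/-- A `p`-adically complete `ℤ_p`-algebra which is topologically of finite type: some finitely
generated subalgebra is dense for the `p`-adic topology. -/
def IsTopFiniteType (p : ℕ) [Fact p.Prime] (R : Type*) [CommRing R] [Algebra ℤ_[p] R] : Prop :=
  IsAdicComplete (Ideal.span {(p : R)}) R ∧
    ∃ s : Finset R, ∀ (x : R) (n : ℕ), ∃ y ∈ Algebra.adjoin ℤ_[p] (s : Set R),
      ∃ z : R, x = y + (p : R) ^ n * z

end PhiGamma

end

open PhiGamma

/-!
Every ring in sight contains `[ϖ]` or `T`, inverting them after completing. So a map or an element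
has to be controlled only up to a fixed power of `[ϖ]` or `T`, and this tolerance is what makes the
argument work. The module `A` enters through a single property, `exists_torsion_bound`: its
`p`-power torsion is killed by some `p^c`, because `A / p A` is a noetherian module and `A` is
`p`-adically separated. Consequently `p^c A` is flat over `ℤ_p`.

*The comparison map.* With `z = p / [ϖ]^{1/r}`, a power of `[ϖ]` depending on `a` maps
`Ã^{(0,r],∘}` into `A_inf + p^a Ã^{(0,r],∘}`. Multiplying by this power, reducing modulo `p^a` and
dividing by the power again gives `OverconvA.trunc`, and these maps for all `a` form the map
`OverconvA.toATildeA`. The same observation yields uniqueness (`OverconvA.hom_ext`): a map into the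
truncation at level `a` does not see multiples of `p^a`, so its values on `Ã^{(0,r],∘} ⊗ A` are
determined by those on the image of `A_inf ⊗ A`, and continuity does the rest. Compatibility with
the transition maps and with the Galois action follows from uniqueness.

*Injectivity.* An element of the kernel is the limit of a Cauchy sequence whose `i`-th term `y` is,
for every `k`, congruent to a multiple of `[ϖ]^i` modulo `p^k (W(ℂ^♭) ⊗ A)`. One has to conclude that
`y` is divisible by `[ϖ]^i` in `Ã^{(0,r],∘} ⊗ A`, up to a power of `[ϖ]` that does not depend on `i`.
This is `exists_pow_smul_eq_of_forall_close`. It uses that `p = z w` with `w = [ϖ]^{1/r}`, so that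
`p^k` carries the divisor `w^k` in `Ã^{(0,r],∘}`, and that the kernel of
`Ã^{(0,r],∘} ⊗ A → W(ℂ^♭) ⊗ A` is killed by a fixed power of `[ϖ]`. The injectivity of the
transition maps and the statements on `Ã_A^†` and on invariants are formal consequences.

*The imperfect rings.* There is no comparison map to use here, and the transition maps are treated
directly by `CplLoc.map_rTensor_injective`. The module `A` is cut into `A / p^c A` and `p^c A`.
For modules killed by a power of `p` one needs that divisibility by `T^i` modulo `p` in
`A_K^{(0,r],∘}` implies divisibility in `A_K^{(0,s],∘}`, up to a fixed power of `T`
(`exists_p_dvd_sub_T_pow_mul`). This rests on the finiteness of the set of residues modulo `ϖ` of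
elements of `E_K` in `𝓞_ℂ^♭` (`finite_residues`), a consequence of the bound `[K : ℚ_p]` for the
degree of `K_n` over `ℚ_p(ζ_{p^n})`, and on the fact that `A_K / p` injects into `ℂ^♭`
(`mem_AK_of_p_mul_mem`), which is proved by adjoining the generators of `A_K` one at a time
(`IsCohenSubring.adjoin`). The torsion free module `p^c A` has enough functionals to `ℤ_p`
(`mem_of_forall_functional`), which reduces it to `A = ℤ_p`. There the assertion holds because
`Ã^{(0,s],∘}` contains the sums of power series in `T`, and the ideals generated by the powers of
`T` in `Ã^{(0,r],∘}` have intersection zero.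
-/

open scoped TensorProduct NNReal

noncomputable section

namespace PhiGamma

/-! ### Convergent power series in one element of a ring -/

/-- All power series `∑ β_i t^i` can be summed in `R`: the sums `x n = ∑ β_{n+i} t^i` of the
series and of its tails exist and satisfy the evident recursion. This is derived `t`-adic
completeness. -/
def SumsExist (R : Type*) [CommRing R] (t : R) : Prop :=
  ∀ β : ℕ → R, ∃ x : ℕ → R, ∀ n, x n = β n + t * x (n + 1)

theorem eq_partialSum_add {R : Type*} [CommRing R] {t : R} {β x : ℕ → R}
    (h : ∀ n, x n = β n + t * x (n + 1)) (n : ℕ) :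
    x 0 = ∑ i ∈ Finset.range n, t ^ i * β i + t ^ n * x n := by
  induction n with
  | zero => simp
  | succ n ih => rw [ih, Finset.sum_range_succ, h n]; ring

theorem SumsExist.of_isAdicComplete {R : Type*} [CommRing R] (t : R)
    [IsAdicComplete (Ideal.span {t}) R] : SumsExist R t := by
  intro β
  have hmem : ∀ (n : ℕ) (x y : R), x ≡ y [SMOD ((Ideal.span {t}) ^ n • ⊤ : Submodule R R)] ↔
      t ^ n ∣ x - y := fun n x y => by
    rw [SModEq.sub_mem, Ideal.span_singleton_pow, smul_eq_mul, Ideal.mul_top,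
      Ideal.mem_span_singleton]
  have hprec : ∀ m, ∃ L : R, ∀ n, t ^ n ∣ (∑ i ∈ Finset.range n, t ^ i * β (m + i)) - L := by
    intro m
    obtain ⟨L, hL⟩ := IsPrecomplete.prec (I := Ideal.span {t}) (M := R) inferInstance
      (f := fun n => ∑ i ∈ Finset.range n, t ^ i * β (m + i)) (fun {a b} hab => by
        rw [hmem, ← dvd_neg, neg_sub, ← Finset.sum_range_add_sum_Ico _ hab, add_sub_cancel_left]
        exact Finset.dvd_sum fun i hi =>
          Dvd.dvd.mul_right (pow_dvd_pow _ (Finset.mem_Ico.1 hi).1) _)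
    exact ⟨L, fun n => (hmem _ _ _).1 (hL n)⟩
  choose x hx using hprec
  refine ⟨x, fun m => ?_⟩
  refine (IsHausdorff.eq_iff_smodEq (I := Ideal.span {t})).2 fun n => (hmem _ _ _).2 ?_
  have h1 := (pow_dvd_pow t (Nat.le_succ n)).trans (hx m (n + 1))
  have h2 := (hx (m + 1) n).mul_left t
  have e : x m - (β m + t * x (m + 1)) =
      t * ((∑ i ∈ Finset.range n, t ^ i * β (m + 1 + i)) - x (m + 1)) -
      ((∑ i ∈ Finset.range (n + 1), t ^ i * β (m + i)) - x m) := by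
    have : ∑ i ∈ Finset.range (n + 1), t ^ i * β (m + i) =
        β m + t * ∑ i ∈ Finset.range n, t ^ i * β (m + 1 + i) := by
      rw [Finset.sum_range_succ', Finset.mul_sum, add_comm]
      congr 1
      · simp
      · refine Finset.sum_congr rfl fun i _ => ?_
        rw [show m + (i + 1) = m + 1 + i by ring]; ring
    rw [this]; ring
  rw [e]
  exact dvd_sub (h2) h1

/-- Power series in `t` can be summed in a `p`-complete ring as soon as they can be summed
modulo `p`. -/
theorem SumsExist.of_mod {R : Type*} [CommRing R] {p t : R} (hp : SumsExist R p)
    (hsep : ∀ x : R, (∀ n : ℕ, p ^ n ∣ x) → x = 0)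
    (h : ∀ β : ℕ → R, ∃ w γ : ℕ → R, ∀ n, w n + p * γ n = β n + t * w (n + 1)) :
    SumsExist R t := by
  intro β
  choose w γ hwγ using h
  -- `B a` is the series to be summed at the `a`-th stage
  let B : ℕ → ℕ → R := fun a => Nat.rec β (fun _ b => γ b) a
  have hB : ∀ a, B (a + 1) = γ (B a) := fun a => rfl
  have hX : ∀ n, ∃ X : ℕ → R, ∀ a, X a = w (B a) n + p * X (a + 1) := fun n => hp _
  choose X hX using hX
  have hdiv : ∀ k a n, p ^ k ∣ X n a - t * X (n + 1) a - B a n := by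
    intro k
    induction k with
    | zero => intro a n; simp
    | succ k ih =>
      intro a n
      have e : X n a - t * X (n + 1) a - B a n =
          p * (X n (a + 1) - t * X (n + 1) (a + 1) - B (a + 1) n) := by
        rw [hX n a, hX (n + 1) a, hB]
        linear_combination hwγ (B a) n
      rw [e, pow_succ']
      exact mul_dvd_mul_left _ (ih _ _)
  refine ⟨fun n => X n 0, fun n => ?_⟩
  have := hsep _ fun k => hdiv k 0 n
  linear_combination this

/-- An element which is divisible by all powers of `p` vanishes in a ring of Witt vectors. -/
theorem witt_eq_zero_of_forall_dvd {p : ℕ} [Fact p.Prime] {k : Type*} [CommRing k] [CharP k p]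
    [PerfectRing k p] {x : WittVector p k} (h : ∀ n : ℕ, (p : WittVector p k) ^ n ∣ x) : x = 0 := by
  refine IsHausdorff.haus (I := Ideal.span {(p : WittVector p k)}) inferInstance x fun n => ?_
  rw [SModEq.zero, Ideal.span_singleton_pow, smul_eq_mul, Ideal.mul_top, Ideal.mem_span_singleton]
  exact h n

theorem witt_sumsExist_p (p : ℕ) [Fact p.Prime] (k : Type*) [CommRing k] [CharP k p]
    [PerfectRing k p] : SumsExist (WittVector p k) (p : WittVector p k) :=
  SumsExist.of_isAdicComplete _

theorem witt_p_dvd_iff {p : ℕ} [Fact p.Prime] {k : Type*} [CommRing k] [CharP k p]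
    [PerfectRing k p] {x : WittVector p k} : (p : WittVector p k) ∣ x ↔ x.coeff 0 = 0 := by
  rw [← WittVector.mem_span_p_iff_coeff_zero_eq_zero, Ideal.mem_span_singleton]

theorem coeff_zero_add' {p : ℕ} [Fact p.Prime] {k : Type*} [CommRing k] (x y : WittVector p k) :
    (x + y).coeff 0 = x.coeff 0 + y.coeff 0 := map_add WittVector.constantCoeff x y

theorem coeff_zero_sub' {p : ℕ} [Fact p.Prime] {k : Type*} [CommRing k] (x y : WittVector p k) :
    (x - y).coeff 0 = x.coeff 0 - y.coeff 0 := map_sub WittVector.constantCoeff x y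

theorem coeff_zero_mul' {p : ℕ} [Fact p.Prime] {k : Type*} [CommRing k] (x y : WittVector p k) :
    (x * y).coeff 0 = x.coeff 0 * y.coeff 0 := map_mul WittVector.constantCoeff x y

theorem coeff_zero_pow' {p : ℕ} [Fact p.Prime] {k : Type*} [CommRing k] (x : WittVector p k)
    (n : ℕ) : (x ^ n).coeff 0 = x.coeff 0 ^ n := map_pow WittVector.constantCoeff x n

/-! ### The ring `𝓞_ℂ^♭` and the element `ϖ` -/

section OFlat

variable {p : ℕ} [Fact p.Prime]

instance : PerfectRing (CFlat p) p := by
  refine PerfectRing.ofSurjective (CFlat p) p fun x => ?_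
  obtain ⟨a, b, hb, rfl⟩ := IsFractionRing.div_surjective (A := OFlat p) x
  refine ⟨algebraMap _ _ ((frobeniusEquiv (OFlat p) p).symm a) /
    algebraMap _ _ ((frobeniusEquiv (OFlat p) p).symm b), ?_⟩
  have h : ∀ y : OFlat p, (frobeniusEquiv (OFlat p) p).symm y ^ p = y :=
    frobenius_apply_frobeniusEquiv_symm (OFlat p) p
  rw [frobenius_def, div_pow, ← map_pow (algebraMap (OFlat p) (CFlat p)),
    ← map_pow (algebraMap (OFlat p) (CFlat p)), h, h]

variable (Z : CycloSystem p)

theorem coeff_zero_varpi : PreTilt.coeff 0 Z.varpi = 0 := by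
  rw [CycloSystem.varpi, map_sub, map_one, sub_eq_zero]
  change Ideal.Quotient.mk _ (Z.zetaO 0) = 1
  rw [← map_one (Ideal.Quotient.mk _)]
  congr 1
  apply Subtype.ext
  change ((Z.ζ 0 : PadicAlgCl p) : ℂ_[p]) = 1
  have := Z.pow_eq_one 0
  rw [pow_zero, pow_one] at this
  rw [this]
  exact map_one (algebraMap (PadicAlgCl p) ℂ_[p])

theorem coeff_varpi_pow (n : ℕ) : PreTilt.coeff n (Z.varpi ^ p ^ n) = 0 := by
  have h := PreTilt.coeff_iterate_frobenius (O := 𝓞_ℂ_[p]) (p := p) 0 n Z.varpi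
  rw [zero_add, iterate_frobenius, coeff_zero_varpi] at h
  exact h

theorem OFlat_eq_zero_of_forall_dvd {x : OFlat p} (h : ∀ n : ℕ, Z.varpi ^ n ∣ x) : x = 0 := by
  refine Perfection.ext fun n => ?_
  obtain ⟨y, rfl⟩ := h (p ^ n)
  change PreTilt.coeff n _ = PreTilt.coeff n 0
  rw [map_mul, coeff_varpi_pow, zero_mul, map_zero]

theorem OFlat_sumsExist : SumsExist (OFlat p) Z.varpi := by
  intro β
  have hstab : ∀ (m n k : ℕ), p ^ n ≤ k →
      PreTilt.coeff n (∑ i ∈ Finset.range k, Z.varpi ^ i * β (m + i)) =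
      PreTilt.coeff n (∑ i ∈ Finset.range (p ^ n), Z.varpi ^ i * β (m + i)) := by
    intro m n k hk
    rw [← Finset.sum_range_add_sum_Ico _ hk, map_add, add_eq_left, map_sum]
    refine Finset.sum_eq_zero fun i hi => ?_
    obtain ⟨j, rfl⟩ := Nat.exists_eq_add_of_le (Finset.mem_Ico.1 hi).1
    rw [pow_add, map_mul, map_mul, coeff_varpi_pow, zero_mul, zero_mul]
  let x : ℕ → OFlat p := fun m =>
    ⟨fun n => PreTilt.coeff n (∑ i ∈ Finset.range (p ^ n), Z.varpi ^ i * β (m + i)), fun n => by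
      beta_reduce
      rw [← hstab m n (p ^ (n + 1)) (Nat.pow_le_pow_right (Fact.out : p.Prime).pos n.le_succ)]
      exact PreTilt.coeff_pow_p _ n⟩
  have hx : ∀ m n, PreTilt.coeff n (x m) =
      PreTilt.coeff n (∑ i ∈ Finset.range (p ^ n), Z.varpi ^ i * β (m + i)) := fun m n => rfl
  refine ⟨x, fun m => Perfection.ext fun n => ?_⟩
  change PreTilt.coeff n (x m) = PreTilt.coeff n (β m + Z.varpi * x (m + 1))
  rw [map_add, map_mul, hx, hx, ← hstab m n (p ^ n + 1) (Nat.le_succ _), ← map_mul, ← map_add]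
  congr 1
  rw [Finset.sum_range_succ', Finset.mul_sum, add_comm]
  congr 1
  · simp
  · refine Finset.sum_congr rfl fun i _ => ?_
    rw [show m + (i + 1) = m + 1 + i by ring]; ring

theorem norm_padicAlgCl_p : ‖(p : PadicAlgCl p)‖ = (p : ℝ)⁻¹ := by
  have h : (p : PadicAlgCl p) = algebraMap ℚ_[p] (PadicAlgCl p) p := (map_natCast _ _).symm
  rw [h]
  exact (PadicAlgCl.norm_extends p (p : ℚ_[p])).trans (Padic.norm_p)

/-- `‖ζ - 1‖ ^ φ(p^(n+1)) = 1 / p` for a primitive `p^(n+1)`-th root of unity `ζ`: the norms of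
the conjugates of `1 - ζ` agree, and their product is `Φ(1) = p`. -/
theorem norm_zeta_sub_one_pow {n : ℕ} {ζ : PadicAlgCl p} (hζ : IsPrimitiveRoot ζ (p ^ (n + 1))) :
    ‖ζ - 1‖ ^ Nat.totient (p ^ (n + 1)) = (p : ℝ)⁻¹ := by
  have hpos : 0 < p ^ (n + 1) := pow_pos (Fact.out : p.Prime).pos _
  have hle : ∀ a b : PadicAlgCl p, IsPrimitiveRoot a (p ^ (n + 1)) →
      IsPrimitiveRoot b (p ^ (n + 1)) → ‖1 - b‖ ≤ ‖1 - a‖ := by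
    intro a b ha hb
    have hna : ‖a‖ = 1 := by
      have : ‖a‖ ^ p ^ (n + 1) = 1 := by rw [← norm_pow, ha.pow_eq_one, norm_one]
      exact (pow_eq_one_iff_of_nonneg (norm_nonneg _) hpos.ne').1 this
    obtain ⟨i, -, rfl⟩ := ha.eq_pow_of_pow_eq_one hb.pow_eq_one
    rw [← mul_neg_geom_sum, norm_mul]
    refine mul_le_of_le_one_right (norm_nonneg _) ?_
    refine IsUltrametricDist.norm_sum_le_of_forall_le_of_nonneg zero_le_one fun j _ => ?_
    rw [norm_pow, hna, one_pow]
  have h1 := Polynomial.eval_one_cyclotomic_prime_pow (R := PadicAlgCl p) (p := p) n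
  rw [Polynomial.cyclotomic_eq_prod_X_sub_primitiveRoots hζ, Polynomial.eval_prod] at h1
  have h2 := congrArg norm h1
  rw [norm_prod, norm_padicAlgCl_p] at h2
  rw [← h2, ← hζ.card_primitiveRoots]
  refine (Finset.prod_eq_pow_card fun μ hμ => ?_).symm
  have hμ' := isPrimitiveRoot_of_mem_primitiveRoots hμ
  rw [Polynomial.eval_sub, Polynomial.eval_X, Polynomial.eval_C, norm_sub_rev ζ]
  exact le_antisymm (hle _ _ hζ hμ') (hle _ _ hμ' hζ)

theorem norm_zeta_sub_one_lt_one {n : ℕ} {ζ : PadicAlgCl p}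
    (hζ : IsPrimitiveRoot ζ (p ^ (n + 1))) : ‖ζ - 1‖ < 1 := by
  have h := norm_zeta_sub_one_pow hζ
  by_contra hc
  have h1 := one_le_pow₀ (not_lt.1 hc) (n := Nat.totient (p ^ (n + 1)))
  rw [h] at h1
  exact absurd h1 (not_le.2 (inv_lt_one_of_one_lt₀ (by exact_mod_cast (Fact.out : p.Prime).one_lt)))

theorem inv_lt_norm_zeta_sub_one {n : ℕ} {ζ : PadicAlgCl p}
    (hζ : IsPrimitiveRoot ζ (p ^ (n + 2))) : (p : ℝ)⁻¹ < ‖ζ - 1‖ := by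
  have h := norm_zeta_sub_one_pow hζ
  have h1 := norm_zeta_sub_one_lt_one hζ
  have hp := (Fact.out : p.Prime)
  have hφ : 2 ≤ Nat.totient (p ^ (n + 2)) := by
    rw [Nat.totient_prime_pow_succ hp, pow_succ, mul_assoc]
    have h2 : 2 ≤ p * (p - 1) := by
      have := hp.two_le
      calc 2 = 2 * 1 := rfl
        _ ≤ p * (p - 1) := Nat.mul_le_mul this (by omega)
    exact h2.trans (Nat.le_mul_of_pos_left _ (pow_pos hp.pos _))
  have h0 : 0 < ‖ζ - 1‖ := by
    rcases (norm_nonneg (ζ - 1)).eq_or_lt with h0 | h0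
    · rw [← h0, zero_pow (show Nat.totient (p ^ (n + 1 + 1)) ≠ 0 from fun h => by simp [h] at hφ)] at h
      exact absurd h.symm (inv_ne_zero (by exact_mod_cast hp.ne_zero))
    · exact h0
  calc (p : ℝ)⁻¹ = ‖ζ - 1‖ ^ Nat.totient (p ^ (n + 2)) := h.symm
    _ ≤ ‖ζ - 1‖ ^ 2 := pow_le_pow_of_le_one h0.le h1.le hφ
    _ < ‖ζ - 1‖ := by nlinarith

theorem coeff_varpi (n : ℕ) : PreTilt.coeff n Z.varpi = Ideal.Quotient.mk _ (Z.zetaO n - 1) := by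
  rw [CycloSystem.varpi, map_sub, map_one, map_sub, map_one]
  rfl

theorem norm_zetaO_sub_one (n : ℕ) : ‖((Z.zetaO n - 1 : 𝓞_ℂ_[p]) : ℂ_[p])‖ = ‖Z.ζ n - 1‖ := by
  rw [← PadicComplex.norm_extends]
  congr 1
  exact (map_sub (algebraMap (PadicAlgCl p) ℂ_[p]) _ _).symm.trans rfl

theorem norm_le_of_mk_eq_zero {x : 𝓞_ℂ_[p]}
    (h : (Ideal.Quotient.mk _ x : ModP 𝓞_ℂ_[p] p) = 0) : ‖(x : ℂ_[p])‖ ≤ (p : ℝ)⁻¹ := by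
  rw [Ideal.Quotient.eq_zero_iff_mem, Ideal.mem_span_singleton] at h
  obtain ⟨y, rfl⟩ := h
  have hy := (mem_int_iff _).1 y.2
  have hp : ‖((p : 𝓞_ℂ_[p]) : ℂ_[p])‖ = (p : ℝ)⁻¹ := by
    rw [← norm_padicAlgCl_p, ← PadicComplex.norm_extends]
    congr 1
    exact (map_natCast (algebraMap (PadicAlgCl p) ℂ_[p]) p).symm
  rw [MulMemClass.coe_mul, norm_mul, hp]
  exact mul_le_of_le_one_right (by positivity) hy

theorem varpi_ne_zero : Z.varpi ≠ 0 := by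
  intro h
  have h1 := coeff_varpi Z 2
  rw [h, map_zero] at h1
  have h2 := norm_le_of_mk_eq_zero h1.symm
  rw [norm_zetaO_sub_one] at h2
  exact absurd h2 (not_le.2 (inv_lt_norm_zeta_sub_one (n := 0) (Z.isPrimitiveRoot 2)))

theorem not_isUnit_varpi : ¬ IsUnit Z.varpi := by
  intro h
  have := h.map (PreTilt.coeff (O := 𝓞_ℂ_[p]) (p := p) 0)
  rw [coeff_zero_varpi] at this
  exact not_isUnit_zero this

end OFlat

/-! ### Divisibility by `p` in `A_inf` and in `W(ℂ^♭)` -/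

section Emb

variable (p : ℕ) [Fact p.Prime]

/-- The inclusion of `A_inf` into `W(ℂ^♭)`. -/
abbrev emb : AInf p →+* ATilde p := algebraMap (AInf p) (ATilde p)

variable {p}

theorem coeff_emb (x : AInf p) (n : ℕ) :
    (emb p x).coeff n = algebraMap (OFlat p) (CFlat p) (x.coeff n) := rfl

theorem algebraMap_OFlat_injective : Function.Injective (algebraMap (OFlat p) (CFlat p)) :=
  IsFractionRing.injective (OFlat p) (CFlat p)

theorem p_ne_zero_ATilde : (p : ATilde p) ≠ 0 := WittVector.p_nonzero p (CFlat p)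

theorem p_ne_zero_AInf : (p : AInf p) ≠ 0 := WittVector.p_nonzero p (OFlat p)

theorem p_dvd_emb_iff {x : AInf p} : (p : ATilde p) ∣ emb p x ↔ (p : AInf p) ∣ x := by
  rw [witt_p_dvd_iff, witt_p_dvd_iff, coeff_emb, map_eq_zero_iff _ algebraMap_OFlat_injective]

theorem exists_of_p_mul_eq_emb {y : ATilde p} {x : AInf p} (h : (p : ATilde p) * y = emb p x) :
    ∃ x', y = emb p x' ∧ x = p * x' := by
  obtain ⟨x', rfl⟩ := p_dvd_emb_iff.1 ⟨y, h.symm⟩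
  refine ⟨x', mul_left_cancel₀ p_ne_zero_ATilde ?_, rfl⟩
  rw [h, map_mul, map_natCast]

theorem p_pow_dvd_emb_iff {n : ℕ} {x : AInf p} :
    (p : ATilde p) ^ n ∣ emb p x ↔ (p : AInf p) ^ n ∣ x := by
  constructor
  · induction n generalizing x with
    | zero => simp
    | succ n ih =>
      rintro ⟨y, hy⟩
      rw [pow_succ', mul_assoc] at hy
      obtain ⟨x', hx', rfl⟩ := exists_of_p_mul_eq_emb hy.symm
      rw [pow_succ']
      exact mul_dvd_mul_left _ (ih ⟨y, hx'.symm⟩)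
  · rintro ⟨y, rfl⟩
    exact ⟨emb p y, by rw [map_mul, map_pow, map_natCast]⟩

theorem p_prime_ATilde : Prime (p : ATilde p) := by
  refine ⟨p_ne_zero_ATilde, fun h => ?_, fun a b hab => ?_⟩
  · have := (witt_p_dvd_iff (x := (1 : ATilde p))).1 h.dvd
    rw [WittVector.one_coeff_zero] at this
    exact one_ne_zero this
  · rw [witt_p_dvd_iff, coeff_zero_mul', mul_eq_zero] at hab
    rwa [witt_p_dvd_iff, witt_p_dvd_iff]

theorem isUnit_of_not_p_dvd {x : ATilde p} (h : ¬ (p : ATilde p) ∣ x) : IsUnit x :=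
  WittVector.isUnit_of_coeff_zero_ne_zero x fun h0 => h (witt_p_dvd_iff.2 h0)

variable (Z : CycloSystem p)

theorem coeff_zero_T : Z.T.coeff 0 = Z.varpi := by
  rw [CycloSystem.T, coeff_zero_sub', WittVector.teichmuller_coeff_zero, WittVector.one_coeff_zero]
  rfl

theorem coeff_zero_teichVarpi : Z.teichVarpi.coeff 0 = Z.varpi :=
  WittVector.teichmuller_coeff_zero _ _

theorem not_p_dvd_emb_T : ¬ (p : ATilde p) ∣ emb p Z.T := by
  rw [p_dvd_emb_iff, witt_p_dvd_iff, coeff_zero_T]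
  exact varpi_ne_zero Z

theorem not_p_dvd_emb_teichVarpi : ¬ (p : ATilde p) ∣ emb p Z.teichVarpi := by
  rw [p_dvd_emb_iff, witt_p_dvd_iff, coeff_zero_teichVarpi]
  exact varpi_ne_zero Z

theorem isUnit_emb_T : IsUnit (emb p Z.T) := isUnit_of_not_p_dvd (not_p_dvd_emb_T Z)

theorem isUnit_emb_teichVarpi : IsUnit (emb p Z.teichVarpi) :=
  isUnit_of_not_p_dvd (not_p_dvd_emb_teichVarpi Z)

/-- A lift `t` of `ϖ` to `A_inf`, such as `T` or `[ϖ]`, is not a zero divisor modulo `p`. -/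
theorem p_dvd_of_p_dvd_mul {t : AInf p} (ht : t.coeff 0 = Z.varpi) {x : AInf p} {n : ℕ}
    (h : (p : AInf p) ∣ t ^ n * x) : (p : AInf p) ∣ x := by
  rw [witt_p_dvd_iff, coeff_zero_mul', coeff_zero_pow', ht, mul_eq_zero] at h
  rw [witt_p_dvd_iff]
  exact h.resolve_left (pow_ne_zero _ (varpi_ne_zero Z))

/-- Power series in a lift `t` of `ϖ`, such as `T` or `[ϖ]`, with coefficients in `A_inf` can be
summed. -/
theorem AInf_sumsExist {t : AInf p} (ht : t.coeff 0 = Z.varpi) : SumsExist (AInf p) t := by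
  refine SumsExist.of_mod (witt_sumsExist_p p (OFlat p)) (fun x => witt_eq_zero_of_forall_dvd) ?_
  intro β
  obtain ⟨o, ho⟩ := OFlat_sumsExist Z fun n => (β n).coeff 0
  have h : ∀ n, (p : AInf p) ∣ β n + t * WittVector.teichmuller p (o (n + 1)) -
      WittVector.teichmuller p (o n) := fun n => by
    rw [witt_p_dvd_iff, coeff_zero_sub', coeff_zero_add', coeff_zero_mul',
      WittVector.teichmuller_coeff_zero, WittVector.teichmuller_coeff_zero, ht, ho n, sub_self]
  choose γ hγ using h
  exact ⟨fun n => WittVector.teichmuller p (o n), γ, fun n => by rw [← hγ n]; ring⟩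

end Emb

/-! ### The structure of `Ã^{(0,r],∘}` -/

section Overconvergent

variable {p : ℕ} [Fact p.Prime] (Z : CycloSystem p)

/-- The element `z = p / [ϖ]^{1/r}`, the element `w = [ϖ]^{1/r}` of `A_inf`, and a natural number
`e ≥ 1/r`. -/
structure RadiusData (r : Radius p) where
  /-- the element `p / [ϖ]^{1/r}` -/
  z : ATilde p
  /-- the element `[ϖ]^{1/r}` -/
  w : AInf p
  /-- a natural number which is at least `1/r` -/
  e : ℕ
  polyRing_eq : polyRing Z r = Algebra.adjoin (AInf p) {z}
  z_mul_w : z * emb p w = p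
  w_dvd : w ∣ Z.teichVarpi ^ e
  dvd_w_pow : ∀ i : ℕ, ∃ k₀ : ℕ, ∀ k, k₀ ≤ k → Z.teichVarpi ^ i ∣ w ^ k

theorem varpiRoot_pow (a b : ℕ) : Z.varpiRoot (a + b) ^ p ^ b = Z.varpiRoot a := by
  induction b with
  | zero => simp
  | succ b ih =>
    rw [← ih, pow_succ', pow_mul]
    congr 1
    have : frobenius (OFlat p) p (Z.varpiRoot (a + b + 1)) = Z.varpiRoot (a + b) := by
      rw [← frobeniusEquiv_apply]
      simp only [CycloSystem.varpiRoot, Function.iterate_succ_apply', RingEquiv.apply_symm_apply]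
    exact this

theorem nonempty_radiusData (r : Radius p) : Nonempty (RadiusData Z r) := by
  obtain ⟨m, n, hmn⟩ := r.2.2
  have hp := (Fact.out : p.Prime)
  have hp0 : (0 : ℚ) < p := by exact_mod_cast hp.pos
  have hroot : WittVector.teichmuller p (Z.varpiRoot n) ^ p ^ n = Z.teichVarpi := by
    rw [← map_pow]
    have := varpiRoot_pow Z 0 n
    rw [zero_add] at this
    rw [this]
    rfl
  have hm : 1 ≤ m := by
    have : (0 : ℚ) < m := by rw [hmn]; exact mul_pos (inv_pos.2 r.2.1) (pow_pos hp0 n)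
    exact_mod_cast this
  have hwd : WittVector.teichmuller p (Z.varpiRoot n) ^ m ∣ Z.teichVarpi ^ m := by
    rw [← hroot, ← pow_mul]
    exact pow_dvd_pow _ (Nat.le_mul_of_pos_left _ (pow_pos hp.pos _))
  have hu : IsUnit (emb p (WittVector.teichmuller p (Z.varpiRoot n) ^ m)) :=
    isUnit_of_dvd_unit (map_dvd (emb p) hwd)
      (by rw [map_pow]; exact (isUnit_emb_teichVarpi Z).pow m)
  obtain ⟨u, hu⟩ := hu
  have hz : (p : ATilde p) * (↑u⁻¹ : ATilde p) *
      emb p (WittVector.teichmuller p (Z.varpiRoot n) ^ m) = p := by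
    rw [← hu, mul_assoc, Units.inv_mul, mul_one]
  refine ⟨⟨p * ↑u⁻¹, WittVector.teichmuller p (Z.varpiRoot n) ^ m, m, ?_, hz, hwd, fun i => ?_⟩⟩
  · rw [polyRing]
    congr 1
    ext z'
    rw [Set.mem_singleton_iff]
    constructor
    · rintro ⟨m', n', hmn', hz'⟩
      have e1 : WittVector.teichmuller p (Z.varpiRoot n') ^ m' =
          WittVector.teichmuller p (Z.varpiRoot n) ^ m := by
        rw [← varpiRoot_pow Z n n', ← varpiRoot_pow Z n' n, map_pow, map_pow, ← pow_mul,
          ← pow_mul, add_comm n' n]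
        congr 1
        have : ((p ^ n * m' : ℕ) : ℚ) = ((p ^ n' * m : ℕ) : ℚ) := by
          push_cast
          rw [hmn, hmn']; ring
        exact_mod_cast this
      rw [← map_pow, e1, ← hu] at hz'
      rw [← hz', mul_assoc, Units.mul_inv, mul_one]
    · rintro rfl
      exact ⟨m, n, hmn, by rw [← map_pow]; exact hz⟩
  · refine ⟨p ^ n * i, fun k hk => ?_⟩
    rw [← hroot, ← pow_mul, ← pow_mul]
    exact pow_dvd_pow _ (hk.trans (Nat.le_mul_of_pos_left _ hm))

variable {Z} {r : Radius p}

theorem emb_mem_overconvInt (x : AInf p) : emb p x ∈ overconvInt Z r :=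
  Subalgebra.algebraMap_mem (overconvInt Z r) x

theorem polyRing_le_overconvInt {x : ATilde p} (hx : x ∈ polyRing Z r) : x ∈ overconvInt Z r :=
  ⟨fun _ => x, fun _ => hx, fun _ => ⟨0, zero_mem _, by simp⟩, fun _ => by simp⟩

theorem RadiusData.isUnit_emb_w (D : RadiusData Z r) : IsUnit (emb p D.w) :=
  isUnit_of_dvd_unit (map_dvd (emb p) D.w_dvd)
    (by rw [map_pow]; exact (isUnit_emb_teichVarpi Z).pow _)

theorem RadiusData.z_mem (D : RadiusData Z r) : D.z ∈ overconvInt Z r :=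
  polyRing_le_overconvInt (by rw [D.polyRing_eq]; exact Algebra.subset_adjoin rfl)

/-- Series `∑ p^i s_i` with terms `s_i` in `A_inf[p / [ϖ]^{1/r}]` converge in `Ã^{(0,r],∘}`. -/
theorem exists_sum_of_polyRing {s : ℕ → ATilde p} (hs : ∀ n, s n ∈ polyRing Z r) :
    ∃ X : ℕ → ATilde p, (∀ n, X n ∈ overconvInt Z r) ∧ ∀ n, X n = s n + p * X (n + 1) := by
  obtain ⟨X, hX⟩ := witt_sumsExist_p p (CFlat p) s
  refine ⟨X, fun m => ?_, hX⟩
  refine ⟨fun n => ∑ i ∈ Finset.range n, (p : ATilde p) ^ i * s (m + i), fun n => ?_, fun n => ?_,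
    fun n => ?_⟩
  · exact sum_mem fun i _ => mul_mem (pow_mem (natCast_mem _ p) _) (hs _)
  · exact ⟨s (m + n), hs _, by beta_reduce; rw [Finset.sum_range_succ, add_sub_cancel_left]⟩
  · have := eq_partialSum_add (t := (p : ATilde p)) (β := fun i => s (m + i))
      (x := fun i => X (m + i)) (fun i => hX (m + i)) n
    exact ⟨X (m + n), by rw [add_zero] at this; rw [this]; ring⟩

theorem exists_polyRing_add_p_mul {x : ATilde p} (hx : x ∈ overconvInt Z r) :
    ∃ s ∈ polyRing Z r, ∃ y ∈ overconvInt Z r, x = s + p * y := by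
  obtain ⟨s, hs, hs', hx⟩ := hx
  choose b hb hb' using hs'
  obtain ⟨X, hX, hXb⟩ := exists_sum_of_polyRing (fun n => hb (n + 1))
  refine ⟨s 1, hs 1, X 0, hX 0, ?_⟩
  rw [← sub_eq_zero]
  refine witt_eq_zero_of_forall_dvd fun n => ?_
  have h1 : s (n + 1) = s 1 + p * ∑ i ∈ Finset.range n, (p : ATilde p) ^ i * b (i + 1) := by
    rw [← sub_eq_iff_eq_add', ← Finset.sum_range_sub (fun i => s (i + 1)), Finset.mul_sum]
    exact Finset.sum_congr rfl fun i _ => by rw [hb' (i + 1), pow_succ']; ring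
  have h2 := eq_partialSum_add hXb n
  obtain ⟨u, hu⟩ := hx (n + 1)
  refine ⟨p * u - p * X n, ?_⟩
  rw [pow_succ'] at hu
  linear_combination hu + h1 - (p : ATilde p) * h2

theorem exists_polyRing_add_p_pow_mul {x : ATilde p} (hx : x ∈ overconvInt Z r) (j : ℕ) :
    ∃ s ∈ polyRing Z r, ∃ y ∈ overconvInt Z r, x = s + p ^ j * y := by
  induction j with
  | zero => exact ⟨0, zero_mem _, x, hx, by simp⟩
  | succ j ih =>
    obtain ⟨s, hs, y, hy, rfl⟩ := ih
    obtain ⟨s', hs', y', hy', rfl⟩ := exists_polyRing_add_p_mul hy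
    exact ⟨s + p ^ j * s', add_mem hs (mul_mem (pow_mem (natCast_mem _ p) _) hs'), y', hy',
      by ring⟩

theorem overconvInt_sumsExist_p : SumsExist (overconvInt Z r) (p : overconvInt Z r) := by
  intro β
  choose s hs y hy hsy using fun x : overconvInt Z r => exists_polyRing_add_p_mul x.2
  -- the correction terms `Y n` are carried over to the next coefficient
  let d : ℕ → overconvInt Z r := fun n =>
    Nat.rec (β 0) (fun k dk => β (k + 1) + ⟨y dk, hy dk⟩) n
  have hd : ∀ n, d (n + 1) = β (n + 1) + ⟨y (d n), hy (d n)⟩ := fun n => rfl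
  obtain ⟨X, hX, hXs⟩ := exists_sum_of_polyRing (fun n => hs (d n))
  refine ⟨fun n => ⟨X n, hX n⟩ - (d n - β n), fun n => Subtype.ext ?_⟩
  have h1 := hXs n
  have h2 := hsy (d n)
  have h3 := congrArg Subtype.val (hd n)
  push_cast at h3 ⊢
  linear_combination h1 - h2 + (p : ATilde p) * h3

theorem RadiusData.exists_of_mem_polyRing (D : RadiusData Z r) {x : ATilde p}
    (hx : x ∈ polyRing Z r) : ∃ α : AInf p, ∃ y ∈ polyRing Z r, x = emb p α + D.z * y := by
  have hz : D.z ∈ polyRing Z r := by rw [D.polyRing_eq]; exact Algebra.subset_adjoin rfl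
  have hemb : ∀ a : AInf p, emb p a ∈ polyRing Z r := fun a => Subalgebra.algebraMap_mem _ a
  have hx' := hx
  rw [D.polyRing_eq] at hx'
  induction hx' using Algebra.adjoin_induction with
  | mem x hx' =>
    rw [Set.mem_singleton_iff] at hx'
    exact ⟨0, 1, one_mem _, by rw [hx', map_zero]; ring⟩
  | algebraMap a => exact ⟨a, 0, zero_mem _, by rw [mul_zero, add_zero]⟩
  | add x y hx' hy' h1 h2 =>
    rw [← D.polyRing_eq] at hx' hy'
    obtain ⟨a, u, hu, rfl⟩ := h1 hx'
    obtain ⟨b, v, hv, rfl⟩ := h2 hy'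
    exact ⟨a + b, u + v, add_mem hu hv, by rw [map_add]; ring⟩
  | mul x y hx' hy' h1 h2 =>
    rw [← D.polyRing_eq] at hx' hy'
    obtain ⟨a, u, hu, rfl⟩ := h1 hx'
    obtain ⟨b, v, hv, rfl⟩ := h2 hy'
    exact ⟨a * b, u * (emb p b + D.z * v) + emb p a * v,
      add_mem (mul_mem hu hy') (mul_mem (hemb a) hv), by rw [map_mul]; ring⟩

theorem RadiusData.exists_pow_mul_polyRing (D : RadiusData Z r) {x : ATilde p}
    (hx : x ∈ polyRing Z r) : ∃ (N : ℕ) (α : AInf p), emb p Z.teichVarpi ^ N * x = emb p α := by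
  rw [D.polyRing_eq] at hx
  induction hx using Algebra.adjoin_induction with
  | mem x hx =>
    obtain ⟨u, hu⟩ := D.w_dvd
    refine ⟨D.e, p * u, ?_⟩
    rw [Set.mem_singleton_iff.1 hx, ← map_pow, hu, map_mul, map_mul, map_natCast, ← D.z_mul_w]
    ring
  | algebraMap a => exact ⟨0, a, by rw [pow_zero, one_mul]⟩
  | add x y _ _ h1 h2 =>
    obtain ⟨N, α, h1⟩ := h1
    obtain ⟨N', α', h2⟩ := h2
    refine ⟨N + N', Z.teichVarpi ^ N' * α + Z.teichVarpi ^ N * α', ?_⟩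
    rw [map_add, map_mul, map_mul, map_pow, map_pow, ← h1, ← h2]
    ring
  | mul x y _ _ h1 h2 =>
    obtain ⟨N, α, h1⟩ := h1
    obtain ⟨N', α', h2⟩ := h2
    exact ⟨N + N', α * α', by rw [map_mul, ← h1, ← h2]; ring⟩

/-- Every element of `Ã^{(0,r],∘}` is of the form `α + z y` with `α ∈ A_inf`. -/
theorem RadiusData.exists_add_z_mul (D : RadiusData Z r) {x : ATilde p}
    (hx : x ∈ overconvInt Z r) : ∃ α : AInf p, ∃ y ∈ overconvInt Z r, x = emb p α + D.z * y := by
  obtain ⟨s, hs, y, hy, rfl⟩ := exists_polyRing_add_p_mul hx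
  obtain ⟨α, y', hy', rfl⟩ := D.exists_of_mem_polyRing hs
  refine ⟨α, y' + emb p D.w * y, add_mem (polyRing_le_overconvInt hy')
    (mul_mem (emb_mem_overconvInt _) hy), ?_⟩
  linear_combination -y * D.z_mul_w

/-- Every element of `Ã^{(0,r],∘}` is a polynomial of degree `< k` in `z` over `A_inf`, up to a
multiple of `z^k`; multiplication by `w^k` clears the denominators of the polynomial. -/
theorem RadiusData.exists_add_z_pow_mul (D : RadiusData Z r) {x : ATilde p}
    (hx : x ∈ overconvInt Z r) (k : ℕ) :
    ∃ x₀ ∈ overconvInt Z r, ∃ y ∈ overconvInt Z r, ∃ α : AInf p,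
      x = x₀ + D.z ^ k * y ∧ emb p D.w ^ k * x₀ = emb p α := by
  induction k with
  | zero => exact ⟨0, zero_mem _, x, hx, 0, by simp, by simp⟩
  | succ k ih =>
    obtain ⟨x₀, hx₀, y, hy, α, rfl, hα⟩ := ih
    obtain ⟨β, y', hy', rfl⟩ := D.exists_add_z_mul hy
    refine ⟨x₀ + D.z ^ k * emb p β,
      add_mem hx₀ (mul_mem (pow_mem D.z_mem _) (emb_mem_overconvInt _)), y', hy',
      D.w * α + p ^ k * D.w * β, by ring, ?_⟩
    rw [map_add, map_mul, map_mul, map_mul, ← hα, map_pow, map_natCast, ← D.z_mul_w]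
    ring

/-- `[ϖ]^e` maps `Ã^{(0,r],∘}` into `A_inf + p Ã^{(0,r],∘}`; here `[ϖ]` may be replaced by `T`. -/
theorem RadiusData.exists_pow_e_mul (D : RadiusData Z r) {t : AInf p} (ht : t.coeff 0 = Z.varpi)
    {x : ATilde p} (hx : x ∈ overconvInt Z r) :
    ∃ α : AInf p, ∃ y ∈ overconvInt Z r, emb p t ^ D.e * x = emb p α + p * y := by
  obtain ⟨α, y, hy, hxy⟩ := D.exists_add_z_mul hx
  obtain ⟨u, hu⟩ := D.w_dvd
  have h1 : (p : AInf p) ∣ t ^ D.e - Z.teichVarpi ^ D.e := by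
    rw [witt_p_dvd_iff, coeff_zero_sub', coeff_zero_pow', coeff_zero_pow', ht,
      coeff_zero_teichVarpi, sub_self]
  obtain ⟨v, hv⟩ := h1
  refine ⟨t ^ D.e * α, emb p u * y + emb p v * D.z * y,
    add_mem (mul_mem (emb_mem_overconvInt _) hy)
      (mul_mem (mul_mem (emb_mem_overconvInt _) D.z_mem) hy), ?_⟩
  have hv' := congrArg (emb p) hv
  have hu' := congrArg (emb p) hu
  rw [map_sub, map_pow, map_pow, map_mul, map_natCast] at hv'
  rw [map_mul, map_pow] at hu'
  rw [map_mul, map_pow, hxy]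
  linear_combination (D.z * y) * hv' + (D.z * y) * hu' + (emb p u * y) * D.z_mul_w

theorem RadiusData.exists_pow_mul (D : RadiusData Z r) (a : ℕ) {x : ATilde p}
    (hx : x ∈ overconvInt Z r) :
    ∃ α : AInf p, ∃ y ∈ overconvInt Z r,
      emb p Z.teichVarpi ^ (D.e * a) * x = emb p α + p ^ a * y := by
  induction a with
  | zero => exact ⟨0, x, hx, by simp⟩
  | succ a ih =>
    obtain ⟨α, y, hy, h1⟩ := ih
    obtain ⟨β, y', hy', h2⟩ := D.exists_pow_e_mul (coeff_zero_teichVarpi Z) hy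
    refine ⟨Z.teichVarpi ^ D.e * α + p ^ a * β, y', hy', ?_⟩
    rw [map_add, map_mul, map_mul, map_pow, map_pow, map_natCast]
    linear_combination (emb p Z.teichVarpi) ^ D.e * h1 + (p : ATilde p) ^ a * h2

/-- An element of `Ã^{(0,r],∘}` which is divisible by `p` in `W(ℂ^♭)` is divisible by `p` in
`Ã^{(0,r],∘}` after multiplication by `t^e`. -/
theorem RadiusData.exists_p_mul (D : RadiusData Z r) {t : AInf p} (ht : t.coeff 0 = Z.varpi)
    {x : ATilde p} (hx : x ∈ overconvInt Z r) (hpx : (p : ATilde p) ∣ x) :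
    ∃ y ∈ overconvInt Z r, emb p t ^ D.e * x = p * y := by
  obtain ⟨α, y, hy, h⟩ := D.exists_pow_e_mul ht hx
  have h1 : (p : ATilde p) ∣ emb p α := by
    have : emb p α = emb p t ^ D.e * x - p * y := by rw [h]; ring
    rw [this]
    exact dvd_sub (hpx.mul_left _) (dvd_mul_right _ _)
  obtain ⟨β, rfl⟩ := p_dvd_emb_iff.1 h1
  exact ⟨emb p β + y, add_mem (emb_mem_overconvInt _) hy, by
    rw [h, map_mul, map_natCast]; ring⟩

/-- The intersection of the `t^i Ã^{(0,r],∘}` vanishes. -/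
theorem RadiusData.eq_zero_of_forall_pow_mul (D : RadiusData Z r) {t : AInf p}
    (ht : t.coeff 0 = Z.varpi) {x : ATilde p}
    (h : ∀ i, ∃ y ∈ overconvInt Z r, x = emb p t ^ i * y) : x = 0 := by
  have hpt : ¬ (p : ATilde p) ∣ emb p t := by
    rw [p_dvd_emb_iff, witt_p_dvd_iff, ht]; exact varpi_ne_zero Z
  have key : ∀ (x : ATilde p), (∀ i, ∃ y ∈ overconvInt Z r, x = emb p t ^ i * y) →
      (p : ATilde p) ∣ x := by
    intro x h
    have h0 : ∀ i, ∃ α : AInf p, (p : ATilde p) ∣ emb p t ^ D.e * x - emb p t ^ i * emb p α := by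
      intro i
      obtain ⟨y, hy, rfl⟩ := h i
      obtain ⟨α, y', -, h1⟩ := D.exists_pow_e_mul ht hy
      exact ⟨α, emb p t ^ i * y', by linear_combination emb p t ^ i * h1⟩
    obtain ⟨α, hα⟩ := h0 0
    rw [pow_zero, one_mul] at hα
    have h1 : α.coeff 0 = 0 := by
      refine OFlat_eq_zero_of_forall_dvd Z fun n => ?_
      obtain ⟨β, hβ⟩ := h0 n
      have := dvd_sub hβ hα
      rw [sub_sub_sub_cancel_left, ← map_pow, ← map_mul, ← map_sub, p_dvd_emb_iff, witt_p_dvd_iff,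
        coeff_zero_sub', coeff_zero_mul', coeff_zero_pow', ht, sub_eq_zero] at this
      exact ⟨_, this⟩
    have h2 := dvd_add hα (p_dvd_emb_iff.2 (witt_p_dvd_iff.2 h1))
    rw [sub_add_cancel] at h2
    exact (p_prime_ATilde.dvd_or_dvd h2).resolve_left fun h3 => hpt (p_prime_ATilde.dvd_of_dvd_pow h3)
  -- dividing by `p` costs a factor `t^e`, which does not affect divisibility by `p`
  have key2 : ∀ (n : ℕ) (x : ATilde p), (∀ i, ∃ y ∈ overconvInt Z r, x = emb p t ^ i * y) →
      (p : ATilde p) ^ n ∣ x := by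
    intro n
    induction n with
    | zero => simp
    | succ n ih =>
      intro x h
      obtain ⟨x', rfl⟩ := key x h
      have hx' : ∀ i, ∃ y ∈ overconvInt Z r, emb p t ^ D.e * x' = emb p t ^ i * y := by
        intro i
        obtain ⟨y, hy, h1⟩ := h i
        have h2 : (p : ATilde p) ∣ y := by
          have : (p : ATilde p) ∣ emb p t ^ i * y := ⟨x', h1.symm⟩
          exact (p_prime_ATilde.dvd_or_dvd this).resolve_left
            fun h3 => hpt (p_prime_ATilde.dvd_of_dvd_pow h3)
        obtain ⟨y', hy', h3⟩ := D.exists_p_mul ht hy h2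
        refine ⟨y', hy', mul_left_cancel₀ p_ne_zero_ATilde ?_⟩
        linear_combination emb p t ^ D.e * h1 + emb p t ^ i * h3
      have h4 := ih _ hx'
      have hu : IsUnit (emb p t ^ D.e) := (isUnit_of_not_p_dvd hpt).pow _
      rw [hu.dvd_mul_left] at h4
      rw [pow_succ']
      exact mul_dvd_mul_left _ h4
  exact witt_eq_zero_of_forall_dvd fun n => key2 n x h

theorem RadiusData.exists_p_pow_eq (D : RadiusData Z r) (i : ℕ) :
    ∃ j, ∃ y ∈ overconvInt Z r, (p : ATilde p) ^ j = emb p Z.teichVarpi ^ i * y := by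
  obtain ⟨k, hk⟩ := D.dvd_w_pow i
  obtain ⟨u, hu⟩ := hk k le_rfl
  refine ⟨k, D.z ^ k * emb p u, mul_mem (pow_mem D.z_mem _) (emb_mem_overconvInt _), ?_⟩
  rw [← D.z_mul_w, mul_pow, ← map_pow, hu, map_mul, map_pow]
  ring

/-- Power series in `T` or `[ϖ]` with coefficients in `Ã^{(0,r],∘}` can be summed. -/
theorem overconvInt_sumsExist {t : AInf p} (ht : t.coeff 0 = Z.varpi) :
    SumsExist (overconvInt Z r) (algebraMap (AInf p) (overconvInt Z r) t) := by
  obtain ⟨D⟩ := nonempty_radiusData Z r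
  refine SumsExist.of_mod (p := (p : overconvInt Z r)) overconvInt_sumsExist_p (fun x hx => ?_) ?_
  · refine Subtype.ext (witt_eq_zero_of_forall_dvd fun n => ?_)
    obtain ⟨y, rfl⟩ := hx n
    exact ⟨y, by push_cast; rfl⟩
  · intro β
    choose α y hy hαy using fun n => D.exists_pow_e_mul ht (β n).2
    obtain ⟨v, hv⟩ := AInf_sumsExist Z ht fun n => α (n + D.e)
    let τ := algebraMap (AInf p) (overconvInt Z r) t
    refine ⟨fun n => ∑ i ∈ Finset.range D.e, τ ^ i * β (n + i) +
      algebraMap (AInf p) (overconvInt Z r) (v n), fun n => ⟨y (n + D.e), hy _⟩, fun n => ?_⟩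
    have h1 : τ * ∑ i ∈ Finset.range D.e, τ ^ i * β (n + 1 + i) + β n =
        ∑ i ∈ Finset.range D.e, τ ^ i * β (n + i) + τ ^ D.e * β (n + D.e) := by
      rw [← Finset.sum_range_succ (fun i => τ ^ i * β (n + i)), Finset.sum_range_succ',
        Finset.mul_sum]
      congr 1
      · refine Finset.sum_congr rfl fun i _ => ?_
        rw [show n + (i + 1) = n + 1 + i by ring]; ring
      · simp
    have h2 : τ ^ D.e * β (n + D.e) = algebraMap (AInf p) (overconvInt Z r) (α (n + D.e)) +
        p * ⟨y (n + D.e), hy _⟩ := by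
      refine Subtype.ext ?_
      have := hαy (n + D.e)
      push_cast
      exact this
    have h3 := congrArg (algebraMap (AInf p) (overconvInt Z r)) (hv n)
    rw [map_add, map_mul] at h3
    linear_combination -h1 - h2 + h3

end Overconvergent

/-! ### Étale extensions inside a complete domain -/

section Etale

open Polynomial

variable {R : Type*} [CommRing R] {p : R}

theorem eq_zero_of_forall_pow_dvd [IsAdicComplete (Ideal.span {p}) R] {x : R} (h : ∀ n : ℕ, p ^ n ∣ x) : x = 0 := by
  refine IsHausdorff.haus (I := Ideal.span {p}) inferInstance x fun n => ?_
  rw [SModEq.zero, Ideal.span_singleton_pow, smul_eq_mul, Ideal.mul_top, Ideal.mem_span_singleton]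
  exact h n

/-- A subring `C` of a `p`-adically complete domain is a *Cohen subring* if `C / p` injects into
the ambient ring modulo `p`, if `C` is closed for the `p`-adic topology, and if `C / p` is a
field. -/
structure IsCohenSubring (p : R) (C : Subring R) : Prop where
  p_mem : p ∈ C
  mem_of_mul_mem : ∀ x, p * x ∈ C → x ∈ C
  mem_of_forall_dvd : ∀ x, (∀ n : ℕ, ∃ c ∈ C, p ^ n ∣ x - c) → x ∈ C
  exists_inv : ∀ x ∈ C, ¬ p ∣ x → ∃ y ∈ C, p ∣ x * y - 1

variable {C : Subring R}

theorem coe_mem_subalgebra (S : Subalgebra C R) {c : R} (hc : c ∈ C) : c ∈ S :=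
  Subalgebra.algebraMap_mem S (⟨c, hc⟩ : C)

theorem self_mem_adjoin (θ : R) : θ ∈ Algebra.adjoin C {θ} :=
  Algebra.subset_adjoin (Set.mem_singleton θ)

theorem sum_mul_pow_mem_adjoin (θ : R) {c : ℕ → R} (hc : ∀ k, c k ∈ C) (n : ℕ) :
    ∑ k ∈ Finset.range n, c k * θ ^ k ∈ Algebra.adjoin C {θ} :=
  Subalgebra.sum_mem _ fun k _ => Subalgebra.mul_mem _ (coe_mem_subalgebra _ (hc k))
    (Subalgebra.pow_mem _ (self_mem_adjoin θ) k)

theorem dvd_aeval_of_dvd_coeff {g : C[X]} (h : ∀ k, p ∣ (g.coeff k : R)) (y : R) :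
    p ∣ aeval y g := by
  rw [aeval_eq_sum_range]
  refine Finset.dvd_sum fun i _ => ?_
  rw [Subring.smul_def, smul_eq_mul]
  exact (h i).mul_right _

theorem dvd_aeval_sub_aeval (g : C[X]) {y y' : R} (h : p ∣ y - y') :
    p ∣ aeval y g - aeval y' g := by
  rw [aeval_def, aeval_def, ← eval_map, ← eval_map]
  exact h.trans (sub_dvd_eval_sub _ _ _)

/-- Inverses modulo `p` of integral elements are polynomials in these elements. -/
theorem IsCohenSubring.exists_aeval_inv (hp : Prime p) (hC : IsCohenSubring p C) {y : R}
    (hy : ¬ p ∣ y) {n : ℕ} {h : C[X]} (hm : h.Monic) (hn : h.natDegree = n)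
    (hpy : p ∣ aeval y h) : ∃ g : C[X], p ∣ y * aeval y g - 1 := by
  induction n generalizing h with
  | zero =>
    rw [hm.natDegree_eq_zero.1 hn, map_one] at hpy
    exact absurd (isUnit_of_dvd_one hpy) hp.not_isUnit
  | succ n ih =>
    have hX : aeval y h = y * aeval y h.divX + (h.coeff 0 : R) := by
      conv_lhs => rw [← X_mul_divX_add h]
      rw [map_add, map_mul, aeval_X, aeval_C]
      rfl
    have hdeg : h.divX.natDegree = n := by rw [natDegree_divX_eq_natDegree_tsub_one, hn]; rfl
    by_cases hc : p ∣ (h.coeff 0 : R)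
    · refine ih (h := h.divX) ?_ hdeg ?_
      · rw [Monic, leadingCoeff, hdeg, coeff_divX, ← hn]
        exact hm
      · rw [hX, dvd_add_left hc] at hpy
        exact (hp.dvd_or_dvd hpy).resolve_left hy
    · obtain ⟨c, hcC, hc'⟩ := hC.exists_inv _ (h.coeff 0).2 hc
      refine ⟨-Polynomial.C (⟨c, hcC⟩ : C) * h.divX, ?_⟩
      obtain ⟨u, hu⟩ := hpy
      obtain ⟨v, hv⟩ := hc'
      refine ⟨v - c * u, ?_⟩
      rw [map_mul, map_neg, aeval_C]
      change y * (-c * _) - 1 = _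
      linear_combination hv - c * hu + c * hX

/-- If `θ` is integral over `C`, then the subring `C[θ]` contains the sums of the series
`∑ p^k m_k` with terms in it. -/
theorem IsCohenSubring.sum_mem_adjoin [IsAdicComplete (Ideal.span {p}) R]
    (hC : IsCohenSubring p C) {θ : R} {h : C[X]} (hm : h.Monic)
    (hθ : aeval θ h = 0) {m x : ℕ → R} (hmem : ∀ k, m k ∈ Algebra.adjoin C {θ})
    (hx : ∀ k, x k = m k + p * x (k + 1)) : x 0 ∈ Algebra.adjoin C {θ} := by
  have h1 : ∀ k, ∃ g : C[X], g.natDegree < h.natDegree + 1 ∧ aeval θ g = m k := by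
    intro k
    have := hmem k
    rw [Algebra.adjoin_singleton_eq_range_aeval] at this
    obtain ⟨g, hg⟩ := this
    exact ⟨g %ₘ h, Nat.lt_succ_of_le (natDegree_modByMonic_le _ hm),
      (aeval_modByMonic_eq_self_of_root hθ).trans hg⟩
  choose g hgdeg hg using h1
  have hsum : ∀ k, m k = ∑ j ∈ Finset.range (h.natDegree + 1), ((g k).coeff j : R) * θ ^ j := by
    intro k
    rw [← hg k, aeval_eq_sum_range' (hgdeg k)]
    rfl
  choose a ha using fun j : ℕ => SumsExist.of_isAdicComplete p fun k => ((g k).coeff j : R)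
  have haC : ∀ j, a j 0 ∈ C := fun j => hC.mem_of_forall_dvd _ fun n =>
    ⟨∑ i ∈ Finset.range n, p ^ i * ((g i).coeff j : R),
      sum_mem fun i _ => mul_mem (pow_mem hC.p_mem _) ((g i).coeff j).2,
      a j n, by rw [eq_partialSum_add (ha j) n]; ring⟩
  have hdiff : ∀ n k, p ^ n ∣ x k - ∑ j ∈ Finset.range (h.natDegree + 1), a j k * θ ^ j := by
    intro n
    induction n with
    | zero => simp
    | succ n ih =>
      intro k
      have e : x k - ∑ j ∈ Finset.range (h.natDegree + 1), a j k * θ ^ j =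
          p * (x (k + 1) - ∑ j ∈ Finset.range (h.natDegree + 1), a j (k + 1) * θ ^ j) := by
        have : ∑ j ∈ Finset.range (h.natDegree + 1), a j k * θ ^ j = m k +
            p * ∑ j ∈ Finset.range (h.natDegree + 1), a j (k + 1) * θ ^ j := by
          rw [hsum k, Finset.mul_sum, ← Finset.sum_add_distrib]
          exact Finset.sum_congr rfl fun j _ => by rw [ha j k]; ring
        rw [this, hx k]; ring
      rw [e, pow_succ']
      exact mul_dvd_mul_left _ (ih _)
  rw [sub_eq_zero.1 (eq_zero_of_forall_pow_dvd (p := p) fun n => hdiff n 0)]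
  exact sum_mul_pow_mem_adjoin θ haC _

theorem exists_aeval_of_mem_adjoin {θ y : R} (hy : y ∈ Algebra.adjoin C {θ}) :
    ∃ g : C[X], aeval θ g = y := by
  rw [Algebra.adjoin_singleton_eq_range_aeval] at hy
  exact hy

theorem aeval_mem_adjoin (θ : R) (g : C[X]) : aeval θ g ∈ Algebra.adjoin C {θ} := by
  rw [Algebra.adjoin_singleton_eq_range_aeval]
  exact ⟨g, rfl⟩

/-- If `h` is a monic polynomial over `C` of least degree among those with `p ∣ h(x)`, then the
powers of `x` below this degree are linearly independent modulo `p`. -/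
theorem IsCohenSubring.dvd_coeff (hC : IsCohenSubring p C) {x : R} {n : ℕ}
    (hmin : ∀ h : C[X], h.Monic → p ∣ aeval x h → n ≤ h.natDegree) :
    ∀ m, m ≤ n → ∀ g : C[X], g.degree < m → p ∣ aeval x g → ∀ k, p ∣ (g.coeff k : R) := by
  intro m
  induction m with
  | zero =>
    intro _ g hg _ k
    have : g = 0 := by
      rw [← degree_eq_bot]
      simpa using hg
    simp [this]
  | succ m ih =>
    intro hmn g hg hpg
    have hc : p ∣ (g.coeff m : R) := by
      by_contra hc
      have : Nontrivial C := ⟨g.coeff m, 0, fun h => hc (by rw [h]; exact dvd_zero _)⟩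
      obtain ⟨c', hc'C, hc'⟩ := hC.exists_inv _ (g.coeff m).2 hc
      let c : C := ⟨c', hc'C⟩
      let h : C[X] := X ^ m + Polynomial.C c * (g - Polynomial.C (g.coeff m) * X ^ m)
      have hdeg : (Polynomial.C c * (g - Polynomial.C (g.coeff m) * X ^ m)).degree <
          (m : WithBot ℕ) := by
        rw [degree_lt_iff_coeff_zero]
        intro k hk
        rw [coeff_C_mul, coeff_sub, coeff_C_mul, coeff_X_pow]
        rcases hk.eq_or_lt with rfl | hk
        · simp
        · rw [if_neg hk.ne', mul_zero, sub_zero, (degree_lt_iff_coeff_zero _ _).1 hg k hk,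
            mul_zero]
      have hm : h.Monic := monic_X_pow_add hdeg
      have hn : h.natDegree = m := natDegree_eq_of_degree_eq_some (by
        rw [← degree_X_pow (R := C) m] at hdeg
        rw [degree_add_eq_left_of_degree_lt hdeg, degree_X_pow])
      have hph : p ∣ aeval x h := by
        obtain ⟨u, hu⟩ := hpg
        obtain ⟨v, hv⟩ := hc'
        have : aeval x h = x ^ m + c' * (aeval x g - (g.coeff m : R) * x ^ m) := by
          simp only [h, map_add, map_mul, map_sub, map_pow, aeval_X, aeval_C]
          rfl
        rw [this]
        exact ⟨c' * u - v * x ^ m, by linear_combination c' * hu - x ^ m * hv⟩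
      have := hmin h hm hph
      omega
    have h0 := ih (by omega) (g - Polynomial.C (g.coeff m) * X ^ m) (by
      rw [degree_lt_iff_coeff_zero]
      intro k hk
      rw [coeff_sub, coeff_C_mul, coeff_X_pow]
      rcases hk.eq_or_lt with rfl | hk
      · simp
      · rw [if_neg hk.ne', mul_zero, sub_zero]
        exact (degree_lt_iff_coeff_zero _ _).1 hg k hk) (by
      have : aeval x (g - Polynomial.C (g.coeff m) * X ^ m) =
          aeval x g - (g.coeff m : R) * x ^ m := by
        simp only [map_mul, map_sub, map_pow, aeval_X, aeval_C]
        rfl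
      rw [this]
      exact dvd_sub hpg (hc.mul_right _))
    intro k
    by_cases hk : k = m
    · rw [hk]; exact hc
    · have := h0 k
      rwa [coeff_sub, coeff_C_mul, coeff_X_pow, if_neg hk, mul_zero, sub_zero] at this

/-- The extension `C[x]` of a Cohen subring `C` by a root `x` of a monic polynomial `f` for which
`f'(x)` is a unit is a Cohen subring. A monic lift `h` of the minimal polynomial of `x` modulo `p`
has a root `θ` near `x`; then `C[θ]` is visibly a Cohen subring, it contains `x` by Newton's
method, and it is equal to `C[x]` because the two rings agree modulo `p`. -/
theorem IsCohenSubring.adjoin [IsDomain R] [IsAdicComplete (Ideal.span {p}) R] (hp : Prime p)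
    (hC : IsCohenSubring p C) {x : R} {f : C[X]} (hf : f.Monic) (hfx : aeval x f = 0)
    (hfx' : IsUnit (aeval x (derivative f))) :
    IsCohenSubring p (Algebra.adjoin C {x}).toSubring := by
  classical
  have hex : ∃ n, ∃ h : C[X], h.Monic ∧ p ∣ aeval x h ∧ h.natDegree = n :=
    ⟨_, f, hf, by rw [hfx]; exact dvd_zero _, rfl⟩
  obtain ⟨h, hm, hpx, hn⟩ := Nat.find_spec hex
  have hmin : ∀ g : C[X], g.Monic → p ∣ aeval x g → h.natDegree ≤ g.natDegree :=
    fun g hg hpg => hn.trans_le (Nat.find_min' hex ⟨g, hg, hpg, rfl⟩)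
  have hindep : ∀ g : C[X], g.degree < h.natDegree → p ∣ aeval x g → ∀ k, p ∣ (g.coeff k : R) :=
    hC.dvd_coeff hmin _ le_rfl
  have hdegmod : ∀ g : C[X], (g %ₘ h).degree < h.natDegree := fun g => by
    rw [← degree_eq_natDegree hm.ne_zero]
    exact degree_modByMonic_lt _ hm
  -- `x` is a simple root of `h` modulo `p`
  have hx' : IsUnit (Ideal.Quotient.mk (Ideal.span {p}) (aeval x (derivative h))) := by
    have hr : ∀ k, p ∣ ((f %ₘ h).coeff k : R) := by
      refine hindep _ (hdegmod f) ?_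
      have := congrArg (aeval x) (modByMonic_add_div f h)
      rw [map_add, map_mul, hfx] at this
      rw [eq_neg_of_add_eq_zero_left this, dvd_neg]
      exact hpx.mul_right _
    have hr' : p ∣ aeval x (derivative (f %ₘ h)) := by
      refine dvd_aeval_of_dvd_coeff (fun k => ?_) x
      rw [coeff_derivative]
      push_cast
      exact (hr _).mul_right _
    have e := congrArg (fun g => aeval x (derivative g)) (modByMonic_add_div f h)
    simp only [derivative_mul, map_add, map_mul] at e
    have hz : Ideal.Quotient.mk (Ideal.span {p}) (aeval x (derivative f)) =
        Ideal.Quotient.mk (Ideal.span {p}) (aeval x (derivative h)) *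
        Ideal.Quotient.mk (Ideal.span {p}) (aeval x (f /ₘ h)) := by
      rw [← map_mul, Ideal.Quotient.mk_eq_mk_iff_sub_mem, Ideal.mem_span_singleton, ← e]
      have : aeval x (derivative (f %ₘ h)) + (aeval x (derivative h) * aeval x (f /ₘ h) +
          aeval x h * aeval x (derivative (f /ₘ h))) - aeval x (derivative h) * aeval x (f /ₘ h) =
          aeval x (derivative (f %ₘ h)) + aeval x h * aeval x (derivative (f /ₘ h)) := by ring
      rw [this]
      exact dvd_add hr' (hpx.mul_right _)
    have hu := hfx'.map (Ideal.Quotient.mk (Ideal.span {p}))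
    rw [hz] at hu
    exact isUnit_of_mul_isUnit_left hu
  obtain ⟨θ, hθ, hθx⟩ : ∃ θ, aeval θ h = 0 ∧ p ∣ θ - x := by
    obtain ⟨θ, h1, h2⟩ := HenselianRing.is_henselian (I := Ideal.span {p}) (h.map (algebraMap C R))
      (hm.map _) x (by rw [eval_map_algebraMap, Ideal.mem_span_singleton]; exact hpx)
      (by rw [derivative_map, eval_map_algebraMap]; exact hx')
    rw [IsRoot, eval_map_algebraMap] at h1
    exact ⟨θ, h1, Ideal.mem_span_singleton.1 h2⟩
  set M := Algebra.adjoin C {θ} with hM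
  have hpC : ∀ (S : Subalgebra C R), p ∈ S := fun S =>
    coe_mem_subalgebra S hC.p_mem
  -- `C[θ] / p` injects into the ambient ring modulo `p`
  have hsat : ∀ y, p * y ∈ M → y ∈ M := by
    intro y hy
    obtain ⟨g, hg⟩ := exists_aeval_of_mem_adjoin hy
    have hg' : aeval θ (g %ₘ h) = p * y := (aeval_modByMonic_eq_self_of_root hθ).trans hg
    have hpg : p ∣ aeval x (g %ₘ h) := by
      have h1 := dvd_aeval_sub_aeval (g %ₘ h) hθx
      rw [hg'] at h1
      exact (dvd_sub_right (dvd_mul_right _ _)).1 h1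
    choose c hc using hindep _ (hdegmod g) hpg
    have hcC : ∀ k, c k ∈ C := fun k => hC.mem_of_mul_mem _ (by rw [← hc k]; exact Subtype.prop _)
    have : y = ∑ k ∈ Finset.range ((g %ₘ h).natDegree + 1), c k * θ ^ k := by
      refine mul_left_cancel₀ hp.ne_zero ?_
      rw [← hg', aeval_eq_sum_range, Finset.mul_sum]
      refine Finset.sum_congr rfl fun k _ => ?_
      rw [Subring.smul_def, smul_eq_mul, hc k, mul_assoc]
    rw [this]
    exact sum_mul_pow_mem_adjoin θ hcC _
  have hsat' : ∀ n y, p ^ n * y ∈ M → y ∈ M := by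
    intro n
    induction n with
    | zero => intro y hy; simpa using hy
    | succ n ih => exact fun y hy => ih _ (hsat _ (by rwa [pow_succ', mul_assoc] at hy))
  have hclosed : ∀ y, (∀ n : ℕ, ∃ c ∈ M, p ^ n ∣ y - c) → y ∈ M := by
    intro y hy
    choose m hmM hmy using hy
    have hd : ∀ k, ∃ d ∈ M, m (k + 1) - m k = p ^ k * d := by
      intro k
      have : p ^ k ∣ m (k + 1) - m k := by
        have := dvd_sub (hmy k) ((pow_dvd_pow p k.le_succ).trans (hmy (k + 1)))
        rwa [sub_sub_sub_cancel_left] at this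
      obtain ⟨d, hd⟩ := this
      exact ⟨d, hsat' k d (by rw [← hd]; exact sub_mem (hmM _) (hmM _)), hd⟩
    choose d hdM hd using hd
    obtain ⟨X, hX⟩ := SumsExist.of_isAdicComplete p d
    have hX0 := hC.sum_mem_adjoin hm hθ hdM hX
    have : y = m 0 + X 0 := by
      rw [← sub_eq_zero]
      refine eq_zero_of_forall_pow_dvd (p := p) fun n => ?_
      have h1 : m n = m 0 + ∑ i ∈ Finset.range n, p ^ i * d i := by
        rw [← sub_eq_iff_eq_add', ← Finset.sum_range_sub]
        exact Finset.sum_congr rfl fun i _ => hd i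
      have h2 := eq_partialSum_add hX n
      obtain ⟨u, hu⟩ := hmy n
      exact ⟨u - X n, by linear_combination hu + h1 - h2⟩
    rw [this]
    exact add_mem (hmM 0) hX0
  have hfield : ∀ y ∈ M, ¬ p ∣ y → ∃ y' ∈ M, p ∣ y * y' - 1 := by
    intro y hy hpy
    have hint : IsIntegral C y := by
      have h1 : M ≤ integralClosure C R := by
        refine Algebra.adjoin_le ?_
        rintro _ rfl
        exact ⟨h, hm, hθ⟩
      exact h1 hy
    obtain ⟨q, hq, hqy⟩ := hint
    obtain ⟨g, hg⟩ := hC.exists_aeval_inv hp hpy hq rfl (by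
      rw [aeval_def, hqy]; exact dvd_zero _)
    exact ⟨aeval y g, (Subalgebra.aeval_coe M ⟨y, hy⟩ g) ▸ Subtype.prop _, hg⟩
  -- Newton's method
  have hxM : x ∈ M := by
    have key : ∀ n : ℕ, ∃ m ∈ M, p ^ (n + 1) ∣ x - m := by
      intro n
      induction n with
      | zero =>
        exact ⟨θ, self_mem_adjoin θ, by
          rw [zero_add, pow_one, ← dvd_neg, neg_sub]; exact hθx⟩
      | succ n ih =>
        obtain ⟨m, hmM, δ, hδ⟩ := ih
        have hfm : aeval m f ∈ M := (Subalgebra.aeval_coe M ⟨m, hmM⟩ f) ▸ Subtype.prop _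
        have hfm' : aeval m (derivative f) ∈ M :=
          (Subalgebra.aeval_coe M ⟨m, hmM⟩ (derivative f)) ▸ Subtype.prop _
        have hpf : ¬ p ∣ aeval m (derivative f) := by
          intro hc
          have h1 : p ∣ aeval x (derivative f) - aeval m (derivative f) :=
            dvd_aeval_sub_aeval (derivative f)
              (by rw [hδ, pow_succ']; exact (dvd_mul_right _ _).mul_right _)
          rw [dvd_sub_left hc] at h1
          exact hp.not_isUnit (isUnit_of_dvd_unit h1 hfx')
        obtain ⟨u, huM, v, hu⟩ := hfield _ hfm' hpf
        -- Taylor expansion at `m`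
        have htaylor : ∃ c, aeval x f = aeval m f + aeval m (derivative f) * (x - m) +
            c * (x - m) ^ 2 := by
          obtain ⟨c, hc⟩ := (f.map (algebraMap C R)).binomExpansion m (x - m)
          rw [add_sub_cancel, derivative_map, eval_map_algebraMap, eval_map_algebraMap,
            eval_map_algebraMap] at hc
          exact ⟨c, hc⟩
        obtain ⟨c, hc⟩ := htaylor
        rw [hfx, hδ] at hc
        obtain ⟨ω, hω⟩ : ∃ ω, aeval m f = p ^ (n + 1) * ω :=
          ⟨-(aeval m (derivative f) * δ) - c * p ^ (n + 1) * δ ^ 2, by linear_combination -hc⟩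
        have hωM : ω ∈ M := hsat' (n + 1) ω (by rw [← hω]; exact hfm)
        have hωδ : ω = -(aeval m (derivative f) * δ) - c * p ^ (n + 1) * δ ^ 2 := by
          refine mul_left_cancel₀ (pow_ne_zero (n + 1) hp.ne_zero) ?_
          rw [← hω]; linear_combination -hc
        refine ⟨m - p ^ (n + 1) * (u * ω), sub_mem hmM
          (mul_mem (pow_mem (hpC M) _) (mul_mem huM hωM)), -(v * δ) - u * c * p ^ n * δ ^ 2, ?_⟩
        rw [hωδ]
        rw [pow_succ p (n + 1)]
        linear_combination hδ - p ^ (n + 1) * δ * hu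
    refine hclosed x fun n => ?_
    obtain ⟨m, hmM, h1⟩ := key n
    exact ⟨m, hmM, (pow_dvd_pow p n.le_succ).trans h1⟩
  have hNM : Algebra.adjoin C {x} ≤ M := Algebra.adjoin_le (by rintro _ rfl; exact hxM)
  -- `C[θ] = C[x] + p C[θ]`
  have hMN : M ≤ Algebra.adjoin C {x} := by
    have h1 : ∀ y : M, ∃ n ∈ Algebra.adjoin C {x}, ∃ y' : M, (y : R) = n + p * y' := by
      rintro ⟨y, hy⟩
      obtain ⟨g, rfl⟩ := exists_aeval_of_mem_adjoin hy
      obtain ⟨u, hu⟩ := dvd_aeval_sub_aeval g hθx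
      have hgx := aeval_mem_adjoin x g
      refine ⟨aeval x g, hgx, ⟨u, hsat u ?_⟩, by rw [← hu]; ring⟩
      rw [← hu]
      exact sub_mem hy (hNM hgx)
    choose n hn y' hy' using h1
    intro y hy
    let Y : ℕ → M := fun k => Nat.rec ⟨y, hy⟩ (fun _ z => y' z) k
    let X : ℕ → R := fun k => (Y k).1
    have hX : ∀ k, X k = n (Y k) + p * X (k + 1) := fun k => hy' (Y k)
    exact hC.sum_mem_adjoin hf hfx (fun k => hn (Y k)) hX
  rw [le_antisymm hNM hMN]
  exact ⟨hpC M, hsat, hclosed, hfield⟩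

end Etale

/-! ### The rings `A_{ℚ_p}` and `A_K` -/

section AKRing

variable {p : ℕ} [Fact p.Prime] (Z : CycloSystem p)

theorem T_mem_AQpPlus : Z.T ∈ AQpPlus Z := fun _ => ⟨Z.T, Algebra.subset_adjoin rfl, by simp⟩

theorem mem_AQpPlus_of_approx {x : AInf p} (h : ∀ n : ℕ, ∃ y ∈ AQpPlus Z, Z.T ^ n ∣ x - y) :
    x ∈ AQpPlus Z := by
  intro n
  obtain ⟨y, hy, hxy⟩ := h n
  obtain ⟨q, hq, hyq⟩ := hy n
  exact ⟨q, hq, by rw [← sub_add_sub_cancel x y q]; exact dvd_add hxy hyq⟩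

/-- An element of `ℤ_p` which is divisible by `T` modulo `p` is divisible by `p`. -/
theorem exists_eq_p_mul_of_dvd {c : ℤ_[p]} {y : AInf p}
    (h : (p : AInf p) ∣ algebraMap ℤ_[p] (AInf p) c + Z.T * y) : ∃ c', c = p * c' := by
  by_contra hc
  have hu : IsUnit c := by
    by_contra hu
    rw [← mem_nonunits_iff, ← IsLocalRing.mem_maximalIdeal, PadicInt.maximalIdeal_eq_span_p,
      Ideal.mem_span_singleton] at hu
    exact hc hu
  have h1 : IsUnit ((algebraMap ℤ_[p] (AInf p) c).coeff 0) :=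
    (hu.map (algebraMap ℤ_[p] (AInf p))).map (WittVector.constantCoeff : AInf p →+* OFlat p)
  rw [witt_p_dvd_iff, coeff_zero_add', coeff_zero_mul', coeff_zero_T] at h
  rw [eq_neg_of_add_eq_zero_left h] at h1
  exact not_isUnit_varpi Z (isUnit_of_mul_isUnit_left ((IsUnit.neg_iff _).1 h1))

theorem algebraMap_eq_zero_of_T_dvd {c : ℤ_[p]} (h : Z.T ∣ algebraMap ℤ_[p] (AInf p) c) :
    c = 0 := by
  have key : ∀ n : ℕ, ∀ c : ℤ_[p], Z.T ∣ algebraMap ℤ_[p] (AInf p) c → (p : ℤ_[p]) ^ n ∣ c := by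
    intro n
    induction n with
    | zero => simp
    | succ n ih =>
      rintro c ⟨y, hy⟩
      obtain ⟨c', rfl⟩ := exists_eq_p_mul_of_dvd Z (c := c) (y := -y) (by rw [hy]; simp)
      rw [pow_succ']
      refine mul_dvd_mul_left _ (ih c' ?_)
      have h1 : (p : AInf p) ∣ Z.T ^ 1 * y := by
        rw [pow_one, ← hy, map_mul, map_natCast]; exact dvd_mul_right _ _
      obtain ⟨y', rfl⟩ := p_dvd_of_p_dvd_mul Z (coeff_zero_T Z) h1
      refine ⟨y', mul_left_cancel₀ (p_ne_zero_AInf (p := p)) ?_⟩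
      rw [map_mul, map_natCast] at hy
      rw [hy]; ring
  by_contra hc
  have hfin : ∀ n, (p : ℤ_[p]) ^ n ∣ c := fun n => key n c h
  have : c = 0 := by
    refine IsHausdorff.haus (I := IsLocalRing.maximalIdeal ℤ_[p]) inferInstance c fun n => ?_
    rw [SModEq.zero, PadicInt.maximalIdeal_eq_span_p, Ideal.span_singleton_pow, smul_eq_mul,
      Ideal.mul_top, Ideal.mem_span_singleton]
    exact hfin n
  exact hc this

theorem exists_eq_add_T_mul_of_mem_adjoin {q : AInf p}
    (hq : q ∈ Algebra.adjoin ℤ_[p] ({Z.T} : Set (AInf p))) :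
    ∃ (c : ℤ_[p]), ∃ q' ∈ Algebra.adjoin ℤ_[p] ({Z.T} : Set (AInf p)),
      q = algebraMap ℤ_[p] (AInf p) c + Z.T * q' := by
  rw [Algebra.adjoin_singleton_eq_range_aeval] at hq
  obtain ⟨f, rfl⟩ := hq
  refine ⟨f.coeff 0, Polynomial.aeval Z.T f.divX, ?_, ?_⟩
  · rw [Algebra.adjoin_singleton_eq_range_aeval]
    exact ⟨_, rfl⟩
  · change Polynomial.aeval Z.T f = _
    conv_lhs => rw [← Polynomial.X_mul_divX_add f]
    rw [map_add, map_mul, Polynomial.aeval_X, Polynomial.aeval_C, add_comm]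

theorem mem_AQpPlus_of_T_mul_mem {y : AInf p} (h : Z.T * y ∈ AQpPlus Z) : y ∈ AQpPlus Z := by
  intro n
  obtain ⟨q, hq, u, hu⟩ := h (n + 1)
  obtain ⟨c, q', hq', rfl⟩ := exists_eq_add_T_mul_of_mem_adjoin Z hq
  have hc : c = 0 := algebraMap_eq_zero_of_T_dvd Z
    ⟨y - q' - Z.T ^ n * u, by linear_combination -hu⟩
  have hT : Z.T ≠ 0 := by
    intro h0
    have := coeff_zero_T Z
    rw [h0, WittVector.zero_coeff] at this
    exact varpi_ne_zero Z this.symm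
  refine ⟨q', hq', u, mul_left_cancel₀ hT ?_⟩
  rw [hc, map_zero] at hu
  linear_combination hu

theorem exists_eq_add_T_mul {y : AInf p} (hy : y ∈ AQpPlus Z) :
    ∃ (c : ℤ_[p]), ∃ y' ∈ AQpPlus Z, y = algebraMap ℤ_[p] (AInf p) c + Z.T * y' := by
  obtain ⟨q, hq, u, hu⟩ := hy 1
  obtain ⟨c, q', hq', rfl⟩ := exists_eq_add_T_mul_of_mem_adjoin Z hq
  have h : y = algebraMap ℤ_[p] (AInf p) c + Z.T * (q' + u) := by linear_combination hu
  refine ⟨c, q' + u, mem_AQpPlus_of_T_mul_mem Z ?_, h⟩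
  rw [(sub_eq_iff_eq_add'.2 h).symm]
  exact sub_mem hy (Subalgebra.algebraMap_mem _ c)

theorem mem_AQpPlus_of_p_mul_mem {y : AInf p} (h : (p : AInf p) * y ∈ AQpPlus Z) :
    y ∈ AQpPlus Z := by
  suffices key : ∀ n : ℕ, ∀ y : AInf p, (p : AInf p) * y ∈ AQpPlus Z →
      ∃ q ∈ Algebra.adjoin ℤ_[p] ({Z.T} : Set (AInf p)), Z.T ^ n ∣ y - q from
    fun n => key n y h
  intro n
  induction n with
  | zero => exact fun y _ => ⟨0, zero_mem _, by simp⟩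
  | succ n ih =>
    intro y hy
    obtain ⟨c, y₁, hy₁, h⟩ := exists_eq_add_T_mul Z hy
    obtain ⟨c', rfl⟩ := exists_eq_p_mul_of_dvd Z (c := c) (y := y₁) ⟨y, h.symm⟩
    rw [map_mul, map_natCast] at h
    have h1 : (p : AInf p) ∣ Z.T ^ 1 * y₁ :=
      ⟨y - algebraMap ℤ_[p] (AInf p) c', by linear_combination -h⟩
    obtain ⟨y₂, rfl⟩ := p_dvd_of_p_dvd_mul Z (coeff_zero_T Z) h1
    obtain ⟨q, hq, u, hu⟩ := ih y₂ hy₁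
    have h2 : y = algebraMap ℤ_[p] (AInf p) c' + Z.T * y₂ :=
      mul_left_cancel₀ (p_ne_zero_AInf (p := p)) (by linear_combination h)
    refine ⟨algebraMap ℤ_[p] (AInf p) c' + Z.T * q, add_mem (Subalgebra.algebraMap_mem _ _)
      (mul_mem (Algebra.subset_adjoin rfl) hq), u, ?_⟩
    rw [h2, pow_succ']
    linear_combination Z.T * hu

/-- Power series in `T` with coefficients in `A_{ℚ_p}^+` can be summed in `A_{ℚ_p}^+`. -/
theorem AQpPlus_sum_mem {β x : ℕ → AInf p} (hβ : ∀ n, β n ∈ AQpPlus Z)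
    (hx : ∀ n, x n = β n + Z.T * x (n + 1)) : x 0 ∈ AQpPlus Z :=
  mem_AQpPlus_of_approx Z fun n => ⟨∑ i ∈ Finset.range n, Z.T ^ i * β i,
    sum_mem fun i _ => mul_mem (pow_mem (T_mem_AQpPlus Z) i) (hβ i),
    x n, by rw [eq_partialSum_add hx n]; ring⟩

/-- An element of `A_{ℚ_p}^+` with invertible constant term is invertible modulo `p`. -/
theorem exists_AQpPlus_inv {c : ℤ_[p]} (hc : ¬ (p : ℤ_[p]) ∣ c) {y : AInf p} (hy : y ∈ AQpPlus Z) :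
    ∃ v ∈ AQpPlus Z, (p : AInf p) ∣ (algebraMap ℤ_[p] (AInf p) c + Z.T * y) * v - 1 := by
  have hu : IsUnit c := by
    by_contra hu
    rw [← mem_nonunits_iff, ← IsLocalRing.mem_maximalIdeal, PadicInt.maximalIdeal_eq_span_p,
      Ideal.mem_span_singleton] at hu
    exact hc hu
  obtain ⟨c', hc'⟩ := hu.exists_right_inv
  set a := algebraMap ℤ_[p] (AInf p) c with ha
  set a' := algebraMap ℤ_[p] (AInf p) c' with ha'
  have haa : a * a' = 1 := by rw [ha, ha', ← map_mul, hc', map_one]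
  have ha'm : a' ∈ AQpPlus Z := Subalgebra.algebraMap_mem _ _
  obtain ⟨x, hx⟩ := AInf_sumsExist Z (coeff_zero_T Z) fun n => a' * (-(a' * y)) ^ n
  refine ⟨x 0, AQpPlus_sum_mem Z (fun n => mul_mem ha'm (pow_mem (neg_mem (mul_mem ha'm hy)) n)) hx,
    ?_⟩
  rw [witt_p_dvd_iff]
  refine OFlat_eq_zero_of_forall_dvd Z fun n => ?_
  have h1 : Z.T ^ n ∣ (a + Z.T * y) * x 0 - 1 := by
    have h2 : ∀ n, (a + Z.T * y) * ∑ i ∈ Finset.range n, Z.T ^ i * (a' * (-(a' * y)) ^ i) =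
        1 - Z.T ^ n * (-(a' * y)) ^ n := by
      intro n
      induction n with
      | zero => simp
      | succ n ih =>
        rw [Finset.sum_range_succ, mul_add, ih, pow_succ Z.T, pow_succ (-(a' * y))]
        linear_combination (Z.T ^ n * (-(a' * y)) ^ n) * haa
    rw [eq_partialSum_add hx n, mul_add, h2]
    exact ⟨(a + Z.T * y) * x n - (-(a' * y)) ^ n, by ring⟩
  obtain ⟨u, hu⟩ := h1
  rw [hu, coeff_zero_mul', coeff_zero_pow', coeff_zero_T]
  exact dvd_mul_right _ _

/-- Modulo `p`, a nonzero element of `A_{ℚ_p}^+` is a power of `T` times a unit. -/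
theorem exists_eq_T_pow_mul {y : AInf p} (hy : y ∈ AQpPlus Z) (hpy : ¬ (p : AInf p) ∣ y) :
    ∃ (N : ℕ) (v : AInf p), v ∈ AQpPlus Z ∧ (p : AInf p) ∣ y * v - Z.T ^ N := by
  by_contra hcon
  push Not at hcon
  have key : ∀ N : ℕ, ∃ y' ∈ AQpPlus Z, (p : AInf p) ∣ y - Z.T ^ N * y' := by
    intro N
    induction N with
    | zero => exact ⟨y, hy, by simp⟩
    | succ N ih =>
      obtain ⟨y', hy', u, hu⟩ := ih
      obtain ⟨c, y₁, hy₁, rfl⟩ := exists_eq_add_T_mul Z hy'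
      by_cases hc : (p : ℤ_[p]) ∣ c
      · obtain ⟨c', rfl⟩ := hc
        refine ⟨y₁, hy₁, u + Z.T ^ N * algebraMap ℤ_[p] (AInf p) c', ?_⟩
        rw [map_mul, map_natCast] at hu
        rw [pow_succ]
        linear_combination hu
      · obtain ⟨v, hv, w, hw⟩ := exists_AQpPlus_inv Z hc hy₁
        exact absurd ⟨u * v + Z.T ^ N * w, by linear_combination v * hu + Z.T ^ N * hw⟩
          (hcon N v hv)
  refine hpy (witt_p_dvd_iff.2 (OFlat_eq_zero_of_forall_dvd Z fun N => ?_))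
  obtain ⟨y', _, h⟩ := key N
  rw [witt_p_dvd_iff, coeff_zero_sub', coeff_zero_mul', coeff_zero_pow', coeff_zero_T,
    sub_eq_zero] at h
  rw [h]
  exact dvd_mul_right _ _

theorem emb_mem_AQp {y : AInf p} (hy : y ∈ AQpPlus Z) : emb p y ∈ AQp Z :=
  fun _ => ⟨0, y, hy, by simp⟩

theorem mem_AQp_of_T_mul_eq_one {t : ATilde p} (ht : emb p Z.T * t = 1) : t ∈ AQp Z :=
  fun _ => ⟨1, 1, one_mem _, by rw [pow_one, map_one]; change _ ∣ emb p Z.T * t - 1; simp [ht]⟩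

/-- The reduction of `A_{ℚ_p}` modulo `p` is a field, because nonzero elements of `A_{ℚ_p}^+ / p` are
powers of `T` times units. -/
theorem isCohenSubring_AQp : IsCohenSubring (p : ATilde p) (AQp Z).toSubring where
  p_mem := natCast_mem (AQp Z) p
  mem_of_mul_mem x hx n := by
    obtain ⟨m, y, hy, u, hu⟩ := hx (n + 1)
    have h1 : (p : ATilde p) * (emb p Z.T ^ m * x - p ^ n * u) = emb p y := by
      rw [pow_succ'] at hu
      change emb p Z.T ^ m * (p * x) - emb p y = _ at hu
      linear_combination hu
    obtain ⟨y', hy', rfl⟩ := exists_of_p_mul_eq_emb h1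
    refine ⟨m, y', mem_AQpPlus_of_p_mul_mem Z hy, u, ?_⟩
    change emb p Z.T ^ m * x - emb p y' = _
    linear_combination hy'
  mem_of_forall_dvd x hx n := by
    obtain ⟨c, hc, hxc⟩ := hx n
    obtain ⟨m, y, hy, hcy⟩ := hc n
    refine ⟨m, y, hy, ?_⟩
    rw [← sub_add_sub_cancel _ (algebraMap (AInf p) (ATilde p) Z.T ^ m * c), ← mul_sub]
    exact dvd_add (hxc.mul_left _) hcy
  exists_inv x hx hpx := by
    obtain ⟨m, y, hy, u, hu⟩ := hx 1
    change emb p Z.T ^ m * x - emb p y = _ at hu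
    obtain ⟨t, ht⟩ := (isUnit_emb_T Z).exists_right_inv
    have hpy : ¬ (p : AInf p) ∣ y := by
      rw [← p_dvd_emb_iff]
      rintro ⟨y', hy'⟩
      have h1 : (p : ATilde p) ∣ emb p Z.T ^ m * x :=
        ⟨y' + u, by linear_combination hu + hy'⟩
      rcases p_prime_ATilde.dvd_or_dvd h1 with h1 | h1
      · exact not_p_dvd_emb_T Z (p_prime_ATilde.dvd_of_dvd_pow h1)
      · exact hpx h1
    obtain ⟨N, v, hv, w, hw⟩ := exists_eq_T_pow_mul Z hy hpy
    have hw' := congrArg (emb p) hw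
    rw [map_sub, map_mul, map_mul, map_pow, map_natCast] at hw'
    have htA := mem_AQp_of_T_mul_eq_one Z ht
    refine ⟨emb p Z.T ^ m * t ^ N * emb p v, mul_mem (mul_mem (pow_mem (emb_mem_AQp Z
      (T_mem_AQpPlus Z)) _) (pow_mem htA _)) (emb_mem_AQp Z hv), u * t ^ N * emb p v +
        t ^ N * emb p w, ?_⟩
    have hN : emb p Z.T ^ N * t ^ N = 1 := by rw [← mul_pow, ht, one_pow]
    linear_combination t ^ N * emb p v * hu + t ^ N * hw' + hN

/-- Adjoining finitely many of the generators of `A_K` to `A_{ℚ_p}` yields a Cohen subring. -/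
theorem isCohenSubring_adjoin_finset (F : Finset (ATilde p)) (hF : ∀ x ∈ F,
    ∃ f : Polynomial (AQp Z), f.Monic ∧ Polynomial.aeval x f = 0 ∧
      IsUnit (Polynomial.aeval x (Polynomial.derivative f))) :
    IsCohenSubring (p : ATilde p)
      (Algebra.adjoin (AQp Z) (F : Set (ATilde p))).toSubring := by
  classical
  induction F using Finset.induction_on with
  | empty =>
    have : (Algebra.adjoin (AQp Z) ((∅ : Finset (ATilde p)) : Set (ATilde p))).toSubring =
        (AQp Z).toSubring := by
      ext x
      rw [Finset.coe_empty, Algebra.adjoin_empty]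
      change x ∈ (⊥ : Subalgebra (AQp Z) (ATilde p)) ↔ x ∈ AQp Z
      rw [Algebra.mem_bot]
      exact ⟨fun ⟨y, hy⟩ => hy ▸ y.2, fun h => ⟨⟨x, h⟩, rfl⟩⟩
    rw [this]
    exact isCohenSubring_AQp Z
  | insert x F _ ih =>
    have ihC := ih fun y hy => hF y (Finset.mem_insert_of_mem hy)
    set C := (Algebra.adjoin (AQp Z) (F : Set (ATilde p))).toSubring with hCdef
    obtain ⟨f, hf, hfx, hfx'⟩ := hF x (Finset.mem_insert_self _ _)
    have hmem : ∀ a : AQp Z, (a : ATilde p) ∈ C := fun a =>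
      Subalgebra.algebraMap_mem (Algebra.adjoin (AQp Z) (F : Set (ATilde p))) a
    let φ : AQp Z →+* C := (algebraMap (AQp Z) (ATilde p)).codRestrict C hmem
    have hφ : (algebraMap C (ATilde p)).comp φ = algebraMap (AQp Z) (ATilde p) := rfl
    have haev : ∀ g : Polynomial (AQp Z),
        Polynomial.aeval x (g.map φ) = Polynomial.aeval x g := fun g => by
      rw [Polynomial.aeval_def, Polynomial.aeval_def, Polynomial.eval₂_map, hφ]
    have h1 := ihC.adjoin (x := x) p_prime_ATilde (hf.map φ) (by rw [haev, hfx])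
      (by rw [Polynomial.derivative_map, haev]; exact hfx')
    have h2 : (Algebra.adjoin C {x}).toSubring =
        (Algebra.adjoin (AQp Z) ((insert x F : Finset (ATilde p)) : Set (ATilde p))).toSubring := by
      apply le_antisymm
      · intro y hy
        change y ∈ Algebra.adjoin C {x} at hy
        change y ∈ Algebra.adjoin (AQp Z) ((insert x F : Finset (ATilde p)) : Set (ATilde p))
        induction hy using Algebra.adjoin_induction with
        | mem y hy => exact Algebra.subset_adjoin (by rw [hy]; simp)
        | algebraMap c =>
          exact Algebra.adjoin_mono (by simp) c.2
        | add a b _ _ ha hb => exact add_mem ha hb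
        | mul a b _ _ ha hb => exact mul_mem ha hb
      · intro y hy
        change y ∈ Algebra.adjoin (AQp Z) ((insert x F : Finset (ATilde p)) : Set (ATilde p)) at hy
        change y ∈ Algebra.adjoin C {x}
        induction hy using Algebra.adjoin_induction with
        | mem y hy =>
          rw [Finset.coe_insert] at hy
          rcases hy with rfl | hy
          · exact self_mem_adjoin y
          · exact coe_mem_subalgebra _ (Algebra.subset_adjoin hy)
        | algebraMap c => exact coe_mem_subalgebra _ (hmem c)
        | add a b _ _ ha hb => exact add_mem ha hb
        | mul a b _ _ ha hb => exact mul_mem ha hb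
    rw [← h2]
    exact h1

variable (K : IntermediateField ℚ_[p] (PadicAlgCl p))

/-- `A_K / p` injects into `W(ℂ^♭) / p`. -/
theorem mem_AK_of_p_mul_mem {x : ATilde p} (hx : (p : ATilde p) * x ∈ AK Z K) : x ∈ AK Z K := by
  classical
  have key : ∀ y ∈ AK Z K, ∃ F : Finset (ATilde p), (F : Set (ATilde p)) ⊆ {x | x.coeff 0 ∈ EK K ∧
      ∃ f : Polynomial (AQp Z), f.Monic ∧ Polynomial.aeval x f = 0 ∧
        IsUnit (Polynomial.aeval x (Polynomial.derivative f))} ∧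
      y ∈ Algebra.adjoin (AQp Z) (F : Set (ATilde p)) := by
    intro y hy
    induction hy using Algebra.adjoin_induction with
    | mem y hy => exact ⟨{y}, by simpa using hy, Algebra.subset_adjoin (by simp)⟩
    | algebraMap c => exact ⟨∅, by simp, Subalgebra.algebraMap_mem _ c⟩
    | add a b _ _ ha hb =>
      obtain ⟨F, hF, ha⟩ := ha
      obtain ⟨G, hG, hb⟩ := hb
      exact ⟨F ∪ G, by rw [Finset.coe_union]; exact Set.union_subset hF hG,
        add_mem (Algebra.adjoin_mono (by simp) ha) (Algebra.adjoin_mono (by simp) hb)⟩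
    | mul a b _ _ ha hb =>
      obtain ⟨F, hF, ha⟩ := ha
      obtain ⟨G, hG, hb⟩ := hb
      exact ⟨F ∪ G, by rw [Finset.coe_union]; exact Set.union_subset hF hG,
        mul_mem (Algebra.adjoin_mono (by simp) ha) (Algebra.adjoin_mono (by simp) hb)⟩
  obtain ⟨F, hF, hxF⟩ := key _ hx
  exact Algebra.adjoin_mono hF
    ((isCohenSubring_adjoin_finset Z F fun y hy => (hF hy).2).mem_of_mul_mem x hxF)

theorem emb_mem_AK {y : AInf p} (hy : y ∈ AQpPlus Z) : emb p y ∈ AK Z K :=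
  Subalgebra.algebraMap_mem (AK Z K) (⟨_, emb_mem_AQp Z hy⟩ : AQp Z)

theorem mem_AK_of_T_pow_mul_mem {x : ATilde p} {n : ℕ} (hx : emb p Z.T ^ n * x ∈ AK Z K) :
    x ∈ AK Z K := by
  obtain ⟨t, ht⟩ := (isUnit_emb_T Z).exists_right_inv
  have h : x = t ^ n * (emb p Z.T ^ n * x) := by
    rw [← mul_assoc, ← mul_pow, mul_comm t, ht, one_pow, one_mul]
  rw [h]
  exact mul_mem (pow_mem (Subalgebra.algebraMap_mem (AK Z K)
    (⟨_, mem_AQp_of_T_mul_eq_one Z ht⟩ : AQp Z)) _) hx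

end AKRing

/-! ### The field of norms -/

section FieldOfNorms

variable {p : ℕ} [Fact p.Prime] (K : IntermediateField ℚ_[p] (PadicAlgCl p))

theorem norm_add_pow_le {a b : ℂ_[p]} {c : ℝ} (ha : ‖a‖ ^ p ≤ c) (hb : ‖b‖ ^ p ≤ c) :
    ‖a + b‖ ^ p ≤ c := by
  rcases le_max_iff.1 (IsUltrametricDist.norm_add_le_max a b) with h | h
  · exact (pow_le_pow_left₀ (norm_nonneg _) h _).trans ha
  · exact (pow_le_pow_left₀ (norm_nonneg _) h _).trans hb

theorem inv_p_lt_one : (1 : ℝ) / p < 1 := by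
  have hp : (1 : ℝ) < p := by exact_mod_cast (Fact.out : p.Prime).one_lt
  rw [div_lt_one (by linarith)]
  exact hp

theorem lt_one_of_pow_le {a : ℝ} (h : a ^ p ≤ 1 / (p : ℝ)) : a < 1 := by
  by_contra hc
  exact absurd (one_le_pow₀ (not_lt.1 hc)) (not_le.2 (h.trans_lt inv_p_lt_one))

/-- The elements of `𝓞_ℂ / p` which are congruent to an element of `K_n` modulo the ideal of
elements of valuation at least `1 / p`. -/
def layerModP (n : ℕ) : Subring (ModP 𝓞_ℂ_[p] p) where
  carrier := {a | ∃ y ∈ cycloLayer K n, ∃ z : 𝓞_ℂ_[p], Ideal.Quotient.mk _ z = a ∧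
    ‖(z : ℂ_[p]) - ((y : PadicAlgCl p) : ℂ_[p])‖ ^ p ≤ 1 / (p : ℝ)}
  zero_mem' := ⟨0, zero_mem _, 0, map_zero _, by
    have : ((0 : PadicAlgCl p) : ℂ_[p]) = 0 := map_zero (algebraMap (PadicAlgCl p) ℂ_[p])
    rw [this]
    simp [(Fact.out : p.Prime).ne_zero]⟩
  one_mem' := ⟨1, one_mem _, 1, map_one _, by
    have : ((1 : PadicAlgCl p) : ℂ_[p]) = 1 := map_one (algebraMap (PadicAlgCl p) ℂ_[p])
    rw [this]
    simp [(Fact.out : p.Prime).ne_zero]⟩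
  add_mem' := by
    rintro _ _ ⟨y, hy, z, rfl, h⟩ ⟨y', hy', z', rfl, h'⟩
    refine ⟨y + y', add_mem hy hy', z + z', map_add _ _ _, ?_⟩
    have : ((y + y' : PadicAlgCl p) : ℂ_[p]) = y + y' :=
      map_add (algebraMap (PadicAlgCl p) ℂ_[p]) _ _
    rw [this, Subring.coe_add, add_sub_add_comm]
    exact norm_add_pow_le h h'
  neg_mem' := by
    rintro _ ⟨y, hy, z, rfl, h⟩
    refine ⟨-y, neg_mem hy, -z, map_neg _ _, ?_⟩
    have : ((-y : PadicAlgCl p) : ℂ_[p]) = -y := map_neg (algebraMap (PadicAlgCl p) ℂ_[p]) _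
    rw [this, Subring.coe_neg, neg_sub_neg, norm_sub_rev]
    exact h
  mul_mem' := by
    rintro _ _ ⟨y, hy, z, rfl, h⟩ ⟨y', hy', z', rfl, h'⟩
    refine ⟨y * y', mul_mem hy hy', z * z', map_mul _ _ _, ?_⟩
    have e : ((y * y' : PadicAlgCl p) : ℂ_[p]) = y * y' :=
      map_mul (algebraMap (PadicAlgCl p) ℂ_[p]) _ _
    have hz := (mem_int_iff _).1 z.2
    have hy' : ‖(y' : ℂ_[p])‖ ≤ 1 := by
      have h1 : (y' : ℂ_[p]) = z' + -((z' : ℂ_[p]) - y') := by ring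
      rw [h1]
      refine (IsUltrametricDist.norm_add_le_max _ _).trans (max_le ((mem_int_iff _).1 z'.2) ?_)
      rw [norm_neg]
      exact (lt_one_of_pow_le h').le
    have e2 : (z : ℂ_[p]) * z' - y * y' = z * (z' - y') + (z - y) * y' := by ring
    rw [e, Subring.coe_mul, e2]
    refine norm_add_pow_le ?_ ?_
    · rw [norm_mul]
      exact (pow_le_pow_left₀ (by positivity)
        (mul_le_of_le_one_left (norm_nonneg _) hz) _).trans h'
    · rw [norm_mul]
      exact (pow_le_pow_left₀ (by positivity)
        (mul_le_of_le_one_right (norm_nonneg _) hy') _).trans h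

theorem mem_EKplus_iff {x : OFlat p} :
    x ∈ EKplus K ↔ ∃ n₀ : ℕ, ∀ n, n₀ ≤ n → PreTilt.coeff n x ∈ layerModP K n := Iff.rfl

theorem EKplus_add_mem {x y : OFlat p} (hx : x ∈ EKplus K) (hy : y ∈ EKplus K) :
    x + y ∈ EKplus K := by
  rw [mem_EKplus_iff] at *
  obtain ⟨a, ha⟩ := hx
  obtain ⟨b, hb⟩ := hy
  exact ⟨max a b, fun n hn => by
    rw [map_add]
    exact add_mem (ha n ((le_max_left _ _).trans hn)) (hb n ((le_max_right _ _).trans hn))⟩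

theorem EKplus_mul_mem {x y : OFlat p} (hx : x ∈ EKplus K) (hy : y ∈ EKplus K) :
    x * y ∈ EKplus K := by
  rw [mem_EKplus_iff] at *
  obtain ⟨a, ha⟩ := hx
  obtain ⟨b, hb⟩ := hy
  exact ⟨max a b, fun n hn => by
    rw [map_mul]
    exact mul_mem (ha n ((le_max_left _ _).trans hn)) (hb n ((le_max_right _ _).trans hn))⟩

theorem EK_add_mem {x y : CFlat p} (hx : x ∈ EK K) (hy : y ∈ EK K) : x + y ∈ EK K := by
  obtain ⟨a, ha, b, hb, hb0, h⟩ := hx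
  obtain ⟨a', ha', b', hb', hb0', h'⟩ := hy
  refine ⟨a * b' + a' * b, EKplus_add_mem K (EKplus_mul_mem K ha hb') (EKplus_mul_mem K ha' hb),
    b * b', EKplus_mul_mem K hb hb', mul_ne_zero hb0 hb0', ?_⟩
  rw [map_mul, map_add, map_mul, map_mul, ← h, ← h']
  ring

theorem EK_mul_mem {x y : CFlat p} (hx : x ∈ EK K) (hy : y ∈ EK K) : x * y ∈ EK K := by
  obtain ⟨a, ha, b, hb, hb0, h⟩ := hx
  obtain ⟨a', ha', b', hb', hb0', h'⟩ := hy
  refine ⟨a * a', EKplus_mul_mem K ha ha', b * b', EKplus_mul_mem K hb hb',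
    mul_ne_zero hb0 hb0', ?_⟩
  rw [map_mul, map_mul, ← h, ← h']
  ring

variable (Z : CycloSystem p)

theorem zeta_mem_cycloLayer (n : ℕ) : Z.ζ n ∈ cycloLayer K n :=
  (le_sup_right : _ ≤ cycloLayer K n) (IntermediateField.subset_adjoin _ _ (Z.pow_eq_one n))

theorem mk_zetaO_mem_layerModP (n : ℕ) :
    Ideal.Quotient.mk _ (Z.zetaO n) ∈ layerModP K n :=
  ⟨_, zeta_mem_cycloLayer K Z n, _, rfl, by
    change ‖((Z.ζ n : PadicAlgCl p) : ℂ_[p]) - ((Z.ζ n : PadicAlgCl p) : ℂ_[p])‖ ^ p ≤ _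
    rw [sub_self, norm_zero, zero_pow (Fact.out : p.Prime).ne_zero]
    positivity⟩

theorem coeff_varpi_mem_layerModP (n : ℕ) : PreTilt.coeff n Z.varpi ∈ layerModP K n := by
  rw [coeff_varpi, map_sub, map_one]
  exact sub_mem (mk_zetaO_mem_layerModP K Z n) (one_mem _)

theorem coeff_zero_mem_EKplus {y : AInf p} (hy : y ∈ AQpPlus Z) : y.coeff 0 ∈ EKplus K := by
  rw [mem_EKplus_iff]
  refine ⟨0, fun n _ => ?_⟩
  obtain ⟨q, hq, u, hu⟩ := hy (p ^ n)
  have h1 : PreTilt.coeff n (y.coeff 0) = PreTilt.coeff n (q.coeff 0) := by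
    rw [← sub_eq_zero, ← map_sub, ← coeff_zero_sub', hu, coeff_zero_mul', coeff_zero_pow',
      coeff_zero_T, map_mul, coeff_varpi_pow, zero_mul]
  rw [h1]
  clear h1 hu
  induction hq using Algebra.adjoin_induction with
  | mem q hq =>
    rw [Set.mem_singleton_iff.1 hq, coeff_zero_T]
    exact coeff_varpi_mem_layerModP K Z n
  | algebraMap c =>
    obtain ⟨m, _, hm⟩ := PadicInt.exists_mem_range c
    rw [PadicInt.maximalIdeal_eq_span_p, Ideal.mem_span_singleton] at hm
    obtain ⟨c', hc'⟩ := hm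
    have : (p : AInf p) ∣ algebraMap ℤ_[p] (AInf p) c - (m : AInf p) :=
      ⟨algebraMap ℤ_[p] (AInf p) c', by
        rw [← map_natCast (algebraMap ℤ_[p] (AInf p)) m, ← map_sub, hc', map_mul, map_natCast]⟩
    rw [witt_p_dvd_iff, coeff_zero_sub', sub_eq_zero] at this
    rw [this, show (m : AInf p).coeff 0 = (m : OFlat p) from
      map_natCast (WittVector.constantCoeff : AInf p →+* OFlat p) m, map_natCast]
    exact natCast_mem _ _
  | add a b _ _ ha hb => rw [coeff_zero_add', map_add]; exact add_mem ha hb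
  | mul a b _ _ ha hb => rw [coeff_zero_mul', map_mul]; exact mul_mem ha hb

/-- The reduction of `A_K` modulo `p` is contained in `E_K`. -/
theorem coeff_zero_mem_EK {x : ATilde p} (hx : x ∈ AK Z K) : x.coeff 0 ∈ EK K := by
  induction hx using Algebra.adjoin_induction with
  | mem x hx => exact hx.1
  | algebraMap x =>
    obtain ⟨x, hx⟩ := x
    change x.coeff 0 ∈ EK K
    obtain ⟨m, y, hy, hu⟩ := hx 1
    refine ⟨y.coeff 0, coeff_zero_mem_EKplus K Z hy, Z.varpi ^ m, ?_,
      pow_ne_zero _ (varpi_ne_zero Z), ?_⟩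
    · rw [← coeff_zero_T, ← coeff_zero_pow']
      exact coeff_zero_mem_EKplus K Z (pow_mem (T_mem_AQpPlus Z) m)
    · rw [pow_one, witt_p_dvd_iff, coeff_zero_sub', coeff_zero_mul', coeff_zero_pow',
        sub_eq_zero] at hu
      rw [map_pow, mul_comm, ← coeff_zero_T]
      exact hu
  | add a b _ _ ha hb => rw [coeff_zero_add']; exact EK_add_mem K ha hb
  | mul a b _ _ ha hb => rw [coeff_zero_mul']; exact EK_mul_mem K ha hb

end FieldOfNorms

/-! ### Congruences modulo `p` in `𝓞_ℂ` -/

section Divisibility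

variable {p : ℕ} [Fact p.Prime]

theorem p_dvd_int_iff {x : 𝓞_ℂ_[p]} : (p : 𝓞_ℂ_[p]) ∣ x ↔ ‖(x : ℂ_[p])‖ ≤ (p : ℝ)⁻¹ := by
  have hp : ‖((p : 𝓞_ℂ_[p]) : ℂ_[p])‖ = (p : ℝ)⁻¹ := by
    rw [← norm_padicAlgCl_p, ← PadicComplex.norm_extends]
    congr 1
    exact (map_natCast (algebraMap (PadicAlgCl p) ℂ_[p]) p).symm
  have hp0 : (0 : ℝ) < (p : ℝ)⁻¹ := inv_pos.2 (by exact_mod_cast (Fact.out : p.Prime).pos)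
  constructor
  · rintro ⟨y, rfl⟩
    rw [Subring.coe_mul, norm_mul, hp]
    exact mul_le_of_le_one_right hp0.le ((mem_int_iff _).1 y.2)
  · intro h
    have hne : ((p : 𝓞_ℂ_[p]) : ℂ_[p]) ≠ 0 := by
      rw [← norm_pos_iff, hp]; exact hp0
    refine ⟨⟨(x : ℂ_[p]) / ((p : 𝓞_ℂ_[p]) : ℂ_[p]), ?_⟩, Subtype.ext ?_⟩
    · rw [mem_int_iff, norm_div, hp, div_le_one hp0]
      exact h
    · rw [Subring.coe_mul]
      field_simp

theorem mk_eq_mk_int_iff {x y : 𝓞_ℂ_[p]} :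
    (Ideal.Quotient.mk _ x : ModP 𝓞_ℂ_[p] p) = Ideal.Quotient.mk _ y ↔
      ‖(x : ℂ_[p]) - y‖ ≤ (p : ℝ)⁻¹ := by
  rw [Ideal.Quotient.mk_eq_mk_iff_sub_mem, Ideal.mem_span_singleton, p_dvd_int_iff]
  rfl

end Divisibility

/-! ### Residues of elements of the cyclotomic tower -/

section Layers

variable {p : ℕ} [Fact p.Prime] (Z : CycloSystem p)

/-- The ring `ℤ_p[ζ]`, where `ζ` is a primitive `p^n`-th root of unity, inside `ℚ̄_p`. -/
def zetaRing (n : ℕ) : Subring (PadicAlgCl p) :=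
  (Polynomial.eval₂RingHom ((algebraMap ℚ_[p] (PadicAlgCl p)).comp PadicInt.Coe.ringHom)
    (Z.ζ n - 1)).range

theorem coe_mem_zetaRing (n : ℕ) (c : ℤ_[p]) :
    algebraMap ℚ_[p] (PadicAlgCl p) c ∈ zetaRing Z n :=
  ⟨Polynomial.C c, by rw [Polynomial.coe_eval₂RingHom, Polynomial.eval₂_C]; rfl⟩

theorem zeta_sub_one_mem_zetaRing (n : ℕ) : Z.ζ n - 1 ∈ zetaRing Z n :=
  ⟨Polynomial.X, by rw [Polynomial.coe_eval₂RingHom, Polynomial.eval₂_X]⟩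

theorem exists_eq_add_mul_of_mem_zetaRing {n : ℕ} {s : PadicAlgCl p} (hs : s ∈ zetaRing Z n) :
    ∃ c : ℤ_[p], ∃ s' ∈ zetaRing Z n,
      s = algebraMap ℚ_[p] (PadicAlgCl p) c + (Z.ζ n - 1) * s' := by
  obtain ⟨f, rfl⟩ := hs
  refine ⟨f.coeff 0, _, ⟨f.divX, rfl⟩, ?_⟩
  conv_lhs => rw [← Polynomial.X_mul_divX_add f]
  simp only [Polynomial.coe_eval₂RingHom, Polynomial.eval₂_add, Polynomial.eval₂_mul,
    Polynomial.eval₂_X, Polynomial.eval₂_C]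
  rw [add_comm]
  rfl

/-- `p` is divisible by `ζ - 1`, because `Φ(1) = p` and `Φ(ζ) = 0` for the cyclotomic
polynomial `Φ`. -/
theorem exists_p_eq_mul (n : ℕ) :
    ∃ s ∈ zetaRing Z (n + 1), (p : PadicAlgCl p) = (Z.ζ (n + 1) - 1) * s := by
  set f : Polynomial ℤ_[p] :=
    (Polynomial.cyclotomic (p ^ (n + 1)) ℤ_[p]).comp (Polynomial.X + 1) with hf
  have h0 : f.coeff 0 = p := by
    rw [Polynomial.coeff_zero_eq_eval_zero, hf, Polynomial.eval_comp]
    simp [Polynomial.eval_one_cyclotomic_prime_pow]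
  set ι := (algebraMap ℚ_[p] (PadicAlgCl p)).comp PadicInt.Coe.ringHom with hι
  have h1 : Polynomial.eval₂ ι (Z.ζ (n + 1) - 1) f = 0 := by
    rw [hf, Polynomial.eval₂_comp, Polynomial.eval₂_add, Polynomial.eval₂_X, Polynomial.eval₂_one,
      sub_add_cancel, ← Polynomial.eval_map, Polynomial.map_cyclotomic]
    exact (Z.isPrimitiveRoot (n + 1)).isRoot_cyclotomic (pow_pos (Fact.out : p.Prime).pos _)
  refine ⟨_, neg_mem ⟨f.divX, rfl⟩, ?_⟩
  rw [← Polynomial.X_mul_divX_add f, Polynomial.eval₂_add, Polynomial.eval₂_mul,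
    Polynomial.eval₂_X, Polynomial.eval₂_C, h0, map_natCast] at h1
  rw [Polynomial.coe_eval₂RingHom]
  linear_combination h1

theorem exists_natCast_add_mul {n : ℕ} {s : PadicAlgCl p} (hs : s ∈ zetaRing Z (n + 1)) :
    ∃ m < p, ∃ s' ∈ zetaRing Z (n + 1), s = m + (Z.ζ (n + 1) - 1) * s' := by
  obtain ⟨c, s', hs', rfl⟩ := exists_eq_add_mul_of_mem_zetaRing Z hs
  obtain ⟨m, hm, hc⟩ := PadicInt.exists_mem_range c
  rw [PadicInt.maximalIdeal_eq_span_p, Ideal.mem_span_singleton] at hc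
  obtain ⟨c', hc'⟩ := hc
  obtain ⟨s₀, hs₀, h0⟩ := exists_p_eq_mul Z n
  refine ⟨m, hm, s₀ * algebraMap ℚ_[p] (PadicAlgCl p) c' + s',
    add_mem (mul_mem hs₀ (coe_mem_zetaRing Z _ c')) hs', ?_⟩
  have h1 : c = m + p * c' := by rw [← hc']; ring
  have h2 : ((m + p * c' : ℤ_[p]) : ℚ_[p]) = m + p * (c' : ℚ_[p]) := by push_cast; rfl
  rw [h1, h2, map_add, map_mul, map_natCast, map_natCast]
  linear_combination algebraMap ℚ_[p] (PadicAlgCl p) c' * h0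

theorem norm_zeta_sub_one_le_one (n : ℕ) : ‖Z.ζ n - 1‖ ≤ 1 := by
  rw [← norm_zetaO_sub_one]
  exact (mem_int_iff _).1 (Z.zetaO n - 1).2

theorem norm_le_one_of_mem_zetaRing {n : ℕ} {s : PadicAlgCl p} (hs : s ∈ zetaRing Z n) :
    ‖s‖ ≤ 1 := by
  obtain ⟨f, rfl⟩ := hs
  rw [Polynomial.coe_eval₂RingHom]
  induction f using Polynomial.induction_on' with
  | add f g hf hg =>
    rw [Polynomial.eval₂_add]
    exact (IsUltrametricDist.norm_add_le_max _ _).trans (max_le hf hg)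
  | monomial k c =>
    rw [Polynomial.eval₂_monomial, norm_mul, norm_pow]
    refine mul_le_one₀ ?_ (by positivity) (pow_le_one₀ (norm_nonneg _) (norm_zeta_sub_one_le_one Z n))
    exact (PadicAlgCl.norm_extends p (c : ℚ_[p])).trans_le (PadicInt.norm_le_one c)

theorem exists_pow_mul_mem_zetaRing {n : ℕ} {x : PadicAlgCl p}
    (hx : x ∈ IntermediateField.adjoin ℚ_[p] {z : PadicAlgCl p | z ^ (p ^ n) = 1}) :
    ∃ k : ℕ, (p : PadicAlgCl p) ^ k * x ∈ zetaRing Z n := by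
  rw [← IntermediateField.mem_toSubalgebra,
    IntermediateField.adjoin_toSubalgebra_of_isAlgebraic fun z _ =>
      Algebra.IsAlgebraic.isAlgebraic z] at hx
  have hζ : Z.ζ n ∈ zetaRing Z n := by
    have := add_mem (zeta_sub_one_mem_zetaRing Z n) (one_mem (zetaRing Z n))
    rwa [sub_add_cancel] at this
  induction hx using Algebra.adjoin_induction with
  | mem z hz =>
    obtain ⟨i, _, hi⟩ := (Z.isPrimitiveRoot n).eq_pow_of_pow_eq_one hz
    exact ⟨0, by rw [pow_zero, one_mul, ← hi]; exact pow_mem hζ _⟩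
  | algebraMap q =>
    obtain ⟨⟨a, b⟩, hab⟩ := IsLocalization.surj (nonZeroDivisors ℤ_[p]) q
    have hb : (b : ℤ_[p]) ≠ 0 := nonZeroDivisors.ne_zero b.2
    refine ⟨(b : ℤ_[p]).valuation, ?_⟩
    have h1 := PadicInt.unitCoeff_spec hb
    have hu : (((PadicInt.unitCoeff hb)⁻¹ : ℤ_[p]ˣ) : ℤ_[p]) * (PadicInt.unitCoeff hb) = 1 := by simp
    have h2 : (p : ℚ_[p]) ^ (b : ℤ_[p]).valuation * q =
        (((((PadicInt.unitCoeff hb)⁻¹ : ℤ_[p]ˣ) : ℤ_[p]) * a : ℤ_[p]) : ℚ_[p]) := by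
      have h3 : q * ((b : ℤ_[p]) : ℚ_[p]) = (a : ℚ_[p]) := hab
      rw [h1] at h3
      have hu' := congrArg (fun x : ℤ_[p] => (x : ℚ_[p])) hu
      push_cast at h3 hu' ⊢
      rw [← h3]
      linear_combination -((p : ℚ_[p]) ^ (b : ℤ_[p]).valuation * q) * hu'
    have h4 := coe_mem_zetaRing Z n ((((PadicInt.unitCoeff hb)⁻¹ : ℤ_[p]ˣ) : ℤ_[p]) * a)
    rw [← h2, map_mul, map_pow, map_natCast] at h4
    exact h4
  | add a b _ _ ha hb =>
    obtain ⟨k, hk⟩ := ha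
    obtain ⟨l, hl⟩ := hb
    refine ⟨k + l, ?_⟩
    have hp : (p : PadicAlgCl p) ∈ zetaRing Z n := natCast_mem _ p
    have : (p : PadicAlgCl p) ^ (k + l) * (a + b) =
        p ^ l * (p ^ k * a) + p ^ k * (p ^ l * b) := by ring
    rw [this]
    exact add_mem (mul_mem (pow_mem hp _) hk) (mul_mem (pow_mem hp _) hl)
  | mul a b _ _ ha hb =>
    obtain ⟨k, hk⟩ := ha
    obtain ⟨l, hl⟩ := hb
    refine ⟨k + l, ?_⟩
    have : (p : PadicAlgCl p) ^ (k + l) * (a * b) = (p ^ k * a) * (p ^ l * b) := by ring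
    rw [this]
    exact mul_mem hk hl

/-- More than `[K : ℚ_p]` elements of `K_n` satisfy a linear relation over `ℚ_p(ζ)`. -/
theorem exists_relation_cycloLayer (K : IntermediateField ℚ_[p] (PadicAlgCl p))
    [FiniteDimensional ℚ_[p] K] (n : ℕ)
    {y : Fin (Module.finrank ℚ_[p] K + 1) → PadicAlgCl p} (hy : ∀ i, y i ∈ cycloLayer K n) :
    ∃ c : Fin (Module.finrank ℚ_[p] K + 1) → PadicAlgCl p,
      (∀ i, c i ∈ IntermediateField.adjoin ℚ_[p] {z : PadicAlgCl p | z ^ (p ^ n) = 1}) ∧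
      (∃ i, c i ≠ 0) ∧ ∑ i, c i * y i = 0 := by
  classical
  set L := IntermediateField.adjoin ℚ_[p] {z : PadicAlgCl p | z ^ (p ^ n) = 1} with hL
  have hfinset : {z : PadicAlgCl p | z ^ (p ^ n) = 1}.Finite := by
    refine Set.Finite.subset ((Polynomial.nthRoots (p ^ n) (1 : PadicAlgCl p)).toFinset.finite_toSet)
      fun z hz => ?_
    rw [Finset.mem_coe, Multiset.mem_toFinset,
      Polynomial.mem_nthRoots (pow_pos (Fact.out : p.Prime).pos _)]
    exact hz
  have : FiniteDimensional ℚ_[p] L :=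
    have := hfinset.to_subtype
    IntermediateField.finiteDimensional_adjoin fun z _ => Algebra.IsIntegral.isIntegral z
  have hLM : L ≤ cycloLayer K n := le_sup_right
  set M := IntermediateField.extendScalars hLM with hM
  have hfinM : FiniteDimensional ℚ_[p] (cycloLayer K n) :=
    inferInstanceAs (FiniteDimensional ℚ_[p] ↥(K ⊔ L))
  have hfinM' : FiniteDimensional ℚ_[p] M := hfinM
  have : FiniteDimensional L M := FiniteDimensional.right ℚ_[p] L M
  have hrank : Module.finrank L M ≤ Module.finrank ℚ_[p] K := by
    have h1 := IntermediateField.finrank_sup_le K L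
    have h2 : Module.finrank ℚ_[p] L * Module.finrank L M = Module.finrank ℚ_[p] ↥(K ⊔ L) :=
      Module.finrank_mul_finrank ℚ_[p] L M
    rw [← h2, mul_comm] at h1
    exact Nat.le_of_mul_le_mul_right h1 Module.finrank_pos
  let y' : Fin (Module.finrank ℚ_[p] K + 1) → M := fun i => ⟨y i, hy i⟩
  have hdep : ¬ LinearIndependent L y' := by
    intro hli
    have := hli.fintype_card_le_finrank
    rw [Fintype.card_fin] at this
    omega
  rw [Fintype.not_linearIndependent_iff] at hdep
  obtain ⟨g, hg, i, hi⟩ := hdep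
  refine ⟨fun i => g i, fun i => (g i).2, ⟨i, fun h => hi (Subtype.ext h)⟩, ?_⟩
  have := congrArg (algebraMap M (PadicAlgCl p)) hg
  rw [map_sum, map_zero] at this
  exact this

/-- More than `[K : ℚ_p]` elements of `K_n` satisfy a linear relation over `ℤ_p[ζ]`, which is
nontrivial modulo `ζ - 1`. -/
theorem exists_relation_zetaRing (K : IntermediateField ℚ_[p] (PadicAlgCl p))
    [FiniteDimensional ℚ_[p] K] (n : ℕ)
    {y : Fin (Module.finrank ℚ_[p] K + 1) → PadicAlgCl p} (hy : ∀ i, y i ∈ cycloLayer K (n + 1)) :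
    ∃ (m : Fin (Module.finrank ℚ_[p] K + 1) → ℕ)
      (s : Fin (Module.finrank ℚ_[p] K + 1) → PadicAlgCl p),
      (∀ i, s i ∈ zetaRing Z (n + 1)) ∧ (∃ i, ¬ p ∣ m i) ∧
        ∑ i, (m i + (Z.ζ (n + 1) - 1) * s i) * y i = 0 := by
  obtain ⟨c, hc, hc0, hcy⟩ := exists_relation_cycloLayer K (n + 1) hy
  choose k hk using fun i => exists_pow_mul_mem_zetaRing Z (hc i)
  have hp0 : (p : PadicAlgCl p) ≠ 0 := by exact_mod_cast (Fact.out : p.Prime).ne_zero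
  have hπ := norm_zeta_sub_one_lt_one (Z.isPrimitiveRoot (n + 1))
  have hπ0 : 0 < ‖Z.ζ (n + 1) - 1‖ := by
    rw [norm_pos_iff]
    intro h
    obtain ⟨s, _, hs⟩ := exists_p_eq_mul Z n
    exact hp0 (by rw [hs, h, zero_mul])
  have key : ∀ N : ℕ, ∀ s : Fin (Module.finrank ℚ_[p] K + 1) → PadicAlgCl p,
      (∀ i, s i ∈ zetaRing Z (n + 1)) → (∃ i, ‖Z.ζ (n + 1) - 1‖ ^ N < ‖s i‖) →
      ∑ i, s i * y i = 0 →
      ∃ (m : Fin (Module.finrank ℚ_[p] K + 1) → ℕ)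
        (s : Fin (Module.finrank ℚ_[p] K + 1) → PadicAlgCl p),
        (∀ i, s i ∈ zetaRing Z (n + 1)) ∧ (∃ i, ¬ p ∣ m i) ∧
          ∑ i, (m i + (Z.ζ (n + 1) - 1) * s i) * y i = 0 := by
    intro N
    induction N with
    | zero =>
      rintro s hs ⟨i, hi⟩ _
      rw [pow_zero] at hi
      exact absurd (norm_le_one_of_mem_zetaRing Z (hs i)) (not_le.2 hi)
    | succ N ih =>
      rintro s hs ⟨i, hi⟩ hsy
      choose m hm s' hs' hms using fun i => exists_natCast_add_mul Z (hs i)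
      by_cases hall : ∀ i, p ∣ m i
      · have hm0 : ∀ i, m i = 0 := fun i => Nat.eq_zero_of_dvd_of_lt (hall i) (hm i)
        have hss : ∀ i, s i = (Z.ζ (n + 1) - 1) * s' i := fun i => by
          rw [hms i, hm0 i, Nat.cast_zero, zero_add]
        refine ih s' hs' ⟨i, ?_⟩ ?_
        · rw [hss, norm_mul, pow_succ'] at hi
          exact lt_of_mul_lt_mul_left hi hπ0.le
        · have : (Z.ζ (n + 1) - 1) * ∑ i, s' i * y i = 0 := by
            rw [Finset.mul_sum, ← hsy]
            exact Finset.sum_congr rfl fun i _ => by rw [hss]; ring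
          exact (mul_eq_zero.1 this).resolve_left (norm_pos_iff.1 hπ0)
      · push Not at hall
        exact ⟨m, s', hs', hall, by
          rw [← hsy]; exact Finset.sum_congr rfl fun i _ => by rw [← hms i]⟩
  obtain ⟨i, hi⟩ := hc0
  have hpos : 0 < ‖(p : PadicAlgCl p) ^ (∑ j, k j) * c i‖ :=
    norm_pos_iff.2 (mul_ne_zero (pow_ne_zero _ hp0) hi)
  obtain ⟨N, hN⟩ := exists_pow_lt_of_lt_one hpos hπ
  refine key N (fun i => (p : PadicAlgCl p) ^ (∑ j, k j) * c i) (fun i => ?_) ⟨i, hN⟩ ?_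
  · rw [← Finset.sum_erase_add _ _ (Finset.mem_univ i), pow_add, mul_assoc]
    exact mul_mem (pow_mem (natCast_mem _ p) _) (hk i)
  · have : ∑ i, (p : PadicAlgCl p) ^ (∑ j, k j) * c i * y i =
        (p : PadicAlgCl p) ^ (∑ j, k j) * ∑ i, c i * y i := by
      rw [Finset.mul_sum]
      exact Finset.sum_congr rfl fun i _ => by ring
    rw [this, hcy, mul_zero]

/-- Among more than `[K : ℚ_p]` elements of `𝓞_{K_n}` there is a nontrivial linear relation over
`𝔽_p` modulo `ζ - 1`. -/
theorem exists_norm_sum_le (K : IntermediateField ℚ_[p] (PadicAlgCl p))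
    [FiniteDimensional ℚ_[p] K] (n : ℕ)
    {y : Fin (Module.finrank ℚ_[p] K + 1) → PadicAlgCl p} (hy : ∀ i, y i ∈ cycloLayer K (n + 1))
    (hy1 : ∀ i, ‖y i‖ ≤ 1) :
    ∃ m : Fin (Module.finrank ℚ_[p] K + 1) → ℕ, (∃ i, ¬ p ∣ m i) ∧
      ‖∑ i, (m i : PadicAlgCl p) * y i‖ ≤ ‖Z.ζ (n + 1) - 1‖ := by
  obtain ⟨m, s, hs, hm, h⟩ := exists_relation_zetaRing Z K n hy
  refine ⟨m, hm, ?_⟩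
  have h1 : ∑ i, (m i : PadicAlgCl p) * y i = -((Z.ζ (n + 1) - 1) * ∑ i, s i * y i) := by
    rw [← sub_eq_zero, sub_neg_eq_add, Finset.mul_sum, ← Finset.sum_add_distrib, ← h]
    exact Finset.sum_congr rfl fun i _ => by ring
  rw [h1, norm_neg, norm_mul]
  refine mul_le_of_le_one_right (norm_nonneg _) ?_
  refine IsUltrametricDist.norm_sum_le_of_forall_le_of_nonneg zero_le_one fun i _ => ?_
  rw [norm_mul]
  exact mul_le_one₀ (norm_le_one_of_mem_zetaRing Z (hs i)) (norm_nonneg _) (hy1 i)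

end Layers

/-! ### Finiteness of the residues of the field of norms -/

section Residues

variable {p : ℕ} [Fact p.Prime] (Z : CycloSystem p)

theorem norm_sub_le_max {E : Type*} [SeminormedAddCommGroup E] [IsUltrametricDist E] (a b : E) :
    ‖a - b‖ ≤ max ‖a‖ ‖b‖ := by
  have h := IsUltrametricDist.norm_add_le_max a (-b)
  rwa [norm_neg, ← sub_eq_add_neg] at h

theorem inv_le_norm_zeta_sub_one_sq (n : ℕ) : (p : ℝ)⁻¹ ≤ ‖Z.ζ (n + 2) - 1‖ ^ 2 := by
  have hp := (Fact.out : p.Prime)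
  rw [← norm_zeta_sub_one_pow (Z.isPrimitiveRoot (n + 2))]
  refine pow_le_pow_of_le_one (norm_nonneg _) (norm_zeta_sub_one_le_one Z _) ?_
  rw [Nat.totient_prime_pow_succ hp, pow_succ, mul_assoc]
  calc 2 ≤ p := hp.two_le
    _ = 1 * (p * 1) := by ring
    _ ≤ _ := Nat.mul_le_mul (Nat.one_le_pow _ _ hp.pos)
      (Nat.mul_le_mul le_rfl (by have := hp.two_le; omega))

theorem norm_pow_sub_le_of_coeff {x : OFlat p} {n : ℕ} {z z' : 𝓞_ℂ_[p]}
    (hz : Ideal.Quotient.mk _ z = PreTilt.coeff n x)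
    (hz' : Ideal.Quotient.mk _ z' = PreTilt.coeff (n + 1) x) :
    ‖(z' : ℂ_[p]) ^ p - z‖ ≤ (p : ℝ)⁻¹ := by
  have h : (Ideal.Quotient.mk _ (z' ^ p) : ModP 𝓞_ℂ_[p] p) = Ideal.Quotient.mk _ z := by
    rw [map_pow, hz', hz, PreTilt.coeff_pow_p]
  exact mk_eq_mk_int_iff.1 h

theorem norm_zeta_pow_sub_le (n : ℕ) :
    ‖((Z.zetaO (n + 1) - 1 : 𝓞_ℂ_[p]) : ℂ_[p]) ^ p - ((Z.zetaO n - 1 : 𝓞_ℂ_[p]) : ℂ_[p])‖ ≤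
      (p : ℝ)⁻¹ :=
  norm_pow_sub_le_of_coeff (x := Z.varpi) (coeff_varpi Z n).symm (coeff_varpi Z (n + 1)).symm

theorem eq_of_coeff_add_eq {x y : OFlat p} (n : ℕ)
    (h : ∀ k, PreTilt.coeff (k + n) x = PreTilt.coeff (k + n) y) : x = y := by
  induction n with
  | zero => exact Perfection.ext h
  | succ n ih =>
    refine ih fun k => ?_
    rw [← PreTilt.coeff_pow_p, ← PreTilt.coeff_pow_p y, add_assoc, h]

/-- An element of `𝓞_ℂ^♭` of valuation at least the valuation of `ϖ` is divisible by `ϖ`. The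
`p`-th powers of the quotients of lifts to `𝓞_ℂ` are a compatible system modulo `p`. -/
theorem varpi_dvd_of_norm_le {x : OFlat p} {n : ℕ} {z : 𝓞_ℂ_[p]}
    (hz : Ideal.Quotient.mk _ z = PreTilt.coeff (n + 2) x)
    (hle : ‖(z : ℂ_[p])‖ ≤ ‖Z.ζ (n + 2) - 1‖) : Z.varpi ∣ x := by
  have hp := (Fact.out : p.Prime)
  choose l hl using fun m => Ideal.Quotient.mk_surjective (PreTilt.coeff m x)
  let π : ℕ → ℂ_[p] := fun m => ((Z.zetaO m - 1 : 𝓞_ℂ_[p]) : ℂ_[p])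
  have hπ : ∀ m, ‖π m‖ = ‖Z.ζ m - 1‖ := norm_zetaO_sub_one Z
  have hπlt : ∀ m, (p : ℝ)⁻¹ < ‖π (m + 2)‖ := fun m => by
    rw [hπ]; exact inv_lt_norm_zeta_sub_one (Z.isPrimitiveRoot (m + 2))
  have hp0 : (0 : ℝ) < (p : ℝ)⁻¹ := inv_pos.2 (by exact_mod_cast hp.pos)
  have hπ0 : ∀ m, π (m + 2) ≠ 0 := fun m => norm_pos_iff.1 (hp0.trans (hπlt m))
  have hl1 : ∀ k, ‖(l (n + k + 2) : ℂ_[p])‖ ≤ ‖π (n + k + 2)‖ := by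
    intro k
    induction k with
    | zero =>
      have h1 : ‖(l (n + 2) : ℂ_[p]) - z‖ ≤ (p : ℝ)⁻¹ := mk_eq_mk_int_iff.1 ((hl _).trans hz.symm)
      have h2 := IsUltrametricDist.norm_add_le_max ((l (n + 2) : ℂ_[p]) - z) z
      rw [sub_add_cancel] at h2
      exact h2.trans (max_le (h1.trans (hπlt n).le) (by rw [hπ]; exact hle))
    | succ k ih =>
      have h1 := norm_pow_sub_le_of_coeff (hl (n + k + 2)) (hl (n + k + 2 + 1))
      have h2 := norm_zeta_pow_sub_le Z (n + k + 2)
      have h3 := IsUltrametricDist.norm_add_le_max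
        ((l (n + k + 2 + 1) : ℂ_[p]) ^ p - l (n + k + 2)) (l (n + k + 2))
      rw [sub_add_cancel, norm_pow] at h3
      have h4 := norm_sub_le_max (π (n + k + 2 + 1) ^ p)
        (π (n + k + 2 + 1) ^ p - π (n + k + 2))
      rw [sub_sub_cancel, norm_pow] at h4
      have h5 : ‖π (n + k + 2)‖ ≤ ‖π (n + k + 2 + 1)‖ ^ p := by
        rcases le_max_iff.1 h4 with h | h
        · exact h
        · exact absurd (h.trans h2) (not_le.2 (hπlt _))
      have h6 : ‖(l (n + k + 2 + 1) : ℂ_[p])‖ ^ p ≤ ‖π (n + k + 2 + 1)‖ ^ p :=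
        (h3.trans (max_le (h1.trans (hπlt _).le) ih)).trans h5
      exact le_of_pow_le_pow_left₀ hp.ne_zero (norm_nonneg _) h6
  let q : ℕ → 𝓞_ℂ_[p] := fun k => ⟨(l (n + k + 2) : ℂ_[p]) / π (n + k + 2), by
    rw [mem_int_iff, norm_div]
    exact div_le_one_of_le₀ (hl1 k) (norm_nonneg _)⟩
  have hq : ∀ k, (q k : ℂ_[p]) * π (n + k + 2) = l (n + k + 2) := fun k =>
    div_mul_cancel₀ _ (hπ0 _)
  -- `q (k + 1) ^ p` and `q k` are congruent modulo `p / (ζ - 1)`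
  have hd : ∀ k, ‖((q (k + 1) : ℂ_[p]) ^ p - q k) * π (n + k + 2)‖ ≤ (p : ℝ)⁻¹ := by
    intro k
    have e : ((q (k + 1) : ℂ_[p]) ^ p - q k) * π (n + k + 2) =
        ((l (n + k + 2 + 1) : ℂ_[p]) ^ p - l (n + k + 2)) -
        (q (k + 1) : ℂ_[p]) ^ p * (π (n + k + 2 + 1) ^ p - π (n + k + 2)) := by
      have h1 := hq (k + 1)
      have h2 := hq k
      change (q (k + 1) : ℂ_[p]) * π (n + k + 2 + 1) = l (n + k + 2 + 1) at h1
      rw [← h1, ← h2]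
      ring
    rw [e]
    refine (norm_sub_le_max _ _).trans (max_le
      (norm_pow_sub_le_of_coeff (hl (n + k + 2)) (hl (n + k + 2 + 1))) ?_)
    rw [norm_mul, norm_pow]
    exact (mul_le_of_le_one_left (norm_nonneg _) (pow_le_one₀ (norm_nonneg _)
      ((mem_int_iff _).1 (q (k + 1)).2))).trans (norm_zeta_pow_sub_le Z (n + k + 2))
  have hcompat : ∀ k, (Ideal.Quotient.mk _ (q (k + 1) ^ p) : ModP 𝓞_ℂ_[p] p) ^ p =
      Ideal.Quotient.mk _ (q k) ^ p := by
    intro k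
    set d := q (k + 1) ^ p - q k with hddef
    have hdπ : ‖(d : ℂ_[p])‖ * ‖π (n + k + 2)‖ ≤ (p : ℝ)⁻¹ := by
      rw [← norm_mul]; exact hd k
    have hd1 : ‖(d : ℂ_[p])‖ ≤ 1 := (mem_int_iff _).1 d.2
    have hd2 : ‖(d : ℂ_[p])‖ ^ 2 ≤ (p : ℝ)⁻¹ := by
      have h1 := inv_le_norm_zeta_sub_one_sq Z (n + k)
      rw [← hπ] at h1
      have h2 : (‖(d : ℂ_[p])‖ * ‖π (n + k + 2)‖) ^ 2 ≤ (p : ℝ)⁻¹ ^ 2 :=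
        pow_le_pow_left₀ (by positivity) hdπ 2
      rw [mul_pow] at h2
      have h3 : ‖(d : ℂ_[p])‖ ^ 2 * (p : ℝ)⁻¹ ≤ (p : ℝ)⁻¹ * (p : ℝ)⁻¹ := by
        rw [← sq]
        exact (mul_le_mul_of_nonneg_left h1 (by positivity)).trans h2
      exact le_of_mul_le_mul_right h3 hp0
    have hdp : (Ideal.Quotient.mk _ d : ModP 𝓞_ℂ_[p] p) ^ p = 0 := by
      rw [← map_pow, ← map_zero (Ideal.Quotient.mk _), mk_eq_mk_int_iff]
      change ‖(d : ℂ_[p]) ^ p - 0‖ ≤ _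
      rw [sub_zero, norm_pow]
      exact (pow_le_pow_of_le_one (norm_nonneg _) hd1 hp.two_le).trans hd2
    have e : q (k + 1) ^ p = q k + d := by rw [hddef]; ring
    rw [e, map_add, add_pow_char, hdp, add_zero]
  let Q : OFlat p := ⟨fun k => (Ideal.Quotient.mk _ (q (k + 1)) : ModP 𝓞_ℂ_[p] p) ^ p, fun k => by
    have := hcompat (k + 1)
    rwa [map_pow] at this⟩
  have hQ : ∀ k, PreTilt.coeff k Q = (Ideal.Quotient.mk _ (q (k + 1)) : ModP 𝓞_ℂ_[p] p) ^ p :=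
    fun _ => rfl
  refine ⟨Q ^ p ^ (n + 2), eq_of_coeff_add_eq (n + 2) fun k => ?_⟩
  have h1 : PreTilt.coeff (k + (n + 2)) (Q ^ p ^ (n + 2)) = PreTilt.coeff k Q := by
    have := PreTilt.coeff_iterate_frobenius k (n + 2) Q
    rwa [iterate_frobenius] at this
  rw [map_mul, h1, hQ, coeff_varpi, ← hl, ← map_pow, ← map_mul, mk_eq_mk_int_iff]
  rw [show k + (n + 2) = n + k + 2 by ring]
  change ‖(l (n + k + 2) : ℂ_[p]) - π (n + k + 2) * (q (k + 1) : ℂ_[p]) ^ p‖ ≤ _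
  have e : (l (n + k + 2) : ℂ_[p]) - π (n + k + 2) * (q (k + 1) : ℂ_[p]) ^ p =
      -(((q (k + 1) : ℂ_[p]) ^ p - q k) * π (n + k + 2)) := by
    rw [← hq k]; ring
  rw [e, norm_neg]
  exact hd k

theorem EKplus_prod_mem (K : IntermediateField ℚ_[p] (PadicAlgCl p)) {ι : Type*} (s : Finset ι)
    {f : ι → OFlat p} (hf : ∀ i ∈ s, f i ∈ EKplus K) : ∏ i ∈ s, f i ∈ EKplus K := by
  refine Finset.prod_induction f (· ∈ EKplus K) (fun a b => EKplus_mul_mem K) ?_ hf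
  rw [mem_EKplus_iff]
  exact ⟨0, fun n _ => by rw [map_one]; exact one_mem _⟩

/-- Finitely many elements of `E_K` in `𝓞_ℂ^♭` have a common denominator in `E_K^+`. -/
theorem exists_common_denominator (K : IntermediateField ℚ_[p] (PadicAlgCl p)) {ι : Type*}
    [Fintype ι] {o : ι → OFlat p} (ho : ∀ i, algebraMap (OFlat p) (CFlat p) (o i) ∈ EK K) :
    ∃ b ∈ EKplus K, b ≠ 0 ∧ ∀ i, o i * b ∈ EKplus K := by
  classical
  choose a ha b hb hb0 hab using ho
  refine ⟨∏ i, b i, EKplus_prod_mem K _ fun i _ => hb i, Finset.prod_ne_zero_iff.2 fun i _ => hb0 i,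
    fun i => ?_⟩
  have h1 : o i * b i = a i := by
    apply algebraMap_OFlat_injective (p := p)
    rw [map_mul, hab]
  rw [← Finset.mul_prod_erase _ _ (Finset.mem_univ i), ← mul_assoc, h1]
  exact EKplus_mul_mem K (ha i) (EKplus_prod_mem K _ fun i _ => hb i)

theorem coeff_pow_p_pow (x : OFlat p) (n k : ℕ) :
    PreTilt.coeff (n + k) x ^ p ^ k = PreTilt.coeff n x := by
  induction k with
  | zero => simp
  | succ k ih => rw [pow_succ', pow_mul, ← add_assoc, PreTilt.coeff_pow_p, ih]

/-- Among more than `[K : ℚ_p]` elements of `E_K` in `𝓞_ℂ^♭` there is a nontrivial linear relation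
over `𝔽_p` modulo `ϖ`. -/
theorem exists_varpi_dvd_sum (K : IntermediateField ℚ_[p] (PadicAlgCl p))
    [FiniteDimensional ℚ_[p] K] {o : Fin (Module.finrank ℚ_[p] K + 1) → OFlat p}
    (ho : ∀ i, algebraMap (OFlat p) (CFlat p) (o i) ∈ EK K) :
    ∃ m : Fin (Module.finrank ℚ_[p] K + 1) → ℕ, (∃ i, ¬ p ∣ m i) ∧
      Z.varpi ∣ ∑ i, (m i : OFlat p) * o i := by
  have hp := (Fact.out : p.Prime)
  have hp0 : (0 : ℝ) < (p : ℝ)⁻¹ := inv_pos.2 (by exact_mod_cast hp.pos)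
  obtain ⟨b, hb, hb0, hob⟩ := exists_common_denominator K ho
  obtain ⟨n₁, hn₁⟩ : ∃ n₁, PreTilt.coeff n₁ b ≠ 0 := by
    by_contra h
    push Not at h
    exact hb0 (Perfection.ext fun n => (h n).trans (map_zero (PreTilt.coeff n)).symm)
  rw [mem_EKplus_iff] at hb
  simp only [mem_EKplus_iff] at hob
  obtain ⟨n₀, hn₀⟩ := hb
  choose n₂ hn₂ using hob
  -- a level at which all approximations are good enough
  obtain ⟨N, hN0, hN1⟩ : ∃ N, n₀ ≤ n₁ + N + 3 ∧ ∀ i, n₂ i ≤ n₁ + N + 3 :=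
    ⟨n₀ + ∑ i, n₂ i, by omega, fun i => by
      have := Finset.single_le_sum (f := n₂) (fun i _ => Nat.zero_le _) (Finset.mem_univ i)
      omega⟩
  let n := n₁ + N + 3
  let c : PadicAlgCl p →+* ℂ_[p] := algebraMap (PadicAlgCl p) ℂ_[p]
  have hc : ∀ y, ‖c y‖ = ‖y‖ := PadicComplex.norm_extends p
  obtain ⟨y, hy, z, hz, hyz⟩ := hn₀ n hN0
  choose y' hy' z' hz' hyz' using fun i => hn₂ i n (hN1 i)
  change ‖(z : ℂ_[p]) - c y‖ ^ p ≤ _ at hyz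
  change ∀ i, ‖(z' i : ℂ_[p]) - c (y' i)‖ ^ p ≤ _ at hyz'
  choose l hl using fun i => Ideal.Quotient.mk_surjective (PreTilt.coeff n (o i))
  set π := ‖Z.ζ n - 1‖ with hπ
  have hπ1 : π ≤ 1 := norm_zeta_sub_one_le_one Z n
  have hz1 : ‖(z : ℂ_[p])‖ ≤ 1 := (mem_int_iff _).1 z.2
  have hsq : ∀ (a : ℝ) (k : ℕ), 0 ≤ a → a ≤ 1 → (p : ℝ)⁻¹ ≤ a ^ (p * (k + 2)) →
      (p : ℝ)⁻¹ ≤ (a ^ p) ^ 2 := fun a k h0 h1 h => by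
    rw [pow_mul] at h
    exact h.trans (pow_le_pow_of_le_one (by positivity) (pow_le_one₀ h0 h1) (by omega))
  have hπsq : (p : ℝ)⁻¹ ≤ (π ^ p) ^ 2 := by
    have h1 := norm_zeta_sub_one_pow (Z.isPrimitiveRoot (n₁ + N + 2 + 1))
    rw [Nat.totient_prime_pow_succ hp, pow_succ', mul_assoc] at h1
    refine hsq π (p ^ (n₁ + N + 1) * (p - 1) - 2) (norm_nonneg _) hπ1 ?_
    have h2 : 2 ≤ p ^ (n₁ + N + 1) * (p - 1) :=
      calc 2 ≤ p := hp.two_le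
        _ = p ^ 1 * 1 := by ring
        _ ≤ _ := Nat.mul_le_mul (Nat.pow_le_pow_right hp.pos (by omega))
          (by have := hp.two_le; omega)
    rw [Nat.sub_add_cancel h2]
    exact h1.symm.le
  have hzsq : (p : ℝ)⁻¹ ≤ (‖(z : ℂ_[p])‖ ^ p) ^ 2 := by
    have h1 : ¬ ‖((z ^ p ^ (N + 3) : 𝓞_ℂ_[p]) : ℂ_[p])‖ ≤ (p : ℝ)⁻¹ := by
      intro h
      rw [← p_dvd_int_iff, ← Ideal.mem_span_singleton, ← Ideal.Quotient.eq_zero_iff_mem, map_pow,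
        hz] at h
      exact hn₁ ((coeff_pow_p_pow b n₁ (N + 3)).symm.trans h)
    refine hsq _ (p ^ (N + 2) - 2) (norm_nonneg _) hz1 ?_
    have h2 : 2 ≤ p ^ (N + 2) := hp.two_le.trans (by
      calc p = p ^ 1 := (pow_one p).symm
        _ ≤ _ := Nat.pow_le_pow_right hp.pos (by omega))
    rw [Nat.sub_add_cancel h2, ← pow_succ', ← norm_pow]
    exact (not_le.1 h1).le
  have hzπ : (p : ℝ)⁻¹ ≤ (‖(z : ℂ_[p])‖ * π) ^ p := by
    have h1 : (p : ℝ)⁻¹ ^ 2 ≤ ((‖(z : ℂ_[p])‖ * π) ^ p) ^ 2 := by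
      rw [mul_pow, mul_pow, sq]
      exact mul_le_mul hzsq hπsq hp0.le (by positivity)
    exact le_of_pow_le_pow_left₀ two_ne_zero (by positivity) h1
  have hle : ∀ x : ℂ_[p], ‖x‖ ^ p ≤ 1 / p → ‖x‖ ≤ ‖(z : ℂ_[p])‖ * π := fun x hx => by
    rw [one_div] at hx
    exact le_of_pow_le_pow_left₀ hp.ne_zero (by positivity) (hx.trans hzπ)
  have hπlt : π < 1 := norm_zeta_sub_one_lt_one (Z.isPrimitiveRoot (n₁ + N + 2 + 1))
  have hzpos : 0 < ‖(z : ℂ_[p])‖ := by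
    by_contra h
    have h0 := le_antisymm (not_lt.1 h) (norm_nonneg _)
    rw [h0, zero_mul, zero_pow hp.ne_zero] at hzπ
    exact absurd hzπ (not_le.2 hp0)
  have hyn : ‖c y‖ = ‖(z : ℂ_[p])‖ := by
    have h1 : ‖(z : ℂ_[p]) - c y‖ < ‖(z : ℂ_[p])‖ :=
      (hle _ hyz).trans_lt (mul_lt_of_lt_one_right hzpos hπlt)
    have h2 := IsUltrametricDist.norm_eq_of_add_norm_lt_max (x := (z : ℂ_[p])) (y := -c y)
      (by rw [← sub_eq_add_neg]; exact h1.trans_le (le_max_left _ _))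
    rw [h2, norm_neg]
  have hcy : c y ≠ 0 := norm_pos_iff.1 (by rw [hyn]; exact hzpos)
  have hy0 : y ≠ 0 := fun h => hcy (by rw [h, map_zero])
  have hclose : ∀ i, ‖(l i : ℂ_[p]) - c (y' i / y)‖ ≤ π := by
    intro i
    have h1 : ‖(l i : ℂ_[p]) * z - z' i‖ ^ p ≤ 1 / (p : ℝ) := by
      have h2 : (Ideal.Quotient.mk _ (l i * z) : ModP 𝓞_ℂ_[p] p) = Ideal.Quotient.mk _ (z' i) := by
        rw [map_mul, hl, hz, hz', map_mul]
      have h3 : ‖(l i : ℂ_[p]) * z - z' i‖ ≤ (p : ℝ)⁻¹ := mk_eq_mk_int_iff.1 h2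
      rw [one_div]
      refine (pow_le_of_le_one (norm_nonneg _) (h3.trans ?_) hp.ne_zero).trans h3
      exact inv_le_one_of_one_le₀ (by exact_mod_cast hp.one_le)
    have h2 : ‖(l i : ℂ_[p]) * (c y - z)‖ ^ p ≤ 1 / (p : ℝ) := by
      rw [norm_mul, norm_sub_rev]
      exact (pow_le_pow_left₀ (by positivity) (mul_le_of_le_one_left (norm_nonneg _)
        ((mem_int_iff _).1 (l i).2)) _).trans hyz
    have h3 := hle _ (norm_add_pow_le (norm_add_pow_le h2 h1) (hyz' i))
    have e : (l i : ℂ_[p]) * (c y - z) + ((l i : ℂ_[p]) * z - z' i) + (z' i - c (y' i)) =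
        ((l i : ℂ_[p]) - c (y' i / y)) * c y := by
      rw [map_div₀]
      field_simp
      ring
    rw [e, norm_mul, hyn, mul_comm] at h3
    exact le_of_mul_le_mul_left h3 hzpos
  obtain ⟨m, hm, hsum⟩ := exists_norm_sum_le Z K (n₁ + N + 2) (y := fun i => y' i / y)
    (fun i => div_mem (hy' i) hy) (fun i => by
      rw [← hc]
      have h1 := norm_sub_le_max (l i : ℂ_[p]) ((l i : ℂ_[p]) - c (y' i / y))
      rw [sub_sub_cancel] at h1
      exact h1.trans (max_le ((mem_int_iff _).1 (l i).2) ((hclose i).trans hπ1)))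
  refine ⟨m, hm, varpi_dvd_of_norm_le Z (n := n₁ + N + 1) (z := ∑ i, (m i : 𝓞_ℂ_[p]) * l i) ?_ ?_⟩
  · rw [map_sum, map_sum]
    refine Finset.sum_congr rfl fun i _ => ?_
    rw [map_mul, map_mul, map_natCast, map_natCast, hl]
  · have e : ((∑ i, (m i : 𝓞_ℂ_[p]) * l i : 𝓞_ℂ_[p]) : ℂ_[p]) =
        ∑ i, (m i : ℂ_[p]) * ((l i : ℂ_[p]) - c (y' i / y)) +
          c (∑ i, (m i : PadicAlgCl p) * (y' i / y)) := by
      have h1 : ((∑ i, (m i : 𝓞_ℂ_[p]) * l i : 𝓞_ℂ_[p]) : ℂ_[p]) =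
          ∑ i, (m i : ℂ_[p]) * (l i : ℂ_[p]) := by
        rw [← Subring.subtype_apply, map_sum]
        refine Finset.sum_congr rfl fun i _ => ?_
        rw [map_mul, map_natCast]
        rfl
      rw [h1, map_sum, ← Finset.sum_add_distrib]
      refine Finset.sum_congr rfl fun i _ => ?_
      rw [map_mul, map_natCast]
      ring
    rw [e]
    refine (IsUltrametricDist.norm_add_le_max _ _).trans (max_le ?_ (by rw [hc]; exact hsum))
    refine IsUltrametricDist.norm_sum_le_of_forall_le_of_nonneg (norm_nonneg _) fun i _ => ?_
    rw [norm_mul]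
    refine (mul_le_of_le_one_left (norm_nonneg _) ?_).trans (hclose i)
    exact IsUltrametricDist.norm_natCast_le_one ℂ_[p] (m i)

/-- The residues modulo `ϖ` of the elements of `E_K` in `𝓞_ℂ^♭` form a finite set. -/
theorem finite_residues (K : IntermediateField ℚ_[p] (PadicAlgCl p)) [FiniteDimensional ℚ_[p] K] :
    (Ideal.Quotient.mk (Ideal.span {Z.varpi}) ''
      {o | algebraMap (OFlat p) (CFlat p) o ∈ EK K}).Finite := by
  have hnat : ∀ m : ℕ, algebraMap (OFlat p) (CFlat p) m ∈ EK K := fun m =>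
    ⟨m, ⟨0, fun n _ => by
      change PreTilt.coeff n (m : OFlat p) ∈ layerModP K n
      rw [map_natCast]; exact natCast_mem _ m⟩, 1, ⟨0, fun n _ => by
      change PreTilt.coeff n (1 : OFlat p) ∈ layerModP K n
      rw [map_one]; exact one_mem _⟩, one_ne_zero, by rw [map_one, mul_one]⟩
  let _ : Algebra (ZMod p) (OFlat p) := ZMod.algebra (OFlat p) p
  have hsmul : ∀ (c : ZMod p) (o : OFlat p), c • o = (c.val : OFlat p) * o := fun c o => by
    rw [Algebra.smul_def]
    congr 1
    conv_lhs => rw [← ZMod.natCast_zmod_val c]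
    rw [map_natCast]
  let W : Submodule (ZMod p) (OFlat p) :=
    { carrier := {o | algebraMap (OFlat p) (CFlat p) o ∈ EK K}
      zero_mem' := by simpa using hnat 0
      add_mem' := fun {a b} ha hb => by
        change algebraMap (OFlat p) (CFlat p) (a + b) ∈ EK K
        rw [map_add]; exact EK_add_mem K ha hb
      smul_mem' := fun c o ho => by
        change algebraMap (OFlat p) (CFlat p) (c • o) ∈ EK K
        rw [hsmul, map_mul]; exact EK_mul_mem K (hnat _) ho }
  let φ : OFlat p →ₗ[ZMod p] OFlat p ⧸ Ideal.span {Z.varpi} :=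
    (Ideal.Quotient.mkₐ (ZMod p) (Ideal.span {Z.varpi})).toLinearMap
  let V := W.map φ
  have hrank : Module.rank (ZMod p) V ≤ Module.finrank ℚ_[p] K := by
    refine rank_le fun s hs => ?_
    by_contra hcard
    obtain ⟨e⟩ : Nonempty (Fin (Module.finrank ℚ_[p] K + 1) ↪ s) := by
      refine Function.Embedding.nonempty_of_card_le ?_
      rw [Fintype.card_fin, Fintype.card_coe]
      omega
    choose o ho hoe using fun i => ((e i : V)).2
    obtain ⟨m, ⟨i, hi⟩, hdvd⟩ := exists_varpi_dvd_sum Z K ho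
    have h1 : LinearIndependent (ZMod p) fun i => (e i : V) := hs.comp e e.injective
    rw [Fintype.linearIndependent_iff] at h1
    refine hi ((ZMod.natCast_eq_zero_iff _ _).1 (h1 (fun i => (m i : ZMod p)) ?_ i))
    refine Subtype.ext ?_
    rw [Submodule.coe_sum, Submodule.coe_zero]
    have h2 : φ (∑ i, (m i : OFlat p) * o i) = 0 :=
      Ideal.Quotient.eq_zero_iff_mem.2 (Ideal.mem_span_singleton.2 hdvd)
    rw [← h2, map_sum]
    refine Finset.sum_congr rfl fun i _ => ?_
    rw [Submodule.coe_smul, ← hoe, ← map_smul, Algebra.smul_def, map_natCast]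
  have hfin : Module.Finite (ZMod p) V :=
    Module.rank_lt_aleph0_iff.1 (hrank.trans_lt (Cardinal.natCast_lt_aleph0))
  have : Finite V := Module.finite_of_finite (ZMod p)
  exact Set.toFinite (V : Set (OFlat p ⧸ Ideal.span {Z.varpi}))

end Residues

/-! ### Divisibility by `T` in `A_K^{(0,r],∘}` -/

section AKInt

variable {p : ℕ} [Fact p.Prime] (Z : CycloSystem p) (K : IntermediateField ℚ_[p] (PadicAlgCl p))

theorem emb_mem_AKoverconvInt (r : Radius p) {y : AInf p} (hy : y ∈ AQpPlus Z) :
    emb p y ∈ AKoverconvInt Z K r := ⟨emb_mem_AK Z K hy, emb_mem_overconvInt y⟩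

/-- The residues of `ϖ^{-j} b` for the elements `b` of `A_K^{(0,r],∘}` with reduction divisible
by `ϖ^j`. -/
def leadingResidues (r : Radius p) (j : ℕ) : Set (OFlat p ⧸ Ideal.span {Z.varpi}) :=
  {v | ∃ b ∈ AKoverconvInt Z K r, ∃ o, b.coeff 0 = algebraMap (OFlat p) (CFlat p) (Z.varpi ^ j * o) ∧
    Ideal.Quotient.mk _ o = v}

/-- Multiplication by `T` maps the leading residues in degree `j` to those in degree `j + 1`. -/
theorem leadingResidues_mono (r : Radius p) : Monotone (leadingResidues Z K r) := by
  refine monotone_nat_of_le_succ fun j => ?_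
  rintro _ ⟨b, hb, o, hbo, rfl⟩
  refine ⟨emb p Z.T * b, mul_mem (emb_mem_AKoverconvInt Z K r (T_mem_AQpPlus Z)) hb, o, ?_, rfl⟩
  rw [coeff_zero_mul', coeff_emb, coeff_zero_T, hbo, ← map_mul, pow_succ']
  ring_nf

theorem leadingResidues_subset (r : Radius p) (j : ℕ) : leadingResidues Z K r j ⊆
    Ideal.Quotient.mk (Ideal.span {Z.varpi}) '' {o | algebraMap (OFlat p) (CFlat p) o ∈ EK K} := by
  rintro _ ⟨b, hb, o, hbo, rfl⟩
  refine ⟨o, ?_, rfl⟩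
  obtain ⟨a, ha, c, hc, hc0, h⟩ := coeff_zero_mem_EK K Z hb.1
  have hϖ : Z.varpi ^ j ∈ EKplus K := by
    rw [← coeff_zero_T, ← coeff_zero_pow']
    exact coeff_zero_mem_EKplus K Z (pow_mem (T_mem_AQpPlus Z) j)
  refine ⟨a, ha, Z.varpi ^ j * c, EKplus_mul_mem K hϖ hc,
    mul_ne_zero (pow_ne_zero _ (varpi_ne_zero Z)) hc0, ?_⟩
  rw [← h, hbo, map_mul, map_mul]
  ring

variable [FiniteDimensional ℚ_[p] K]

/-- The increasing sets of leading residues stabilise: they are contained in the finite set of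
residues of elements of `E_K`. -/
theorem exists_leadingResidues_stable (r : Radius p) :
    ∃ i₀, ∀ j, i₀ ≤ j → leadingResidues Z K r j = leadingResidues Z K r i₀ := by
  set V := Ideal.Quotient.mk (Ideal.span {Z.varpi}) ''
    {o | algebraMap (OFlat p) (CFlat p) o ∈ EK K} with hV
  have hfin : V.Finite := finite_residues Z K
  have : Finite V := hfin.to_subtype
  let f : ℕ →o Set V := ⟨fun j => {v | (v : OFlat p ⧸ Ideal.span {Z.varpi}) ∈
    leadingResidues Z K r j}, fun i j hij v hv => leadingResidues_mono Z K r hij hv⟩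
  obtain ⟨i₀, hi₀⟩ := WellFoundedGT.monotone_chain_condition f
  refine ⟨i₀, fun j hj => (leadingResidues_mono Z K r hj).antisymm' fun v hv => ?_⟩
  have h : (⟨v, leadingResidues_subset Z K r j hv⟩ : V) ∈ f j := hv
  rw [← hi₀ j hj] at h
  exact h

/-- If an element `b` of `A_K^{(0,r],∘}` has a reduction which is divisible by a sufficiently high
power `ϖ^{i+i₀}`, then this reduction is `ϖ^i` times the reduction of an element of
`A_K^{(0,r],∘}`. The latter is a power series in `T` whose coefficients are taken from
a finite set of representatives for the leading residues. -/
theorem exists_p_dvd_sub_T_pow_mul (r : Radius p) : ∃ i₀ : ℕ, ∀ (i : ℕ),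
    ∀ b ∈ AKoverconvInt Z K r, ∀ α : AInf p,
      (p : ATilde p) ∣ b - emb p Z.T ^ (i + i₀) * emb p α →
      ∃ w ∈ AKoverconvInt Z K r, (p : ATilde p) ∣ b - emb p Z.T ^ i * w := by
  classical
  obtain ⟨i₀, hi₀⟩ := exists_leadingResidues_stable Z K r
  refine ⟨i₀, fun i b hb α hbα => ?_⟩
  have hfin : (leadingResidues Z K r i₀).Finite :=
    (finite_residues Z K).subset (leadingResidues_subset Z K r i₀)
  have : Fintype (leadingResidues Z K r i₀) := hfin.fintype
  choose β hβ o hβo ho using fun v : leadingResidues Z K r i₀ => v.2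
  have hT := emb_mem_AKoverconvInt Z K r (T_mem_AQpPlus Z)
  -- the pairs of a remainder at the `k`-th stage and its leading coefficient
  let X : ℕ → Type := fun k => {x : ATilde p × OFlat p // x.1 ∈ AKoverconvInt Z K r ∧
    x.1.coeff 0 = algebraMap (OFlat p) (CFlat p) (Z.varpi ^ (i + k + i₀) * x.2)}
  have hnext : ∀ k (x : X k), ∃ (v : leadingResidues Z K r i₀) (x' : X (k + 1)),
      x.1.1 = emb p Z.T ^ (i + k) * β v + x'.1.1 := by
    rintro k ⟨⟨b, u⟩, hb, hbu⟩
    have hmem : Ideal.Quotient.mk (Ideal.span {Z.varpi}) u ∈ leadingResidues Z K r i₀ := by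
      rw [← hi₀ (i + k + i₀) (by omega)]
      exact ⟨b, hb, u, hbu, rfl⟩
    let v : leadingResidues Z K r i₀ := ⟨_, hmem⟩
    obtain ⟨u', hu'⟩ : Z.varpi ∣ u - o v := by
      rw [← Ideal.mem_span_singleton, ← Ideal.Quotient.mk_eq_mk_iff_sub_mem, ho v]
    refine ⟨v, ⟨⟨b - emb p Z.T ^ (i + k) * β v, u'⟩, sub_mem hb (mul_mem (pow_mem hT _) (hβ v)),
      ?_⟩, by simp⟩
    change (b - emb p Z.T ^ (i + k) * β v).coeff 0 = _
    change b.coeff 0 = _ at hbu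
    rw [coeff_zero_sub', coeff_zero_mul', coeff_zero_pow', coeff_emb, coeff_zero_T, hβo v, hbu,
      ← map_pow, ← map_mul, ← map_sub]
    congr 1
    linear_combination Z.varpi ^ (i + k + i₀) * hu'
  choose v nxt hnxt using hnext
  let x₀ : X 0 := ⟨⟨b, α.coeff 0⟩, hb, by
    rw [witt_p_dvd_iff, coeff_zero_sub', coeff_zero_mul', coeff_zero_pow', coeff_emb, coeff_emb,
      coeff_zero_T, sub_eq_zero] at hbα
    rw [add_zero, map_mul, map_pow]
    exact hbα⟩
  let x : ∀ k, X k := fun k => Nat.rec x₀ (fun k y => nxt k y) k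
  let w : ℕ → leadingResidues Z K r i₀ := fun k => v k (x k)
  have hx : ∀ k, (x k).1.1 = emb p Z.T ^ (i + k) * β (w k) + (x (k + 1)).1.1 :=
    fun k => hnxt k (x k)
  -- sum the powers of `T` that are multiplied by a given representative
  choose S hS using fun u : leadingResidues Z K r i₀ =>
    AInf_sumsExist Z (coeff_zero_T Z) fun k => if w k = u then (1 : AInf p) else 0
  have hSmem : ∀ u, S u 0 ∈ AQpPlus Z := fun u => AQpPlus_sum_mem Z (fun n => by
    split_ifs
    · exact one_mem _
    · exact zero_mem _) (hS u)
  refine ⟨∑ u, emb p (S u 0) * β u,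
    sum_mem fun u _ => mul_mem (emb_mem_AKoverconvInt Z K r (hSmem u)) (hβ u), ?_⟩
  have hN : ∀ N, b - emb p Z.T ^ i * ∑ u, emb p (S u 0) * β u =
      (x N).1.1 - emb p Z.T ^ (i + N) * ∑ u, emb p (S u N) * β u := by
    intro N
    induction N with
    | zero => rfl
    | succ N ih =>
      have h1 : ∑ u, emb p (S u N) * β u =
          β (w N) + emb p Z.T * ∑ u, emb p (S u (N + 1)) * β u := by
        have h2 : ∀ u, emb p (S u N) * β u = (if w N = u then β u else 0) +
            emb p Z.T * (emb p (S u (N + 1)) * β u) := fun u => by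
          rw [hS u N, map_add, map_mul]
          split_ifs <;> simp <;> ring
        rw [Finset.sum_congr rfl fun u _ => h2 u, Finset.sum_add_distrib, ← Finset.mul_sum,
          Finset.sum_ite_eq, if_pos (Finset.mem_univ _)]
      rw [ih, h1, hx N]
      ring
  have hcoeff : ∀ N, ∃ g, (b - emb p Z.T ^ i * ∑ u, emb p (S u 0) * β u).coeff 0 =
      algebraMap (OFlat p) (CFlat p) (Z.varpi ^ N * g) := by
    intro N
    have h1 : (∑ u, emb p (S u N) * β u).coeff 0 =
        algebraMap (OFlat p) (CFlat p) (∑ u, (S u N).coeff 0 * (Z.varpi ^ i₀ * o u)) := by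
      rw [show (∑ u, emb p (S u N) * β u).coeff 0 = ∑ u, (emb p (S u N) * β u).coeff 0 from
        map_sum (WittVector.constantCoeff : ATilde p →+* CFlat p) _ _, map_sum]
      refine Finset.sum_congr rfl fun u _ => ?_
      rw [coeff_zero_mul', coeff_emb, hβo u, ← map_mul]
    refine ⟨Z.varpi ^ (i + i₀) * (x N).1.2 - Z.varpi ^ i *
      ∑ u, (S u N).coeff 0 * (Z.varpi ^ i₀ * o u), ?_⟩
    rw [hN N, coeff_zero_sub', coeff_zero_mul', coeff_zero_pow', coeff_emb, coeff_zero_T, h1,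
      (x N).2.2, ← map_pow, ← map_mul, ← map_sub]
    congr 1
    ring
  obtain ⟨g, hg⟩ := hcoeff 0
  have hg0 : Z.varpi ^ 0 * g = 0 := OFlat_eq_zero_of_forall_dvd Z fun N => by
    obtain ⟨g', hg'⟩ := hcoeff N
    rw [hg] at hg'
    exact ⟨g', algebraMap_OFlat_injective hg'⟩
  rw [witt_p_dvd_iff, hg, hg0, map_zero]

end AKInt

section AKTorsion

variable {p : ℕ} [Fact p.Prime] (Z : CycloSystem p) (K : IntermediateField ℚ_[p] (PadicAlgCl p))

/-- An element of `A_K^{(0,r],∘}` which is divisible by `p` in `W(ℂ^♭)` is divisible by `p` in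
`A_K^{(0,r],∘}` after multiplication by `T^e`. -/
theorem AKoverconvInt_exists_p_mul {r : Radius p} (D : RadiusData Z r) {x : ATilde p}
    (hx : x ∈ AKoverconvInt Z K r) (hpx : (p : ATilde p) ∣ x) :
    ∃ y ∈ AKoverconvInt Z K r, emb p Z.T ^ D.e * x = p * y := by
  obtain ⟨y, hy, h⟩ := D.exists_p_mul (coeff_zero_T Z) hx.2 hpx
  refine ⟨y, ⟨mem_AK_of_p_mul_mem Z K ?_, hy⟩, h⟩
  rw [← h]
  exact mul_mem (pow_mem (emb_mem_AK Z K (T_mem_AQpPlus Z)) _) hx.1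

/-- A sequence in `A_K^{(0,s],∘}` with `b_i ≡ b_{i+1}` modulo `T^i`, whose `i`-th term is divisible
by `T^i` in `A_K^{(0,r],∘}`, also has these divisibilities in `A_K^{(0,s],∘}`. -/
theorem AKoverconvInt_exists_T_pow_mul {r s : Radius p} (hrs : r ≤ s) {b d : ℕ → ATilde p}
    (hd : ∀ i, d i ∈ AKoverconvInt Z K s) (hb : ∀ i, b i ∈ AKoverconvInt Z K s)
    (hbd : ∀ i, b (i + 1) - b i = emb p Z.T ^ i * d i)
    (hbr : ∀ i, ∃ y ∈ AKoverconvInt Z K r, b i = emb p Z.T ^ i * y) (i : ℕ) :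
    ∃ y ∈ AKoverconvInt Z K s, b i = emb p Z.T ^ i * y := by
  obtain ⟨X, hX⟩ := overconvInt_sumsExist (Z := Z) (r := s) (coeff_zero_T Z)
    fun i => ⟨d i, (hd i).2⟩
  have hX' : ∀ i, (X i : ATilde p) = d i + emb p Z.T * X (i + 1) := fun i =>
    congrArg Subtype.val (hX i)
  obtain ⟨D⟩ := nonempty_radiusData Z r
  -- the limit of the sequence vanishes
  have hlim : ∀ i, b i + emb p Z.T ^ i * X i = b 0 + X 0 := by
    intro i
    induction i with
    | zero => simp
    | succ i ih =>
      rw [← ih, hX' i]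
      linear_combination hbd i
  have h0 : b 0 + (X 0 : ATilde p) = 0 := by
    refine D.eq_zero_of_forall_pow_mul (coeff_zero_T Z) fun i => ?_
    obtain ⟨y, hy, h⟩ := hbr i
    refine ⟨y + X i, add_mem hy.2 (overconvInt_mono Z hrs (X i).2), ?_⟩
    rw [← hlim i, h]
    ring
  have h1 : b i = emb p Z.T ^ i * -(X i : ATilde p) := by
    linear_combination (hlim i).trans h0
  refine ⟨_, ⟨mem_AK_of_T_pow_mul_mem Z K (n := i) ?_, neg_mem (X i).2⟩, h1⟩
  rw [← h1]
  exact (hb i).1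

end AKTorsion

/-! ### Tensor products with modules killed by a power of `p` -/

section TensorTorsion

variable {p : ℕ} [Fact p.Prime]

/-- The submodule `p^k N`. -/
abbrev pPow (p : ℕ) [Fact p.Prime] (N : Type*) [AddCommGroup N] [Module ℤ_[p] N] (k : ℕ) :
    Submodule ℤ_[p] N :=
  LinearMap.range ((p : ℤ_[p]) ^ k • (LinearMap.id : N →ₗ[ℤ_[p]] N))

theorem rTensor_smul_id (c : ℤ_[p]) (G N : Type*) [AddCommGroup G] [Module ℤ_[p] G]
    [AddCommGroup N] [Module ℤ_[p] N] (u : G ⊗[ℤ_[p]] N) :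
    (c • (LinearMap.id : G →ₗ[ℤ_[p]] G)).rTensor N u = c • u := by
  rw [LinearMap.rTensor_smul, LinearMap.rTensor_id, LinearMap.smul_apply, LinearMap.id_apply]

theorem lTensor_smul_id (c : ℤ_[p]) (G N : Type*) [AddCommGroup G] [Module ℤ_[p] G]
    [AddCommGroup N] [Module ℤ_[p] N] (u : G ⊗[ℤ_[p]] N) :
    (c • (LinearMap.id : N →ₗ[ℤ_[p]] N)).lTensor G u = c • u := by
  rw [LinearMap.lTensor_smul, LinearMap.lTensor_id, LinearMap.smul_apply, LinearMap.id_apply]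

/-- If the kernel of `q : G → Q` is `c G`, then the kernel of `q ⊗ N` is `c (G ⊗ N)`. -/
theorem exists_eq_smul_of_rTensor_eq_zero {G Q N : Type*} [AddCommGroup G] [Module ℤ_[p] G]
    [AddCommGroup Q] [Module ℤ_[p] Q] [AddCommGroup N] [Module ℤ_[p] N] {q : G →ₗ[ℤ_[p]] Q}
    (hq : Function.Surjective q) {c : ℤ_[p]} (hker : ∀ x, q x = 0 ↔ ∃ y, c • y = x)
    {u : G ⊗[ℤ_[p]] N} (hu : q.rTensor N u = 0) : ∃ v, u = c • v := by
  have hex : Function.Exact (c • (LinearMap.id : G →ₗ[ℤ_[p]] G)) q := fun x => hker x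
  obtain ⟨v, hv⟩ := (rTensor_exact N hex hq u).1 hu
  exact ⟨v, by rw [← hv, rTensor_smul_id]⟩

/-- The kernel of `G ⊗ N → G ⊗ N / p^k N` is `p^k (G ⊗ N)`. -/
theorem exists_eq_smul_of_lTensor_eq_zero {G N : Type*} [AddCommGroup G] [Module ℤ_[p] G]
    [AddCommGroup N] [Module ℤ_[p] N] {k : ℕ}
    {u : G ⊗[ℤ_[p]] N} (hu : (pPow p N k).mkQ.lTensor G u = 0) : ∃ v, u = (p : ℤ_[p]) ^ k • v := by
  have hex : Function.Exact ((p : ℤ_[p]) ^ k • (LinearMap.id : N →ₗ[ℤ_[p]] N)) (pPow p N k).mkQ :=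
    LinearMap.exact_map_mkQ_range _
  obtain ⟨v, hv⟩ := (lTensor_exact G hex (Submodule.mkQ_surjective _) u).1 hu
  exact ⟨v, by rw [← hv, lTensor_smul_id]⟩

theorem exists_eq_lTensor_subtype {G N : Type*} [AddCommGroup G] [Module ℤ_[p] G]
    [AddCommGroup N] [Module ℤ_[p] N] {N' : Submodule ℤ_[p] N}
    {u : G ⊗[ℤ_[p]] N} (hu : N'.mkQ.lTensor G u = 0) :
    ∃ v : G ⊗[ℤ_[p]] N', N'.subtype.lTensor G v = u :=
  (lTensor_exact G (LinearMap.exact_subtype_mkQ N') (Submodule.mkQ_surjective _) u).1 hu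

theorem lTensor_subtype_injective {G N : Type*} [AddCommGroup G] [Module ℤ_[p] G]
    [Module.Flat ℤ_[p] G] [AddCommGroup N] [Module ℤ_[p] N] (N' : Submodule ℤ_[p] N) :
    Function.Injective (N'.subtype.lTensor G) :=
  Module.Flat.lTensor_preserves_injective_linearMap _ N'.injective_subtype

theorem lTensor_rTensor_comm {G H M N : Type*} [AddCommGroup G] [Module ℤ_[p] G]
    [AddCommGroup H] [Module ℤ_[p] H] [AddCommGroup M] [Module ℤ_[p] M] [AddCommGroup N]
    [Module ℤ_[p] N] (f : G →ₗ[ℤ_[p]] H) (g : M →ₗ[ℤ_[p]] N) (u : G ⊗[ℤ_[p]] M) :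
    g.lTensor H (f.rTensor M u) = f.rTensor N (g.lTensor G u) := by
  rw [← LinearMap.comp_apply, ← LinearMap.comp_apply, LinearMap.lTensor_comp_rTensor,
    LinearMap.rTensor_comp_lTensor]

/-- A module killed by `p` has a basis over `ℤ_p / p`. -/
theorem exists_basis_of_p_smul_eq_zero {N : Type*} [AddCommGroup N] [Module ℤ_[p] N]
    (hN : ∀ x : N, (p : ℤ_[p]) • x = 0) :
    ∃ (s : Set N) (c : s → N →ₗ[ℤ_[p]] ℤ_[p] ⧸ Ideal.span {(p : ℤ_[p])}),
      (∀ i : s, c i i = 1) ∧ (∀ i j : s, i ≠ j → c i j = 0) ∧ Submodule.span ℤ_[p] s = ⊤ := by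
  have hmax : (Ideal.span {(p : ℤ_[p])}).IsMaximal := by
    rw [← PadicInt.maximalIdeal_eq_span_p]; infer_instance
  let _ : Field (ℤ_[p] ⧸ Ideal.span {(p : ℤ_[p])}) := Ideal.Quotient.field _
  have htors : Module.IsTorsionBySet ℤ_[p] N (Ideal.span {(p : ℤ_[p])} : Set ℤ_[p]) := by
    rw [Module.isTorsionBySet_span_singleton_iff]
    exact fun x => hN x
  let _ : Module (ℤ_[p] ⧸ Ideal.span {(p : ℤ_[p])}) N := htors.module
  have _ : IsScalarTower ℤ_[p] (ℤ_[p] ⧸ Ideal.span {(p : ℤ_[p])}) N :=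
    htors.isScalarTower
  let b := Module.Basis.ofVectorSpace (ℤ_[p] ⧸ Ideal.span {(p : ℤ_[p])}) N
  have hb : ∀ i, b i = i := Module.Basis.ofVectorSpace_apply_self _ N
  refine ⟨Module.Basis.ofVectorSpaceIndex (ℤ_[p] ⧸ Ideal.span {(p : ℤ_[p])}) N,
    fun i => (b.coord i).restrictScalars ℤ_[p], fun i => ?_, fun i j hij => ?_, ?_⟩
  · rw [← hb i]
    simp
  · rw [← hb j]
    simp [hij.symm]
  · rw [eq_top_iff]
    intro x _
    have hx := b.mem_span x
    rw [show Set.range b = Module.Basis.ofVectorSpaceIndex (ℤ_[p] ⧸ Ideal.span {(p : ℤ_[p])}) N by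
      rw [Module.Basis.range_ofVectorSpace]] at hx
    induction hx using Submodule.span_induction with
    | mem x hx => exact Submodule.subset_span hx
    | zero => exact zero_mem _
    | add x y _ _ hx hy => exact add_mem (hx trivial) (hy trivial)
    | smul a x _ hx =>
      obtain ⟨a, rfl⟩ := Ideal.Quotient.mk_surjective a
      exact Submodule.smul_mem _ a (hx trivial)

variable {N : Type*} [AddCommGroup N] [Module ℤ_[p] N]

theorem exists_finset_sum_eq {s : Set N} (hs : Submodule.span ℤ_[p] s = ⊤) {G : Type*}
    [AddCommGroup G] [Module ℤ_[p] G] (u : G ⊗[ℤ_[p]] N) :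
    ∃ g : s →₀ G, ∀ t : Finset s, g.support ⊆ t → u = ∑ i ∈ t, g i ⊗ₜ[ℤ_[p]] (i : N) := by
  classical
  suffices h : ∃ g : s →₀ G, u = g.sum fun i x => x ⊗ₜ[ℤ_[p]] (i : N) by
    obtain ⟨g, hg⟩ := h
    exact ⟨g, fun t ht => hg.trans (Finsupp.sum_of_support_subset g ht _ (by simp))⟩
  induction u using TensorProduct.induction_on with
  | zero => exact ⟨0, by simp⟩
  | add u v hu hv =>
    obtain ⟨g, rfl⟩ := hu
    obtain ⟨h, rfl⟩ := hv
    exact ⟨g + h, (Finsupp.sum_add_index' (by simp) (by simp [TensorProduct.add_tmul])).symm⟩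
  | tmul x n =>
    have hn : n ∈ Submodule.span ℤ_[p] s := hs ▸ Submodule.mem_top
    induction hn using Submodule.span_induction with
    | mem n hn => exact ⟨Finsupp.single ⟨n, hn⟩ x, by simp⟩
    | zero => exact ⟨0, by simp⟩
    | add m n _ _ hm hn =>
      obtain ⟨g, hg⟩ := hm
      obtain ⟨h, hh⟩ := hn
      exact ⟨g + h, by
        rw [TensorProduct.tmul_add, hg, hh]
        exact (Finsupp.sum_add_index' (by simp) (by simp [TensorProduct.add_tmul])).symm⟩
    | smul a n _ hn =>
      obtain ⟨g, hg⟩ := hn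
      refine ⟨a • g, ?_⟩
      rw [TensorProduct.tmul_smul, hg, Finsupp.sum_smul_index' (by simp), Finsupp.smul_sum]
      simp [TensorProduct.smul_tmul']

theorem exists_eq_p_smul_of_sum_eq_zero {s : Set N}
    {c : s → N →ₗ[ℤ_[p]] ℤ_[p] ⧸ Ideal.span {(p : ℤ_[p])}} (hc1 : ∀ i : s, c i i = 1)
    (hc0 : ∀ i j : s, i ≠ j → c i j = 0) {G : Type*} [AddCommGroup G] [Module ℤ_[p] G]
    {g : s → G} {t : Finset s} (h : ∑ i ∈ t, g i ⊗ₜ[ℤ_[p]] (i : N) = 0) {i : s} (hi : i ∈ t) :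
    ∃ g', g i = (p : ℤ_[p]) • g' := by
  have h1 := congrArg ((c i).lTensor G) h
  rw [map_sum, map_zero, Finset.sum_eq_single i (fun j _ hj => by
    rw [LinearMap.lTensor_tmul, hc0 i j hj.symm, TensorProduct.tmul_zero])
    (fun hi' => absurd hi hi'), LinearMap.lTensor_tmul, hc1] at h1
  have h2 := congrArg (TensorProduct.tensorQuotEquivQuotSMul G (Ideal.span {(p : ℤ_[p])})) h1
  rw [map_zero, ← map_one (Ideal.Quotient.mk (Ideal.span {(p : ℤ_[p])})),
    TensorProduct.tensorQuotEquivQuotSMul_tmul_mk, Submodule.Quotient.mk_eq_zero, one_smul,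
    Submodule.ideal_span_singleton_smul] at h2
  obtain ⟨g', _, hg'⟩ := h2
  exact ⟨g', hg'.symm⟩

theorem p_smul_quotient_eq_zero (x : N ⧸ pPow p N 1) : (p : ℤ_[p]) • x = 0 := by
  obtain ⟨x, rfl⟩ := Submodule.mkQ_surjective _ x
  rw [← map_smul, Submodule.mkQ_apply, Submodule.Quotient.mk_eq_zero]
  exact ⟨x, by simp⟩

theorem p_pow_smul_pPow_eq_zero {a : ℕ} (hN : ∀ x : N, (p : ℤ_[p]) ^ (a + 1) • x = 0)
    (x : pPow p N 1) : (p : ℤ_[p]) ^ a • x = 0 := by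
  obtain ⟨_, x, rfl⟩ := x
  refine Subtype.ext ?_
  have := hN x
  rw [pow_succ, mul_smul] at this
  simpa using this

end TensorTorsion

/-! ### Divisibility by `t` in tensor products with modules killed by a power of `p` -/

section Killed

universe u

open TensorProduct.AlgebraTensorModule (lTensor rTensor)

variable {p : ℕ} [Fact p.Prime] {S : Type*} [CommRing S] [Algebra ℤ_[p] S]
  {G H : Type*} [AddCommGroup G] [Module ℤ_[p] G] [Module S G] [IsScalarTower ℤ_[p] S G]
  [AddCommGroup H] [Module ℤ_[p] H] [Module S H] [IsScalarTower ℤ_[p] S H]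

theorem lTensor_rTensor_comm' {M N : Type*} [AddCommGroup M] [Module ℤ_[p] M]
    [AddCommGroup N] [Module ℤ_[p] N] (f : G →ₗ[S] H) (g : M →ₗ[ℤ_[p]] N) (u : G ⊗[ℤ_[p]] M) :
    lTensor S H g (rTensor ℤ_[p] M f u) = rTensor ℤ_[p] N f (lTensor S G g u) :=
  lTensor_rTensor_comm (f.restrictScalars ℤ_[p]) g u

variable {N : Type u} [AddCommGroup N] [Module ℤ_[p] N]

/-- If `G / p → H / p` is injective, then so is `G ⊗ N → H ⊗ N` for modules `N` killed by a power
of `p`. -/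
theorem rTensor_injective_of_killed [Module.Flat ℤ_[p] H] {j : G →ₗ[S] H}
    (hj : ∀ g h, j g = (p : ℤ_[p]) • h → ∃ g', g = (p : ℤ_[p]) • g') {a : ℕ}
    (hN : ∀ x : N, (p : ℤ_[p]) ^ a • x = 0) {u : G ⊗[ℤ_[p]] N} (hu : rTensor ℤ_[p] N j u = 0) :
    u = 0 := by
  induction a generalizing N with
  | zero =>
    have : Subsingleton N := ⟨fun x y => by
      rw [← one_smul ℤ_[p] x, ← one_smul ℤ_[p] y, ← pow_zero (p : ℤ_[p]), hN, hN]⟩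
    exact Subsingleton.elim _ _
  | succ a ih =>
    have h1 : (pPow p N 1).mkQ.lTensor G u = 0 := by
      obtain ⟨s, c, hc1, hc0, hs⟩ := exists_basis_of_p_smul_eq_zero
        (p_smul_quotient_eq_zero (p := p) (N := N))
      obtain ⟨g, hg⟩ := exists_finset_sum_eq hs ((pPow p N 1).mkQ.lTensor G u)
      have hg := hg _ subset_rfl
      have hz : ∑ i ∈ g.support, j (g i) ⊗ₜ[ℤ_[p]] (i : N ⧸ pPow p N 1) = 0 := by
        have h2 := lTensor_rTensor_comm' j (pPow p N 1).mkQ u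
        rw [hu, map_zero] at h2
        change 0 = rTensor ℤ_[p] _ j ((pPow p N 1).mkQ.lTensor G u) at h2
        rw [hg, map_sum] at h2
        exact h2.symm
      have h3 : ∀ i ∈ g.support, ∃ g', g i = (p : ℤ_[p]) • g' := fun i hi => by
        obtain ⟨h, hh⟩ := exists_eq_p_smul_of_sum_eq_zero hc1 hc0 hz hi
        exact hj _ _ hh
      rw [hg]
      refine Finset.sum_eq_zero fun i hi => ?_
      obtain ⟨g', hg'⟩ := h3 i hi
      rw [hg', TensorProduct.smul_tmul, p_smul_quotient_eq_zero, TensorProduct.tmul_zero]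
    obtain ⟨v, rfl⟩ := exists_eq_lTensor_subtype h1
    have h2 : rTensor ℤ_[p] _ j v = 0 := by
      apply lTensor_subtype_injective (pPow p N 1)
      rw [map_zero]
      exact (lTensor_rTensor_comm' j (pPow p N 1).subtype v).trans hu
    rw [ih (p_pow_smul_pPow_eq_zero hN) h2, map_zero]

/-- If the `t`-power torsion of `G / p` is killed by `t^M`, then the `t`-power torsion of `G ⊗ N` is
killed by `t^{aM}` for modules `N` killed by `p^a`. -/
theorem torsion_bounded_of_killed [Module.Flat ℤ_[p] G] {t : S} {M : ℕ}
    (hG : ∀ (n : ℕ) (g g' : G), t ^ n • g = (p : ℤ_[p]) • g' →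
      ∃ g'' : G, t ^ M • g = (p : ℤ_[p]) • g'') {a : ℕ}
    (hN : ∀ x : N, (p : ℤ_[p]) ^ a • x = 0) {n : ℕ} {u : G ⊗[ℤ_[p]] N} (hu : t ^ n • u = 0) :
    t ^ (a * M) • u = 0 := by
  induction a generalizing N with
  | zero =>
    have : Subsingleton N := ⟨fun x y => by
      rw [← one_smul ℤ_[p] x, ← one_smul ℤ_[p] y, ← pow_zero (p : ℤ_[p]), hN, hN]⟩
    exact Subsingleton.elim _ _
  | succ a ih =>
    have h1 : lTensor S G (pPow p N 1).mkQ (t ^ M • u) = 0 := by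
      obtain ⟨s, c, hc1, hc0, hs⟩ := exists_basis_of_p_smul_eq_zero
        (p_smul_quotient_eq_zero (p := p) (N := N))
      obtain ⟨g, hg⟩ := exists_finset_sum_eq hs (lTensor S G (pPow p N 1).mkQ u)
      have hg := hg _ subset_rfl
      have hz : ∑ i ∈ g.support, (t ^ n • g i) ⊗ₜ[ℤ_[p]] (i : N ⧸ pPow p N 1) = 0 := by
        have h2 := congrArg (lTensor S G (pPow p N 1).mkQ) hu
        rw [map_smul, map_zero, hg, Finset.smul_sum] at h2
        exact h2
      rw [map_smul, hg, Finset.smul_sum]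
      refine Finset.sum_eq_zero fun i hi => ?_
      obtain ⟨g', hg'⟩ := exists_eq_p_smul_of_sum_eq_zero hc1 hc0 hz hi
      obtain ⟨g'', hg''⟩ := hG _ _ _ hg'
      rw [TensorProduct.smul_tmul', hg'', TensorProduct.smul_tmul, p_smul_quotient_eq_zero,
        TensorProduct.tmul_zero]
    obtain ⟨v, hv⟩ := exists_eq_lTensor_subtype h1
    have hv : lTensor S G (pPow p N 1).subtype v = t ^ M • u := hv
    have h2 : t ^ n • v = 0 := by
      apply lTensor_subtype_injective (G := G) (pPow p N 1)
      rw [map_zero]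
      change lTensor S G (pPow p N 1).subtype (t ^ n • v) = 0
      rw [map_smul, hv, smul_comm, hu, smul_zero]
    have h3 := ih (p_pow_smul_pPow_eq_zero hN) h2
    rw [add_mul, one_mul, pow_add, mul_smul, ← hv, ← map_smul, h3, map_zero]

/-- If divisibility by powers of `t` in `H / p` implies divisibility in `G / p`, up to a fixed power
of `t`, then the same holds for `G ⊗ N → H ⊗ N` for modules `N` killed by a power of `p`. -/
theorem exists_divisible_of_killed [Module.Flat ℤ_[p] G] [Module.Flat ℤ_[p] H] {t : S}
    {j : G →ₗ[S] H} {M₀ : ℕ}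
    (hH : ∀ (n : ℕ) (g g' : H), t ^ n • g = (p : ℤ_[p]) • g' →
      ∃ g'' : H, t ^ M₀ • g = (p : ℤ_[p]) • g'')
    (hj : ∀ (i : ℕ) (g : G) (h h' : H), j g = t ^ (i + M₀) • h + (p : ℤ_[p]) • h' →
      ∃ g₁ g₂ : G, t ^ M₀ • g = t ^ i • g₁ + (p : ℤ_[p]) • g₂) {a : ℕ}
    (hN : ∀ x : N, (p : ℤ_[p]) ^ a • x = 0) :
    ∃ M, ∀ (i : ℕ) (u : G ⊗[ℤ_[p]] N) (v : H ⊗[ℤ_[p]] N),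
      rTensor ℤ_[p] N j u = t ^ (i + M) • v → ∃ w, t ^ M • u = t ^ i • w := by
  induction a generalizing N with
  | zero =>
    have : Subsingleton N := ⟨fun x y => by
      rw [← one_smul ℤ_[p] x, ← one_smul ℤ_[p] y, ← pow_zero (p : ℤ_[p]), hN, hN]⟩
    exact ⟨0, fun _ _ _ _ => ⟨0, Subsingleton.elim _ _⟩⟩
  | succ a ih =>
    obtain ⟨M', hM'⟩ := ih (p_pow_smul_pPow_eq_zero hN)
    refine ⟨M' + M₀ + M₀, fun i u v huv => ?_⟩
    set π := (pPow p N 1).mkQ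
    have h1 : ∃ w, lTensor S G π (t ^ M₀ • u) = t ^ (i + M' + M₀) • lTensor S G π w := by
      obtain ⟨s, c, hc1, hc0, hs⟩ := exists_basis_of_p_smul_eq_zero
        (p_smul_quotient_eq_zero (p := p) (N := N))
      obtain ⟨g, hg⟩ := exists_finset_sum_eq hs (lTensor S G π u)
      obtain ⟨h, hh⟩ := exists_finset_sum_eq hs (lTensor S H π v)
      classical
      have hg := hg (g.support ∪ h.support) Finset.subset_union_left
      have hh := hh (g.support ∪ h.support) Finset.subset_union_right
      have hz : ∑ i' ∈ g.support ∪ h.support, (j (g i') - t ^ (i + M' + M₀ + M₀) • h i') ⊗ₜ[ℤ_[p]]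
          (i' : N ⧸ pPow p N 1) = 0 := by
        have h2 := lTensor_rTensor_comm' j π u
        rw [huv, map_smul, hg, hh, map_sum, Finset.smul_sum, ← sub_eq_zero,
          ← neg_eq_zero, neg_sub, ← Finset.sum_sub_distrib] at h2
        rw [← h2]
        refine Finset.sum_congr rfl fun i' _ => ?_
        rw [TensorProduct.sub_tmul, add_assoc i, add_assoc i]
        rfl
      have h3 : ∀ i', ∃ g₁ g₂ : G, i' ∈ g.support ∪ h.support →
          t ^ M₀ • g i' = t ^ (i + M' + M₀) • g₁ + (p : ℤ_[p]) • g₂ := fun i' => by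
        by_cases hi' : i' ∈ g.support ∪ h.support
        · obtain ⟨g', hg'⟩ := exists_eq_p_smul_of_sum_eq_zero hc1 hc0 hz hi'
          obtain ⟨g₁, g₂, h12⟩ := hj _ _ _ _ (sub_eq_iff_eq_add'.1 hg')
          exact ⟨g₁, g₂, fun _ => h12⟩
        · exact ⟨0, 0, fun h => absurd h hi'⟩
      choose g₁ g₂ h12 using h3
      obtain ⟨w, hw⟩ := LinearMap.lTensor_surjective G (Submodule.mkQ_surjective (pPow p N 1))
        (∑ i' ∈ g.support ∪ h.support, g₁ i' ⊗ₜ[ℤ_[p]] (i' : N ⧸ pPow p N 1))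
      refine ⟨w, ?_⟩
      change _ = t ^ (i + M' + M₀) • π.lTensor G w
      rw [hw, map_smul, hg, Finset.smul_sum, Finset.smul_sum]
      refine Finset.sum_congr rfl fun i' hi' => ?_
      rw [TensorProduct.smul_tmul', h12 i' hi', TensorProduct.add_tmul,
        TensorProduct.smul_tmul (p : ℤ_[p]), p_smul_quotient_eq_zero, TensorProduct.tmul_zero, add_zero, TensorProduct.smul_tmul']
    obtain ⟨w, hw⟩ := h1
    rw [← map_smul, ← sub_eq_zero, ← map_sub] at hw
    obtain ⟨u', hu'⟩ := exists_eq_lTensor_subtype hw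
    have hu' : lTensor S G (pPow p N 1).subtype u' = t ^ M₀ • u - t ^ (i + M' + M₀) • w := hu'
    -- `v'` becomes divisible by `t ^ (i + M' + M₀)` in `H ⊗ N`, hence by `t ^ (i + M')` in `H ⊗ p N`
    have h2 : lTensor S H (pPow p N 1).subtype (rTensor ℤ_[p] _ j u') =
        t ^ (i + M' + M₀) • (t ^ M₀ • t ^ M₀ • v - rTensor ℤ_[p] _ j w) := by
      rw [lTensor_rTensor_comm', hu', map_sub, map_smul, map_smul, huv, smul_sub]
      simp only [smul_smul, ← pow_add]
      congr 3
      ring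
    set v' := t ^ M₀ • t ^ M₀ • v - rTensor ℤ_[p] _ j w
    have h3 : t ^ (i + M' + M₀) • lTensor S H π v' = 0 := by
      rw [← map_smul, ← h2]
      have : π ∘ₗ (pPow p N 1).subtype = 0 := by
        ext x
        simp [π]
      change π.lTensor H ((pPow p N 1).subtype.lTensor H _) = 0
      rw [← LinearMap.comp_apply, ← LinearMap.lTensor_comp, this, LinearMap.lTensor_zero,
        LinearMap.zero_apply]
    have h4 := torsion_bounded_of_killed hH (a := 1)
      (fun x => by rw [pow_one]; exact p_smul_quotient_eq_zero x) h3
    rw [one_mul, ← map_smul] at h4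
    obtain ⟨v'', hv''⟩ := exists_eq_lTensor_subtype h4
    have hv'' : lTensor S H (pPow p N 1).subtype v'' = t ^ M₀ • v' := hv''
    have h5 : rTensor ℤ_[p] _ j u' = t ^ (i + M') • v'' := by
      apply lTensor_subtype_injective (G := H) (pPow p N 1)
      change lTensor S H (pPow p N 1).subtype _ = lTensor S H (pPow p N 1).subtype _
      rw [h2, map_smul, hv'', smul_smul, ← pow_add]
    obtain ⟨w', hw'⟩ := hM' i u' v'' h5
    refine ⟨t ^ M₀ • (lTensor S G (pPow p N 1).subtype w' + t ^ (M' + M' + M₀) • w), ?_⟩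
    have h6 : t ^ M₀ • u = lTensor S G (pPow p N 1).subtype u' + t ^ (i + M' + M₀) • w := by
      rw [hu']; abel
    have h7 := congrArg (lTensor S G (pPow p N 1).subtype) hw'
    rw [map_smul, map_smul] at h7
    have h8 : t ^ (M' + M₀ + M₀) • u = t ^ M₀ • t ^ M' • t ^ M₀ • u := by
      simp only [smul_smul, ← pow_add]
      congr 2
      ring
    rw [h8, h6, smul_add, h7]
    simp only [smul_add, smul_smul, ← pow_add]
    congr 3 <;> ring

end Killed

/-! ### Completed and localised modules: elements, injectivity and continuity -/

section CplLocGeneral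

variable {S : Type*} [CommRing S] {π : S} {M N : Type*} [AddCommGroup M] [Module S M]
  [AddCommGroup N] [Module S N]

theorem quotient_mk_eq_zero_iff (n : ℕ) (x : M) :
    (Submodule.Quotient.mk x : M ⧸ ((Ideal.span {π}) ^ n • ⊤ : Submodule S M)) = 0 ↔
      ∃ y, x = π ^ n • y := by
  rw [Submodule.Quotient.mk_eq_zero, Ideal.span_singleton_pow, Submodule.ideal_span_singleton_smul]
  exact ⟨fun ⟨y, _, hy⟩ => ⟨y, hy.symm⟩, fun ⟨y, hy⟩ => ⟨y, trivial, hy.symm⟩⟩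

theorem Cpl.eval_of (n : ℕ) (x : M) : AdicCompletion.eval (Ideal.span {π}) M n
    (AdicCompletion.of _ M x) = Submodule.Quotient.mk x := rfl

theorem Cpl.exists_eval_eq (m : Cpl π M) (n : ℕ) :
    ∃ x : M, AdicCompletion.eval _ M n m = Submodule.Quotient.mk x :=
  ⟨_, (Submodule.Quotient.mk_surjective _ (AdicCompletion.eval _ M n m)).choose_spec.symm⟩

theorem Cpl.eval_eq_of_le {m m' : Cpl π M} {i j : ℕ} (h : i ≤ j)
    (hm : AdicCompletion.eval _ M j m = AdicCompletion.eval _ M j m') :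
    AdicCompletion.eval _ M i m = AdicCompletion.eval _ M i m' := by
  have h1 := fun m : Cpl π M => AdicCompletion.transitionMap_comp_eval_apply
    (I := Ideal.span {π}) (M := M) h m
  exact ((h1 m).symm.trans (congrArg _ hm)).trans (h1 m')

theorem Cpl.eq_zero {m : Cpl π M} (h : ∀ n, AdicCompletion.eval _ M n m = 0) : m = 0 :=
  AdicCompletion.ext fun n => by
    have := h n
    simpa using this

theorem Cpl.eval_pow_smul (n : ℕ) (m : Cpl π M) :
    AdicCompletion.eval _ M n (π ^ n • m) = 0 := by
  obtain ⟨x, hx⟩ := m.exists_eval_eq n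
  rw [map_smul, hx, ← Submodule.Quotient.mk_smul, quotient_mk_eq_zero_iff]
  exact ⟨x, rfl⟩

theorem Cpl.exists_eq_pow_smul {n : ℕ} {m : Cpl π M} (h : AdicCompletion.eval _ M n m = 0) :
    ∃ m', m = π ^ n • m' := by
  have h1 : m ∈ (Ideal.span {π} ^ n • ⊤ : Submodule S (Cpl π M)) := by
    have h2 := AdicCompletion.pow_smul_top_eq_ker_eval (I := Ideal.span {π}) (M := M) (n := n)
      ⟨{π}, by simp⟩
    rw [h2]
    exact h
  rw [Ideal.span_singleton_pow, Submodule.ideal_span_singleton_smul] at h1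
  obtain ⟨m', _, rfl⟩ := h1
  exact ⟨m', rfl⟩

/-- An element of the completion is the limit of a Cauchy sequence. -/
theorem Cpl.exists_seq (m : Cpl π M) : ∃ x : ℕ → M,
    (∀ i, AdicCompletion.eval _ M i m = Submodule.Quotient.mk (x i)) ∧
      ∀ i, ∃ y, x (i + 1) - x i = π ^ i • y := by
  choose x hx using m.exists_eval_eq
  refine ⟨x, hx, fun i => ?_⟩
  rw [← quotient_mk_eq_zero_iff, Submodule.Quotient.mk_sub, ← hx, sub_eq_zero]
  have h : AdicCompletion.eval _ M (i + 1) m =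
      AdicCompletion.eval _ M (i + 1) (AdicCompletion.of (Ideal.span {π}) M (x (i + 1))) := hx (i + 1)
  exact (Cpl.eval_eq_of_le (Nat.le_succ i) h).symm

theorem Cpl.eval_map (g : M →ₗ[S] N) {m : Cpl π M} {i : ℕ} {x : M}
    (h : AdicCompletion.eval _ M i m = Submodule.Quotient.mk x) :
    AdicCompletion.eval _ N i (AdicCompletion.map (Ideal.span {π}) g m) =
      Submodule.Quotient.mk (g x) := by
  rw [← Cpl.eval_of, ← AdicCompletion.map_of]
  change _ = AdicCompletion.eval _ M i (AdicCompletion.of (Ideal.span {π}) M x) at h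
  have : ∀ m : Cpl π M, AdicCompletion.eval _ N i (AdicCompletion.map (Ideal.span {π}) g m) =
      LinearMap.reduceModIdeal (Ideal.span {π} ^ i) g (AdicCompletion.eval _ M i m) :=
    fun m => AdicCompletion.map_val_apply ..
  rw [this, this, h]

theorem Cpl.eq_zero_of_smul_eq_zero (hM : ∀ x : M, π • x = 0 → x = 0) {m : Cpl π M}
    (h : π • m = 0) : m = 0 := by
  obtain ⟨x, hx, -⟩ := m.exists_seq
  refine Cpl.eq_zero fun n => ?_
  have h1 := congrArg (AdicCompletion.eval _ M (n + 1)) h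
  rw [map_smul, hx, map_zero, ← Submodule.Quotient.mk_smul, quotient_mk_eq_zero_iff] at h1
  obtain ⟨y, hy⟩ := h1
  rw [pow_succ', mul_smul, ← sub_eq_zero, ← smul_sub] at hy
  have h2 := sub_eq_zero.1 (hM _ hy)
  have h3 : AdicCompletion.eval _ M (n + 1) m =
      AdicCompletion.eval _ M (n + 1) (AdicCompletion.of (Ideal.span {π}) M (x (n + 1))) := hx (n + 1)
  rw [Cpl.eval_eq_of_le (Nat.le_succ n) h3, Cpl.eval_of, quotient_mk_eq_zero_iff]
  exact ⟨y, h2⟩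

theorem eq_zero_of_pow_smul_eq_zero (hM : ∀ x : M, π • x = 0 → x = 0) {n : ℕ} {x : M}
    (h : π ^ n • x = 0) : x = 0 := by
  induction n with
  | zero => simpa using h
  | succ n ih => exact ih (hM _ (by rwa [smul_smul, ← pow_succ']))

theorem CplLoc.exists_pow_smul_eq_mk (z : CplLoc π M) : ∃ n m, π ^ n • z = CplLoc.mk π M m := by
  obtain ⟨⟨m, s, n, hs⟩, h⟩ := IsLocalizedModule.surj (Submonoid.powers π) (CplLoc.mk π M) z
  refine ⟨n, m, ?_⟩
  rw [← h]
  change π ^ n • z = s • z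
  rw [← hs]

theorem CplLoc.pow_smul_injective (n : ℕ) :
    Function.Injective fun z : CplLoc π M => π ^ n • z :=
  IsLocalizedModule.smul_injective (CplLoc.mk π M) (⟨π ^ n, n, rfl⟩ : Submonoid.powers π)

theorem CplLoc.mk_eq_zero_iff {m : Cpl π M} : CplLoc.mk π M m = 0 ↔ ∃ n : ℕ, π ^ n • m = 0 := by
  rw [IsLocalizedModule.eq_zero_iff (Submonoid.powers π)]
  constructor
  · rintro ⟨⟨_, n, rfl⟩, h⟩
    exact ⟨n, h⟩
  · rintro ⟨n, h⟩
    exact ⟨⟨π ^ n, n, rfl⟩, h⟩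

theorem CplLoc.mk_injective (hM : ∀ x : M, π • x = 0 → x = 0) :
    Function.Injective (CplLoc.mk π M) := by
  refine (injective_iff_map_eq_zero _).2 fun m hm => ?_
  obtain ⟨n, hn⟩ := CplLoc.mk_eq_zero_iff.1 hm
  exact eq_zero_of_pow_smul_eq_zero (fun _ => Cpl.eq_zero_of_smul_eq_zero hM) hn

theorem CplLoc.smul_eq_zero_of_forall {c : S} (hc : ∀ x : M, c • x = 0) (z : CplLoc π M) :
    c • z = 0 := by
  obtain ⟨n, m, h⟩ := z.exists_pow_smul_eq_mk
  apply CplLoc.pow_smul_injective n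
  change π ^ n • c • z = π ^ n • 0
  rw [smul_comm, h, smul_zero, ← map_smul]
  have : c • m = 0 := Cpl.eq_zero fun i => by
    obtain ⟨x, hx⟩ := m.exists_eval_eq i
    rw [map_smul, hx, ← Submodule.Quotient.mk_smul, hc, Submodule.Quotient.mk_zero]
  rw [this, map_zero]

/-- If a Cauchy sequence `x` is divisible by `π^i` at the `i`-th place, up to a fixed power of
`π`, then its limit is zero in the localised completion. -/
theorem CplLoc.mk_eq_zero_of_seq {m : Cpl π M} {x : ℕ → M}
    (hx : ∀ i, AdicCompletion.eval _ M i m = Submodule.Quotient.mk (x i)) {k : ℕ}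
    (h : ∀ i, ∃ y, π ^ k • x i = π ^ i • y) : CplLoc.mk π M m = 0 := by
  refine CplLoc.mk_eq_zero_iff.2 ⟨k, Cpl.eq_zero fun i => ?_⟩
  rw [map_smul, hx, ← Submodule.Quotient.mk_smul, quotient_mk_eq_zero_iff]
  exact h i

theorem CplLoc.map_injective (g : M →ₗ[S] N)
    (h : ∀ x : ℕ → M, (∀ i, ∃ y, x (i + 1) - x i = π ^ i • y) →
      (∀ i, ∃ y, g (x i) = π ^ i • y) → ∃ k, ∀ i, ∃ y, π ^ k • x i = π ^ i • y) :
    Function.Injective (CplLoc.map π g) := by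
  refine (injective_iff_map_eq_zero _).2 fun z hz => ?_
  obtain ⟨n, m, hm⟩ := z.exists_pow_smul_eq_mk
  have h1 := congrArg (CplLoc.map π g) hm
  rw [map_smul, hz, smul_zero, CplLoc.map_mk] at h1
  obtain ⟨k, hk⟩ := CplLoc.mk_eq_zero_iff.1 h1.symm
  have h1 : AdicCompletion.map (Ideal.span {π}) g (π ^ k • m) = 0 :=
    (((AdicCompletion.map (Ideal.span {π}) g).restrictScalars S).map_smul (π ^ k) m).trans hk
  obtain ⟨x, hx, hx'⟩ := (π ^ k • m).exists_seq
  obtain ⟨k', hk'⟩ := h x hx' fun i => by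
    rw [← quotient_mk_eq_zero_iff, ← Cpl.eval_map g (hx i), h1, map_zero]
  have h2 := CplLoc.mk_eq_zero_of_seq hx hk'
  rw [map_smul, ← hm, smul_smul, ← pow_add] at h2
  apply CplLoc.pow_smul_injective (k + n)
  change π ^ (k + n) • z = π ^ (k + n) • 0
  rw [h2, smul_zero]

/-- If `g` annihilates the limit of the Cauchy sequence `x` and `N` is `π`-torsion free, then
`g (x i)` is divisible by `π^i`. -/
theorem CplLoc.exists_eq_pow_smul_of_map_eq_zero (g : M →ₗ[S] N) (hN : ∀ x : N, π • x = 0 → x = 0)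
    {m : Cpl π M} {x : ℕ → M}
    (hx : ∀ i, AdicCompletion.eval _ M i m = Submodule.Quotient.mk (x i))
    (h : CplLoc.map π g (CplLoc.mk π M m) = 0) (i : ℕ) : ∃ y, g (x i) = π ^ i • y := by
  rw [CplLoc.map_mk] at h
  have h1 := CplLoc.mk_injective hN (h.trans (map_zero _).symm)
  rw [← quotient_mk_eq_zero_iff, ← Cpl.eval_map g (hx i), h1, map_zero]

/-! #### Topology -/

theorem Cpl.continuous_eval (i : ℕ) :
    @Continuous (Cpl π M) _ _ ⊥ (AdicCompletion.eval (Ideal.span {π}) M i) :=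
  continuous_iInf_dom (i := i) continuous_induced_dom

theorem Cpl.nhds_eq (m : Cpl π M) : nhds m =
    ⨅ i, Filter.comap (AdicCompletion.eval (Ideal.span {π}) M i)
      (pure (AdicCompletion.eval (Ideal.span {π}) M i m)) := by
  refine nhds_iInf.trans (iInf_congr fun i => ?_)
  let _ : TopologicalSpace (M ⧸ ((Ideal.span {π}) ^ i • ⊤ : Submodule S M)) := ⊥
  have _ : DiscreteTopology (M ⧸ ((Ideal.span {π}) ^ i • ⊤ : Submodule S M)) := ⟨rfl⟩
  exact (nhds_induced _ _).trans (by rw [nhds_discrete])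

theorem Cpl.isOpen_iff {U : Set (Cpl π M)} : IsOpen U ↔ ∀ m ∈ U, ∃ i, ∀ m',
    AdicCompletion.eval _ M i m' = AdicCompletion.eval _ M i m → m' ∈ U := by
  constructor
  · intro hU m hm
    have h := hU.mem_nhds hm
    rw [Cpl.nhds_eq, Filter.mem_iInf_of_directed] at h
    · obtain ⟨i, t, ht, htU⟩ := h
      exact ⟨i, fun m' hm' => htU (by rw [Set.mem_preimage, hm']; exact ht)⟩
    · refine directed_of_isDirected_le fun i j hij => ?_
      intro t ht
      obtain ⟨s, hs, hst⟩ := Filter.mem_comap.1 ht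
      refine Filter.mem_comap.2 ⟨{AdicCompletion.eval _ M j m}, Set.mem_singleton _, ?_⟩
      intro m' hm'
      apply hst
      rw [Set.mem_preimage, Cpl.eval_eq_of_le hij hm']
      exact hs
  · intro h
    rw [isOpen_iff_mem_nhds]
    intro m hm
    obtain ⟨i, hi⟩ := h m hm
    have h1 := (@Continuous.isOpen_preimage _ _ _ ⊥ _ (Cpl.continuous_eval (π := π) (M := M) i)
      {AdicCompletion.eval _ M i m} trivial)
    exact Filter.mem_of_superset (h1.mem_nhds rfl) fun m' hm' => hi m' hm'

theorem Cpl.continuous_map (g : M →ₗ[S] N) :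
    Continuous (AdicCompletion.map (Ideal.span {π}) g : Cpl π M → Cpl π N) := by
  refine continuous_def.2 fun U hU => Cpl.isOpen_iff.2 fun m hm => ?_
  obtain ⟨i, hi⟩ := Cpl.isOpen_iff.1 hU _ hm
  refine ⟨i, fun m' hm' => hi _ ?_⟩
  obtain ⟨x, hx⟩ := m.exists_eval_eq i
  rw [Cpl.eval_map g hx, Cpl.eval_map g (hm'.trans hx)]

theorem CplLoc.pow_smul_div (n : ℕ) (m : Cpl π M) :
    π ^ n • CplLoc.div π M n m = CplLoc.mk π M m := by
  refine (LocalizedModule.smul'_mk (S := Submonoid.powers π) (π ^ n) m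
    ⟨π ^ n, n, rfl⟩).trans
    (LocalizedModule.mk_eq.2 ?_)
  exact ⟨1, by simp [Submonoid.smul_def]⟩

theorem CplLoc.div_eq_iff {n : ℕ} {m : Cpl π M} {z : CplLoc π M} :
    CplLoc.div π M n m = z ↔ CplLoc.mk π M m = π ^ n • z := by
  rw [← CplLoc.pow_smul_div n m]
  exact (CplLoc.pow_smul_injective n).eq_iff.symm

theorem CplLoc.continuous_iff {X : Type*} [TopologicalSpace X] {f : CplLoc π M → X} :
    Continuous f ↔ ∀ n, Continuous fun m => f (CplLoc.div π M n m) := by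
  refine continuous_iSup_dom.trans (forall_congr' fun n => ?_)
  exact continuous_coinduced_dom

theorem CplLoc.continuous_div (n : ℕ) : Continuous (CplLoc.div π M n) :=
  CplLoc.continuous_iff.1 continuous_id n

theorem CplLoc.continuous_mk : Continuous (CplLoc.mk π M) := by
  have h : ⇑(CplLoc.mk π M) = CplLoc.div π M 0 := funext fun m => by
    rw [← CplLoc.pow_smul_div 0 m, pow_zero, one_smul]
  rw [h]
  exact CplLoc.continuous_div 0

theorem CplLoc.continuous_map (g : M →ₗ[S] N) : Continuous (CplLoc.map π g) := by
  refine CplLoc.continuous_iff.2 fun n => ?_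
  convert (CplLoc.continuous_div n).comp (Cpl.continuous_map (π := π) g) using 2 with m
  refine (CplLoc.div_eq_iff.2 ?_).symm
  rw [← map_smul, CplLoc.pow_smul_div, CplLoc.map_mk]

/-- The inverse of the multiplication by `π^n`. -/
def CplLoc.divPow (π : S) (M : Type*) [AddCommGroup M] [Module S M] (n : ℕ) :
    CplLoc π M →ₗ[S] CplLoc π M :=
  (LinearEquiv.ofBijective (LinearMap.lsmul S (CplLoc π M) (π ^ n))
    ((Module.End.isUnit_iff _).1 (IsLocalizedModule.map_units (CplLoc.mk π M)
      (⟨π ^ n, n, rfl⟩ : Submonoid.powers π)))).symm.toLinearMap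

theorem CplLoc.pow_smul_divPow (n : ℕ) (z : CplLoc π M) : π ^ n • CplLoc.divPow π M n z = z :=
  LinearEquiv.apply_symm_apply (LinearEquiv.ofBijective (LinearMap.lsmul S (CplLoc π M) (π ^ n))
    ((Module.End.isUnit_iff _).1 (IsLocalizedModule.map_units (CplLoc.mk π M)
      (⟨π ^ n, n, rfl⟩ : Submonoid.powers π)))) z

theorem CplLoc.continuous_divPow (n : ℕ) : Continuous (CplLoc.divPow π M n) := by
  refine CplLoc.continuous_iff.2 fun k => ?_
  convert CplLoc.continuous_div (π := π) (M := M) (k + n) using 2 with m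
  refine (CplLoc.div_eq_iff.2 ?_).symm
  rw [pow_add, mul_smul, CplLoc.pow_smul_divPow, CplLoc.pow_smul_div]

theorem CplLoc.isOpen_coset (c : CplLoc π M) (n : ℕ) :
    IsOpen {z : CplLoc π M | ∃ m, AdicCompletion.eval _ M n m = 0 ∧ z - c = CplLoc.mk π M m} := by
  refine isOpen_iSup_iff.2 fun k => isOpen_coinduced.2 (Cpl.isOpen_iff.2 ?_)
  rintro m ⟨m₀, hm₀, h⟩
  refine ⟨k + n, fun m' hm' => ?_⟩
  obtain ⟨q, hq⟩ := Cpl.exists_eq_pow_smul (sub_eq_zero.2 hm' |> (map_sub _ m' m).trans)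
  refine ⟨m₀ + π ^ n • q, by rw [map_add, hm₀, Cpl.eval_pow_smul, zero_add], ?_⟩
  have h1 : CplLoc.div π M k m' = CplLoc.div π M k m + CplLoc.mk π M (π ^ n • q) := by
    rw [CplLoc.div_eq_iff, smul_add, CplLoc.pow_smul_div, ← map_smul, ← map_add, smul_smul,
      ← pow_add, ← hq]
    congr 1
    abel
  rw [h1, map_add, ← h]
  abel

/-- Continuous linear maps into the localised completion of a `π`-torsion free module are
determined by their restriction to `M`. -/
theorem CplLoc.eq_of_continuous (hN : ∀ x : N, π • x = 0 → x = 0)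
    {f g : CplLoc π M →ₗ[S] CplLoc π N} (hf : Continuous f) (hg : Continuous g)
    (h : ∀ x, f (CplLoc.of π M x) = g (CplLoc.of π M x)) : f = g := by
  have key : ∀ m, f (CplLoc.mk π M m) = g (CplLoc.mk π M m) := by
    intro m
    have h1 : ∀ n, ∃ m₀, AdicCompletion.eval _ N n m₀ = 0 ∧
        g (CplLoc.mk π M m) - f (CplLoc.mk π M m) = CplLoc.mk π N m₀ := by
      intro n
      obtain ⟨i, hi⟩ := Cpl.isOpen_iff.1 ((CplLoc.isOpen_coset (f (CplLoc.mk π M m)) n).preimage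
        (hf.comp CplLoc.continuous_mk)) m ⟨0, by simp, by simp⟩
      obtain ⟨j, hj⟩ := Cpl.isOpen_iff.1 ((CplLoc.isOpen_coset (g (CplLoc.mk π M m)) n).preimage
        (hg.comp CplLoc.continuous_mk)) m ⟨0, by simp, by simp⟩
      obtain ⟨x, hx⟩ := m.exists_eval_eq (max i j)
      obtain ⟨m₁, hm₁, h₁⟩ := hi (AdicCompletion.of _ M x)
        (Cpl.eval_eq_of_le (le_max_left i j) hx.symm)
      obtain ⟨m₂, hm₂, h₂⟩ := hj (AdicCompletion.of _ M x)
        (Cpl.eval_eq_of_le (le_max_right i j) hx.symm)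
      refine ⟨m₁ - m₂, by rw [map_sub, hm₁, hm₂, sub_zero], ?_⟩
      rw [map_sub, ← h₁, ← h₂]
      have h3 := h x
      change f (CplLoc.mk π M (AdicCompletion.of _ M x)) =
        g (CplLoc.mk π M (AdicCompletion.of _ M x)) at h3
      rw [Function.comp_apply, Function.comp_apply, h3]
      abel
    choose m₀ hm₀ h₀ using h1
    have h2 : m₀ 0 = 0 := Cpl.eq_zero fun n => by
      rw [CplLoc.mk_injective hN ((h₀ 0).symm.trans (h₀ n)), hm₀]
    have h3 := h₀ 0
    rw [h2, map_zero, sub_eq_zero] at h3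
    exact h3.symm
  refine LinearMap.ext fun z => ?_
  obtain ⟨n, m, hm⟩ := z.exists_pow_smul_eq_mk
  apply CplLoc.pow_smul_injective n
  change π ^ n • f z = π ^ n • g z
  rw [← map_smul, ← map_smul, hm, key]

end CplLocGeneral

/-! ### Torsion in finitely generated modules over algebras topologically of finite type -/

section BoundedTorsion

variable {p : ℕ} [Fact p.Prime]

theorem IsTopFiniteType.isNoetherianRing_quotient {R : Type*} [CommRing R] [Algebra ℤ_[p] R]
    (hR : IsTopFiniteType p R) : IsNoetherianRing (R ⧸ Ideal.span {(p : R)}) := by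
  obtain ⟨-, s, hs⟩ := hR
  classical
  have : Algebra.FiniteType ℤ_[p] (R ⧸ Ideal.span {(p : R)}) := by
    refine ⟨⟨s.image (Ideal.Quotient.mkₐ ℤ_[p] (Ideal.span {(p : R)})), ?_⟩⟩
    rw [Finset.coe_image, ← AlgHom.map_adjoin, eq_top_iff]
    intro x _
    obtain ⟨x, rfl⟩ := Ideal.Quotient.mk_surjective x
    obtain ⟨y, hy, z, rfl⟩ := hs x 1
    refine ⟨y, hy, ?_⟩
    refine (Ideal.Quotient.eq.2 ?_ : Ideal.Quotient.mk (Ideal.span {(p : R)}) y = _)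
    rw [Ideal.mem_span_singleton]
    exact ⟨-z, by ring⟩
  exact Algebra.FiniteType.isNoetherianRing ℤ_[p] _

theorem isNoetherian_quotient_smul_top {R M : Type*} [CommRing R] [AddCommGroup M] [Module R M]
    [Module.Finite R M] (I : Ideal R) (hI : IsNoetherianRing (R ⧸ I)) :
    IsNoetherian R (M ⧸ (I • ⊤ : Submodule R M)) := by
  refine ⟨fun N => ?_⟩
  let N' : Submodule (R ⧸ I) (M ⧸ (I • ⊤ : Submodule R M)) :=
    { N.toAddSubmonoid with
      smul_mem' := fun c x hx => by
        obtain ⟨c, rfl⟩ := Ideal.Quotient.mk_surjective c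
        exact N.smul_mem c hx }
  have : IsNoetherian (R ⧸ I) (M ⧸ (I • ⊤ : Submodule R M)) :=
    isNoetherian_of_isNoetherianRing_of_finite _ _
  have h : N'.FG := IsNoetherian.noetherian N'
  exact h.restrictScalars_of_surjective Ideal.Quotient.mk_surjective

theorem eq_zero_of_forall_p_pow {A : Type*} [AddCommGroup A] [Module ℤ_[p] A]
    [IsHausdorff (Ideal.span {(p : ℤ_[p])}) A] {a : A}
    (h : ∀ k : ℕ, ∃ b : A, a = (p : ℤ_[p]) ^ k • b) : a = 0 := by
  refine IsHausdorff.haus (I := Ideal.span {(p : ℤ_[p])}) inferInstance a fun n => ?_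
  rw [SModEq.zero, Ideal.span_singleton_pow, Submodule.ideal_span_singleton_smul]
  obtain ⟨b, rfl⟩ := h n
  exact ⟨b, trivial, rfl⟩

/-- The `p`-power torsion of `A` is bounded. The `R`-submodules
`{a | p^n a ∈ p^{n+1} A}` of `A` contain `p A` and increase with `n`, so they stabilise. -/
theorem exists_torsion_bound {R : Type*} [CommRing R] [Algebra ℤ_[p] R]
    (hR : IsTopFiniteType p R) {A : Type*} [AddCommGroup A] [Module ℤ_[p] A] [Module R A]
    [IsScalarTower ℤ_[p] R A] [Module.Finite R A] [IsHausdorff (Ideal.span {(p : ℤ_[p])}) A] :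
    ∃ c : ℕ, ∀ (n : ℕ) (a : A), (p : ℤ_[p]) ^ n • a = 0 → (p : ℤ_[p]) ^ c • a = 0 := by
  have hp : ∀ (n : ℕ) (a : A), (p : R) ^ n • a = (p : ℤ_[p]) ^ n • a := fun n a => by
    rw [← algebraMap_smul R ((p : ℤ_[p]) ^ n) a, map_pow, map_natCast]
  set I := Ideal.span {(p : R)}
  have hN := isNoetherian_quotient_smul_top (M := A) I hR.isNoetherianRing_quotient
  let V : ℕ →o Submodule R (A ⧸ (I • ⊤ : Submodule R A)) :=
    { toFun := fun n => (((⊤ : Submodule R A).map (LinearMap.lsmul R A ((p : R) ^ (n + 1)))).comap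
        (LinearMap.lsmul R A ((p : R) ^ n))).map (Submodule.mkQ _)
      monotone' := monotone_nat_of_le_succ fun n => Submodule.map_mono fun a => by
        rintro ⟨b, -, hb⟩
        refine ⟨b, trivial, ?_⟩
        simp only [LinearMap.lsmul_apply] at hb ⊢
        rw [pow_succ', mul_smul, hb, ← mul_smul, ← pow_succ'] }
  obtain ⟨c, hc⟩ := monotone_stabilizes_iff_noetherian.2 hN V
  have hc : ∀ n, c ≤ n → ∀ a b : A, (p : ℤ_[p]) ^ n • a = (p : ℤ_[p]) ^ (n + 1) • b →
      ∃ b : A, (p : ℤ_[p]) ^ c • a = (p : ℤ_[p]) ^ (c + 1) • b := by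
    intro n hn a b hab
    have h1 : Submodule.mkQ (I • ⊤ : Submodule R A) a ∈ V n :=
      ⟨a, ⟨b, trivial, by
        simp only [LinearMap.lsmul_apply]
        rw [hp, hp, hab]⟩, rfl⟩
    rw [← hc n hn] at h1
    obtain ⟨a', ⟨b', -, hb'⟩, ha'⟩ := h1
    rw [← sub_eq_zero, ← map_sub, Submodule.mkQ_apply, Submodule.Quotient.mk_eq_zero,
      Submodule.ideal_span_singleton_smul] at ha'
    obtain ⟨d, -, hd⟩ := ha'
    simp only [LinearMap.lsmul_apply] at hb'
    rw [hp, hp] at hb'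
    have hd : (p : ℤ_[p]) • d = a' - a := by
      rw [← hd, ← pow_one (p : ℤ_[p]), ← hp, pow_one]
      rfl
    refine ⟨b' - d, ?_⟩
    rw [smul_sub, hb', pow_succ _ c, mul_smul _ _ d, hd, ← smul_sub]
    congr 1
    abel
  refine ⟨c, fun n a ha => eq_zero_of_forall_p_pow (p := p) fun k => ?_⟩
  suffices h : ∃ b : A, (p : ℤ_[p]) ^ c • a = (p : ℤ_[p]) ^ (c + k) • b by
    obtain ⟨b, hb⟩ := h
    exact ⟨(p : ℤ_[p]) ^ c • b, by rw [hb, ← mul_smul, ← pow_add, add_comm]⟩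
  induction k with
  | zero => exact ⟨a, rfl⟩
  | succ k ih =>
    obtain ⟨b, hb⟩ := ih
    have h0 : (p : ℤ_[p]) ^ (n + c + k) • b = 0 := by
      rw [add_assoc, pow_add, mul_smul, ← hb, smul_comm, ha, smul_zero]
    obtain ⟨b', hb'⟩ := hc (n + c + k) (by omega) b 0 (by rw [h0, smul_zero])
    refine ⟨b', ?_⟩
    rw [hb, add_comm c k, pow_add, mul_smul, hb', ← mul_smul, ← pow_add]
    congr 2
    ring

theorem isTorsionFree_of_p_smul {F : Type*} [AddCommGroup F] [Module ℤ_[p] F]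
    (hF : ∀ x : F, (p : ℤ_[p]) • x = 0 → x = 0) : Module.IsTorsionFree ℤ_[p] F := by
  refine Module.IsTorsionFree.of_smul_eq_zero fun r m h => ?_
  refine or_iff_not_imp_left.2 fun hr => ?_
  rw [PadicInt.unitCoeff_spec hr, mul_smul] at h
  exact eq_zero_of_pow_smul_eq_zero hF
    ((PadicInt.unitCoeff hr).isUnit.smul_eq_zero.1 h)

theorem pPow_p_smul_eq_zero {A : Type*} [AddCommGroup A] [Module ℤ_[p] A] {c : ℕ}
    (hc : ∀ (n : ℕ) (a : A), (p : ℤ_[p]) ^ n • a = 0 → (p : ℤ_[p]) ^ c • a = 0)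
    (x : pPow p A c) (hx : (p : ℤ_[p]) • x = 0) : x = 0 := by
  obtain ⟨_, a, rfl⟩ := x
  refine Subtype.ext (hc (c + 1) a ?_)
  rw [pow_succ', mul_smul]
  exact congrArg Subtype.val hx

theorem flat_pPow {A : Type*} [AddCommGroup A] [Module ℤ_[p] A] {c : ℕ}
    (hc : ∀ (n : ℕ) (a : A), (p : ℤ_[p]) ^ n • a = 0 → (p : ℤ_[p]) ^ c • a = 0) :
    Module.Flat ℤ_[p] (pPow p A c) := by
  have := isTorsionFree_of_p_smul (pPow_p_smul_eq_zero hc)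
  infer_instance

end BoundedTorsion

/-! ### Functionals on torsion free modules over `ℤ_p` -/

section Functionals

variable {p : ℕ} [Fact p.Prime]

theorem padicInt_eq_of_forall_dvd {v w : ℤ_[p]} (h : ∀ n : ℕ, (p : ℤ_[p]) ^ n ∣ v - w) : v = w := by
  have : IsHausdorff (Ideal.span {(p : ℤ_[p])}) ℤ_[p] := by
    rw [← PadicInt.maximalIdeal_eq_span_p]
    infer_instance
  refine sub_eq_zero.1 (eq_zero_of_forall_p_pow (p := p) fun k => ?_)
  obtain ⟨b, hb⟩ := h k
  exact ⟨b, hb⟩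

theorem padicInt_exists_limit (a : ℕ → ℤ_[p]) (ha : ∀ n, (p : ℤ_[p]) ^ n ∣ a (n + 1) - a n) :
    ∃ v, ∀ n, (p : ℤ_[p]) ^ n ∣ a n - v := by
  have : IsAdicComplete (Ideal.span {(p : ℤ_[p])}) ℤ_[p] := by
    rw [← PadicInt.maximalIdeal_eq_span_p]
    infer_instance
  choose d hd using ha
  obtain ⟨X, hX⟩ := SumsExist.of_isAdicComplete (p : ℤ_[p]) d
  refine ⟨a 0 + X 0, fun n => ⟨-X n, ?_⟩⟩
  have h1 : ∀ n, a n = a 0 + ∑ i ∈ Finset.range n, (p : ℤ_[p]) ^ i * d i := by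
    intro n
    induction n with
    | zero => simp
    | succ n ih => rw [Finset.sum_range_succ, ← add_assoc, ← ih, ← hd]; ring
  rw [h1 n, eq_partialSum_add hX n]
  ring

variable {F : Type*} [AddCommGroup F] [Module ℤ_[p] F]

/-- The coordinate functionals of `F / p F` lift to functionals on `F`. -/
theorem exists_functional_lift (hF : ∀ x : F, (p : ℤ_[p]) • x = 0 → x = 0) {s : Set (F ⧸ pPow p F 1)}
    {c : s → (F ⧸ pPow p F 1) →ₗ[ℤ_[p]] ℤ_[p] ⧸ Ideal.span {(p : ℤ_[p])}}
    (hc1 : ∀ i : s, c i i = 1) (hc0 : ∀ i j : s, i ≠ j → c i j = 0)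
    (hs : Submodule.span ℤ_[p] s = ⊤) (i : s) :
    ∃ h : F →ₗ[ℤ_[p]] ℤ_[p], ∀ f, Ideal.Quotient.mk _ (h f) = c i ((pPow p F 1).mkQ f) := by
  choose e he using fun j : s => Submodule.mkQ_surjective (pPow p F 1) (j : F ⧸ pPow p F 1)
  set φ : (s →₀ ℤ_[p]) →ₗ[ℤ_[p]] F := Finsupp.linearCombination ℤ_[p] e
  have hcφ : ∀ j L, c j ((pPow p F 1).mkQ (φ L)) = Ideal.Quotient.mk _ (L j) := by
    intro j L
    induction L using Finsupp.induction_linear with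
    | zero => simp
    | add L L' h h' => rw [map_add, map_add, map_add, h, h', Finsupp.add_apply, map_add]
    | single k v =>
      rw [Finsupp.linearCombination_single, map_smul, he, map_smul]
      by_cases hjk : j = k
      · subst hjk
        rw [hc1, Finsupp.single_eq_same]
        exact (Algebra.algebraMap_eq_smul_one v).symm
      · rw [hc0 j k hjk, smul_zero, Finsupp.single_eq_of_ne hjk, map_zero]
  have hp0 : ∀ (j : s) (f : F), c j ((pPow p F 1).mkQ ((p : ℤ_[p]) • f)) = 0 := fun j f => by
    have : (pPow p F 1).mkQ ((p : ℤ_[p]) • f) = 0 := by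
      rw [Submodule.mkQ_apply, Submodule.Quotient.mk_eq_zero]
      exact ⟨f, by simp⟩
    rw [this, map_zero]
  -- `φ` is surjective and injective modulo every power of `p`
  have hex : ∀ (n : ℕ) (f : F), ∃ L f', f = φ L + (p : ℤ_[p]) ^ n • f' := by
    have h1 : ∀ f : F, ∃ L f', f = φ L + (p : ℤ_[p]) • f' := by
      intro f
      have hf : (pPow p F 1).mkQ f ∈ Submodule.span ℤ_[p] s := hs ▸ Submodule.mem_top
      have hr : s = (pPow p F 1).mkQ '' Set.range e := by
        rw [← Set.range_comp]
        ext x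
        constructor
        · intro hx
          exact ⟨⟨x, hx⟩, he _⟩
        · rintro ⟨j, rfl⟩
          rw [Function.comp_apply, he]
          exact j.2
      rw [hr, ← Submodule.map_span, ← Finsupp.range_linearCombination] at hf
      obtain ⟨_, ⟨L, rfl⟩, hL⟩ := hf
      rw [← sub_eq_zero, ← map_sub, Submodule.mkQ_apply, Submodule.Quotient.mk_eq_zero] at hL
      obtain ⟨y, hy⟩ := hL
      refine ⟨L, -y, ?_⟩
      rw [LinearMap.smul_apply, LinearMap.id_apply, pow_one] at hy
      rw [smul_neg, hy]
      abel
    intro n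
    induction n with
    | zero => exact fun f => ⟨0, f, by simp⟩
    | succ n ih =>
      intro f
      obtain ⟨L, f', rfl⟩ := ih f
      obtain ⟨L', f'', rfl⟩ := h1 f'
      refine ⟨L + (p : ℤ_[p]) ^ n • L', f'', ?_⟩
      rw [map_add, map_smul, smul_add, smul_smul, ← pow_succ, add_assoc]
  have hinj : ∀ (n : ℕ) (L : s →₀ ℤ_[p]) (f' : F), φ L = (p : ℤ_[p]) ^ n • f' →
      ∀ j, (p : ℤ_[p]) ^ n ∣ L j := by
    intro n
    induction n with
    | zero => intro L f' _ j; simp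
    | succ n ih =>
      intro L f' h
      have h1 : ∀ j, ∃ v, L j = (p : ℤ_[p]) * v := fun j => by
        have h2 := hcφ j L
        rw [h, pow_succ', mul_smul, hp0] at h2
        exact Ideal.mem_span_singleton.1 (Ideal.Quotient.eq_zero_iff_mem.1 h2.symm)
      choose v hv using h1
      have hp : (p : ℤ_[p]) ≠ 0 := Nat.cast_ne_zero.2 (Fact.out : p.Prime).ne_zero
      let L' : s →₀ ℤ_[p] := Finsupp.onFinset L.support v fun j hj => by
        rw [Finsupp.mem_support_iff, hv]
        exact mul_ne_zero hp hj
      have hL : L = (p : ℤ_[p]) • L' := Finsupp.ext fun j => hv j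
      have h3 : φ L' = (p : ℤ_[p]) ^ n • f' := by
        rw [← sub_eq_zero]
        apply hF
        rw [smul_sub, ← map_smul, ← hL, h, smul_smul, ← pow_succ', sub_self]
      intro j
      rw [hv j, pow_succ']
      exact mul_dvd_mul_left _ (ih L' f' h3 j)
  -- the value of the functional is the limit of the `i`-th coordinates
  let P : F → ℤ_[p] → Prop := fun f v => ∀ n : ℕ, ∃ L f', f = φ L + (p : ℤ_[p]) ^ n • f' ∧
    (p : ℤ_[p]) ^ n ∣ L i - v
  have hPex : ∀ f, ∃ v, P f v := by
    intro f
    choose L f' hL using fun n => hex n f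
    obtain ⟨v, hv⟩ := padicInt_exists_limit (fun n => L n i) fun n => by
      refine hinj n (L (n + 1) - L n) (f' n - (p : ℤ_[p]) • f' (n + 1)) ?_ i
      have h := (hL n).symm.trans (hL (n + 1))
      rw [pow_succ, mul_smul] at h
      rw [map_sub, smul_sub, sub_eq_sub_iff_add_eq_add, ← h]
      abel
    exact ⟨v, fun n => ⟨L n, f' n, hL n, hv n⟩⟩
  have hPuniq : ∀ f v v', P f v → P f v' → v = v' := by
    intro f v v' h h'
    refine padicInt_eq_of_forall_dvd fun n => ?_
    obtain ⟨L, g, hL, hv⟩ := h n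
    obtain ⟨L', g', hL', hv'⟩ := h' n
    have h1 : (p : ℤ_[p]) ^ n ∣ (L - L') i := by
      refine hinj n _ (g' - g) ?_ i
      rw [map_sub, smul_sub, sub_eq_sub_iff_add_eq_add, ← hL, hL']
      abel
    have h2 := dvd_sub (dvd_add h1 hv') hv
    rw [Finsupp.sub_apply] at h2
    convert h2 using 1
    ring
  choose h hh using hPex
  have hPc : ∀ f v, P f v → Ideal.Quotient.mk (Ideal.span {(p : ℤ_[p])}) v =
      c i ((pPow p F 1).mkQ f) := by
    intro f v hP
    obtain ⟨L, f', hL, hv⟩ := hP 1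
    rw [pow_one] at hL hv
    rw [hL, map_add, map_add, hp0, hcφ, add_zero, eq_comm, Ideal.Quotient.eq,
      Ideal.mem_span_singleton]
    exact hv
  refine ⟨⟨⟨h, fun f g => ?_⟩, fun a f => ?_⟩, fun f => hPc f _ (hh f)⟩
  · refine hPuniq _ _ _ (hh _) fun n => ?_
    obtain ⟨L, f', hL, hv⟩ := hh f n
    obtain ⟨L', g', hL', hv'⟩ := hh g n
    refine ⟨L + L', f' + g', ?_, ?_⟩
    · conv_lhs => rw [hL, hL']
      rw [map_add, smul_add]
      abel
    · convert dvd_add hv hv' using 1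
      rw [Finsupp.add_apply]
      ring
  · refine hPuniq _ _ _ (hh _) fun n => ?_
    obtain ⟨L, f', hL, hv⟩ := hh f n
    refine ⟨a • L, a • f', ?_, ?_⟩
    · conv_lhs => rw [hL]
      rw [map_smul, smul_add, smul_comm a]
    · convert hv.mul_left a using 1
      rw [Finsupp.smul_apply, smul_eq_mul, RingHom.id_apply, smul_eq_mul]
      ring

/-- An element outside `p F` of a torsion free module `F` takes the value
`1` under some functional: a coordinate of its residue with respect to a basis of `F / p F` is
nonzero, and the coordinate functional lifts to `F`. -/
theorem exists_functional_eq_one (hF : ∀ x : F, (p : ℤ_[p]) • x = 0 → x = 0) {g : F}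
    (hg : ∀ f : F, g ≠ (p : ℤ_[p]) • f) : ∃ h : F →ₗ[ℤ_[p]] ℤ_[p], h g = 1 := by
  obtain ⟨s, c, hc1, hc0, hs⟩ := exists_basis_of_p_smul_eq_zero
    (p_smul_quotient_eq_zero (p := p) (N := F))
  have hi : ∃ i, c i ((pPow p F 1).mkQ g) ≠ 0 := by
    by_contra! hcg
    have hsum : ∀ x : F ⧸ pPow p F 1, (∀ i, c i x = 0) → x = 0 := by
      intro x hx
      have hx' : x ∈ Submodule.span ℤ_[p] (Set.range fun i : s => (i : F ⧸ pPow p F 1)) := by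
        rw [Subtype.range_coe, hs]
        trivial
      obtain ⟨L, rfl⟩ := (Finsupp.mem_span_range_iff_exists_finsupp).1 hx'
      refine Finset.sum_eq_zero fun i hi => ?_
      have h1 := hx i
      rw [Finsupp.sum, map_sum, Finset.sum_eq_single i (fun j _ hj => by
        rw [map_smul, hc0 i j hj.symm, smul_zero]) (fun h => absurd hi h), map_smul, hc1] at h1
      change L i • Ideal.Quotient.mk (Ideal.span {(p : ℤ_[p])}) (1 : ℤ_[p]) = 0 at h1
      rw [← Ideal.Quotient.mk_eq_mk, ← Submodule.Quotient.mk_smul, smul_eq_mul, mul_one,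
        Submodule.Quotient.mk_eq_zero, Ideal.mem_span_singleton] at h1
      obtain ⟨v, hv⟩ := h1
      change L i • (i : F ⧸ pPow p F 1) = 0
      rw [hv, mul_comm, mul_smul, p_smul_quotient_eq_zero, smul_zero]
    have h0 := hsum _ hcg
    rw [Submodule.mkQ_apply, Submodule.Quotient.mk_eq_zero] at h0
    obtain ⟨f, hf⟩ := h0
    exact hg f (by rw [← hf]; simp)
  obtain ⟨i, hi⟩ := hi
  obtain ⟨h, hh⟩ := exists_functional_lift hF hc1 hc0 hs i
  have hu : IsUnit (h g) := by
    by_contra hu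
    rw [← mem_nonunits_iff, ← IsLocalRing.mem_maximalIdeal, PadicInt.maximalIdeal_eq_span_p,
      ← Ideal.Quotient.eq_zero_iff_mem, hh] at hu
    exact hi hu
  obtain ⟨u, hu⟩ := hu
  exact ⟨(↑u⁻¹ : ℤ_[p]) • h, by rw [LinearMap.smul_apply, ← hu, smul_eq_mul, Units.inv_mul]⟩

/-- Finitely many elements of a torsion free and `p`-adically separated module are fixed by an
endomorphism of finite rank. -/
theorem exists_finite_rank_endomorphism (hF : ∀ x : F, (p : ℤ_[p]) • x = 0 → x = 0)
    (hF' : ∀ x : F, (∀ k : ℕ, ∃ y : F, x = (p : ℤ_[p]) ^ k • y) → x = 0) (t : Finset F) :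
    ∃ E ∈ Submodule.span ℤ_[p] {E : F →ₗ[ℤ_[p]] F | ∃ (h : F →ₗ[ℤ_[p]] ℤ_[p]) (f : F),
      E = h.smulRight f}, ∀ x ∈ t, E x = x := by
  classical
  induction t using Finset.induction_on with
  | empty => exact ⟨0, zero_mem _, by simp⟩
  | insert f t _ ih =>
    obtain ⟨E, hE, hEt⟩ := ih
    by_cases hfE : f - E f = 0
    · refine ⟨E, hE, fun x hx => ?_⟩
      rcases Finset.mem_insert.1 hx with rfl | hx
      · exact (sub_eq_zero.1 hfE).symm
      · exact hEt x hx
    -- write `f - E f = p^m g` with `g` not divisible by `p`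
    have h1 : ∃ m g, f - E f = (p : ℤ_[p]) ^ m • g ∧ ∀ y : F, g ≠ (p : ℤ_[p]) • y := by
      by_contra! hcon
      refine hfE (hF' _ fun k => ?_)
      induction k with
      | zero => exact ⟨f - E f, by simp⟩
      | succ k ih =>
        obtain ⟨y, hy⟩ := ih
        obtain ⟨z, rfl⟩ := hcon k y hy
        exact ⟨z, by rw [hy, smul_smul, ← pow_succ]⟩
    obtain ⟨m, g, hg, hg'⟩ := h1
    obtain ⟨h, hh⟩ := exists_functional_eq_one hF hg'
    refine ⟨E + (h ∘ₗ (LinearMap.id - E)).smulRight g,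
      add_mem hE (Submodule.subset_span ⟨_, _, rfl⟩), fun x hx => ?_⟩
    rw [LinearMap.add_apply, LinearMap.smulRight_apply, LinearMap.comp_apply, LinearMap.sub_apply,
      LinearMap.id_apply]
    rcases Finset.mem_insert.1 hx with rfl | hx
    · rw [hg, map_smul, hh, smul_eq_mul, mul_one, ← hg]
      abel
    · rw [hEt x hx, sub_self, map_zero, zero_smul, add_zero]

/-- Membership in a submodule of `G ⊗ F` can be tested by applying all functionals on `F`. -/
theorem mem_of_forall_functional (hF : ∀ x : F, (p : ℤ_[p]) • x = 0 → x = 0)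
    (hF' : ∀ x : F, (∀ k : ℕ, ∃ y : F, x = (p : ℤ_[p]) ^ k • y) → x = 0)
    {G : Type*} [AddCommGroup G] [Module ℤ_[p] G] (Q : Submodule ℤ_[p] (G ⊗[ℤ_[p]] F))
    {u : G ⊗[ℤ_[p]] F}
    (hu : ∀ (h : F →ₗ[ℤ_[p]] ℤ_[p]) (f : F), (h.smulRight f).lTensor G u ∈ Q) : u ∈ Q := by
  classical
  obtain ⟨t, ht⟩ : ∃ t : Finset F, ∀ E : F →ₗ[ℤ_[p]] F, (∀ x ∈ t, E x = x) →
      E.lTensor G u = u := by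
    clear hu
    induction u using TensorProduct.induction_on with
    | zero => exact ⟨∅, fun E _ => map_zero _⟩
    | tmul g f =>
      exact ⟨{f}, fun E hE => by rw [LinearMap.lTensor_tmul, hE f (Finset.mem_singleton_self f)]⟩
    | add u v hu hv =>
      obtain ⟨t, ht⟩ := hu
      obtain ⟨t', ht'⟩ := hv
      refine ⟨t ∪ t', fun E hE => ?_⟩
      rw [map_add, ht E fun x hx => hE x (Finset.mem_union_left _ hx),
        ht' E fun x hx => hE x (Finset.mem_union_right _ hx)]
  obtain ⟨E, hE, hEt⟩ := exists_finite_rank_endomorphism hF hF' t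
  rw [← ht E hEt]
  clear hEt
  induction hE using Submodule.span_induction with
  | mem E hE =>
    obtain ⟨h, f, rfl⟩ := hE
    exact hu h f
  | zero => rw [LinearMap.lTensor_zero]; exact zero_mem _
  | add E E' _ _ h h' => rw [LinearMap.lTensor_add]; exact add_mem h h'
  | smul a E _ h => rw [LinearMap.lTensor_smul]; exact Submodule.smul_mem _ a h

end Functionals

/-! ### Injectivity after tensoring with a module of bounded torsion -/

section Glue

universe u

open TensorProduct.AlgebraTensorModule (lTensor rTensor)

variable {p : ℕ} [Fact p.Prime] {S : Type*} [CommRing S] [Algebra ℤ_[p] S]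
  {G H : Type*} [AddCommGroup G] [Module ℤ_[p] G] [Module S G] [IsScalarTower ℤ_[p] S G]
  [AddCommGroup H] [Module ℤ_[p] H] [Module S H] [IsScalarTower ℤ_[p] S H]

/-- The map `G ⊗ F → G` given by a functional on `F`. -/
def contract (S G : Type*) [CommRing S] [Algebra ℤ_[p] S] [AddCommGroup G] [Module ℤ_[p] G]
    [Module S G] [IsScalarTower ℤ_[p] S G] {F : Type*} [AddCommGroup F] [Module ℤ_[p] F]
    (h : F →ₗ[ℤ_[p]] ℤ_[p]) : G ⊗[ℤ_[p]] F →ₗ[S] G :=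
  (TensorProduct.AlgebraTensorModule.rid ℤ_[p] S G).toLinearMap ∘ₗ lTensor S G h

theorem contract_tmul {F : Type*} [AddCommGroup F] [Module ℤ_[p] F] (h : F →ₗ[ℤ_[p]] ℤ_[p])
    (g : G) (f : F) : contract S G h (g ⊗ₜ f) = h f • g :=
  TensorProduct.AlgebraTensorModule.rid_tmul (R := ℤ_[p]) (A := S) (M := G) (h f) g

theorem contract_tmul_eq {F : Type*} [AddCommGroup F] [Module ℤ_[p] F] (h : F →ₗ[ℤ_[p]] ℤ_[p])
    (f : F) (u : G ⊗[ℤ_[p]] F) :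
    (h.smulRight f).lTensor G u = contract S G h u ⊗ₜ[ℤ_[p]] f := by
  induction u using TensorProduct.induction_on with
  | zero => rw [map_zero, map_zero, TensorProduct.zero_tmul]
  | tmul g f' =>
    rw [contract_tmul (S := S), LinearMap.lTensor_tmul, LinearMap.smulRight_apply, TensorProduct.tmul_smul,
      TensorProduct.smul_tmul']
  | add u v hu hv => rw [map_add, map_add, hu, hv, TensorProduct.add_tmul]

theorem contract_rTensor {F : Type*} [AddCommGroup F] [Module ℤ_[p] F] (h : F →ₗ[ℤ_[p]] ℤ_[p])
    (j : G →ₗ[S] H) (u : G ⊗[ℤ_[p]] F) :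
    contract S H h (rTensor ℤ_[p] F j u) = j (contract S G h u) := by
  induction u using TensorProduct.induction_on with
  | zero => simp only [map_zero]
  | tmul g f =>
    rw [contract_tmul (S := S)]
    refine (contract_tmul h (j g) f).trans ?_
    exact ((j.restrictScalars ℤ_[p]).map_smul (h f) g).symm
  | add u v hu hv => rw [map_add, map_add, map_add, map_add, hu, hv]

theorem exists_pow_smul_of_le {X : Type*} [AddCommGroup X] [Module S X] {t : S} {x : ℕ → X}
    (hx : ∀ i, ∃ y, x (i + 1) - x i = t ^ i • y) (i k : ℕ) :
    ∃ y, x (i + k) - x i = t ^ i • y := by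
  induction k with
  | zero => exact ⟨0, by simp⟩
  | succ k ih =>
    obtain ⟨y, hy⟩ := ih
    obtain ⟨z, hz⟩ := hx (i + k)
    refine ⟨y + t ^ k • z, ?_⟩
    rw [smul_add, smul_smul, ← pow_add, ← hy, ← hz, add_assoc]
    abel

variable {A : Type u} [AddCommGroup A] [Module ℤ_[p] A]

/-- If the `t`-power torsion of `G / p` is killed by `t^{M₀}`, then an element of the kernel of
`G ⊗ A → G ⊗ A / p^c` which is divisible by `t^{i + c M₀}` in `G ⊗ A` is divisible by `t^i` in
`G ⊗ p^c A`. -/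
theorem exists_eq_pow_smul_of_lTensor_subtype [Module.Flat ℤ_[p] G] {t : S} {M₀ : ℕ}
    (hG : ∀ (n : ℕ) (g g' : G), t ^ n • g = (p : ℤ_[p]) • g' →
      ∃ g'' : G, t ^ M₀ • g = (p : ℤ_[p]) • g'') {c i : ℕ} {u : G ⊗[ℤ_[p]] (pPow p A c)}
    {v : G ⊗[ℤ_[p]] A} (h : lTensor S G (pPow p A c).subtype u = t ^ (i + c * M₀) • v) :
    ∃ w, u = t ^ i • w := by
  have h1 : t ^ (i + c * M₀) • lTensor S G (pPow p A c).mkQ v = 0 := by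
    rw [← map_smul, ← h]
    have h2 : (pPow p A c).mkQ ∘ₗ (pPow p A c).subtype = 0 := by
      ext x
      exact (Submodule.Quotient.mk_eq_zero _).2 x.2
    change (pPow p A c).mkQ.lTensor G ((pPow p A c).subtype.lTensor G u) = 0
    rw [← LinearMap.comp_apply, ← LinearMap.lTensor_comp, h2, LinearMap.lTensor_zero,
      LinearMap.zero_apply]
  have h3 := torsion_bounded_of_killed hG (a := c) (N := A ⧸ pPow p A c) (fun x => by
    obtain ⟨x, rfl⟩ := Submodule.mkQ_surjective _ x
    rw [← map_smul, Submodule.mkQ_apply, Submodule.Quotient.mk_eq_zero]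
    exact ⟨x, rfl⟩) h1
  rw [← map_smul] at h3
  obtain ⟨w, hw⟩ := exists_eq_lTensor_subtype h3
  have hw : lTensor S G (pPow p A c).subtype w = t ^ (c * M₀) • v := hw
  refine ⟨w, lTensor_subtype_injective (G := G) (pPow p A c) ?_⟩
  change lTensor S G (pPow p A c).subtype u = lTensor S G (pPow p A c).subtype (t ^ i • w)
  rw [h, map_smul, hw, smul_smul, ← pow_add]

/-- The localised `t`-adic completion of `j ⊗ A` is injective if `A` has bounded `p`-torsion, the
kernels and cokernels of `j` modulo `p` behave well with respect to divisibility by `t`, and Cauchy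
sequences in `G` which tend to zero in `H` tend to zero in `G`. The proof treats `A / p^c A` and the
torsion free module `p^c A` separately; functionals on the latter reduce to `A = ℤ_p`. -/
theorem CplLoc.map_rTensor_injective [Module.Flat ℤ_[p] G] [Module.Flat ℤ_[p] H] {t : S}
    {j : G →ₗ[S] H} {M₀ : ℕ}
    (hG : ∀ (n : ℕ) (g g' : G), t ^ n • g = (p : ℤ_[p]) • g' →
      ∃ g'' : G, t ^ M₀ • g = (p : ℤ_[p]) • g'')
    (hH : ∀ (n : ℕ) (g g' : H), t ^ n • g = (p : ℤ_[p]) • g' →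
      ∃ g'' : H, t ^ M₀ • g = (p : ℤ_[p]) • g'')
    (hj : ∀ (i : ℕ) (g : G) (h h' : H), j g = t ^ (i + M₀) • h + (p : ℤ_[p]) • h' →
      ∃ g₁ g₂ : G, t ^ M₀ • g = t ^ i • g₁ + (p : ℤ_[p]) • g₂)
    (hseq : ∀ b : ℕ → G, (∀ i, ∃ d, b (i + 1) - b i = t ^ i • d) →
      (∀ i, ∃ y, j (b i) = t ^ i • y) → ∀ i, ∃ y, b i = t ^ i • y)
    {c : ℕ} (hc : ∀ (n : ℕ) (a : A), (p : ℤ_[p]) ^ n • a = 0 → (p : ℤ_[p]) ^ c • a = 0)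
    (hA : ∀ x : A, (∀ k : ℕ, ∃ y : A, x = (p : ℤ_[p]) ^ k • y) → x = 0) :
    Function.Injective (CplLoc.map t (rTensor ℤ_[p] A j)) := by
  refine CplLoc.map_injective _ fun x hx hjx => ?_
  set F := pPow p A c
  obtain ⟨M₁, hM₁⟩ := exists_divisible_of_killed (a := c) (N := A ⧸ F) hH hj (fun x => by
    obtain ⟨x, rfl⟩ := Submodule.mkQ_surjective _ x
    rw [← map_smul, Submodule.mkQ_apply, Submodule.Quotient.mk_eq_zero]
    exact ⟨x, rfl⟩)
  set M₂ := c * M₀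
  choose z hz using hjx
  have h1 : ∀ i, ∃ w u, t ^ M₁ • x (i + M₁) - t ^ i • w = lTensor S G F.subtype u := by
    intro i
    obtain ⟨w, hw⟩ := hM₁ i (lTensor S G F.mkQ (x (i + M₁))) (lTensor S H F.mkQ (z (i + M₁))) (by
      rw [← lTensor_rTensor_comm', hz, map_smul])
    obtain ⟨w, rfl⟩ := LinearMap.lTensor_surjective G (Submodule.mkQ_surjective F) w
    have hw : t ^ M₁ • lTensor S G F.mkQ (x (i + M₁)) = t ^ i • lTensor S G F.mkQ w := hw
    rw [← map_smul, ← map_smul, ← sub_eq_zero, ← map_sub] at hw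
    obtain ⟨u, hu⟩ := exists_eq_lTensor_subtype hw
    exact ⟨w, u, hu.symm⟩
  choose w u hu using h1
  -- the sequence `u (i + M₂)` in `G ⊗ F` is Cauchy and tends to zero in `H ⊗ F`
  have hUd : ∀ i, ∃ d, u (i + 1 + M₂) - u (i + M₂) = t ^ i • d := by
    intro i
    obtain ⟨y, hy⟩ := exists_pow_smul_of_le hx (i + M₂ + M₁) 1
    refine exists_eq_pow_smul_of_lTensor_subtype hG (v := t ^ (M₁ + M₁) • y - t • w (i + 1 + M₂) +
      w (i + M₂)) ?_
    have e : i + 1 + M₂ + M₁ = i + M₂ + M₁ + 1 := by ring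
    rw [map_sub, ← hu, ← hu, e, sub_sub_sub_comm, ← smul_sub, hy, smul_add, smul_sub]
    simp only [smul_smul, ← pow_add, ← pow_succ]
    rw [show M₁ + (i + M₂ + M₁) = i + M₂ + (M₁ + M₁) by ring,
      show i + M₂ + 1 = i + 1 + M₂ by ring]
    abel
  have hUj : ∀ i, ∃ y, rTensor ℤ_[p] F j (u (i + M₂)) = t ^ i • y := by
    intro i
    refine exists_eq_pow_smul_of_lTensor_subtype hH (v := t ^ (M₁ + M₁) • z (i + M₂ + M₁) -
      rTensor ℤ_[p] A j (w (i + M₂))) ?_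
    rw [lTensor_rTensor_comm', ← hu, map_sub, map_smul, map_smul, hz, smul_sub]
    simp only [smul_smul, ← pow_add]
    rw [show M₁ + (i + M₂ + M₁) = i + M₂ + (M₁ + M₁) by ring]
  have hU : ∀ i, ∃ y, u (i + M₂) = t ^ i • y := by
    intro i
    let Q : Submodule ℤ_[p] (G ⊗[ℤ_[p]] F) :=
      (LinearMap.range (LinearMap.lsmul S (G ⊗[ℤ_[p]] F) (t ^ i))).restrictScalars ℤ_[p]
    suffices h : u (i + M₂) ∈ Q by
      obtain ⟨y, hy⟩ := h
      exact ⟨y, hy.symm⟩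
    refine mem_of_forall_functional (pPow_p_smul_eq_zero hc) (fun f hf => ?_) Q fun h f => ?_
    · refine Subtype.ext (hA f fun k => ?_)
      obtain ⟨y, rfl⟩ := hf k
      exact ⟨y, rfl⟩
    · rw [contract_tmul_eq (S := S)]
      obtain ⟨y, hy⟩ := hseq (fun i => contract S G h (u (i + M₂))) (fun i => by
        obtain ⟨d, hd⟩ := hUd i
        exact ⟨contract S G h d, by rw [← map_sub, hd, map_smul]⟩) (fun i => by
        obtain ⟨y, hy⟩ := hUj i
        exact ⟨contract S H h y, by rw [← contract_rTensor, hy, map_smul]⟩) i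
      have hy : contract S G h (u (i + M₂)) = t ^ i • y := hy
      rw [hy]
      exact ⟨y ⊗ₜ f, TensorProduct.smul_tmul' _ _ _⟩
  refine ⟨M₁, fun i => ?_⟩
  obtain ⟨y, hy⟩ := hU i
  obtain ⟨y', hy'⟩ := exists_pow_smul_of_le hx i (M₂ + M₁)
  have h2 := hu (i + M₂)
  rw [hy, map_smul, sub_eq_iff_eq_add] at h2
  refine ⟨lTensor S G F.subtype y + t ^ M₂ • w (i + M₂) - t ^ M₁ • y', ?_⟩
  rw [smul_sub, smul_add, smul_comm (t ^ i) (t ^ M₁), ← hy', smul_smul, ← pow_add, ← h2, smul_sub,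
    add_assoc]
  abel

end Glue

/-! ### The imperfect rings -/

section Imperfect

variable {p : ℕ} [Fact p.Prime] (Z : CycloSystem p) (K : IntermediateField ℚ_[p] (PadicAlgCl p))

local instance AKoverconvInt.smul (r : Radius p) : SMul Z.PT (AKoverconvInt Z K r) :=
  (inferInstance : Module Z.PT (AKoverconvInt Z K r)).toSMul

theorem coe_pow_piT_smul {r : Radius p} (n : ℕ) (x : AKoverconvInt Z K r) :
    ((Z.piT ^ n • x : AKoverconvInt Z K r) : ATilde p) = emb p Z.T ^ n * x := by
  change (Z.piT ^ n) • (x : ATilde p) = _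
  rw [Algebra.smul_def, map_pow]
  rfl

theorem coe_AKoverconvIntIncl {r s : Radius p} (h : r ≤ s) (x : AKoverconvInt Z K s) :
    (AKoverconvIntIncl Z K h x : ATilde p) = x :=
  coe_inclLin Z.PT (AKoverconvInt_mono Z K h) x

theorem coe_p_smul_AK {r : Radius p} (x : AKoverconvInt Z K r) :
    (((p : ℤ_[p]) • x : AKoverconvInt Z K r) : ATilde p) = p * x := by
  change (p : ℤ_[p]) • (x : ATilde p) = _
  rw [Algebra.smul_def, map_natCast]

theorem flat_AKoverconvInt (r : Radius p) : Module.Flat ℤ_[p] (AKoverconvInt Z K r) := by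
  have := isTorsionFree_of_p_smul (p := p) (F := AKoverconvInt Z K r) fun x hx => by
    have h := congrArg Subtype.val hx
    rw [coe_p_smul_AK] at h
    exact Subtype.ext ((mul_eq_zero.1 h).resolve_left p_ne_zero_ATilde)
  infer_instance

/-- The `T`-power torsion of `A_K^{(0,r],∘} / p` is killed by `T^e`. -/
theorem AKoverconvInt_p_smul_of_pow_smul {r : Radius p} (D : RadiusData Z r) {M₀ : ℕ}
    (hM : D.e ≤ M₀) (n : ℕ) (g g' : AKoverconvInt Z K r)
    (h : Z.piT ^ n • g = (p : ℤ_[p]) • g') :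
    ∃ g'' : AKoverconvInt Z K r, Z.piT ^ M₀ • g = (p : ℤ_[p]) • g'' := by
  have h1 := congrArg Subtype.val h
  rw [coe_pow_piT_smul, coe_p_smul_AK] at h1
  have h2 : (p : ATilde p) ∣ g := by
    have h3 : (p : ATilde p) ∣ emb p Z.T ^ n * g := ⟨_, h1⟩
    exact (p_prime_ATilde.dvd_or_dvd h3).resolve_left fun h4 =>
      not_p_dvd_emb_T Z (p_prime_ATilde.dvd_of_dvd_pow h4)
  obtain ⟨y, hy, h3⟩ := AKoverconvInt_exists_p_mul Z K D g.2 h2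
  refine ⟨Z.piT ^ (M₀ - D.e) • ⟨y, hy⟩, Subtype.ext ?_⟩
  rw [coe_pow_piT_smul, coe_p_smul_AK, coe_pow_piT_smul, mul_left_comm, ← h3, ← mul_assoc,
    ← pow_add, Nat.sub_add_cancel hM]

/-- Divisibility by a power of `T` modulo `p` in `A_K^{(0,r],∘}` implies the same in `A_K^{(0,s],∘}`,
up to a fixed power of `T`: by `hi₀` it suffices to have divisibility in `A_inf`, and `T^e` maps
`A_K^{(0,r],∘}` into `A_inf + p Ã^{(0,r],∘}`. -/
theorem AKoverconvInt_exists_of_incl_eq {r s : Radius p} (h : r ≤ s) (Dr : RadiusData Z r)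
    (Ds : RadiusData Z s) {i₀ : ℕ} (hi₀ : ∀ (i : ℕ), ∀ b ∈ AKoverconvInt Z K s, ∀ α : AInf p,
      (p : ATilde p) ∣ b - emb p Z.T ^ (i + i₀) * emb p α →
      ∃ w ∈ AKoverconvInt Z K s, (p : ATilde p) ∣ b - emb p Z.T ^ i * w)
    (i : ℕ) (g : AKoverconvInt Z K s) (x x' : AKoverconvInt Z K r)
    (hx : AKoverconvIntIncl Z K h g = Z.piT ^ (i + (Ds.e + Dr.e + i₀)) • x + (p : ℤ_[p]) • x') :
    ∃ g₁ g₂ : AKoverconvInt Z K s,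
      Z.piT ^ (Ds.e + Dr.e + i₀) • g = Z.piT ^ i • g₁ + (p : ℤ_[p]) • g₂ := by
  have h1 : (g : ATilde p) = emb p Z.T ^ (i + (Ds.e + Dr.e + i₀)) * x + p * x' := by
    have h2 := congrArg Subtype.val hx
    rwa [Subalgebra.coe_add, coe_pow_piT_smul, coe_p_smul_AK, coe_AKoverconvIntIncl] at h2
  obtain ⟨α, y, hy, hα⟩ := Dr.exists_pow_e_mul (coeff_zero_T Z) x.2.2
  obtain ⟨w, hw, v, hv⟩ := hi₀ i g g.2 (Z.T ^ Ds.e * α) ⟨emb p Z.T ^ (i + i₀ + Ds.e) * y + x', by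
    rw [h1, map_mul, map_pow]
    linear_combination emb p Z.T ^ (i + i₀ + Ds.e) * hα⟩
  obtain ⟨y', hy', h3⟩ := AKoverconvInt_exists_p_mul Z K Ds
    (sub_mem g.2 (mul_mem (pow_mem (emb_mem_AKoverconvInt Z K s (T_mem_AQpPlus Z)) i) hw)) ⟨v, hv⟩
  refine ⟨Z.piT ^ (Ds.e + Dr.e + i₀) • ⟨w, hw⟩, Z.piT ^ (Dr.e + i₀) • ⟨y', hy'⟩, Subtype.ext ?_⟩
  rw [Subalgebra.coe_add, coe_p_smul_AK]
  simp only [coe_pow_piT_smul]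
  linear_combination emb p Z.T ^ (Dr.e + i₀) * h3

theorem AKoverconvInt_exists_eq_pow_smul {r s : Radius p} (h : r ≤ s)
    (b : ℕ → AKoverconvInt Z K s) (hb : ∀ i, ∃ d, b (i + 1) - b i = Z.piT ^ i • d)
    (hbr : ∀ i, ∃ y, AKoverconvIntIncl Z K h (b i) = Z.piT ^ i • y) (i : ℕ) :
    ∃ y, b i = Z.piT ^ i • y := by
  choose d hd using hb
  obtain ⟨y, hy, h1⟩ := AKoverconvInt_exists_T_pow_mul Z K h (b := fun i => b i)
    (d := fun i => d i) (fun i => (d i).2) (fun i => (b i).2) (fun i => by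
      have h2 := congrArg Subtype.val (hd i)
      rwa [Subalgebra.coe_sub, coe_pow_piT_smul] at h2) (fun i => by
      obtain ⟨y, hy⟩ := hbr i
      have h2 := congrArg Subtype.val hy
      rw [coe_pow_piT_smul, coe_AKoverconvIntIncl] at h2
      exact ⟨y, y.2, h2⟩) i
  exact ⟨⟨y, hy⟩, Subtype.ext (by rw [coe_pow_piT_smul]; exact h1)⟩

theorem OverconvImpKA.trans_injective [FiniteDimensional ℚ_[p] K] {A : Type*} [AddCommGroup A]
    [Module ℤ_[p] A] {c : ℕ}
    (hc : ∀ (n : ℕ) (a : A), (p : ℤ_[p]) ^ n • a = 0 → (p : ℤ_[p]) ^ c • a = 0)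
    (hA : ∀ x : A, (∀ k : ℕ, ∃ y : A, x = (p : ℤ_[p]) ^ k • y) → x = 0) {r s : Radius p}
    (h : r ≤ s) : Function.Injective (OverconvImpKA.trans Z K A h) := by
  obtain ⟨Dr⟩ := nonempty_radiusData Z r
  obtain ⟨Ds⟩ := nonempty_radiusData Z s
  obtain ⟨i₀, hi₀⟩ := exists_p_dvd_sub_T_pow_mul Z K s
  have := flat_AKoverconvInt Z K r
  have := flat_AKoverconvInt Z K s
  exact CplLoc.map_rTensor_injective (M₀ := Ds.e + Dr.e + i₀)
    (AKoverconvInt_p_smul_of_pow_smul Z K Ds (by omega : _ ≤ Ds.e + Dr.e + i₀))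
    (AKoverconvInt_p_smul_of_pow_smul Z K Dr (by omega : _ ≤ Ds.e + Dr.e + i₀))
    (AKoverconvInt_exists_of_incl_eq Z K h Dr Ds hi₀)
    (AKoverconvInt_exists_eq_pow_smul Z K h) hc hA

end Imperfect

/-! ### Divisibility by powers of `[ϖ]` in `Ã^{(0,r],∘} ⊗ A` -/

section BaseChange

universe u

variable {p : ℕ} [Fact p.Prime]

theorem smul_tensor_eq_zero {G N : Type*} [AddCommGroup G] [Module ℤ_[p] G] [AddCommGroup N]
    [Module ℤ_[p] N] {c : ℤ_[p]} (hN : ∀ x : N, c • x = 0) (u : G ⊗[ℤ_[p]] N) : c • u = 0 := by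
  have h : c • (LinearMap.id : N →ₗ[ℤ_[p]] N) = 0 := LinearMap.ext hN
  rw [← lTensor_smul_id, h, LinearMap.lTensor_zero, LinearMap.zero_apply]

theorem p_pow_smul_quotient_eq_zero {A : Type*} [AddCommGroup A] [Module ℤ_[p] A] {k : ℕ}
    (x : A ⧸ pPow p A k) : (p : ℤ_[p]) ^ k • x = 0 := by
  obtain ⟨x, rfl⟩ := Submodule.mkQ_surjective _ x
  rw [← map_smul, Submodule.mkQ_apply, Submodule.Quotient.mk_eq_zero]
  exact ⟨x, rfl⟩

/-- The map `X ⊗ A → Y ⊗ A` for an `X`-algebra `Y`. -/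
def baseIncl (X Y A : Type*) [CommRing X] [CommRing Y] [Algebra ℤ_[p] X] [Algebra ℤ_[p] Y]
    [Algebra X Y] [IsScalarTower ℤ_[p] X Y] [AddCommGroup A] [Module ℤ_[p] A] :
    X ⊗[ℤ_[p]] A →ₗ[ℤ_[p]] Y ⊗[ℤ_[p]] A :=
  (IsScalarTower.toAlgHom ℤ_[p] X Y).toLinearMap.rTensor A

theorem baseIncl_tmul {X Y A : Type*} [CommRing X] [CommRing Y] [Algebra ℤ_[p] X] [Algebra ℤ_[p] Y]
    [Algebra X Y] [IsScalarTower ℤ_[p] X Y] [AddCommGroup A] [Module ℤ_[p] A] (x : X) (a : A) :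
    baseIncl X Y A (x ⊗ₜ[ℤ_[p]] a) = algebraMap X Y x ⊗ₜ[ℤ_[p]] a := rfl

theorem baseIncl_smul {X Y A : Type*} [CommRing X] [CommRing Y] [Algebra ℤ_[p] X] [Algebra ℤ_[p] Y]
    [Algebra X Y] [IsScalarTower ℤ_[p] X Y] [AddCommGroup A] [Module ℤ_[p] A] (x : X)
    (u : X ⊗[ℤ_[p]] A) : baseIncl X Y A (x • u) = algebraMap X Y x • baseIncl X Y A u := by
  induction u using TensorProduct.induction_on with
  | zero => simp only [smul_zero, map_zero]
  | tmul y a =>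
    rw [TensorProduct.smul_tmul', smul_eq_mul, baseIncl_tmul, baseIncl_tmul, map_mul,
      TensorProduct.smul_tmul', smul_eq_mul]
  | add u v hu hv => rw [smul_add, map_add, map_add, smul_add, hu, hv]

variable {B Λ C : Type*} [CommRing B] [CommRing Λ] [CommRing C] [Algebra ℤ_[p] B] [Algebra ℤ_[p] Λ]
  [Algebra ℤ_[p] C] [Algebra B Λ] [Algebra Λ C] [IsScalarTower ℤ_[p] B Λ] [IsScalarTower ℤ_[p] Λ C]
  {A : Type u} [AddCommGroup A] [Module ℤ_[p] A]

/-- If `B / p → C / p` is injective, then divisibility by `p^k` in `C ⊗ A` implies divisibility in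
`B ⊗ A`. -/
theorem exists_eq_p_pow_smul_of_baseIncl [Module.Flat ℤ_[p] C]
    (hBC : ∀ (b : B) (c : C), algebraMap Λ C (algebraMap B Λ b) = p * c → ∃ b', b = p * b') {k : ℕ}
    {u : B ⊗[ℤ_[p]] A} {v : C ⊗[ℤ_[p]] A}
    (h : baseIncl Λ C A (baseIncl B Λ A u) = (p : ℤ_[p]) ^ k • v) :
    ∃ u', u = (p : ℤ_[p]) ^ k • u' := by
  refine exists_eq_smul_of_lTensor_eq_zero ?_
  set j : B →ₗ[ℤ_[p]] C :=
    (IsScalarTower.toAlgHom ℤ_[p] Λ C).toLinearMap ∘ₗ (IsScalarTower.toAlgHom ℤ_[p] B Λ).toLinearMap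
  have hj : baseIncl Λ C A (baseIncl B Λ A u) = j.rTensor A u := by
    rw [LinearMap.rTensor_comp]
    rfl
  refine rTensor_injective_of_killed (S := ℤ_[p]) (j := j) (a := k) (fun g c hgc => ?_)
    p_pow_smul_quotient_eq_zero ?_
  · rw [Algebra.smul_def, map_natCast] at hgc
    obtain ⟨b', hb'⟩ := hBC g c hgc
    exact ⟨b', by rw [Algebra.smul_def, map_natCast, hb']⟩
  · refine (lTensor_rTensor_comm j (pPow p A k).mkQ u).symm.trans ?_
    rw [← hj, h, map_smul]
    exact smul_tensor_eq_zero p_pow_smul_quotient_eq_zero _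

/-- The kernel of `Λ ⊗ A → C ⊗ A` is killed by a power of `P`: such a power maps it into
`p^c (Λ ⊗ A)`, and `Λ ⊗ p^c A → C ⊗ p^c A` is injective because `p^c A` is flat. -/
theorem pow_smul_eq_zero_of_baseIncl_eq_zero [Module.Flat ℤ_[p] C]
    (hBC : ∀ (b : B) (c : C), algebraMap Λ C (algebraMap B Λ b) = p * c → ∃ b', b = p * b')
    (hinj : Function.Injective (algebraMap Λ C)) {P : Λ} {e c : ℕ}
    (hdec : ∀ x : Λ, ∃ (α : B) (y : Λ), P ^ e * x = algebraMap B Λ α + p ^ c * y)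
    (hc : ∀ (n : ℕ) (a : A), (p : ℤ_[p]) ^ n • a = 0 → (p : ℤ_[p]) ^ c • a = 0)
    {u : Λ ⊗[ℤ_[p]] A} (hu : baseIncl Λ C A u = 0) : P ^ e • u = 0 := by
  have h1 : ∀ u : Λ ⊗[ℤ_[p]] A, ∃ α β, P ^ e • u = baseIncl B Λ A α + (p : ℤ_[p]) ^ c • β := by
    intro u
    induction u using TensorProduct.induction_on with
    | zero => exact ⟨0, 0, by simp only [smul_zero, map_zero, add_zero]⟩
    | tmul x a =>
      obtain ⟨α, y, h⟩ := hdec x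
      refine ⟨α ⊗ₜ a, y ⊗ₜ a, ?_⟩
      rw [TensorProduct.smul_tmul', smul_eq_mul, h, TensorProduct.add_tmul, baseIncl_tmul,
        TensorProduct.smul_tmul', Algebra.smul_def, map_pow, map_natCast]
    | add u v hu hv =>
      obtain ⟨α, β, h⟩ := hu
      obtain ⟨α', β', h'⟩ := hv
      exact ⟨α + α', β + β', by rw [smul_add, h, h', map_add, smul_add]; abel⟩
  obtain ⟨α, β, h2⟩ := h1 u
  obtain ⟨α', rfl⟩ := exists_eq_p_pow_smul_of_baseIncl (Λ := Λ) hBC (u := α) (k := c)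
    (v := - baseIncl Λ C A β) (by
      have h3 := congrArg (baseIncl Λ C A) h2
      rw [baseIncl_smul, hu, smul_zero, map_add, map_smul] at h3
      rw [smul_neg]
      exact eq_neg_of_add_eq_zero_left h3.symm)
  set γ := baseIncl B Λ A α' + β
  have h3 : P ^ e • u = (p : ℤ_[p]) ^ c • γ := by rw [h2, map_smul, smul_add]
  let m : A →ₗ[ℤ_[p]] pPow p A c := LinearMap.rangeRestrict _
  have hm : ∀ {X : Type _} [AddCommGroup X] [Module ℤ_[p] X] (v : X ⊗[ℤ_[p]] A),
      (pPow p A c).subtype.lTensor X (m.lTensor X v) = (p : ℤ_[p]) ^ c • v := fun v => by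
    rw [← lTensor_smul_id, ← LinearMap.comp_apply, ← LinearMap.lTensor_comp]
    rfl
  have hflat : Module.Flat ℤ_[p] (pPow p A c) := flat_pPow hc
  rw [h3, ← hm]
  have h4 : m.lTensor Λ γ = 0 := by
    apply Module.Flat.rTensor_preserves_injective_linearMap (M := pPow p A c)
      (IsScalarTower.toAlgHom ℤ_[p] Λ C).toLinearMap hinj
    apply lTensor_subtype_injective (G := C) (pPow p A c)
    rw [map_zero, map_zero, lTensor_rTensor_comm, hm]
    change baseIncl Λ C A _ = 0
    rw [← h3, baseIncl_smul, hu, smul_zero]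
  rw [h4, map_zero]

/-- An element `y` of `Λ ⊗ A` which is `p`-adically close in `C ⊗ A` to elements of `P^i (Λ ⊗ A)`
is, up to a fixed power of `P`, divisible by `P^i` in `Λ ⊗ A`. The elements `z` and `w` with
`z w = p` allow to trade divisibility by `p^k` for divisibility by `w^k`, hence by a power of `P`. -/
theorem exists_pow_smul_eq_of_forall_close [Module.Flat ℤ_[p] C]
    (hBC : ∀ (b : B) (c : C), algebraMap Λ C (algebraMap B Λ b) = p * c → ∃ b', b = p * b')
    (hinj : Function.Injective (algebraMap Λ C)) {P : B} {e c : ℕ}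
    (hdec : ∀ x : Λ, ∃ (α : B) (y : Λ), algebraMap B Λ P ^ e * x = algebraMap B Λ α + p ^ c * y)
    (hc : ∀ (n : ℕ) (a : A), (p : ℤ_[p]) ^ n • a = 0 → (p : ℤ_[p]) ^ c • a = 0)
    (hP : IsUnit (algebraMap Λ C (algebraMap B Λ P))) {z : Λ} {w : B}
    (hzw : z * algebraMap B Λ w = p) (hw : IsUnit (algebraMap Λ C (algebraMap B Λ w)))
    (hwP : ∀ i : ℕ, ∃ k : ℕ, P ^ i ∣ w ^ k)
    (hzdec : ∀ (k : ℕ) (x : Λ), ∃ (x₀ y : Λ) (α : B),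
      x = x₀ + z ^ k * y ∧ algebraMap B Λ w ^ k * x₀ = algebraMap B Λ α)
    (happrox : ∀ (i : ℕ) (x : Λ), ∃ (N : ℕ) (α : B) (y : Λ),
      algebraMap B Λ P ^ N * x = algebraMap B Λ α + algebraMap B Λ P ^ (N + i) * y)
    {i : ℕ} {y : Λ ⊗[ℤ_[p]] A}
    (hy : ∀ k : ℕ, ∃ (x : Λ ⊗[ℤ_[p]] A) (v : C ⊗[ℤ_[p]] A),
      baseIncl Λ C A y = baseIncl Λ C A (algebraMap B Λ P ^ i • x) + (p : ℤ_[p]) ^ k • v) :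
    ∃ x, algebraMap B Λ P ^ e • y = algebraMap B Λ P ^ i • x := by
  set Q := algebraMap B Λ P
  have h1 : ∀ y : Λ ⊗[ℤ_[p]] A, ∃ (N : ℕ) (y' : B ⊗[ℤ_[p]] A) (x : Λ ⊗[ℤ_[p]] A),
      Q ^ N • y = baseIncl B Λ A y' + Q ^ (N + i) • x := by
    intro y
    induction y using TensorProduct.induction_on with
    | zero => exact ⟨0, 0, 0, by simp only [smul_zero, map_zero, add_zero]⟩
    | tmul x a =>
      obtain ⟨N, α, y, h⟩ := happrox i x
      refine ⟨N, α ⊗ₜ a, y ⊗ₜ a, ?_⟩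
      rw [TensorProduct.smul_tmul', smul_eq_mul, h, TensorProduct.add_tmul, baseIncl_tmul,
        TensorProduct.smul_tmul', smul_eq_mul]
    | add u v hu hv =>
      obtain ⟨N, α, x, h⟩ := hu
      obtain ⟨N', α', x', h'⟩ := hv
      refine ⟨N + N', P ^ N' • α + P ^ N • α', x + x', ?_⟩
      have e1 : Q ^ (N + N') • u = Q ^ N' • Q ^ N • u := by rw [smul_smul, ← pow_add, add_comm]
      have e2 : Q ^ (N + N') • v = Q ^ N • Q ^ N' • v := by rw [smul_smul, ← pow_add]
      rw [smul_add, e1, e2, h, h', map_add, baseIncl_smul, baseIncl_smul, map_pow, map_pow]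
      simp only [smul_add, smul_smul, ← pow_add]
      rw [show N' + (N + i) = N + N' + i by ring, show N + (N' + i) = N + N' + i by ring]
      abel
  have h2 : ∀ (k : ℕ) (u : Λ ⊗[ℤ_[p]] A), ∃ (u₀ v : Λ ⊗[ℤ_[p]] A) (α : B ⊗[ℤ_[p]] A),
      u = u₀ + z ^ k • v ∧ algebraMap B Λ w ^ k • u₀ = baseIncl B Λ A α := by
    intro k u
    induction u using TensorProduct.induction_on with
    | zero => exact ⟨0, 0, 0, by simp only [smul_zero, add_zero], by simp only [smul_zero, map_zero]⟩
    | tmul x a =>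
      obtain ⟨x₀, y, α, h, h'⟩ := hzdec k x
      refine ⟨x₀ ⊗ₜ a, y ⊗ₜ a, α ⊗ₜ a, ?_, ?_⟩
      · rw [TensorProduct.smul_tmul', smul_eq_mul, ← TensorProduct.add_tmul, ← h]
      · rw [TensorProduct.smul_tmul', smul_eq_mul, h', baseIncl_tmul]
    | add u v hu hv =>
      obtain ⟨u₀, v, α, h, h'⟩ := hu
      obtain ⟨u₁, v₁, α₁, h₁, h₁'⟩ := hv
      refine ⟨u₀ + u₁, v + v₁, α + α₁, ?_, ?_⟩
      · rw [h, h₁, smul_add]; abel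
      · rw [smul_add, h', h₁', map_add]
  obtain ⟨N, y', x₁, h3⟩ := h1 y
  obtain ⟨k, g, hg⟩ := hwP (N + i)
  obtain ⟨x₂, v, h4⟩ := hy k
  obtain ⟨x₀, x', α, h5, h6⟩ := h2 k (x₂ - x₁)
  set γ := algebraMap B Λ g
  have hgQ : algebraMap B Λ w ^ k = γ * Q ^ (N + i) := by rw [← map_pow, hg, map_mul, map_pow, mul_comm]
  have hγB : ∀ u : B ⊗[ℤ_[p]] A, baseIncl B Λ A (g • u) = γ • baseIncl B Λ A u := baseIncl_smul g
  have hzp : ∀ x : Λ ⊗[ℤ_[p]] A, γ • Q ^ (N + i) • z ^ k • x = (p : ℤ_[p]) ^ k • x := fun x => by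
    rw [smul_smul, smul_smul, ← hgQ, ← mul_pow, mul_comm _ z, hzw,
      ← algebraMap_smul Λ ((p : ℤ_[p]) ^ k) x, map_pow, map_natCast]
  -- `g y' - α` becomes divisible by `p^k`
  have h7 : baseIncl Λ C A (baseIncl B Λ A y') =
      baseIncl Λ C A (Q ^ (N + i) • (x₂ - x₁)) + (p : ℤ_[p]) ^ k • algebraMap Λ C (Q ^ N) • v := by
    have h8 := congrArg (baseIncl Λ C A) h3
    rw [map_add, baseIncl_smul, h4, smul_add, ← baseIncl_smul, smul_smul, ← pow_add,
      smul_comm _ ((p : ℤ_[p]) ^ k)] at h8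
    rw [smul_sub, map_sub, eq_sub_of_add_eq h8.symm]
    abel
  obtain ⟨v', h8⟩ := exists_eq_p_pow_smul_of_baseIncl (Λ := Λ) hBC (u := g • y' - α) (k := k)
    (v := baseIncl Λ C A x' + algebraMap Λ C γ • algebraMap Λ C (Q ^ N) • v) (by
      rw [map_sub, map_sub, hγB, baseIncl_smul, h7, smul_add, ← baseIncl_smul, h5,
        smul_add, smul_add, hzp, ← h6, hgQ, mul_smul, map_add,
        (baseIncl Λ C A).map_smul ((p : ℤ_[p]) ^ k), smul_add,
        smul_comm _ ((p : ℤ_[p]) ^ k)]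
      abel)
  set X := x₀ + z ^ k • baseIncl B Λ A v'
  have h9 : γ • (baseIncl B Λ A y' - Q ^ (N + i) • X) = 0 := by
    have h10 := congrArg (baseIncl B Λ A) h8
    rw [map_sub, hγB, map_smul, ← h6, hgQ, mul_smul] at h10
    rw [smul_sub, smul_add, smul_add, hzp, ← h10]
    abel
  have hγ : IsUnit (algebraMap Λ C γ) := by
    refine isUnit_of_dvd_unit ?_ (hw.pow k)
    rw [← map_pow, hgQ, map_mul]
    exact dvd_mul_right _ _
  have h10 : γ • Q ^ N • (y - Q ^ i • (X + x₁)) = 0 := by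
    rw [← h9, smul_sub (Q ^ N), h3, smul_smul, ← pow_add, smul_add (Q ^ (N + i))]
    congr 1
    abel
  have h11 := pow_smul_eq_zero_of_baseIncl_eq_zero hBC hinj hdec hc
    (u := y - Q ^ i • (X + x₁)) (by
      have h12 := congrArg (baseIncl Λ C A) h10
      rw [baseIncl_smul, baseIncl_smul, map_zero, hγ.smul_eq_zero, map_pow,
        (hP.pow N).smul_eq_zero] at h12
      exact h12)
  rw [smul_sub, sub_eq_zero, smul_comm] at h11
  exact ⟨_, h11⟩

/-- If the image of `u` under a map `Λ ⊗ A → B / p^k ⊗ A` which is essentially the multiplication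
by `P^N` is divisible by `P^{i+N}`, then `u` is congruent to an element of `P^i (B ⊗ A)` modulo
`p^k (C ⊗ A)`. -/
theorem exists_close_of_rTensor_eq {P : B} (hP : IsUnit (algebraMap Λ C (algebraMap B Λ P)))
    {k N : ℕ} {f : Λ →ₗ[ℤ_[p]] B ⧸ Ideal.span {(p : B) ^ k}}
    (hf : ∀ x, ∃ (α : B) (y : Λ), algebraMap B Λ P ^ N * x = algebraMap B Λ α + p ^ k * y ∧
      f x = Ideal.Quotient.mk _ α) {i : ℕ} {u : Λ ⊗[ℤ_[p]] A}
    {y : (B ⧸ Ideal.span {(p : B) ^ k}) ⊗[ℤ_[p]] A} (hu : f.rTensor A u = P ^ (i + N) • y) :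
    ∃ (x : Λ ⊗[ℤ_[p]] A) (v : C ⊗[ℤ_[p]] A),
      baseIncl Λ C A u = baseIncl Λ C A (algebraMap B Λ P ^ i • x) + (p : ℤ_[p]) ^ k • v := by
  set Q := algebraMap B Λ P
  set q : B →ₗ[ℤ_[p]] B ⧸ Ideal.span {(p : B) ^ k} := (Ideal.Quotient.mkₐ ℤ_[p] _).toLinearMap
  have hqs : Function.Surjective q := Ideal.Quotient.mk_surjective
  have h1 : ∀ u : Λ ⊗[ℤ_[p]] A, ∃ α β, Q ^ N • u = baseIncl B Λ A α + (p : ℤ_[p]) ^ k • β ∧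
      f.rTensor A u = q.rTensor A α := by
    intro u
    induction u using TensorProduct.induction_on with
    | zero => exact ⟨0, 0, by simp only [smul_zero, map_zero, add_zero], by simp only [map_zero]⟩
    | tmul x a =>
      obtain ⟨α, y, h, h'⟩ := hf x
      refine ⟨α ⊗ₜ a, y ⊗ₜ a, ?_, ?_⟩
      · rw [TensorProduct.smul_tmul', smul_eq_mul, h, TensorProduct.add_tmul, baseIncl_tmul,
          TensorProduct.smul_tmul', Algebra.smul_def, map_pow, map_natCast]
      · rw [LinearMap.rTensor_tmul, h']
        rfl
    | add u v hu hv =>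
      obtain ⟨α, β, h, h₁⟩ := hu
      obtain ⟨α', β', h', h₁'⟩ := hv
      exact ⟨α + α', β + β', by rw [smul_add, h, h', map_add, smul_add]; abel,
        by rw [map_add, map_add, h₁, h₁']⟩
  obtain ⟨α, β, h2, h3⟩ := h1 u
  obtain ⟨y, rfl⟩ := LinearMap.rTensor_surjective A hqs y
  have hqsmul : ∀ (b : B) (v : B ⊗[ℤ_[p]] A), q.rTensor A (b • v) = b • q.rTensor A v := by
    intro b v
    induction v using TensorProduct.induction_on with
    | zero => simp only [smul_zero, map_zero]
    | tmul x a => rfl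
    | add u v hu hv => rw [smul_add, map_add, map_add, smul_add, hu, hv]
  obtain ⟨v, h4⟩ := exists_eq_smul_of_rTensor_eq_zero (q := q) (c := (p : ℤ_[p]) ^ k) hqs
    (fun x => by
      change Ideal.Quotient.mk _ x = 0 ↔ _
      rw [Ideal.Quotient.eq_zero_iff_mem, Ideal.mem_span_singleton]
      refine exists_congr fun y => ?_
      rw [Algebra.smul_def, map_pow, map_natCast, eq_comm])
    (u := α - P ^ (i + N) • y) (by rw [map_sub, hqsmul, ← h3, ← hu, sub_self])
  rw [sub_eq_iff_eq_add] at h4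
  rw [h4, map_add, baseIncl_smul, map_smul, map_pow] at h2
  obtain ⟨U, hU⟩ := hP.pow N
  refine ⟨baseIncl B Λ A y, (↑U⁻¹ : C) • baseIncl Λ C A (baseIncl B Λ A v + β), ?_⟩
  have h5 : algebraMap Λ C Q ^ N • baseIncl Λ C A u = algebraMap Λ C Q ^ N •
      baseIncl Λ C A (Q ^ i • baseIncl B Λ A y) +
      (p : ℤ_[p]) ^ k • baseIncl Λ C A (baseIncl B Λ A v + β) := by
    rw [← map_pow, ← baseIncl_smul (Y := C), ← baseIncl_smul (Y := C),
      ← (baseIncl Λ C A).map_smul ((p : ℤ_[p]) ^ k), ← map_add, h2, smul_smul, ← pow_add,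
      smul_add, add_comm N i]
    congr 1
    abel
  rw [← hU] at h5
  have h6 := congrArg (fun x => (↑U⁻¹ : C) • x) h5
  simp only [smul_add, smul_smul, Units.inv_mul, one_smul] at h6
  rw [h6, smul_comm ((p : ℤ_[p]) ^ k)]

end BaseChange

/-! ### The maps from `Ã_A^{(0,r]}` to `W_a(𝓞_ℂ^♭)_A[1/[ϖ]]` -/

section Truncation

open TensorProduct.AlgebraTensorModule (lTensor rTensor)

variable {p : ℕ} [Fact p.Prime] (Z : CycloSystem p)

theorem coe_PW_smul {r : Radius p} (c : Z.PW) (x : overconvInt Z r) :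
    ((c • x : overconvInt Z r) : ATilde p) = emb p c * x := by
  change c • (x : ATilde p) = _
  rw [Algebra.smul_def]
  rfl

/-- An exponent `N` for which `[ϖ]^N` maps `Ã^{(0,r],∘}` into `A_inf + p^a Ã^{(0,r],∘}`. -/
def truncExp (r : Radius p) (a : ℕ) : ℕ := (nonempty_radiusData Z r).some.e * a

theorem exists_truncExp (r : Radius p) (a : ℕ) (x : overconvInt Z r) :
    ∃ (α : AInf p) (y : overconvInt Z r),
      emb p Z.teichVarpi ^ truncExp Z r a * x = emb p α + p ^ a * y := by
  obtain ⟨α, y, hy, h⟩ := (nonempty_radiusData Z r).some.exists_pow_mul a x.2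
  exact ⟨α, ⟨y, hy⟩, h⟩

theorem mk_eq_mk_of_emb_add {a : ℕ} {α β : AInf p} {y y' : ATilde p}
    (h : emb p α + p ^ a * y = emb p β + p ^ a * y') :
    (Ideal.Quotient.mk _ α : WTrunc p a) = Ideal.Quotient.mk _ β := by
  rw [Ideal.Quotient.eq, Ideal.mem_span_singleton, ← p_pow_dvd_emb_iff]
  exact ⟨y' - y, by rw [map_sub]; linear_combination h⟩

/-- The multiplication by `[ϖ]^N`, for a suitable `N`, followed by the reduction modulo `p^a`, as a
map from `Ã^{(0,r],∘}` to `W_a(𝓞_ℂ^♭)`. -/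
def truncLin (r : Radius p) (a : ℕ) : overconvInt Z r →ₗ[Z.PW] WTrunc p a where
  toFun x := Ideal.Quotient.mk _ (exists_truncExp Z r a x).choose
  map_add' x y := by
    obtain ⟨u, hu⟩ := (exists_truncExp Z r a x).choose_spec
    obtain ⟨v, hv⟩ := (exists_truncExp Z r a y).choose_spec
    obtain ⟨w, hw⟩ := (exists_truncExp Z r a (x + y)).choose_spec
    rw [← map_add]
    refine mk_eq_mk_of_emb_add (y' := u + v) (hw.symm.trans ?_)
    rw [Subalgebra.coe_add, map_add]
    linear_combination hu + hv
  map_smul' c x := by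
    obtain ⟨u, hu⟩ := (exists_truncExp Z r a x).choose_spec
    obtain ⟨w, hw⟩ := (exists_truncExp Z r a (c • x)).choose_spec
    refine (mk_eq_mk_of_emb_add (β := (c : AInf p) * (exists_truncExp Z r a x).choose)
      (y' := emb p c * (u : ATilde p)) (hw.symm.trans ?_)).trans rfl
    rw [coe_PW_smul, map_mul]
    linear_combination emb p c * hu

variable {Z}

theorem truncLin_spec {r : Radius p} {a : ℕ} (x : overconvInt Z r) :
    ∃ (α : AInf p) (y : overconvInt Z r),
      emb p Z.teichVarpi ^ truncExp Z r a * x = emb p α + p ^ a * y ∧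
        truncLin Z r a x = Ideal.Quotient.mk _ α := by
  obtain ⟨u, hu⟩ := (exists_truncExp Z r a x).choose_spec
  exact ⟨_, u, hu, rfl⟩

theorem truncLin_algebraMap {r : Radius p} {a : ℕ} (x : AInf p) :
    truncLin Z r a (algebraMap (AInf p) (overconvInt Z r) x) =
      Z.piW ^ truncExp Z r a • (Ideal.Quotient.mk _ x : WTrunc p a) := by
  obtain ⟨α, y, h, h1⟩ := truncLin_spec (a := a) (algebraMap (AInf p) (overconvInt Z r) x)
  rw [h1]
  have h2 : (Ideal.Quotient.mk _ α : WTrunc p a) =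
      Ideal.Quotient.mk _ (Z.teichVarpi ^ truncExp Z r a * x) := by
    refine mk_eq_mk_of_emb_add (y := y) (y' := 0) ?_
    rw [← h, map_mul, map_pow, mul_zero, add_zero]
    rfl
  rw [h2]
  rfl

variable (Z) (A : Type*) [AddCommGroup A] [Module ℤ_[p] A]

/-- The map from `Ã_A^{(0,r]}` to `W_a(𝓞_ℂ^♭)_A[1/[ϖ]]`. -/
def OverconvA.trunc (r : Radius p) (a : ℕ) : OverconvA Z A r →ₗ[Z.PW] WTruncA Z A a :=
  CplLoc.divPow Z.piW _ (truncExp Z r a) ∘ₗ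
    CplLoc.map Z.piW (rTensor ℤ_[p] A (truncLin Z r a))

variable {A}

theorem OverconvA.pow_smul_trunc {r : Radius p} {a : ℕ} (x : OverconvA Z A r) :
    Z.piW ^ truncExp Z r a • OverconvA.trunc Z A r a x =
      CplLoc.map Z.piW (rTensor ℤ_[p] A (truncLin Z r a)) x :=
  CplLoc.pow_smul_divPow _ _

theorem OverconvA.trunc_tmul (r : Radius p) (a : ℕ) (x : AInf p) (b : A) :
    OverconvA.trunc Z A r a (OverconvA.tmul Z A r x b) =
      CplLoc.of Z.piW _ ((Ideal.Quotient.mk _ x : WTrunc p a) ⊗ₜ[ℤ_[p]] b) := by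
  apply CplLoc.pow_smul_injective (truncExp Z r a)
  refine (OverconvA.pow_smul_trunc Z _).trans ?_
  rw [OverconvA.tmul, CplLoc.map_of]
  refine Eq.trans (congrArg _ ?_) (map_smul (CplLoc.of Z.piW (WTrunc p a ⊗[ℤ_[p]] A)) _ _)
  refine (congrArg (fun v : WTrunc p a => v ⊗ₜ[ℤ_[p]] b) (truncLin_algebraMap x)).trans ?_
  exact (TensorProduct.smul_tmul' (Z.piW ^ truncExp Z r a) (Ideal.Quotient.mk _ x : WTrunc p a)
    b).symm

theorem OverconvA.continuous_trunc (r : Radius p) (a : ℕ) :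
    Continuous (OverconvA.trunc Z A r a) :=
  (CplLoc.continuous_divPow _).comp (CplLoc.continuous_map _)

theorem mk_surjective_WTrunc (a : ℕ) :
    Function.Surjective ((Ideal.Quotient.mkₐ Z.PW (Ideal.span {(p : AInf p) ^ a})).toLinearMap :
      AInf p →ₗ[Z.PW] WTrunc p a) :=
  Ideal.Quotient.mk_surjective

theorem flat_AInf : Module.Flat ℤ_[p] (AInf p) := by
  have := isTorsionFree_of_p_smul (p := p) (F := AInf p) fun x hx => by
    rw [Algebra.smul_def, map_natCast] at hx
    exact (mul_eq_zero.1 hx).resolve_left p_ne_zero_AInf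
  infer_instance

theorem flat_ATilde : Module.Flat ℤ_[p] (ATilde p) := by
  have := isTorsionFree_of_p_smul (p := p) (F := ATilde p) fun x hx => by
    rw [Algebra.smul_def, map_natCast] at hx
    exact (mul_eq_zero.1 hx).resolve_left p_ne_zero_ATilde
  infer_instance

theorem p_pow_smul_WTrunc (a : ℕ) (x : WTrunc p a) : (p : ℤ_[p]) ^ a • x = 0 := by
  obtain ⟨x, rfl⟩ := Ideal.Quotient.mk_surjective x
  rw [Algebra.smul_def, map_pow, map_natCast, ← map_natCast (Ideal.Quotient.mk _), ← map_pow,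
    ← map_mul, Ideal.Quotient.eq_zero_iff_mem, Ideal.mem_span_singleton]
  exact dvd_mul_right _ _

theorem p_pow_smul_WTrunc_tensor (a : ℕ) (u : WTrunc p a ⊗[ℤ_[p]] A) :
    (p : ℤ_[p]) ^ a • u = 0 := by
  have h : (p : ℤ_[p]) ^ a • (LinearMap.id : WTrunc p a →ₗ[ℤ_[p]] WTrunc p a) = 0 :=
    LinearMap.ext (p_pow_smul_WTrunc a)
  rw [← rTensor_smul_id, h, LinearMap.rTensor_zero, LinearMap.zero_apply]

theorem WTrunc_tensor_torsion_free (a : ℕ) (u : WTrunc p a ⊗[ℤ_[p]] A) (hu : Z.piW • u = 0) :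
    u = 0 := by
  set q : AInf p →ₗ[Z.PW] WTrunc p a :=
    (Ideal.Quotient.mkₐ Z.PW (Ideal.span {(p : AInf p) ^ a})).toLinearMap
  have hq : Function.Surjective q := mk_surjective_WTrunc Z a
  have hker : ∀ x, q x = 0 ↔ ∃ y, (p : ℤ_[p]) ^ a • y = x := fun x => by
    change Ideal.Quotient.mk _ x = 0 ↔ _
    rw [Ideal.Quotient.eq_zero_iff_mem, Ideal.mem_span_singleton]
    refine exists_congr fun y => ?_
    rw [Algebra.smul_def, map_pow, map_natCast, eq_comm]
  obtain ⟨u, rfl⟩ := LinearMap.rTensor_surjective (P := WTrunc p a) A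
    (g := q.restrictScalars ℤ_[p]) hq u
  have h1 : rTensor ℤ_[p] A q (Z.piW • u) = 0 := by
    rw [map_smul]
    exact hu
  obtain ⟨v, hv⟩ := exists_eq_smul_of_rTensor_eq_zero (q := q.restrictScalars ℤ_[p]) hq hker
    (u := Z.piW • u) h1
  have h2 : lTensor Z.PW (AInf p) (pPow p A a).mkQ u = 0 := by
    have _ : Module.Flat ℤ_[p] (AInf p) := flat_AInf
    have h3 := torsion_bounded_of_killed (S := Z.PW) (G := AInf p) (t := Z.piW) (M := 0) (a := a)
      (N := A ⧸ pPow p A a) (n := 1) (u := lTensor Z.PW (AInf p) (pPow p A a).mkQ u)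
      (fun n g g' h => ?_) p_pow_smul_quotient_eq_zero ?_
    · rw [mul_zero, pow_zero] at h3
      exact (one_smul Z.PW _).symm.trans h3
    · have h4 : Z.teichVarpi ^ n * g = p * g' := by
        have h5 : (p : ℤ_[p]) • g' = p * g' := by rw [Algebra.smul_def, map_natCast]
        rw [← h5, ← h]
        rfl
      obtain ⟨g'', hg⟩ := p_dvd_of_p_dvd_mul Z (coeff_zero_teichVarpi Z) ⟨g', h4⟩
      exact ⟨g'', by rw [pow_zero, one_smul, Algebra.smul_def, map_natCast, hg]⟩
    · rw [pow_one, ← map_smul, hv]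
      change (pPow p A a).mkQ.lTensor (AInf p) _ = 0
      rw [map_smul]
      exact smul_tensor_eq_zero p_pow_smul_quotient_eq_zero _
  obtain ⟨w, rfl⟩ := exists_eq_smul_of_lTensor_eq_zero h2
  rw [map_smul]
  exact p_pow_smul_WTrunc_tensor a _

theorem exists_pow_smul_eq_add {r : Radius p} (a : ℕ) (x : overconvInt Z r) :
    ∃ (α : AInf p) (y : overconvInt Z r), Z.piW ^ truncExp Z r a • x =
      algebraMap (AInf p) (overconvInt Z r) α + (p : Z.PW) ^ a • y := by
  obtain ⟨α, y, hα⟩ := exists_truncExp Z r a x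
  refine ⟨α, y, Subtype.ext ?_⟩
  have h2 : ((Z.piW ^ truncExp Z r a : Z.PW) : AInf p) = Z.teichVarpi ^ truncExp Z r a := rfl
  have h3 : (((p : Z.PW) ^ a : Z.PW) : AInf p) = p ^ a := by push_cast; rfl
  rw [Subalgebra.coe_add, coe_PW_smul, coe_PW_smul, h2, h3, map_pow, map_pow, map_natCast, hα]
  rfl

/-- A continuous linear map from `Ã_A^{(0,r]}` to `W_a(𝓞_ℂ^♭)_A[1/[ϖ]]` is determined by its values
on the elements `x ⊗ b` with `x ∈ A_inf`: a power of `[ϖ]` maps `Ã^{(0,r],∘}` into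
`A_inf + p^a Ã^{(0,r],∘}`, and `p^a` annihilates the target. -/
theorem OverconvA.hom_ext {r : Radius p} {a : ℕ} {f g : OverconvA Z A r →ₗ[Z.PW] WTruncA Z A a}
    (hf : Continuous f) (hg : Continuous g)
    (h : ∀ x b, f (OverconvA.tmul Z A r x b) = g (OverconvA.tmul Z A r x b)) : f = g := by
  refine CplLoc.eq_of_continuous (WTrunc_tensor_torsion_free Z a) hf hg fun u => ?_
  induction u using TensorProduct.induction_on with
  | zero => simp only [map_zero]
  | add u v hu hv => simp only [map_add, hu, hv]
  | tmul x b =>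
    obtain ⟨α, y, hα⟩ := exists_pow_smul_eq_add Z a x
    have h1 : Z.piW ^ truncExp Z r a • (x ⊗ₜ[ℤ_[p]] b) =
        algebraMap (AInf p) (overconvInt Z r) α ⊗ₜ[ℤ_[p]] b + (p : Z.PW) ^ a • (y ⊗ₜ[ℤ_[p]] b) :=
      (congrArg (fun v => v ⊗ₜ[ℤ_[p]] b) hα).trans (TensorProduct.add_tmul _ _ _)
    have h2 : ∀ z : WTruncA Z A a, (p : Z.PW) ^ a • z = 0 :=
      CplLoc.smul_eq_zero_of_forall fun u => by
        have h3 := p_pow_smul_WTrunc_tensor a u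
        rw [← algebraMap_smul Z.PW ((p : ℤ_[p]) ^ a) u, map_pow, map_natCast] at h3
        exact h3
    have h3 : ∀ f : OverconvA Z A r →ₗ[Z.PW] WTruncA Z A a, Z.piW ^ truncExp Z r a •
        f (CplLoc.of Z.piW _ (x ⊗ₜ[ℤ_[p]] b)) = f (OverconvA.tmul Z A r α b) := fun f => by
      rw [← map_smul, ← map_smul, h1, map_add, map_add, map_smul, map_smul, h2, add_zero]
      rfl
    exact CplLoc.pow_smul_injective (truncExp Z r a) ((h3 f).trans ((h α b).trans (h3 g).symm))

end Truncation

/-! ### Injectivity of the comparison map -/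

section Comparison

open TensorProduct.AlgebraTensorModule (lTensor rTensor)

variable {p : ℕ} [Fact p.Prime] (Z : CycloSystem p) {A : Type*} [AddCommGroup A] [Module ℤ_[p] A]

theorem piW_pow_smul_overconvInt {r : Radius p} (n : ℕ) (u : overconvInt Z r ⊗[ℤ_[p]] A) :
    Z.piW ^ n • u = algebraMap (AInf p) (overconvInt Z r) Z.teichVarpi ^ n • u := by
  induction u using TensorProduct.induction_on with
  | zero => rw [smul_zero, smul_zero]
  | add u v hu hv => rw [smul_add, smul_add, hu, hv]
  | tmul x b =>
    have h : Z.piW ^ n • x = algebraMap (AInf p) (overconvInt Z r) Z.teichVarpi ^ n * x := by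
      refine Subtype.ext ?_
      rw [coe_PW_smul, ← map_pow]
      exact congrArg (· * (x : ATilde p)) (congrArg (emb p) rfl)
    exact congrArg (· ⊗ₜ[ℤ_[p]] b) h

theorem piW_pow_smul_WTrunc {a : ℕ} (n : ℕ) (u : WTrunc p a ⊗[ℤ_[p]] A) :
    Z.piW ^ n • u = Z.teichVarpi ^ n • u := by
  induction u using TensorProduct.induction_on with
  | zero => rw [smul_zero, smul_zero]
  | add u v hu hv => rw [smul_add, smul_add, hu, hv]
  | tmul x b => rfl

/-- A version of `exists_pow_smul_eq_of_forall_close` for the ring `Ã^{(0,r],∘}`. -/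
theorem overconvInt_exists_pow_smul_eq {r : Radius p} (D : RadiusData Z r) {c : ℕ}
    (hc : ∀ (n : ℕ) (a : A), (p : ℤ_[p]) ^ n • a = 0 → (p : ℤ_[p]) ^ c • a = 0) {i : ℕ}
    {y : overconvInt Z r ⊗[ℤ_[p]] A}
    (hy : ∀ k : ℕ, ∃ (x : overconvInt Z r ⊗[ℤ_[p]] A) (v : ATilde p ⊗[ℤ_[p]] A),
      baseIncl (overconvInt Z r) (ATilde p) A y = baseIncl (overconvInt Z r) (ATilde p) A
        (algebraMap (AInf p) (overconvInt Z r) Z.teichVarpi ^ i • x) + (p : ℤ_[p]) ^ k • v) :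
    ∃ x, algebraMap (AInf p) (overconvInt Z r) Z.teichVarpi ^ (D.e * c) • y =
      algebraMap (AInf p) (overconvInt Z r) Z.teichVarpi ^ i • x := by
  have _ : Module.Flat ℤ_[p] (ATilde p) := flat_ATilde
  refine exists_pow_smul_eq_of_forall_close (C := ATilde p) (z := ⟨D.z, D.z_mem⟩) (w := D.w)
    ?_ ?_ ?_ hc ?_ ?_ ?_ ?_ ?_ ?_ hy
  · intro b c h
    obtain ⟨b', -, hb'⟩ := exists_of_p_mul_eq_emb h.symm
    exact ⟨b', hb'⟩
  · exact Subtype.val_injective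
  · intro x
    obtain ⟨α, y, hy, h⟩ := D.exists_pow_mul c x.2
    exact ⟨α, ⟨y, hy⟩, Subtype.ext h⟩
  · exact isUnit_emb_teichVarpi Z
  · exact Subtype.ext D.z_mul_w
  · exact D.isUnit_emb_w
  · intro i
    obtain ⟨k, hk⟩ := D.dvd_w_pow i
    exact ⟨k, hk k le_rfl⟩
  · intro k x
    obtain ⟨x₀, hx₀, y, hy, α, h, h'⟩ := D.exists_add_z_pow_mul x.2 k
    exact ⟨⟨x₀, hx₀⟩, ⟨y, hy⟩, α, Subtype.ext h, Subtype.ext h'⟩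
  · intro i x
    obtain ⟨j, μ, hμ, hj⟩ := D.exists_p_pow_eq i
    obtain ⟨s, hs, y, hy, h⟩ := exists_polyRing_add_p_pow_mul x.2 j
    obtain ⟨N, α, hα⟩ := D.exists_pow_mul_polyRing hs
    refine ⟨N, α, ⟨μ * y, mul_mem hμ hy⟩, Subtype.ext ?_⟩
    change emb p Z.teichVarpi ^ N * (x : ATilde p) =
      emb p α + emb p Z.teichVarpi ^ (N + i) * (μ * y)
    rw [h]
    linear_combination hα + emb p Z.teichVarpi ^ N * y * hj

/-- The vanishing of all truncations of the limit of a Cauchy sequence `u` means that `u i` is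
`p`-adically close to the multiples of `[ϖ]^i`; hence `u i` is divisible by `[ϖ]^i` up to a fixed
power of `[ϖ]`. -/
theorem OverconvA.eq_zero_of_trunc_eq_zero {r : Radius p} {c : ℕ}
    (hc : ∀ (n : ℕ) (a : A), (p : ℤ_[p]) ^ n • a = 0 → (p : ℤ_[p]) ^ c • a = 0)
    {x : OverconvA Z A r} (hx : ∀ a, OverconvA.trunc Z A r a x = 0) : x = 0 := by
  obtain ⟨n, m, hm⟩ := x.exists_pow_smul_eq_mk
  obtain ⟨u, hu, hu'⟩ := m.exists_seq
  have h1 : ∀ a i, ∃ y, rTensor ℤ_[p] A (truncLin Z r a) (u i) = Z.piW ^ i • y := by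
    intro a
    refine CplLoc.exists_eq_pow_smul_of_map_eq_zero _ (WTrunc_tensor_torsion_free Z a) hu ?_
    rw [← hm, map_smul, ← OverconvA.pow_smul_trunc, hx, smul_zero, smul_zero]
  obtain ⟨D⟩ := nonempty_radiusData Z r
  have h2 : ∀ i, ∃ y, Z.piW ^ (D.e * c) • u i = Z.piW ^ i • y := by
    intro i
    obtain ⟨y, hy⟩ := overconvInt_exists_pow_smul_eq Z D hc (i := i) (y := u i) fun k => by
      obtain ⟨y, hy⟩ := h1 k (i + truncExp Z r k)
      rw [piW_pow_smul_WTrunc] at hy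
      obtain ⟨x, v, hxv⟩ := exists_close_of_rTensor_eq (Λ := overconvInt Z r) (C := ATilde p)
        (P := Z.teichVarpi) (isUnit_emb_teichVarpi Z) (k := k) (N := truncExp Z r k)
        (f := (truncLin Z r k).restrictScalars ℤ_[p]) (fun x => by
          obtain ⟨α, y, h, h'⟩ := truncLin_spec (a := k) x
          exact ⟨α, y, Subtype.ext h, h'⟩) hy
      obtain ⟨d, hd⟩ := exists_pow_smul_of_le hu' i (truncExp Z r k)
      refine ⟨x - d, v, ?_⟩
      replace hd := sub_eq_iff_eq_add'.1 (hd.trans (piW_pow_smul_overconvInt Z i d))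
      rw [smul_sub, map_sub, sub_add_eq_add_sub, ← hxv, hd, map_add, add_sub_cancel_right]
    exact ⟨y, by rw [piW_pow_smul_overconvInt, piW_pow_smul_overconvInt, hy]⟩
  have h3 := CplLoc.mk_eq_zero_of_seq hu h2
  apply CplLoc.pow_smul_injective n
  change Z.piW ^ n • x = Z.piW ^ n • 0
  rw [hm, h3, smul_zero]

variable (A)

theorem WTruncA.red_trunc (r : Radius p) (a : ℕ) (x : OverconvA Z A r) :
    WTruncA.red Z A a (OverconvA.trunc Z A r (a + 1) x) = OverconvA.trunc Z A r a x := by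
  refine LinearMap.congr_fun (f := WTruncA.red Z A a ∘ₗ OverconvA.trunc Z A r (a + 1))
    (OverconvA.hom_ext Z ((CplLoc.continuous_map _).comp (OverconvA.continuous_trunc Z r (a + 1)))
      (OverconvA.continuous_trunc Z r a) fun x b => ?_) x
  rw [LinearMap.comp_apply, OverconvA.trunc_tmul, OverconvA.trunc_tmul]
  exact CplLoc.map_of _ _ _

/-- The comparison map from `Ã_A^{(0,r]}` to `Ã_A`. -/
def OverconvA.toATildeA (r : Radius p) : OverconvA Z A r →ₗ[Z.PW] ATildeA Z A :=
  LinearMap.codRestrict (ATildeA Z A) (LinearMap.pi fun a => OverconvA.trunc Z A r a)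
    fun x a => WTruncA.red_trunc Z A r a x

variable {A}

theorem OverconvA.toATildeA_apply (r : Radius p) (x : OverconvA Z A r) (a : ℕ) :
    (OverconvA.toATildeA Z A r x : ∀ a, WTruncA Z A a) a = OverconvA.trunc Z A r a x := rfl

theorem OverconvA.continuous_toATildeA (r : Radius p) : Continuous (OverconvA.toATildeA Z A r) :=
  Continuous.subtype_mk (continuous_pi fun a => OverconvA.continuous_trunc Z r a) _

theorem OverconvA.toATildeA_tmul (r : Radius p) (x : AInf p) (b : A) :
    OverconvA.toATildeA Z A r (OverconvA.tmul Z A r x b) = ATildeA.tmul Z A x b :=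
  Subtype.ext (funext fun a => OverconvA.trunc_tmul Z r a x b)

theorem ATildeA.hom_ext {r : Radius p} {f g : OverconvA Z A r →ₗ[Z.PW] ATildeA Z A}
    (hf : Continuous f) (hg : Continuous g)
    (h : ∀ x b, f (OverconvA.tmul Z A r x b) = g (OverconvA.tmul Z A r x b)) : f = g := by
  have hc : ∀ a, Continuous fun x : ATildeA Z A => (x : ∀ a, WTruncA Z A a) a := fun a =>
    (continuous_apply a).comp continuous_subtype_val
  refine LinearMap.ext fun x => Subtype.ext (funext fun a => ?_)
  exact LinearMap.congr_fun (OverconvA.hom_ext Z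
    (f := LinearMap.proj a ∘ₗ (ATildeA Z A).subtype ∘ₗ f)
    (g := LinearMap.proj a ∘ₗ (ATildeA Z A).subtype ∘ₗ g) ((hc a).comp hf) ((hc a).comp hg)
    fun x b => congrArg (fun y : ATildeA Z A => (y : ∀ a, WTruncA Z A a) a) (h x b)) x

theorem OverconvA.toATildeA_injective {c : ℕ}
    (hc : ∀ (n : ℕ) (a : A), (p : ℤ_[p]) ^ n • a = 0 → (p : ℤ_[p]) ^ c • a = 0) (r : Radius p) :
    Function.Injective (OverconvA.toATildeA Z A r) := by
  refine (injective_iff_map_eq_zero _).2 fun x hx => ?_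
  refine OverconvA.eq_zero_of_trunc_eq_zero Z hc fun a => ?_
  rw [← OverconvA.toATildeA_apply, hx]
  rfl

theorem OverconvA.toATildeA_trans {r s : Radius p} (h : r ≤ s) (x : OverconvA Z A s) :
    OverconvA.toATildeA Z A r (OverconvA.trans Z A h x) = OverconvA.toATildeA Z A s x := by
  refine LinearMap.congr_fun (f := OverconvA.toATildeA Z A r ∘ₗ OverconvA.trans Z A h)
    (ATildeA.hom_ext Z ((OverconvA.continuous_toATildeA Z r).comp (CplLoc.continuous_map _))
      (OverconvA.continuous_toATildeA Z s) fun x b => ?_) x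
  rw [LinearMap.comp_apply, OverconvA.toATildeA_tmul, ← OverconvA.toATildeA_tmul Z r]
  congr 1
  refine (CplLoc.map_of _ _ _).trans ?_
  congr 1

theorem WTruncA.gal_trunc {K : IntermediateField ℚ_[p] (PadicAlgCl p)} (r : Radius p) (a : ℕ)
    (σ : HK K) (x : OverconvA Z A r) : OverconvA.trunc Z A r a (OverconvA.gal Z A r σ x) =
      WTruncA.gal Z A a σ (OverconvA.trunc Z A r a x) := by
  refine LinearMap.congr_fun (f := OverconvA.trunc Z A r a ∘ₗ OverconvA.gal Z A r σ)
    (g := WTruncA.gal Z A a σ ∘ₗ OverconvA.trunc Z A r a)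
    (OverconvA.hom_ext Z ((OverconvA.continuous_trunc Z r a).comp (CplLoc.continuous_map _))
      ((CplLoc.continuous_map _).comp (OverconvA.continuous_trunc Z r a)) fun x b => ?_) x
  have h : OverconvA.gal Z A r σ (OverconvA.tmul Z A r x b) =
      OverconvA.tmul Z A r (galAInf (σ : GQp p) x) b := by
    refine (CplLoc.map_of _ _ _).trans ?_
    refine congrArg (CplLoc.of Z.piW _) (congrArg (· ⊗ₜ[ℤ_[p]] b) (Subtype.ext ?_))
    exact galATilde_algebraMap (σ : GQp p) x
  rw [LinearMap.comp_apply, LinearMap.comp_apply, h, OverconvA.trunc_tmul, OverconvA.trunc_tmul]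
  have h' : WTruncA.gal Z A a σ (CplLoc.of Z.piW (WTrunc p a ⊗[ℤ_[p]] A)
      ((Ideal.Quotient.mk _ x : WTrunc p a) ⊗ₜ[ℤ_[p]] b)) = CplLoc.of Z.piW (WTrunc p a ⊗[ℤ_[p]] A)
      ((Ideal.Quotient.mk _ (galAInf (σ : GQp p) x) : WTrunc p a) ⊗ₜ[ℤ_[p]] b) :=
    CplLoc.map_of Z.piW (rTensor ℤ_[p] A (WTrunc.gal Z a σ)) _
  exact h'.symm

theorem OverconvA.toATildeA_gal {K : IntermediateField ℚ_[p] (PadicAlgCl p)} (r : Radius p)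
    (σ : HK K) (x : OverconvA Z A r) : OverconvA.toATildeA Z A r (OverconvA.gal Z A r σ x) =
      ATildeA.gal Z A σ (OverconvA.toATildeA Z A r x) :=
  Subtype.ext (funext fun a => WTruncA.gal_trunc Z r a σ x)

theorem OverconvA.trans_injective {c : ℕ}
    (hc : ∀ (n : ℕ) (a : A), (p : ℤ_[p]) ^ n • a = 0 → (p : ℤ_[p]) ^ c • a = 0) {r s : Radius p}
    (h : r ≤ s) : Function.Injective (OverconvA.trans Z A h) := by
  intro x y hxy
  apply OverconvA.toATildeA_injective Z hc s
  rw [← OverconvA.toATildeA_trans Z h, hxy, OverconvA.toATildeA_trans]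

end Comparison

/-! ### Direct limits along decreasing radii -/

theorem Radius.nonempty (p : ℕ) : Nonempty (Radius p)ᵒᵈ :=
  ⟨⟨1, one_pos, 1, 0, by simp⟩⟩

theorem CplLoc.map_id {S : Type*} [CommRing S] (π : S) (M : Type*) [AddCommGroup M] [Module S M] :
    CplLoc.map π (LinearMap.id : M →ₗ[S] M) = LinearMap.id := by
  refine IsLocalizedModule.ext (Submonoid.powers π) (CplLoc.mk π M)
    (IsLocalizedModule.map_units (CplLoc.mk π M)) (LinearMap.ext fun m => ?_)
  rw [LinearMap.comp_apply, CplLoc.map_mk, AdicCompletion.map_id, LinearMap.id_apply,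
    LinearMap.comp_apply, LinearMap.id_apply]

section Functoriality

open TensorProduct.AlgebraTensorModule (rTensor)

variable {p : ℕ} [Fact p.Prime] {S : Type*} [CommRing S] [Algebra ℤ_[p] S]
  {G H L : Type*} [AddCommGroup G] [Module ℤ_[p] G] [Module S G] [IsScalarTower ℤ_[p] S G]
  [AddCommGroup H] [Module ℤ_[p] H] [Module S H] [IsScalarTower ℤ_[p] S H]
  [AddCommGroup L] [Module ℤ_[p] L] [Module S L] [IsScalarTower ℤ_[p] S L]
  {A : Type*} [AddCommGroup A] [Module ℤ_[p] A] {t : S}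

theorem CplLoc.map_rTensor_comp (j : G →ₗ[S] H) (k : H →ₗ[S] L) {l : G →ₗ[S] L} (h : l = k ∘ₗ j)
    (x : CplLoc t (G ⊗[ℤ_[p]] A)) : CplLoc.map t (rTensor ℤ_[p] A k)
      (CplLoc.map t (rTensor ℤ_[p] A j) x) = CplLoc.map t (rTensor ℤ_[p] A l) x := by
  rw [h, TensorProduct.AlgebraTensorModule.rTensor_comp, CplLoc.map_comp, LinearMap.comp_apply]

theorem CplLoc.map_rTensor_id {j : G →ₗ[S] G} (h : j = LinearMap.id)
    (x : CplLoc t (G ⊗[ℤ_[p]] A)) : CplLoc.map t (rTensor ℤ_[p] A j) x = x := by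
  rw [h, TensorProduct.AlgebraTensorModule.rTensor_id, CplLoc.map_id, LinearMap.id_apply]

end Functoriality

section DirectLimits

variable {p : ℕ} [Fact p.Prime] (Z : CycloSystem p)

section Perfect

variable (A : Type*) [AddCommGroup A] [Module ℤ_[p] A]

theorem Dagger.exists_of (x : Dagger Z A) :
    ∃ (r : Radius p) (y : OverconvA Z A r), Dagger.of Z A r y = x := by
  have := Radius.nonempty p
  obtain ⟨r, y, h⟩ := Module.DirectLimit.exists_of x
  exact ⟨OrderDual.ofDual r, y, h⟩

/-- The map `Ã_A^† → Ã_A` induced by the comparison maps. -/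
def Dagger.toATildeA : Dagger Z A →ₗ[Z.PW] ATildeA Z A :=
  Module.DirectLimit.lift _ _ _ _ (fun r => OverconvA.toATildeA Z A (OrderDual.ofDual r))
    fun _ _ h x => OverconvA.toATildeA_trans Z (OrderDual.ofDual_le_ofDual.2 h) x

variable {A}

theorem Dagger.toATildeA_of (r : Radius p) (x : OverconvA Z A r) :
    Dagger.toATildeA Z A (Dagger.of Z A r x) = OverconvA.toATildeA Z A r x :=
  Module.DirectLimit.lift_of _ _ _

theorem Dagger.continuous_toATildeA : Continuous (Dagger.toATildeA Z A) := by
  refine continuous_iSup_dom.2 fun r => continuous_coinduced_dom.2 ?_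
  convert OverconvA.continuous_toATildeA (A := A) Z r using 1
  exact funext fun x => Dagger.toATildeA_of Z r x

theorem Dagger.toATildeA_injective {c : ℕ}
    (hc : ∀ (n : ℕ) (a : A), (p : ℤ_[p]) ^ n • a = 0 → (p : ℤ_[p]) ^ c • a = 0) :
    Function.Injective (Dagger.toATildeA Z A) :=
  Module.DirectLimit.lift_injective _ _ fun r =>
    OverconvA.toATildeA_injective Z hc (OrderDual.ofDual r)

theorem Dagger.of_injective {c : ℕ}
    (hc : ∀ (n : ℕ) (a : A), (p : ℤ_[p]) ^ n • a = 0 → (p : ℤ_[p]) ^ c • a = 0) (r : Radius p) :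
    Function.Injective (Dagger.of Z A r) := by
  intro x y h
  apply OverconvA.toATildeA_injective Z hc r
  rw [← Dagger.toATildeA_of, h, Dagger.toATildeA_of]

variable {K : IntermediateField ℚ_[p] (PadicAlgCl p)}

theorem Dagger.gal_of (r : Radius p) (σ : HK K) (x : OverconvA Z A r) :
    Dagger.gal Z A σ (Dagger.of Z A r x) = Dagger.of Z A r (OverconvA.gal Z A r σ x) :=
  Module.DirectLimit.map_apply_of _ _ _

theorem Dagger.toATildeA_gal (σ : HK K) (x : Dagger Z A) :
    Dagger.toATildeA Z A (Dagger.gal Z A σ x) =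
      ATildeA.gal Z A σ (Dagger.toATildeA Z A x) := by
  obtain ⟨r, y, rfl⟩ := Dagger.exists_of Z A x
  rw [Dagger.gal_of, Dagger.toATildeA_of, Dagger.toATildeA_of, OverconvA.toATildeA_gal]

theorem mem_OverconvKA {r : Radius p} {x : OverconvA Z A r} :
    x ∈ OverconvKA Z A K r ↔ ∀ σ : HK K, OverconvA.gal Z A r σ x = x := by
  simp only [OverconvKA, Submodule.mem_iInf, LinearMap.mem_eqLocus, LinearMap.id_apply]

theorem mem_ATildeKA {x : ATildeA Z A} :
    x ∈ ATildeKA Z A K ↔ ∀ σ : HK K, ATildeA.gal Z A σ x = x := by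
  simp only [ATildeKA, Submodule.mem_iInf, LinearMap.mem_eqLocus, LinearMap.id_apply]

theorem mem_DaggerKA {x : Dagger Z A} :
    x ∈ DaggerKA Z A K ↔ ∀ σ : HK K, Dagger.gal Z A σ x = x := by
  simp only [DaggerKA, Submodule.mem_iInf, LinearMap.mem_eqLocus, LinearMap.id_apply]

theorem Dagger.toATildeA_mem {x : Dagger Z A} (hx : x ∈ DaggerKA Z A K) :
    Dagger.toATildeA Z A x ∈ ATildeKA Z A K :=
  (mem_ATildeKA Z).2 fun σ => by
    rw [← Dagger.toATildeA_gal, (mem_DaggerKA Z).1 hx σ]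

theorem OverconvA.trans_mem {r s : Radius p} (h : r ≤ s) {x : OverconvA Z A s}
    (hx : x ∈ OverconvKA Z A K s) : OverconvA.trans Z A h x ∈ OverconvKA Z A K r :=
  (mem_OverconvKA Z).2 fun σ => by
    rw [← OverconvA.trans_gal, (mem_OverconvKA Z).1 hx σ]

theorem Dagger.mem_DaggerKA_iff {c : ℕ}
    (hc : ∀ (n : ℕ) (a : A), (p : ℤ_[p]) ^ n • a = 0 → (p : ℤ_[p]) ^ c • a = 0)
    {x : Dagger Z A} : x ∈ DaggerKA Z A K ↔
      ∃ (r : Radius p), ∃ y ∈ OverconvKA Z A K r, Dagger.of Z A r y = x := by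
  constructor
  · intro hx
    obtain ⟨r, y, rfl⟩ := Dagger.exists_of Z A x
    refine ⟨r, y, (mem_OverconvKA Z).2 fun σ => Dagger.of_injective Z hc r ?_, rfl⟩
    rw [← Dagger.gal_of, (mem_DaggerKA Z).1 hx σ]
  · rintro ⟨r, y, hy, rfl⟩
    refine (mem_DaggerKA Z).2 fun σ => ?_
    rw [Dagger.gal_of, (mem_OverconvKA Z).1 hy σ]

end Perfect

section Imperfect

variable (K : IntermediateField ℚ_[p] (PadicAlgCl p)) {A : Type*} [AddCommGroup A]
  [Module ℤ_[p] A]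

/-- The transition maps form a directed system. This is needed to recover elements of a stage from
their images in the direct limit. -/
theorem OverconvImpKA.trans_trans {r s t : Radius p} (h : r ≤ s) (h' : s ≤ t)
    (x : OverconvImpKA Z K A t) : OverconvImpKA.trans Z K A h (OverconvImpKA.trans Z K A h' x) =
      OverconvImpKA.trans Z K A (h.trans h') x := by
  have hi : AKoverconvIntIncl Z K (h.trans h') =
      AKoverconvIntIncl Z K h ∘ₗ AKoverconvIntIncl Z K h' :=
    LinearMap.ext fun x => Subtype.ext <| by
      rw [LinearMap.comp_apply, coe_AKoverconvIntIncl, coe_AKoverconvIntIncl,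
        coe_AKoverconvIntIncl]
  exact CplLoc.map_rTensor_comp _ _ hi x

theorem OverconvImpKA.trans_refl (r : Radius p) (x : OverconvImpKA Z K A r) :
    OverconvImpKA.trans Z K A le_rfl x = x := by
  have hi : AKoverconvIntIncl Z K (le_refl r) = LinearMap.id :=
    LinearMap.ext fun x => Subtype.ext (coe_AKoverconvIntIncl Z K _ x)
  exact CplLoc.map_rTensor_id hi x

theorem DaggerImpKA.exists_of (x : DaggerImpKA Z K A) :
    ∃ (r : Radius p) (y : OverconvImpKA Z K A r), DaggerImpKA.of Z K A r y = x := by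
  have := Radius.nonempty p
  obtain ⟨r, y, h⟩ := Module.DirectLimit.exists_of x
  exact ⟨OrderDual.ofDual r, y, h⟩

theorem DaggerImpKA.of_injective [FiniteDimensional ℚ_[p] K] {c : ℕ}
    (hc : ∀ (n : ℕ) (a : A), (p : ℤ_[p]) ^ n • a = 0 → (p : ℤ_[p]) ^ c • a = 0)
    (hA : ∀ x : A, (∀ k : ℕ, ∃ y : A, x = (p : ℤ_[p]) ^ k • y) → x = 0) (r : Radius p) :
    Function.Injective (DaggerImpKA.of Z K A r) := by
  have : DirectedSystem (fun r : (Radius p)ᵒᵈ => OverconvImpKA Z K A (OrderDual.ofDual r))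
      (fun _ _ h => OverconvImpKA.trans Z K A (OrderDual.ofDual_le_ofDual.2 h)) :=
    { map_self := fun _ x => OverconvImpKA.trans_refl Z K _ x
      map_map := fun _ _ _ h h' x => OverconvImpKA.trans_trans Z K
        (OrderDual.ofDual_le_ofDual.2 h') (OrderDual.ofDual_le_ofDual.2 h) x }
  intro x y h
  obtain ⟨s, hs, h⟩ := Module.DirectLimit.exists_eq_of_of_eq h
  exact OverconvImpKA.trans_injective Z K hc hA (OrderDual.ofDual_le_ofDual.2 hs) h

end Imperfect

end DirectLimits

end PhiGamma

end

open PhiGamma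

theorem theorem2p9 (p : ℕ) [Fact p.Prime] (Z : CycloSystem p)
    (K : IntermediateField ℚ_[p] (PadicAlgCl p)) [FiniteDimensional ℚ_[p] K]
    {R : Type*} [CommRing R] [Algebra ℤ_[p] R] (hR : IsTopFiniteType p R)
    {A : Type*} [AddCommGroup A] [Module ℤ_[p] A] [Module R A] [IsScalarTower ℤ_[p] R A]
    [Module.Finite R A] [IsAdicComplete (Ideal.span {(p : ℤ_[p])}) A] :
    ∃ f : ∀ r : Radius p, OverconvA Z A r →ₗ[Z.PW] ATildeA Z A,
      -- `f r` is continuous, natural and injective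
      (∀ r, Continuous (f r) ∧
        (∀ (x : AInf p) (a : A), f r (OverconvA.tmul Z A r x a) = ATildeA.tmul Z A x a) ∧
        (∀ g : OverconvA Z A r →ₗ[Z.PW] ATildeA Z A, Continuous g →
          (∀ (x : AInf p) (a : A), g (OverconvA.tmul Z A r x a) = ATildeA.tmul Z A x a) →
          g = f r) ∧
        Function.Injective (f r)) ∧
      (∀ r (σ : HK K) (x : OverconvA Z A r),
        f r (OverconvA.gal Z A r σ x) = ATildeA.gal Z A σ (f r x)) ∧
      -- the direct limit over all radii is a union
      (∀ (r s : Radius p) (h : r ≤ s), Function.Injective (OverconvA.trans Z A h)) ∧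
      (∀ r : Radius p, Function.Injective (Dagger.of Z A r)) ∧
      (∀ x : Dagger Z A, ∃ (r : Radius p) (y : OverconvA Z A r), Dagger.of Z A r y = x) ∧
      -- the `f r` glue to a continuous injective map, compatible with invariants under `H_K`
      (∃ F : Dagger Z A →ₗ[Z.PW] ATildeA Z A, Continuous F ∧ Function.Injective F ∧
        (∀ (r : Radius p) (x : OverconvA Z A r), F (Dagger.of Z A r x) = f r x) ∧
        ∀ x ∈ DaggerKA Z A K, F x ∈ ATildeKA Z A K) ∧
      -- the union of the invariants under `H_K`, with injective transition maps
      (∀ (r s : Radius p) (h : r ≤ s),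
        Set.MapsTo (OverconvA.trans Z A h) (OverconvKA Z A K s) (OverconvKA Z A K r) ∧
        Set.InjOn (OverconvA.trans Z A h) (OverconvKA Z A K s)) ∧
      (∀ x : Dagger Z A, x ∈ DaggerKA Z A K ↔
        ∃ (r : Radius p), ∃ y ∈ OverconvKA Z A K r, Dagger.of Z A r y = x) ∧
      -- the imperfect rings
      (∀ (r s : Radius p) (h : r ≤ s), Function.Injective (OverconvImpKA.trans Z K A h)) ∧
      (∀ r : Radius p, Function.Injective (DaggerImpKA.of Z K A r)) ∧
      (∀ x : DaggerImpKA Z K A, ∃ (r : Radius p) (y : OverconvImpKA Z K A r),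
        DaggerImpKA.of Z K A r y = x) := by
  obtain ⟨c, hc⟩ := exists_torsion_bound hR (A := A)
  have hA : ∀ x : A, (∀ k : ℕ, ∃ y : A, x = (p : ℤ_[p]) ^ k • y) → x = 0 :=
    fun _ => eq_zero_of_forall_p_pow
  refine ⟨OverconvA.toATildeA Z A, fun r => ⟨OverconvA.continuous_toATildeA Z r,
      OverconvA.toATildeA_tmul Z r, fun g hg hgt => ?_, OverconvA.toATildeA_injective Z hc r⟩,
    OverconvA.toATildeA_gal Z, fun _ _ h => OverconvA.trans_injective Z hc h,
    Dagger.of_injective Z hc, Dagger.exists_of Z A,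
    ⟨Dagger.toATildeA Z A, Dagger.continuous_toATildeA Z, Dagger.toATildeA_injective Z hc,
      Dagger.toATildeA_of Z, fun _ hx => Dagger.toATildeA_mem Z hx⟩,
    fun _ _ h => ⟨fun _ hx => OverconvA.trans_mem Z h hx,
      (OverconvA.trans_injective Z hc h).injOn⟩,
    fun _ => Dagger.mem_DaggerKA_iff Z hc,
    fun _ _ h => OverconvImpKA.trans_injective Z K hc hA h,
    DaggerImpKA.of_injective Z K hc hA, DaggerImpKA.exists_of Z K⟩
  refine ATildeA.hom_ext Z hg (OverconvA.continuous_toATildeA Z r) fun x a => ?_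
  rw [hgt, OverconvA.toATildeA_tmul]
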